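/- **Definitions.** Let $r\ge 3$. An $(r-1)$-tuple is a sequence of $r-1$ distinct vertices; tuples are also used as sets. A *spike path of length $t$* in an $r$-uniform hypergraph consists of $t$ pairwise disjoint $(r-1)$-tuples $\mathbf a_i=(a_{i,1},\dots,a_{i,r-1})$, $1\le i\le t$, such that $\{a_{i,r-j},\dots,a_{i,1},a_{i+1,1},\dots,a_{i+1,j}\}$ is an edge for all $1\le i\le t-1$ and $1\le j\le r-1$. Its ends are $\mathbf a_1$ and $\mathbf a_t$; its interior vertices are those of $\mathbf a_2,\dots,\mathbf a_{t-1}$. An *exposure hypergraph* is an $(r-1)$-uniform hypergraph $\mathcal E$ on the vertex set of $G$. An algorithm may inspect $G$ only by *revealing* $r$-sets that contain an $(r-1)$-set (a *search base*) which it names; every search base used is then added to $\mathcal E$. Write $e(\mathcal E)$ for the number of edges and $\mathcal E[S]$ for the edges contained in $S$. Running time is counted on a word RAM with words of $\Theta(\log n)$ bits, where testing an $r$-set of a search base, membership of an $(r-1)$-set in $\mathcal E$ and membership of a vertex in $S$ each take one step. $\mathcal G^{(r)}(n,p)$ is the random $r$-uniform hypergraph on $n$ vertices in which each $r$-set is an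 edge independently with probability $p$. **Lemma (Spike path Lemma).** For each $r\ge 3$ there exist $c,C>0$ and a deterministic $O(n^{r-1})$-time algorithm whose input is an $n$-vertex $r$-uniform hypergraph $G$, a pair of distinct $(r-1)$-tuples $\mathbf u$ and $\mathbf v$, a set $S\subseteq V(G)$ and an exposure hypergraph $\mathcal E$ on $V(G)$, with the following properties (the implicit constants and the function $o(\log n)$ depend only on $r$). For every input, the output is either `Fail' or a spike path in $G$ of even length $o(\log n)$ with first tuple $\mathbf u$ and last tuple $\mathbf v$ whose interior vertices are in $S$; and in both cases the exposure hypergraph $\mathcal E'\supseteq\mathcal E$ obtained from $\mathcal E$ by adding all search bases used. We have $e(\mathcal E')\le e(\mathcal E)+O(|S|^{r-2})$, and all edges of $\mathcal E'$ not in $\mathcal E$ are contained in $S\cup\mathbf u\cup\mathbf v$. Suppose that $C(\log n)^3/n\le p\le 1$, that $\mathbf u$ and $\mathbf v$ are disjoint, that no edge of $\mathcal E$ intersects both $S$ and $\mathbf u\cup\mathbf v$, that $|S|=Cp^{-1}\log n$ (rounded up or down to an integer) and that $e(\mathcal E[S])\le c|S|^{r-1}$. If $G$ is drawn from $\mathcal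 G^{(r)}(n,p)$, then the algorithm returns `Fail' with probability at most $n^{-5}$. The same bound holds conditionally on the previously exposed part of $G$: if $X$ is any family of $r$-sets each of which contains an edge of $\mathcal E$, and no member of $X$ consists of $\mathbf u$ and one vertex of $S$ or of $\mathbf v$ and one vertex of $S$, then for every $F\subseteq X$ $$\Pr\big[\text{Fail and } E(G)\cap X=F\big]\le n^{-5}\,\Pr\big[E(G)\cap X=F\big].$$ -/

import Mathlib

namespace SpikeLemma

/-! Vertex set: `Fin n`.  A hypergraph is its set of edges, a finset of finsets of vertices.  -/

/-- Every edge of `H` has exactly `k` vertices. -/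
def IsUniform {n : ℕ} (k : ℕ) (H : Finset (Finset (Fin n))) : Prop :=
  ∀ e ∈ H, e.card = k

/-- The set of vertices of a tuple. -/
def verts {n k : ℕ} (a : Fin k → Fin n) : Finset (Fin n) :=
  Finset.univ.image a

/-- The set formed by the first `m` entries of a tuple. -/
def firstVerts {n k : ℕ} (a : Fin k → Fin n) (m : ℕ) : Finset (Fin n) :=
  (Finset.univ.filter fun l : Fin k => l.val < m).image a

/-- The sequence `a` of `t` tuples is a spike path of length `t` in the `r`-uniform hypergraph `G`:
the tuples consist of distinct vertices, are pairwise disjoint, and for consecutive tuples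
`a_i, a_{i+1}` and `1 ≤ j ≤ r - 1` the set consisting of the first `r - j` entries of `a_i` and the
first `j` entries of `a_{i+1}` is an edge. -/
def IsSpikePath {n : ℕ} (r : ℕ) (G : Finset (Finset (Fin n))) (t : ℕ)
    (a : Fin t → Fin (r - 1) → Fin n) : Prop :=
  (∀ i, Function.Injective (a i)) ∧
  (∀ i i', i ≠ i' → Disjoint (verts (a i)) (verts (a i'))) ∧
  (∀ i i' : Fin t, i'.val = i.val + 1 → ∀ j : ℕ, 1 ≤ j → j ≤ r - 1 →
    firstVerts (a i) (r - j) ∪ firstVerts (a i') j ∈ G)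

/-- The first tuple is `u` and the last one is `v`. -/
def HasEnds {n k t : ℕ} (a : Fin t → Fin k → Fin n) (u v : Fin k → Fin n) : Prop :=
  ∃ h : 0 < t, a ⟨0, h⟩ = u ∧ a ⟨t - 1, Nat.sub_lt h Nat.one_pos⟩ = v

/-- All vertices of the tuples other than the first and the last one lie in `S`. -/
def InteriorIn {n k t : ℕ} (a : Fin t → Fin k → Fin n) (S : Finset (Fin n)) : Prop :=
  ∀ i : Fin t, 0 < i.val → i.val + 1 < t → verts (a i) ⊆ S

/-- The part of the input that is not the hypergraph `G`: two distinct `(r-1)`-tuples, a vertex set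
and an `(r-1)`-uniform exposure hypergraph. -/
structure Instance (r n : ℕ) where
  u : Fin (r - 1) ↪ Fin n
  v : Fin (r - 1) ↪ Fin n
  ne : u ≠ v
  S : Finset (Fin n)
  E : Finset (Finset (Fin n))
  uniform : IsUniform (r - 1) E

/-- The edges of `E` inside `S`. -/
def inside {n : ℕ} (E : Finset (Finset (Fin n))) (S : Finset (Fin n)) :
    Finset (Finset (Fin n)) :=
  E.filter fun e => e ⊆ S

/-! ### The binomial random hypergraph -/

/-- All `r`-sets of vertices. -/
def allSets (r n : ℕ) : Finset (Finset (Fin n)) :=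
  Finset.powersetCard r Finset.univ

open Classical in
/-- The probability that the binomial random `r`-uniform hypergraph on `Fin n` with edge
probability `p` has the property `A`. -/
noncomputable def prob (r n : ℕ) (p : ℝ) (A : Finset (Finset (Fin n)) → Prop) : ℝ :=
  ∑ G ∈ (allSets r n).powerset.filter A,
    p ^ G.card * (1 - p) ^ (allSets r n \ G).card

/-! ### A word RAM

Words have `w` bits.  A machine has registers and a memory, both indexed by natural numbers (only
cells whose address is a word can be reached, and a program mentions finitely many registers).  The
hypergraph `G` can be read only by *revealing*: a command names a search base (an `(r-1)`-set) and
one further vertex, is told whether the two together form an edge, and the search base is added to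
the exposure hypergraph, which is part of the state.  -/

/-- Binary operations on words; comparisons give `1` or `0`. -/
inductive BinOp where
  | add | sub | mul | div | lt | eq

def BinOp.apply : BinOp → ℕ → ℕ → ℕ
  | .add, x, y => x + y
  | .sub, x, y => x - y
  | .mul, x, y => x * y
  | .div, x, y => x / y
  | .lt, x, y => if x < y then 1 else 0
  | .eq, x, y => if x = y then 1 else 0

/-- Expressions: constants, registers, memory cells (with a computed address), operations. -/
inductive RamExpr where
  | const (m : ℕ)
  | reg (i : ℕ)
  | mem (addr : RamExpr)
  | op (o : BinOp) (x y : RamExpr)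

/-- Commands of a program working with `k`-tuples (`k = r - 1`). -/
inductive RamCmd (k : ℕ) where
  | skip
  /-- register `i` gets the value of `e` -/
  | set (i : ℕ) (e : RamExpr)
  /-- the memory cell at `addr` gets the value of `e` -/
  | store (addr e : RamExpr)
  /-- register `i` is told whether the vertex `x` is in `S` -/
  | inS (i : ℕ) (x : RamExpr)
  /-- register `i` is told whether the set of the vertices `b` is in the exposure hypergraph -/
  | inE (i : ℕ) (b : Fin k → RamExpr)
  /-- register `i` is told whether `b ∪ {x}` is an edge of `G`; the search base `b` is exposed -/
  | reveal (i : ℕ) (b : Fin k → RamExpr) (x : RamExpr)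
  | seq (c d : RamCmd k)
  /-- branch on whether the value of `e` is nonzero -/
  | ite (e : RamExpr) (c d : RamCmd k)
  /-- repeat `c` as long as the value of `e` is nonzero -/
  | while (e : RamExpr) (c : RamCmd k)

structure RamState (n : ℕ) where
  reg : ℕ → ℕ
  mem : ℕ → ℕ
  /-- the current exposure hypergraph -/
  E : Finset (Finset (Fin n))

/-- Value of an expression; results are reduced to `w` bits. -/
def RamExpr.eval {n : ℕ} (w : ℕ) (σ : RamState n) : RamExpr → ℕ
  | .const m => m % 2 ^ w
  | .reg i => σ.reg i
  | .mem addr => σ.mem (addr.eval w σ)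
  | .op o x y => o.apply (x.eval w σ) (y.eval w σ) % 2 ^ w

def RamState.setReg {n : ℕ} (σ : RamState n) (i m : ℕ) : RamState n :=
  { σ with reg := Function.update σ.reg i m }

def RamState.setMem {n : ℕ} (σ : RamState n) (i m : ℕ) : RamState n :=
  { σ with mem := Function.update σ.mem i m }

/-- Add `B` to the exposure hypergraph, if it is a `k`-set. -/
def RamState.expose {n : ℕ} (k : ℕ) (σ : RamState n) (B : Finset (Fin n)) : RamState n :=
  { σ with E := if B.card = k then insert B σ.E else σ.E }

/-- The set of the vertices whose numbers are among the words `f`. -/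
def decodeSet (n : ℕ) {k : ℕ} (f : Fin k → ℕ) : Finset (Fin n) :=
  Finset.univ.filter fun x : Fin n => ∃ j, f j = x.val

/-- The set of the vertices with number `m` (empty if `m` is not the number of a vertex). -/
def decodeVertex (n m : ℕ) : Finset (Fin n) :=
  Finset.univ.filter fun x : Fin n => m = x.val

/-- `Exec w G S c σ T σ'`: with word length `w` and inputs `G` and `S`, the command `c` started in
state `σ` halts in state `σ'` after `T` elementary steps (an assignment, a query or the evaluation
of a branching condition is one step; the size of the expressions is a constant of the program). -/
inductive Exec {n k : ℕ} (w : ℕ) (G : Finset (Finset (Fin n))) (S : Finset (Fin n)) :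
    RamCmd k → RamState n → ℕ → RamState n → Prop where
  | skip (σ : RamState n) : Exec w G S .skip σ 1 σ
  | set (σ : RamState n) (i : ℕ) (e : RamExpr) :
      Exec w G S (.set i e) σ 1 (σ.setReg i (e.eval w σ))
  | store (σ : RamState n) (addr e : RamExpr) :
      Exec w G S (.store addr e) σ 1 (σ.setMem (addr.eval w σ) (e.eval w σ))
  | inS (σ : RamState n) (i : ℕ) (x : RamExpr) :
      Exec w G S (.inS i x) σ 1
        (σ.setReg i (if (decodeVertex n (x.eval w σ) ∩ S).Nonempty then 1 else 0))
  | inE (σ : RamState n) (i : ℕ) (b : Fin k → RamExpr) :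
      Exec w G S (.inE i b) σ 1
        (σ.setReg i (if decodeSet n (fun j => (b j).eval w σ) ∈ σ.E then 1 else 0))
  | reveal (σ : RamState n) (i : ℕ) (b : Fin k → RamExpr) (x : RamExpr) :
      Exec w G S (.reveal i b x) σ 1
        ((σ.setReg i
          (if decodeSet n (fun j => (b j).eval w σ) ∪ decodeVertex n (x.eval w σ) ∈ G
            then 1 else 0)).expose k (decodeSet n fun j => (b j).eval w σ))
  | seq {c d : RamCmd k} {σ σ' σ'' : RamState n} {T T' : ℕ} :
      Exec w G S c σ T σ' → Exec w G S d σ' T' σ'' → Exec w G S (.seq c d) σ (T + T') σ''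
  | ite_true {e : RamExpr} {c d : RamCmd k} {σ σ' : RamState n} {T : ℕ} :
      e.eval w σ ≠ 0 → Exec w G S c σ T σ' → Exec w G S (.ite e c d) σ (T + 1) σ'
  | ite_false {e : RamExpr} {c d : RamCmd k} {σ σ' : RamState n} {T : ℕ} :
      e.eval w σ = 0 → Exec w G S d σ T σ' → Exec w G S (.ite e c d) σ (T + 1) σ'
  | while_true {e : RamExpr} {c : RamCmd k} {σ σ' σ'' : RamState n} {T T' : ℕ} :
      e.eval w σ ≠ 0 → Exec w G S c σ T σ' → Exec w G S (.while e c) σ' T' σ'' →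
      Exec w G S (.while e c) σ (T + T' + 1) σ''
  | while_false {e : RamExpr} {c : RamCmd k} {σ : RamState n} :
      e.eval w σ = 0 → Exec w G S (.while e c) σ 1 σ

/-- Initial state: register `0` holds `n`, the first `2(r-1)` memory cells hold `u` and `v`, the
exposure hypergraph is `E`; everything else is `0`. -/
def initState {r n : ℕ} (I : Instance r n) : RamState n where
  reg := fun i => if i = 0 then n else 0
  mem := fun i =>
    if h : i < r - 1 then (I.u ⟨i, h⟩).val
    else if h' : i - (r - 1) < r - 1 then (I.v ⟨i - (r - 1), h'⟩).val
    else 0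
  E := I.E

/-- What an algorithm returns: `none` is `Fail`, `some ⟨t, a⟩` is a sequence of `t` tuples; the
second component is the new exposure hypergraph. -/
structure Output (r n : ℕ) where
  path : Option (Σ t : ℕ, Fin t → Fin (r - 1) → Fin n)
  E' : Finset (Finset (Fin n))

/-- A final state represents an output: register `0` holds `0` for `Fail`, and otherwise the number
of tuples, whose entries are listed in order from memory cell `0` on; the exposure hypergraph of the
output is the one of the state. -/
def Represents {r n : ℕ} (σ : RamState n) (o : Output r n) : Prop :=
  σ.E = o.E' ∧
  match o.path with
  | none => σ.reg 0 = 0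
  | some ⟨t, a⟩ => 0 < t ∧ σ.reg 0 = t ∧
      ∀ (i : Fin t) (j : Fin (r - 1)), σ.mem (i.val * (r - 1) + j.val) = (a i j).val

end SpikeLemma

/-! Put k = r - 1. The usable vertices, those of S outside both end tuples, are cut into 6k classes
of equal size q, indexed by a side (0 for u, 1 for v), a level modulo 3 and a position in a tuple.
From each end a tree of tuples is grown. The entries of a child c of a node g are found one at a
time: the search base for entry j consists of the first k - j entries of g and the first j entries
of c, and the class belonging to the side, level and position is scanned for a vertex completing it
to an edge. The children of g share a stem of h - 1 entries, branch at the next entry, and are then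
completed separately; here h is k/2, rounded up on side 0 and down on side 1. Each tree gets about
q^h/D leaves for a constant D. Root-to-leaf paths are spike paths, and a leaf a of the first tree
and a leaf b of the second can be joined if k further r-sets are edges. Branching m = log₂ n ways
keeps the depth o(log n); an extra non-branching step at the second root corrects the parity.

Independence. No r-set is inspected in two searches. The classes of the vertices of an inspected set
reveal which vertex has which position in which of the two consecutive tuples; levels modulo 3 are
cyclically oriented, so parent and child cannot be confused (`Inp.Shape.inj`). As 2h ≤ k + 1, the
set then contains the beginning of length h of g if j < h and of c if j ≥ h, and different nodes
have different beginnings. So each search meets a fresh random set. `Tri` is a Hoare triple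
recording what is still unrevealed, `Tri.scan` bounds the failure of one scan by an exponential
moment, and `Inp.Hyp.search` combines this with the bookkeeping `Inp.Fresh`.

Avoiding what is already exposed. A sequence of k usable vertices is overloaded if its set belongs
to the exposure hypergraph; a shorter one is overloaded if at least q/D1 + 1 of its one-vertex
extensions are. Overload of a sequence forces a power of the threshold many completions
(`pow_le_card_of_over`), so by the bound on the edges inside S the empty sequence is not overloaded.
A vertex is rejected if it overloads some subsequence of the current base; each of the at most 2^k
subsequences rejects at most q/D1 vertices. The same device with threshold q/8 + 1, applied to the
beginnings already used, leaves room for new beginnings. Together with the vertices of ancestors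
less than half a class is lost (`Inp.Hyp.le_cands`). Since no subsequence is overloaded, no
inspected set contains an old search base (`Inp.Hyp.notMem`), apart from a root tuple itself, which
the assumption on X takes care of.

Joining. Soundness of the tuples on one side limits how many leaves on the other side complete a
part of one to an old base (`card_complete_le`), so at most a quarter of the pairs of leaves are
spoilt. The k joining sets of a pair fall into those containing the length-h beginning of a and
those containing that of b. Revealing the first kind gives each good b a partner with high
probability, as different a use disjoint families; revealing the second kind for these partners
succeeds for some b, as different b use disjoint families (`Inp.Hyp.connect`). Both rounds work
because p q is a large multiple of log n.

Cost. A scan uses one search base and there are O(|S|^(k-1)) tree nodes. For a joining set the base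
drops a vertex on the side contributing more freedom, so it is counted by a leaf of one tree and few
free vertices (`Inp.card_links`). A scan costs at most q times the depth, which is O(n); the
overload table and the pairs of leaves cost O(n^k).

The search is first defined as a partial function (`Par.grow`, `Inp.tree`, `Inp.Succ`). One half of
the proof shows that the machine program computes it within the resource bounds (`Ok.program`) and
that its result is a spike path; the other half bounds the probability that it is undefined or finds
no joinable pair (`Inp.Hyp.fail_le`). -/

namespace SpikeLemma

open Finset

/-! ### Total correctness of programs -/

section Ram

variable {n k : ℕ} {w : ℕ} {G : Finset (Finset (Fin n))} {S : Finset (Fin n)}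
variable {σ : RamState n} {T T' a b i m : ℕ} {e x y : RamExpr}

/-- Started in `σ`, the command `c` halts within `T` steps in a state satisfying `Q`. -/
def Ok (w : ℕ) (G : Finset (Finset (Fin n))) (S : Finset (Fin n)) (c : RamCmd k) (σ : RamState n)
    (T : ℕ) (Q : RamState n → Prop) : Prop :=
  ∃ t σ', Exec w G S c σ t σ' ∧ t ≤ T ∧ Q σ'

theorem Ok.mono {c : RamCmd k} {Q Q' : RamState n → Prop} (h : Ok w G S c σ T Q) (hT : T ≤ T')
    (hQ : ∀ σ', Q σ' → Q' σ') : Ok w G S c σ T' Q' := by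
  obtain ⟨t, σ', h1, h2, h3⟩ := h
  exact ⟨t, σ', h1, h2.trans hT, hQ _ h3⟩

theorem Ok.skip {Q : RamState n → Prop} (hT : 1 ≤ T) (h : Q σ) : Ok w G S (.skip : RamCmd k) σ T Q :=
  ⟨1, σ, Exec.skip σ, hT, h⟩

theorem Ok.set {Q : RamState n → Prop} (hT : 1 ≤ T) (h : Q (σ.setReg i (e.eval w σ))) : Ok w G S
    (.set i e : RamCmd k) σ T Q :=
  ⟨1, _, Exec.set σ i e, hT, h⟩

theorem Ok.store {a : RamExpr} {Q : RamState n → Prop} (hT : 1 ≤ T)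
    (h : Q (σ.setMem (a.eval w σ) (e.eval w σ))) : Ok w G S (.store a e : RamCmd k) σ T Q :=
  ⟨1, _, Exec.store σ a e, hT, h⟩

theorem Ok.inS {Q : RamState n → Prop} (hT : 1 ≤ T)
    (h : Q (σ.setReg i (if (decodeVertex n (x.eval w σ) ∩ S).Nonempty then 1 else 0))) : Ok w G S
    (.inS i x : RamCmd k) σ T Q :=
  ⟨1, _, Exec.inS σ i x, hT, h⟩

theorem Ok.inE {b : Fin k → RamExpr} {Q : RamState n → Prop} (hT : 1 ≤ T)
    (h : Q (σ.setReg i (if decodeSet n (fun j => (b j).eval w σ) ∈ σ.E then 1 else 0))) : Ok w G S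
    (.inE i b : RamCmd k) σ T Q :=
  ⟨1, _, Exec.inE σ i b, hT, h⟩

theorem Ok.reveal {b : Fin k → RamExpr} {Q : RamState n → Prop} (hT : 1 ≤ T)
    (h : Q ((σ.setReg i (if decodeSet n (fun j => (b j).eval w σ) ∪ decodeVertex n (x.eval w σ) ∈ G then 1 else
    0)).expose k (decodeSet n fun j => (b j).eval w σ))) : Ok w G S (.reveal i b x : RamCmd k) σ T Q :=
  ⟨1, _, Exec.reveal σ i b x, hT, h⟩

theorem Ok.seq {c d : RamCmd k} {T'' : ℕ} {P Q : RamState n → Prop}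
    (hc : Ok w G S c σ T P) (hd : ∀ σ', P σ' → Ok w G S d σ' T' Q) (hT : T + T' ≤ T'' := by omega) :
    Ok w G S (.seq c d) σ T'' Q := by
  obtain ⟨t, σ', h1, h2, h3⟩ := hc
  obtain ⟨t', σ'', h4, h5, h6⟩ := hd σ' h3
  exact ⟨t + t', σ'', Exec.seq h1 h4, by omega, h6⟩

theorem Ok.set_seq {d : RamCmd k}
    {Q : RamState n → Prop} (T v : ℕ) (he : e.eval w σ = v) (hd : Ok w G S d (σ.setReg i v) T Q)
    (hT : 1 + T ≤ T' := by omega) : Ok w G S (.seq (.set i e) d) σ T' Q := by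
  subst he
  exact Ok.seq (Ok.set (Q := fun σ' => σ' = _) le_rfl rfl) (by rintro _ rfl; exact hd) hT

theorem Ok.ite {c d : RamCmd k}
    {Q : RamState n → Prop} (hc : e.eval w σ ≠ 0 → Ok w G S c σ T Q)
    (hd : e.eval w σ = 0 → Ok w G S d σ T Q) (hT : T + 1 ≤ T' := by omega) :
    Ok w G S (.ite e c d) σ T' Q := by
  by_cases h : e.eval w σ = 0
  · obtain ⟨t, σ', h1, h2, h3⟩ := hd h
    exact ⟨t + 1, σ', Exec.ite_false h h1, by omega, h3⟩
  · obtain ⟨t, σ', h1, h2, h3⟩ := hc h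
    exact ⟨t + 1, σ', Exec.ite_true h h1, by omega, h3⟩

/-- Repeat `body` while the register `ri` runs through the numbers below `bound`. -/
def forN (ri : ℕ) (bound : RamExpr) (body : RamCmd k) : RamCmd k :=
  .seq (.set ri (.const 0))
    (.while (.op .lt (.reg ri) bound) (.seq body (.set ri (.op .add (.reg ri) (.const 1)))))

/-- The rule for loops with an invariant. The bound is evaluated anew in every round, so the
invariant must fix its value, and `K + 1 < 2 ^ w` keeps the counter from wrapping around. -/
theorem Ok.forN {ri : ℕ} {bound : RamExpr} {body : RamCmd k} {K : ℕ} {Q : RamState n → Prop}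
    (Inv : ℕ → RamState n → Prop) (hK : K + 1 < 2 ^ w) (h0 : Inv 0 (σ.setReg ri 0))
    (hri : ∀ i σ, Inv i σ → σ.reg ri = i) (hb : ∀ i σ, Inv i σ → bound.eval w σ = K)
    (hs : ∀ i < K, ∀ σ, Inv i σ → Ok w G S body σ T (fun σ' => σ'.reg ri = i ∧ Inv (i + 1) (σ'.setReg ri (i +
    1)))) (hQ : ∀ σ, Inv K σ → Q σ) (hT : K * (T + 2) + 2 ≤ T') : Ok w G S (forN ri bound body) σ T' Q := by
  have hcond : ∀ i σ, Inv i σ →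
      (RamExpr.op .lt (.reg ri) bound).eval w σ = if i < K then 1 else 0 := by
    intro i σ h
    have h1 : 1 % 2 ^ w = 1 := Nat.mod_eq_of_lt (by omega)
    simp only [RamExpr.eval, BinOp.apply, hri i σ h, hb i σ h]
    split <;> simp [h1]
  have key : ∀ d i σ, i + d = K → Inv i σ →
      Ok w G S (.while (.op .lt (.reg ri) bound)
        (.seq body (.set ri (.op .add (.reg ri) (.const 1))))) σ (d * (T + 2) + 1) Q := by
    intro d
    induction d with
    | zero =>
      intro i σ hi h
      refine ⟨1, σ, Exec.while_false ?_, by omega, hQ σ ?_⟩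
      · grind
      grind
    | succ d ih =>
      intro i σ hi h
      obtain ⟨t, σ', h1, h2, h3, h4⟩ := hs i (by omega) σ h
      obtain ⟨t', σ'', h5, h6, h7⟩ := ih (i + 1) _ (by omega) h4
      have hv : (RamExpr.op .add (.reg ri) (.const 1)).eval w σ' = i + 1 := by
        simp only [RamExpr.eval, BinOp.apply, h3]
        rw [Nat.mod_eq_of_lt (a := 1) (by omega), Nat.mod_eq_of_lt (by omega)]
      refine ⟨(t + 1) + t' + 1, σ'', Exec.while_true ?_ (Exec.seq h1 (Exec.set _ _ _)) ?_, ?_, h7⟩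
      · grind
      · rw [hv]
        exact h5
      grind
  refine Ok.seq (Ok.set (T := 1) (Q := fun σ' => σ' = σ.setReg ri 0) le_rfl ?_) ?_ (?_ : 1 + (K * (T + 2) + 1) ≤ T')
  · simp [RamExpr.eval]
  · grind
  · omega

@[simp] theorem setReg_reg (σ : RamState n) (i m j : ℕ) : (σ.setReg i m).reg j = if j = i then m else σ.reg
    j := by
  simp [RamState.setReg, Function.update_apply]

theorem setReg_ne {j : ℕ} (h : j ≠ i) : (σ.setReg i m).reg j = σ.reg j := by
  rw [setReg_reg, if_neg h]

@[simp] theorem setReg_mem (σ : RamState n) (i m : ℕ) : (σ.setReg i m).mem = σ.mem := rfl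
@[simp] theorem setReg_E (σ : RamState n) (i m : ℕ) : (σ.setReg i m).E = σ.E := rfl
@[simp] theorem setMem_reg (σ : RamState n) (i m : ℕ) : (σ.setMem i m).reg = σ.reg := rfl
@[simp] theorem setMem_E (σ : RamState n) (i m : ℕ) : (σ.setMem i m).E = σ.E := rfl

@[simp] theorem setMem_mem (σ : RamState n) (i m j : ℕ) : (σ.setMem i m).mem j = if j = i then m else σ.mem
    j := by
  simp [RamState.setMem, Function.update_apply]

@[simp] theorem expose_reg (σ : RamState n) (B : Finset (Fin n)) : (σ.expose k B).reg = σ.reg := rfl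
@[simp] theorem expose_mem (σ : RamState n) (B : Finset (Fin n)) : (σ.expose k B).mem = σ.mem := rfl

/-! ### Expressions -/

theorem eval_const (h : m < 2 ^ w := by omega) :
    (RamExpr.const m).eval w σ = m := Nat.mod_eq_of_lt h

@[simp] theorem eval_reg : (RamExpr.reg i).eval w σ = σ.reg i := rfl

@[simp] theorem eval_mem : (RamExpr.mem e).eval w σ = σ.mem (e.eval w σ) := rfl

theorem eval_add (hx : x.eval w σ = a)
    (hy : y.eval w σ = b) (h : a + b < 2 ^ w := by omega) : (RamExpr.op .add x y).eval w σ = a + b := by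
  simp only [RamExpr.eval, BinOp.apply, hx, hy]
  exact Nat.mod_eq_of_lt h

theorem eval_mul (hx : x.eval w σ = a)
    (hy : y.eval w σ = b) (h : a * b < 2 ^ w := by omega) : (RamExpr.op .mul x y).eval w σ = a * b := by
  simp only [RamExpr.eval, BinOp.apply, hx, hy]
  exact Nat.mod_eq_of_lt h

theorem eval_sub (hx : x.eval w σ = a)
    (hy : y.eval w σ = b) (h : a < 2 ^ w := by omega) : (RamExpr.op .sub x y).eval w σ = a - b := by
  simp only [RamExpr.eval, BinOp.apply, hx, hy]
  exact Nat.mod_eq_of_lt (by omega)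

theorem eval_div (hx : x.eval w σ = a)
    (hy : y.eval w σ = b) (h : a < 2 ^ w := by omega) : (RamExpr.op .div x y).eval w σ = a / b := by
  simp only [RamExpr.eval, BinOp.apply, hx, hy]
  exact Nat.mod_eq_of_lt (lt_of_le_of_lt (Nat.div_le_self _ _) h)

theorem eval_lt (hx : x.eval w σ = a) (hy : y.eval w σ = b) (h : 1 < 2 ^ w) : (RamExpr.op .lt x y).eval w σ = if
    a < b then 1 else 0 := by
  simp only [RamExpr.eval, BinOp.apply, hx, hy]
  exact Nat.mod_eq_of_lt (by split <;> omega)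

theorem eval_eq (hx : x.eval w σ = a) (hy : y.eval w σ = b) (h : 1 < 2 ^ w) : (RamExpr.op .eq x y).eval w σ = if
    a = b then 1 else 0 := by
  simp only [RamExpr.eval, BinOp.apply, hx, hy]
  exact Nat.mod_eq_of_lt (by split <;> omega)

/-- The expression for a power with a constant exponent. -/
def powE (x : RamExpr) : ℕ → RamExpr
  | 0 => .const 1
  | j + 1 => .op .mul (powE x j) x

theorem eval_powE (hx : x.eval w σ = a) (j : ℕ) (ha : 1 ≤ a) (h : a ^ j < 2 ^ w) : (powE x j).eval w σ = a ^
    j := by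
  induction j with
  | zero => exact eval_const h
  | succ j ih =>
    have h1 : a ^ j ≤ a ^ (j + 1) := Nat.pow_le_pow_right ha (by omega)
    rw [pow_succ] at h ⊢
    exact eval_mul (ih (by rw [pow_succ] at h1; omega)) hx h

/-- The conjunction of a list of tests with values `0` and `1`. -/
def allE : List RamExpr → RamExpr
  | [] => .const 1
  | e :: l => .op .mul e (allE l)

theorem eval_allE {ι : Type*} (hw : 1 < 2 ^ w) (l : List ι) (e : ι → RamExpr) (P : ι → Prop) [DecidablePred P]
    (h : ∀ i ∈ l, (e i).eval w σ = if P i then 1 else 0) : (allE (l.map e)).eval w σ = if ∀ i ∈ l, P i then 1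
    else 0 := by
  induction l with
  | nil => simp [allE, RamExpr.eval, Nat.mod_eq_of_lt hw]
  | cons i l ih =>
    have h1 := h i (by simp)
    have h2 := ih (fun i hi => h i (by simp [hi]))
    simp only [List.map_cons, allE]
    rw [eval_mul h1 h2 (by split_ifs <;> omega)]
    by_cases hi : P i <;> simp [hi]

end Ram

/-! ### Overloaded sequences -/

/-- The bound from which on a cell counts as overloaded. -/
def lim (thr : ℕ) : ℕ → ℕ
  | 0 => 1
  | _ + 1 => thr

/-- `cell n thr U j l` is the number of overloaded one-step extensions of `l`, a sequence that is
`j` entries shorter than the sequences in `U`; those in `U` count as overloaded themselves. -/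
def cell (n thr : ℕ) (U : Finset (List ℕ)) : ℕ → List ℕ → ℕ
  | 0, l => if l ∈ U then 1 else 0
  | j + 1, l => ((range n).filter fun x => lim thr j ≤ cell n thr U j (l ++ [x])).card

/-- The sequence `l` is overloaded. -/
def Over (n thr : ℕ) (U : Finset (List ℕ)) (j : ℕ) (l : List ℕ) : Prop :=
  lim thr j ≤ cell n thr U j l

instance (n thr : ℕ) (U : Finset (List ℕ)) (j : ℕ) (l : List ℕ) : Decidable (Over n thr U j l) :=
  inferInstanceAs (Decidable (_ ≤ _))

theorem over_zero {n thr : ℕ} {U : Finset (List ℕ)} {l : List ℕ} :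
    Over n thr U 0 l ↔ l ∈ U := by
  by_cases h : l ∈ U <;> simp [Over, lim, cell, h]

theorem over_succ {n thr : ℕ} {U : Finset (List ℕ)} {j : ℕ} {l : List ℕ} :
    Over n thr U (j + 1) l ↔
      thr ≤ ((range n).filter fun x => Over n thr U j (l ++ [x])).card := Iff.rfl

/-- Members of `U` extending `l` through different next entries are different, so the counts
multiply along the `j` levels. Contrapositively, a small `U` leaves the empty sequence free of
overload. -/
theorem pow_le_card_of_over {n thr : ℕ} {U : Finset (List ℕ)} {j : ℕ} {l : List ℕ}
    (h : Over n thr U j l) : thr ^ j ≤ (U.filter fun l' => l <+: l').card := by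
  induction j generalizing l with
  | zero =>
    rw [over_zero] at h
    exact Finset.card_pos.2 ⟨l, by simp [h]⟩
  | succ j ih =>
    set X := (range n).filter fun x => Over n thr U j (l ++ [x])
    have hd : ∀ x ∈ X, ∀ y ∈ X, x ≠ y → Disjoint (U.filter fun l' => l ++ [x] <+: l')
        (U.filter fun l' => l ++ [y] <+: l') := by
      intro x _ y _ hxy
      rw [Finset.disjoint_left]
      intro l' h1 h2
      have h3 := List.prefix_of_prefix_length_le (mem_filter.1 h1).2 (mem_filter.1 h2).2 (by simp)
      simp_all
    calc thr ^ (j + 1) = thr * thr ^ j := by ring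
      _ ≤ X.card * thr ^ j := Nat.mul_le_mul_right _ h
      _ = ∑ x ∈ X, thr ^ j := by simp
      _ ≤ ∑ x ∈ X, (U.filter fun l' => l ++ [x] <+: l').card :=
        Finset.sum_le_sum fun x hx => ih (mem_filter.1 hx).2
      _ = (X.biUnion fun x => U.filter fun l' => l ++ [x] <+: l').card :=
        (Finset.card_biUnion hd).symm
      _ ≤ _ := by
        apply Finset.card_le_card
        grind [List.prefix_append]

/-- All `j` counters on the way from `l` towards the empty sequence change when `l` is added. -/
def Act (n thr : ℕ) (U : Finset (List ℕ)) (l : List ℕ) : ℕ → Prop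
  | 0 => True
  | j + 1 => Act n thr U l j ∧ cell n thr U j (l.take (l.length - j)) + 1 = lim thr j

-- Inserting `l` can raise only the counters of prefixes of `l`. The counter at a prefix changes
-- exactly if the next longer prefix has just reached its bound, hence if all longer ones have. So
-- an insertion updates counters from the long end and stops at the first one that does not become
-- overloaded.
open Classical in
theorem cell_insert {n thr : ℕ} {U : Finset (List ℕ)} {l : List ℕ} (hl : l ∉ U)
    (hn : ∀ x ∈ l, x < n) (j : ℕ) (l' : List ℕ) (h : l'.length + j = l.length) :
    cell n thr (insert l U) j l' =
      cell n thr U j l' + if l' = l.take (l.length - j) ∧ Act n thr U l j then 1 else 0 := by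
  induction j generalizing l' with
  | zero =>
    grind [cell, Act]
  | succ j ih =>
    simp only [cell]
    have ih' : ∀ x, cell n thr (insert l U) j (l' ++ [x]) = _ :=
      fun x => ih (l' ++ [x]) (by simp; omega)
    simp only [ih']
    -- For a prefix of `l` the only extension whose status can change is the one by the next entry
    -- `y` of `l`; for any other sequence none changes.
    by_cases h' : l' = l.take (l.length - (j + 1))
    · have hj : l.length - (j + 1) < l.length := by omega
      set y := l[l.length - (j + 1)]
      have hy : l.take (l.length - j) = l' ++ [y] := by
        rw [h', show l.length - j = l.length - (j + 1) + 1 by omega, List.take_succ_eq_append_getElem hj]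
      have hyn : y < n := hn _ (List.getElem_mem hj)
      have hx : ∀ x, l' ++ [x] = l.take (l.length - j) ↔ x = y := by
        intro x; rw [hy]; simp
      simp only [hx]
      by_cases ha : Act n thr U l (j + 1)
      · have ha' : Act n thr U l j ∧ cell n thr U j (l' ++ [y]) + 1 = lim thr j := by
          rw [← hy]; exact ha
        simp only [h'.symm, ha, and_self, if_true, ha'.1, and_true]
        have : ((range n).filter fun x =>
            lim thr j ≤ cell n thr U j (l' ++ [x]) + if x = y then 1 else 0) =
            insert y ((range n).filter fun x => lim thr j ≤ cell n thr U j (l' ++ [x])) := by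
          ext x
          by_cases hxy : x = y
          · subst hxy; simp [hyn, ha'.2]
          · simp [hxy]
        grind
      · simp only [ha, and_false, if_false, add_zero]
        grind [Finset.filter_congr, Act, cell, lim]
    · rw [if_neg (fun hh => h' hh.1), add_zero]
      congr 1
      apply Finset.filter_congr
      intro x _
      rw [if_neg, add_zero]
      rintro ⟨hh, -⟩
      have := congrArg (List.take (l.length - (j + 1))) hh
      grind [min_eq_left, List.take_of_length_le]

/-! ### Codes of sequences -/

/-- The number coding the sequence `l` of numbers below `n`. -/
def code (n : ℕ) (l : List ℕ) : ℕ := l.foldl (fun c x => c * (n + 1) + (x + 1)) 0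

@[simp] theorem code_append (n : ℕ) (l : List ℕ) (x : ℕ) :
    code n (l ++ [x]) = code n l * (n + 1) + (x + 1) := by
  simp [code]

theorem code_lt {n : ℕ} {l : List ℕ} (h : ∀ x ∈ l, x < n) : code n l < (n + 1) ^ l.length := by
  induction l using List.reverseRecOn with
  | nil => simp [code]
  | append_singleton l x ih =>
    have h1 := ih fun y hy => h y (by simp [hy])
    have h2 := h x (by simp)
    rw [code_append, List.length_append, List.length_singleton, pow_succ]
    nlinarith

/-- The digits `x + 1` in base `n + 1` are never zero, so sequences of different lengths also get
different codes and a single table can hold the counters of all lengths. -/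
theorem code_inj {n : ℕ} {l l' : List ℕ} (h : ∀ x ∈ l, x < n) (h' : ∀ x ∈ l', x < n)
    (hc : code n l = code n l') : l = l' := by
  induction l using List.reverseRecOn generalizing l' with
  | nil =>
    cases l' using List.reverseRecOn with
    | nil => rfl
    | append_singleton l' x => simp [code] at hc
  | append_singleton l x ih =>
    cases l' using List.reverseRecOn with
    | nil => simp [code] at hc
    | append_singleton l' y =>
      rw [code_append, code_append] at hc
      have h2 := h x (by simp)
      have h3 := h' y (by simp)
      have h4 : code n l * (n + 1) + x = code n l' * (n + 1) + y := by omega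
      have h5 : x = y := by
        grind [Nat.mul_add_mod_of_lt, Nat.mul_add_mod', Nat.mod_eq_of_lt]
      have h6 : code n l = code n l' := by
        simp_all
      grind

/-! ### The set of the vertices in a list -/

/-- The set of the vertices with numbers in `l`. -/
def vset (n : ℕ) (l : List ℕ) : Finset (Fin n) := univ.filter fun x => x.val ∈ l

@[simp] theorem mem_vset {n : ℕ} {l : List ℕ} {x : Fin n} : x ∈ vset n l ↔ x.val ∈ l := by
  simp [vset]

theorem card_vset {n : ℕ} {l : List ℕ} (h : ∀ x ∈ l, x < n) (hl : l.Nodup) :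
    (vset n l).card = l.length := by
  have : (vset n l).map Fin.valEmbedding = l.toFinset := by
    ext x
    simp only [Finset.mem_map, mem_vset, List.mem_toFinset, Fin.valEmbedding_apply]
    exact ⟨fun ⟨y, h1, h2⟩ => h2 ▸ h1, fun hx => ⟨⟨x, h x hx⟩, hx, rfl⟩⟩
  rw [← Finset.card_map Fin.valEmbedding, this, List.toFinset_card_of_nodup hl]

theorem vset_eq_iff {n : ℕ} {l l' : List ℕ} (h : ∀ x ∈ l, x < n) (h' : ∀ x ∈ l', x < n) :
    vset n l = vset n l' ↔ ∀ x, x ∈ l ↔ x ∈ l' := by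
  constructor
  · intro hh x
    constructor
    · intro hx
      have : (⟨x, h x hx⟩ : Fin n) ∈ vset n l := by simpa using hx
      simp_all
    · intro hx
      have : (⟨x, h' x hx⟩ : Fin n) ∈ vset n l' := by simpa using hx
      rw [← hh] at this
      simpa using this
  aesop

theorem vset_append {n : ℕ} (l l' : List ℕ) : vset n (l ++ l') = vset n l ∪ vset n l' := by
  ext x; simp

/-! ### The search tree -/

/-- The parameters of the search from one of the two ends. -/
structure Par where
  /-- number of vertices -/
  n : ℕ
  /-- size of the tuples -/
  k : ℕ
  /-- size of the classes -/
  q : ℕ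
  m : ℕ
  thrE : ℕ
  thrU : ℕ
  dep : ℕ
  sl : ℕ → ℕ
  UE : Finset (List ℕ)
  h : ℕ
  side : ℕ
  /-- the tuple to start from -/
  rt : ℕ → ℕ

/-- The search tree, an array of nodes.  The fields `0` to `k - 1` of a node hold a tuple, the
field `k` holds the parent and the field `k + 1` the level. -/
abbrev Nodes := ℕ → ℕ → ℕ

/-- The first `i` entries of the tuple of a node. -/
def Nodes.pre (A : Nodes) (q i : ℕ) : List ℕ := (List.range i).map (A q)

/-- The ancestors of a node. -/
def Nodes.anc (A : Nodes) (k g : ℕ) : ℕ → ℕ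
  | 0 => g
  | i + 1 => A (A.anc k g i) k

/-- The search base for entry `j` of a child `c` of the node `g`. -/
def Nodes.base (A : Nodes) (k g c j : ℕ) : List ℕ := A.pre g (k - j) ++ A.pre c j

/-- The vertex with number `i` in the class for entry `j` of the tuples of a level. -/
def Par.vtx (P : Par) (lev j i : ℕ) : ℕ := P.sl (((P.side * 3 + lev % 3) * P.k + j) * P.q + i)

/-- The vertex `x` may become entry `j` of a child `c` of the node `g`. -/
def Par.Test (P : Par) (A : Nodes) (U : Finset (List ℕ)) (g c j x : ℕ) : Prop :=
  (∀ Q ∈ (A.base P.k g c j).sublists, Q.length + 1 ≤ P.k →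
    ¬ Over P.n P.thrE P.UE (P.k - (Q.length + 1)) (Q ++ [x])) ∧
  (j < P.h → ¬ Over P.n P.thrU U (P.h - (j + 1)) (A.pre c j ++ [x])) ∧
  (∀ i < P.dep, ∀ f < P.k, A (A.anc P.k g i) f ≠ x)

open Classical in
/-- The admissible vertices among the first `I` of the class. -/
noncomputable def Par.cands (P : Par) (A : Nodes) (U : Finset (List ℕ)) (g c j I : ℕ) : List ℕ :=
  ((List.range I).map (P.vtx (A g (P.k + 1) + 1) j)).filter fun x => P.Test A U g c j x

/-- The admissible vertices found in `G` among the first `I` of the class. -/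
noncomputable def Par.hits (P : Par) (G : Finset (Finset (Fin P.n))) (A : Nodes)
    (U : Finset (List ℕ)) (g c j I : ℕ) : List ℕ :=
  (P.cands A U g c j I).filter fun x => vset P.n (A.base P.k g c j ++ [x]) ∈ G

/-- Write the entries of `xs` into the fields `j` of the nodes from `c` on. -/
def Nodes.write (A : Nodes) (c j : ℕ) (xs : List ℕ) : Nodes := fun p i =>
  if i = j ∧ c ≤ p ∧ p < c + xs.length then xs.getD (p - c) 0 else A p i

/-- Find `s` vertices for entry `j` of children of `g`. -/
noncomputable def Par.scan (P : Par) (G : Finset (Finset (Fin P.n))) (s : ℕ)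
    (U : Finset (List ℕ)) (g c j : ℕ) (A : Nodes) : Option Nodes :=
  if s ≤ (P.hits G A U g c j P.q).length then
    some (A.write c j ((P.hits G A U g c j P.q).take s))
  else none

/-- Find single vertices for a list of entries. -/
noncomputable def Par.scans (P : Par) (G : Finset (Finset (Fin P.n)))
    (U : Finset (List ℕ)) (g c : ℕ) : List ℕ → Nodes → Option Nodes
  | [], A => some A
  | j :: js, A => (P.scan G 1 U g c j A).bind (P.scans G U g c js)

/-- Prepare a child `c'` of `g`, which shares its stem with `c`. -/
def Par.prep (P : Par) (A : Nodes) (g c c' : ℕ) : Nodes := fun p i =>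
  if p = c' then
    if i < P.h - 1 then A c i
    else if i = P.k then g
    else if i = P.k + 1 then A g (P.k + 1) + 1
    else A p i
  else A p i

/-- Complete the child `c + i` of `g`. -/
noncomputable def Par.child (P : Par) (G : Finset (Finset (Fin P.n))) (g c i : ℕ)
    (s : Nodes × Finset (List ℕ)) : Option (Nodes × Finset (List ℕ)) :=
  let A := P.prep s.1 g c (c + i)
  let U := insert (A.pre (c + i) P.h) s.2
  (P.scans G U g (c + i) (List.range' P.h (P.k - P.h)) A).map fun A' => (A', U)

/-- Iterate a partial function. -/
def loopM {α : Type*} (f : ℕ → α → Option α) : ℕ → α → Option α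
  | 0, a => some a
  | i + 1, a => (loopM f i a).bind (f i)

/-- Find `s` children of `g`, to be stored from `c` on. -/
noncomputable def Par.expand (P : Par) (G : Finset (Finset (Fin P.n))) (s g c : ℕ)
    (st : Nodes × Finset (List ℕ)) : Option (Nodes × Finset (List ℕ)) :=
  (P.scans G st.2 g c (List.range (P.h - 1)) st.1).bind fun A =>
    (P.scan G s st.2 g c (P.h - 1) A).bind fun A' =>
      loopM (P.child G g c) s (A', st.2)

/-- Grow the search tree: the nodes `i < e` get one child each, the next `X` nodes `m` each. -/
noncomputable def Par.grow (P : Par) (G : Finset (Finset (Fin P.n))) (e X : ℕ)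
    (st : Nodes × Finset (List ℕ)) : Option (Nodes × Finset (List ℕ)) :=
  (loopM (fun i => P.expand G 1 i (i + 1)) e st).bind
    (loopM (fun i => P.expand G P.m (e + i) (e + 1 + i * P.m)) X)

/-- Ensures that counters fit into a word, so that increments do not wrap around. -/
theorem cell_le {n thr : ℕ} {U : Finset (List ℕ)} {j : ℕ} {l : List ℕ} :
    cell n thr U j l ≤ n + 1 := by
  cases j with
  | zero => unfold cell; split <;> omega
  | succ j =>
    grind [cell, Finset.card_filter_le, lim, Finset.card_range]

section Layout

variable {n k : ℕ} {w B : ℕ} {G : Finset (Finset (Fin n))} {S : Finset (Fin n)}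
variable {σ σ' : RamState n} {N d o rt t thr : ℕ} {M M' l : List ℕ} {U : Finset (List ℕ)}

/-! ### Memory layout: cell `o` of region `t` has the address `t * B + o` -/

/-- The address of cell `e` of region `t`; register `1` holds the size of the regions. -/
def addrE (t : ℕ) (e : RamExpr) : RamExpr := .op .add (.op .mul (.const t) (.reg 1)) e

theorem eval_addrE {e : RamExpr} (h1 : σ.reg 1 = B) (hw : 8 * B < 2 ^ w) (ht : t < 7) (he : e.eval w σ = o)
    (ho : o < B) : (addrE t e).eval w σ = t * B + o := by
  have : t * B ≤ 6 * B := Nat.mul_le_mul_right _ (by omega)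
  exact eval_add (eval_mul eval_const h1) he

/-- Uniqueness of quotient and remainder; besides addresses it also serves for indices of classes
and of pairs of leaves. -/
theorem addr_inj {t' o' : ℕ} (ho : o < B) (ho' : o' < B) (h : t * B + o = t' * B + o') : t = t' ∧ o = o' := by
  have h1 : t = t' := by
    rcases lt_trichotomy t t' with h2 | h2 | h2
    · have : (t + 1) * B ≤ t' * B := Nat.mul_le_mul_right _ h2
      rw [add_mul] at this
      omega
    · exact h2
    · have : (t' + 1) * B ≤ t * B := Nat.mul_le_mul_right _ h2
      rw [add_mul] at this
      omega
  grind

/-- The two states agree outside the regions in `M`. -/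
def SameMem (B : ℕ) (M : List ℕ) (σ σ' : RamState n) : Prop :=
  ∀ t o, t ∉ M → o < B → σ'.mem (t * B + o) = σ.mem (t * B + o)

theorem SameMem.refl (M : List ℕ) (σ : RamState n) : SameMem B M σ σ := fun _ _ _ _ => rfl

theorem SameMem.trans {M'' : List ℕ} {σ'' : RamState n} (h : SameMem B M σ σ') (h' : SameMem B M' σ' σ'')
    (hM : M ⊆ M'') (hM' : M' ⊆ M'') : SameMem B M'' σ σ'' :=
  fun t o ht ho => (h' t o (fun hh => ht (hM' hh)) ho).trans (h t o (fun hh => ht (hM hh)) ho)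

theorem SameMem.mono (h : SameMem B M σ σ') (hM : M ⊆ M') : SameMem B M' σ σ' := fun t o ht ho => h t o (fun hh => ht (hM hh)) ho

theorem sameMem_of_eq (h : σ'.mem = σ.mem) : SameMem B M σ σ' := fun _ _ _ _ => by rw [h]

theorem sameMem_setMem {v : ℕ} (ht : t ∈ M) (ho : o < B) : SameMem B M σ (σ.setMem (t * B + o) v) := by
  intro t' o' ht' ho'
  rw [setMem_mem, if_neg]
  intro h
  exact ht' ((addr_inj ho' ho h).1 ▸ ht)

/-! ### Codes and counters -/

/-- The expression for the code of a sequence. -/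
def codeE (es : List RamExpr) : RamExpr :=
  es.foldl (fun c x => .op .add (.op .mul c (.op .add (.reg 0) (.const 1)))
    (.op .add x (.const 1))) (.const 0)

theorem eval_codeE (h0 : σ.reg 0 = N) (es : List RamExpr) (l : List ℕ) (hl : es.map (RamExpr.eval w σ) = l)
    (hn : ∀ x ∈ l, x < N) (hw : (N + 1) ^ l.length < 2 ^ w) (hN : N + 1 < 2 ^ w) : (codeE es).eval w σ = code N
    l := by
  induction es using List.reverseRecOn generalizing l with
  | nil => aesop
  | append_singleton es e ih =>
    subst hl
    rw [List.map_append, List.map_singleton] at hn hw ⊢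
    have hc := code_lt hn
    rw [code_append] at hc ⊢
    have h1 := ih (es.map (RamExpr.eval w σ)) rfl (fun x hx => hn x (by simp [hx])) (by
      refine lt_of_le_of_lt (Nat.pow_le_pow_right (by omega) ?_) hw
      simp)
    simp only [codeE, List.foldl_append, List.foldl_cons, List.foldl_nil]
    have h3 : (RamExpr.op .add (.reg 0) (.const 1)).eval w σ = N + 1 :=
      eval_add h0 eval_const hN
    exact eval_add (eval_mul h1 h3) (eval_add rfl eval_const (by omega))

/-- The table in region `t` holds the counters of `U`, a set of sequences of length `d`. -/
def Tab (B t N thr d : ℕ) (U : Finset (List ℕ)) (σ : RamState n) : Prop :=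
  ∀ l : List ℕ, l.length ≤ d → (∀ x ∈ l, x < N) →
    σ.mem (t * B + code N l) = cell N thr U (d - l.length) l

theorem code_lt_of_le (hB : (N + 1) ^ d ≤ B) (hl : l.length ≤ d) (hn : ∀ x ∈ l, x < N) : code N l < B :=
  (code_lt hn).trans_le ((Nat.pow_le_pow_right (by omega) hl).trans hB)

theorem Tab.same (h : Tab B t N thr d U σ) (hB : (N + 1) ^ d ≤ B) (hs : SameMem B M σ σ') (ht : t ∉ M) : Tab B t
    N thr d U σ' := fun l hl hn => by
  rw [hs t _ ht (code_lt_of_le hB hl hn)]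
  exact h l hl hn

/-- The bound `lim`, where register `rt` holds the threshold. -/
def limE (rt j : ℕ) : RamExpr := if j = 0 then .const 1 else .reg rt

theorem eval_limE {j : ℕ} (h : σ.reg rt = thr) (hw : 1 < 2 ^ w) : (limE rt j).eval w σ = lim thr j := by
  cases j with
  | zero => exact eval_const hw
  | succ j => simpa [limE, lim] using h

/-- Increase the counter of the sequence of the first `i` entries, and those of shorter ones as
long as a sequence becomes overloaded. -/
def bumpAux (t rt : ℕ) (es : List RamExpr) : ℕ → RamCmd k
  | 0 => .store (addrE t (codeE [])) (.op .add (.mem (addrE t (codeE []))) (.const 1))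
  | i + 1 => .seq (.store (addrE t (codeE (es.take (i + 1))))
      (.op .add (.mem (addrE t (codeE (es.take (i + 1))))) (.const 1)))
      (.ite (.op .eq (.mem (addrE t (codeE (es.take (i + 1))))) (limE rt (es.length - (i + 1))))
        (bumpAux t rt es i) .skip)

/-- Add a sequence to the set counted by the table `t`. -/
def bump (t rt : ℕ) (es : List RamExpr) : RamCmd k := bumpAux t rt es es.length

theorem Ok.bump {es : List RamExpr} {T : ℕ} (hw : 8 * B < 2 ^ w) (ht : t < 7) (hN : N + 2 ≤ B)
    (hB : (N + 1) ^ l.length ≤ B) (hl : l ∉ U) (hn : ∀ x ∈ l, x < N) (h0 : σ.reg 0 = N) (h1 : σ.reg 1 = B)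
    (hrt : σ.reg rt = thr)
    (hes : ∀ σ' : RamState n, σ'.reg = σ.reg → SameMem B [t] σ σ' → es.map (RamExpr.eval w σ') = l)
    (htab : Tab B t N thr l.length U σ) (hT : 2 * l.length + 2 ≤ T) : Ok w G S (bump t rt es : RamCmd k) σ T
    (fun σ' => σ'.reg = σ.reg ∧ σ'.E = σ.E ∧ SameMem B [t] σ σ' ∧ Tab B t N thr l.length (insert l U) σ') := by
  have hlen : es.length = l.length := by
    rw [← hes σ rfl (SameMem.refl _ _), List.length_map]
  -- When the prefix of length `i` is due, counters of sequences longer than `i` already belong to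
  -- `insert l U` and the others still to `U`; `Act` says that every counter above did become
  -- overloaded.
  have key : ∀ i ≤ l.length, ∀ σ1 : RamState n, σ1.reg = σ.reg → σ1.E = σ.E →
      SameMem B [t] σ σ1 → Act N thr U l (l.length - i) →
      (∀ l' : List ℕ, l'.length ≤ l.length → (∀ x ∈ l', x < N) →
        σ1.mem (t * B + code N l') =
          cell N thr (if l'.length ≤ i then U else insert l U) (l.length - l'.length) l') →
      Ok w G S (bumpAux t rt es i : RamCmd k) σ1 (2 * i + 2) (fun σ' => σ'.reg = σ.reg ∧
        σ'.E = σ.E ∧ SameMem B [t] σ σ' ∧ Tab B t N thr l.length (insert l U) σ') := by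
    intro i
    induction i with
    | zero =>
      intro _ σ1 hreg hE hs ha htab
      have hc : (codeE []).eval w σ1 = 0 := by simp [codeE, RamExpr.eval]
      have had : (addrE t (codeE [])).eval w σ1 = t * B + 0 :=
        eval_addrE (by rw [hreg, h1]) hw ht hc (by omega)
      have hv : (RamExpr.op .add (.mem (addrE t (codeE []))) (.const 1)).eval w σ1 =
          cell N thr U l.length [] + 1 := by
        have h2 := htab [] (by simp) (by simp)
        have := @cell_le N thr U l.length []
        refine eval_add ?_ eval_const
        rw [eval_mem, had]
        simpa [code] using h2
      refine Ok.store (by omega) ⟨hreg, hE, ?_, ?_⟩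
      · rw [had]
        exact hs.trans (sameMem_setMem (by simp) (by omega)) (fun x => id) (fun x => id)
      · intro l' hl' hn'
        rw [had, setMem_mem, hv]
        by_cases hnil : l' = []
        · simp_all [if_pos, code, cell_insert, List.length_nil, Nat.sub_zero]
        · rw [if_neg, htab l' hl' hn', if_neg]
          · simpa using hnil
          · intro h
            have := (addr_inj (code_lt_of_le hB hl' hn') (by omega) h).2
            exact hnil (code_inj hn' (by simp) (by simpa [code] using this))
    | succ i ih =>
      intro hi σ1 hreg hE hs ha htab
      have hce : ∀ σ2 : RamState n, σ2.reg = σ.reg → SameMem B [t] σ σ2 →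
          (addrE t (codeE (es.take (i + 1)))).eval w σ2 = t * B + code N (l.take (i + 1)) := by
        intro σ2 hr2 hs2
        refine eval_addrE (by rw [hr2, h1]) hw ht ?_
          (code_lt_of_le hB (by simp) (fun x hx => hn x (List.mem_of_mem_take hx)))
        refine eval_codeE (by rw [hr2, h0]) _ _ ?_ (fun x hx => hn x (List.mem_of_mem_take hx)) ?_
          (by omega)
        · simp_all
        · refine lt_of_le_of_lt ((Nat.pow_le_pow_right (by omega) ?_).trans hB) (by omega)
          simp
      have hlt : (l.take (i + 1)).length = i + 1 := by simp; omega
      have hnt : ∀ x ∈ l.take (i + 1), x < N := fun x hx => hn x (List.mem_of_mem_take hx)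
      have hold := htab (l.take (i + 1)) (by omega) hnt
      rw [if_pos hlt.le, hlt] at hold
      have hcl := @cell_le N thr U (l.length - (i + 1)) (l.take (i + 1))
      have hv : (RamExpr.op .add (.mem (addrE t (codeE (es.take (i + 1))))) (.const 1)).eval w σ1 =
          cell N thr U (l.length - (i + 1)) (l.take (i + 1)) + 1 := by
        refine eval_add ?_ eval_const
        rw [eval_mem, hce σ1 hreg hs, hold]
      set σ2 := σ1.setMem (t * B + code N (l.take (i + 1)))
        (cell N thr U (l.length - (i + 1)) (l.take (i + 1)) + 1) with hσ2
      have hs2 : SameMem B [t] σ σ2 :=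
        hs.trans (sameMem_setMem (by simp) (code_lt_of_le hB (by simp) hnt)) (fun x => id)
          (fun x => id)
      have htab2 : ∀ l' : List ℕ, l'.length ≤ l.length → (∀ x ∈ l', x < N) →
          σ2.mem (t * B + code N l') =
          cell N thr (if l'.length ≤ i then U else insert l U) (l.length - l'.length) l' := by
        intro l' hl' hn'
        rw [hσ2, setMem_mem]
        by_cases heq : l' = l.take (i + 1)
        · subst heq
          rw [if_pos rfl, hlt, if_neg (by omega), cell_insert hl hn _ _ (by omega)]
          rw [show l.length - (l.length - (i + 1)) = i + 1 by omega]
          simp [ha]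
        · rw [if_neg, htab l' hl' hn']
          · by_cases h3 : l'.length ≤ i
            · rw [if_pos h3, if_pos (by omega)]
            · by_cases h4 : l'.length = i + 1
              · rw [if_pos h4.le, if_neg h3, cell_insert hl hn _ _ (by omega), if_neg, add_zero]
                grind
              grind
          grind [code_inj, addr_inj, code_lt_of_le]
      refine Ok.seq (T := 1) (P := fun σ' => σ' = σ2) (T' := 2 * i + 3) (Ok.store le_rfl ?_) ?_
      · rw [hv, hce σ1 hreg hs]
      · rintro _ rfl
        have hlimE : (limE rt (es.length - (i + 1))).eval w σ2 = lim thr (l.length - (i + 1)) := by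
          grind [eval_limE, setMem_reg]
        have hm : (RamExpr.mem (addrE t (codeE (es.take (i + 1))))).eval w σ2 =
            cell N thr U (l.length - (i + 1)) (l.take (i + 1)) + 1 := by
          rw [eval_mem, hce σ2 (by rw [hσ2, setMem_reg, hreg]) hs2, hσ2, setMem_mem, if_pos rfl]
        have hev := eval_eq hm hlimE (show 1 < 2 ^ w by omega)
        have hsub : l.length - i = (l.length - (i + 1)) + 1 := by omega
        have hsub2 : l.length - (l.length - (i + 1)) = i + 1 := by omega
        refine Ok.ite (T := 2 * i + 2) ?_ ?_
        · intro h
          rw [hev] at h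
          have h5 : cell N thr U (l.length - (i + 1)) (l.take (i + 1)) + 1 =
              lim thr (l.length - (i + 1)) := by
            by_contra h6; simp [h6] at h
          refine ih (by omega) σ2 (by rw [hσ2, setMem_reg, hreg]) (by rw [hσ2, setMem_E, hE]) hs2
            ?_ htab2
          rw [hsub]
          exact ⟨ha, by rw [hsub2]; exact h5⟩
        · intro h
          rw [hev] at h
          refine Ok.skip (by omega) ⟨by rw [hσ2, setMem_reg, hreg], by rw [hσ2, setMem_E, hE],
            hs2, ?_⟩
          intro l' hl' hn'
          rw [htab2 l' hl' hn']
          by_cases h6 : l'.length ≤ i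
          · rw [if_pos h6, cell_insert hl hn _ _ (by omega), if_neg, add_zero]
            rintro ⟨-, h7⟩
            -- `Act` passes to fewer levels. Hence if the counter just raised misses its bound, no
            -- counter of a shorter prefix may change, and stopping here is right.
            have h8 : ∀ d, Act N thr U l (l.length - i + d) → Act N thr U l (l.length - i) := by
              intro d
              induction d with
              | zero => exact id
              | succ d ih2 => exact fun h9 => ih2 h9.1
            have h9 := h8 (i - l'.length)
              (by rw [show l.length - i + (i - l'.length) = l.length - l'.length by omega]; exact h7)
            rw [hsub] at h9
            have h10 := h9.2
            grind
          · rw [if_neg h6]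
  have := key l.length le_rfl σ rfl rfl (SameMem.refl _ _) (by simp [Act]) (by
    intro l' hl' hn'
    rw [if_pos hl']
    exact htab l' hl' hn')
  rw [SpikeLemma.bump, hlen]
  exact this.mono hT fun σ' h => h

end Layout

/-! ### Searching a class for new vertices -/

/-- The value of a test. -/
noncomputable def ind (p : Prop) : ℕ := by
  classical exact if p then 1 else 0

theorem ind_true {p : Prop} (h : p) : ind p = 1 := if_pos h

theorem ind_false {p : Prop} (h : ¬ p) : ind p = 0 := if_neg h

theorem ind_le {p : Prop} : ind p ≤ 1 := by
  by_cases h : p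
  · rw [ind_true h]
  · rw [ind_false h]; exact zero_le_one

theorem ind_ne_zero {p : Prop} : ind p ≠ 0 ↔ p := by
  grind [ind_true, ind_false]

theorem ind_congr {p p' : Prop} (h : p ↔ p') : ind p = ind p' := by rw [propext h]

section Eval

variable {n k : ℕ} {w B : ℕ} {G : Finset (Finset (Fin n))} {S : Finset (Fin n)}
variable {σ : RamState n} {a b g i s t : ℕ} {A : Nodes} {e x y : RamExpr}

theorem eval_lt' (hx : x.eval w σ = a)
    (hy : y.eval w σ = b) (h : 1 < 2 ^ w := by omega) :
    (RamExpr.op .lt x y).eval w σ = ind (a < b) := by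
  rw [eval_lt hx hy h]
  by_cases hab : a < b
  · rw [ind_true hab, if_pos hab]
  · rw [ind_false hab, if_neg hab]

/-- The test for inequality. -/
def neE (x y : RamExpr) : RamExpr := .op .eq (.op .eq x y) (.const 0)

theorem eval_neE (hx : x.eval w σ = a) (hy : y.eval w σ = b) (h : 1 < 2 ^ w) : (neE x y).eval w σ = ind
    (a ≠ b) := by
  rw [neE, eval_eq (eval_eq hx hy h) eval_const h]
  grind [ind_false, ind_true]

theorem eval_and {p p' : Prop} (hx : x.eval w σ = ind p)
    (hy : y.eval w σ = ind p') (h : 1 < 2 ^ w := by omega) :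
    (RamExpr.op .mul x y).eval w σ = ind (p ∧ p') := by
  have h1 := @ind_le p
  have h2 := @ind_le p'
  have h3 : ind p * ind p' ≤ 1 := by nlinarith
  rw [eval_mul hx hy]
  grind [ind]

theorem eval_allE' {ι : Type*} (hw : 1 < 2 ^ w) (l : List ι) (e : ι → RamExpr) (P : ι → Prop)
    (h : ∀ i ∈ l, (e i).eval w σ = ind (P i)) : (allE (l.map e)).eval w σ = ind (∀ i ∈ l, P i) := by
  classical
  rw [eval_allE hw l e P (fun i hi => by aesop)]
  unfold ind
  split_ifs <;> rfl

theorem decodeSet_getD {es : List RamExpr} {l : List ℕ} (hl : es.map (RamExpr.eval w σ) = l)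
    (hk : es.length = k) : decodeSet n (fun i : Fin k => (es.getD i (.const 0)).eval w σ) = vset n l := by
  subst hl
  ext x
  simp only [decodeSet, mem_filter, mem_univ, true_and, mem_vset, List.mem_map]
  constructor
  · grind
  · rintro ⟨e, he, hx⟩
    obtain ⟨i, hi, rfl⟩ := List.mem_iff_getElem.1 he
    exact ⟨⟨i, by omega⟩, by grind⟩

theorem vset_concat (l : List ℕ) (x : ℕ) : vset n (l ++ [x]) = vset n l ∪ decodeVertex n x := by
  ext y
  simp [decodeVertex, eq_comm]

/-- Field `i` of the node `g` in region `t`, for nodes with `s` fields. -/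
def slotE (t s : ℕ) (g : RamExpr) (i : ℕ) : RamExpr :=
  .mem (addrE t (.op .add (.op .mul g (.const s)) (.const i)))

/-- Region `t` holds the array `A` of nodes with `s` fields. -/
def Slots (B t s : ℕ) (A : Nodes) (σ : RamState n) : Prop :=
  ∀ p i, i < s → p * s + i < B → σ.mem (t * B + (p * s + i)) = A p i

theorem eval_slotAddr (h1 : σ.reg 1 = B) (hw : 8 * B < 2 ^ w) (ht : t < 7) (he : e.eval w σ = g) (hs : s < B)
    (hi : i < s) (hgi : g * s + i < B) : (addrE t (.op .add (.op .mul e (.const s)) (.const i))).eval w σ = t *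
    B + (g * s + i) :=
  eval_addrE h1 hw ht (eval_add (eval_mul he eval_const)
    eval_const) hgi

theorem eval_slotE (h1 : σ.reg 1 = B) (hw : 8 * B < 2 ^ w) (ht : t < 7) (he : e.eval w σ = g) (hs : s < B)
    (hi : i < s) (hgi : g * s + i < B) (hA : Slots B t s A σ) : (slotE t s e i).eval w σ = A g i := by
  rw [slotE, eval_mem, eval_slotAddr h1 hw ht he hs hi hgi, hA g i hi hgi]

/-- Change one field. -/
def Nodes.upd (A : Nodes) (p i v : ℕ) : Nodes := fun p' i' => if p' = p ∧ i' = i then v else A p' i'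

theorem Slots.setMem {p v : ℕ} (hA : Slots B t s A σ) (hi : i < s) (hpi : p * s + i < B) : Slots B t s
    (A.upd p i v) (σ.setMem (t * B + (p * s + i)) v) := by
  intro p' i' hi' hpi'
  rw [setMem_mem, Nodes.upd]
  by_cases h : p' = p ∧ i' = i
  · grind
  · rw [if_neg h, if_neg, hA p' i' hi' hpi']
    grind [addr_inj]

theorem Slots.same {σ' : RamState n} {M : List ℕ} (hA : Slots B t s A σ) (h : SameMem B M σ σ') (ht : t ∉ M) :
    Slots B t s A σ' :=
  fun p i hi hpi => (h t _ ht hpi).trans (hA p i hi hpi)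

theorem Slots.congr {A' : Nodes} (hA : Slots B t s A σ) (h : ∀ p i, i < s → A p i = A' p i) : Slots B t s A'
    σ :=
  fun p i hi hpi => (hA p i hi hpi).trans (h p i hi)

end Eval

theorem write_of_ne {A : Nodes} {c j p i : ℕ} {xs : List ℕ} (h : p < c ∨ i ≠ j) :
    A.write c j xs p i = A p i := by
  unfold Nodes.write
  rw [if_neg]
  omega

theorem write_nil (A : Nodes) (c j : ℕ) : A.write c j [] = A := by
  funext p i
  unfold Nodes.write
  simp

theorem write_concat (A : Nodes) (c j x : ℕ) (xs : List ℕ) :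
    A.write c j (xs ++ [x]) = (A.write c j xs).upd (c + xs.length) j x := by
  funext p i
  simp only [Nodes.write, Nodes.upd, List.length_append, List.length_singleton]
  grind

theorem pre_congr {A A' : Nodes} {p i : ℕ} (h : ∀ f < i, A p f = A' p f) :
    A.pre p i = A'.pre p i := by
  grind [Nodes.pre, List.map_congr_left]

theorem anc_congr {A A' : Nodes} {k g : ℕ} (h : ∀ p, A p k = A' p k) (i : ℕ) :
    A.anc k g i = A'.anc k g i := by
  induction i with
  | zero => rfl
  | succ i ih => simp only [Nodes.anc, ih, h]

/-- Numerical facts about the word size, the size `B` of the regions and the parameters. -/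
structure Sized (w B : ℕ) (P : Par) : Prop where
  hw : 8 * B < 2 ^ w
  hN : P.n + 2 ≤ B
  hB : (P.n + 1) ^ P.k ≤ B
  hk : 20 * (P.k + 2) ≤ B
  hsl : 6 * P.k * P.q ≤ B
  hside : P.side < 2
  hh1 : 1 ≤ P.h
  hhk : P.h ≤ P.k
  sl_lt : ∀ i < 6 * P.k * P.q, P.sl i < P.n
  hq : P.q ≤ P.n
  hdep : P.dep ≤ P.n
  hm : P.m ≤ P.n

/-- What the programs find in registers and memory. -/
structure Env {n : ℕ} (B : ℕ) (P : Par) (σ : RamState n) : Prop where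
  r0 : σ.reg 0 = P.n
  r1 : σ.reg 1 = B
  r2 : σ.reg 2 = P.q
  r3 : σ.reg 3 = P.m
  r4 : σ.reg 4 = P.thrE
  r5 : σ.reg 5 = P.thrU
  r6 : σ.reg 6 = P.dep
  hsl : ∀ i < 6 * P.k * P.q, σ.mem (6 * B + i) = P.sl i
  hE : Tab B 3 P.n P.thrE P.k P.UE σ

theorem Env.same {n : ℕ} {w B : ℕ} {P : Par} {σ σ' : RamState n} {M : List ℕ} (h : Env B P σ)
    (hP : Sized w B P) (hreg : ∀ i < 7, σ'.reg i = σ.reg i) (hm : SameMem B M σ σ') (h3 : 3 ∉ M)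
    (h6 : 6 ∉ M) : Env B P σ' := by
  refine ⟨?_, ?_, ?_, ?_, ?_, ?_, ?_, ?_, ?_⟩
  · rw [hreg 0 (by omega), h.r0]
  · rw [hreg 1 (by omega), h.r1]
  · rw [hreg 2 (by omega), h.r2]
  · rw [hreg 3 (by omega), h.r3]
  · rw [hreg 4 (by omega), h.r4]
  · rw [hreg 5 (by omega), h.r5]
  · rw [hreg 6 (by omega), h.r6]
  · intro i hi
    rw [hm 6 i h6 (lt_of_lt_of_le hi hP.hsl), h.hsl i hi]
  · exact h.hE.same hP.hB hm h3

/-- The expressions for a search base. -/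
def baseE (k side rg rc j : ℕ) : List RamExpr :=
  (List.range (k - j)).map (slotE (1 + side) (k + 2) (.reg rg)) ++
    (List.range j).map (slotE (1 + side) (k + 2) (.reg rc))

/-- The ancestors of the node in register `45` are compared with register `41`. -/
def ancLoop (k side : ℕ) : RamCmd k :=
  forN 44 (.reg 6) (.seq
    (.set 46 (.op .mul (.reg 46) (allE ((List.range k).map fun f =>
      neE (slotE (1 + side) (k + 2) (.reg 45) f) (.reg 41)))))
    (.set 45 (slotE (1 + side) (k + 2) (.reg 45) k)))

/-- The test that no sequence formed from a part of the search base and register `41` is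
overloaded. -/
def testE (k side rg rc j : ℕ) : RamExpr :=
  allE (((baseE k side rg rc j).sublists.filter fun Q => Q.length + 1 ≤ k).map fun Q =>
    .op .lt (.mem (addrE 3 (codeE (Q ++ [.reg 41])))) (limE 4 (k - (Q.length + 1))))

/-- The test that the new beginning of a tuple is not overloaded. -/
def testU (k h side rc j : ℕ) : RamExpr :=
  if j < h then
    .op .lt (.mem (addrE (4 + side) (codeE (((List.range j).map
      (slotE (1 + side) (k + 2) (.reg rc))) ++ [.reg 41])))) (limE 5 (h - (j + 1)))
  else .const 1

def scanBody (k h side rg rc j : ℕ) (s : RamExpr) : RamCmd k :=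
  .seq (.set 41 (.mem (addrE 6 (.op .add (.reg 47) (.reg 40)))))
  (.seq (.set 46 (.const 1))
  (.seq (.set 45 (.reg rg))
  (.seq (ancLoop k side)
  (.ite (.op .mul (.op .lt (.reg 42) s) (.op .mul (testE k side rg rc j)
      (.op .mul (testU k h side rc j) (.reg 46))))
    (.seq (.reveal 43 (fun i => (baseE k side rg rc j).getD i (.const 0)) (.reg 41))
      (.ite (.reg 43)
        (.seq (.store (addrE (1 + side) (.op .add
            (.op .mul (.op .add (.reg rc) (.reg 42)) (.const (k + 2))) (.const j))) (.reg 41))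
          (.set 42 (.op .add (.reg 42) (.const 1))))
        .skip))
    .skip))))

def levE (k side rg : ℕ) : RamExpr :=
  .op .add (slotE (1 + side) (k + 2) (.reg rg) (k + 1)) (.const 1)

/-- Find `s` vertices for entry `j` of children of the node in register `rg`; they are stored in
the nodes from register `rc` on.  Register `20` is cleared if there are too few. -/
def scanC (k h side rg rc j : ℕ) (s : RamExpr) : RamCmd k :=
  .seq (.set 47 (.op .mul (.op .add (.op .mul (.op .add (.const (side * 3))
      (.op .sub (levE k side rg) (.op .mul (.op .div (levE k side rg) (.const 3)) (.const 3))))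
      (.const k)) (.const j)) (.reg 2)))
  (.seq (.set 42 (.const 0))
  (.seq (forN 40 (.reg 2) (scanBody k h side rg rc j s))
  (.ite (.op .lt (.reg 42) s) (.set 20 (.const 0)) .skip)))

section Scan

variable {n : ℕ} {w B : ℕ} {G : Finset (Finset (Fin n))} {S : Finset (Fin n)} {P : Par}
variable {A : Nodes} {c g i j k p rc x : ℕ} {σ : RamState n} {U : Finset (List ℕ)}

/-- The loop always makes `P.dep` rounds and accumulates the answer as a product of tests. Walking
past the root is harmless, because the root is its own parent. -/
theorem Ok.ancLoop {T cap : ℕ} (hP : Sized w B P) (henv : Env B P σ) (hA : Slots B (1 + P.side) (P.k + 2) A σ)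
    (h45 : σ.reg 45 = g) (h46 : σ.reg 46 = 1) (h41 : σ.reg 41 = x) (hcap : cap * (P.k + 2) ≤ B)
    (hanc : ∀ i, A.anc P.k g i < cap) (hT : P.dep * 4 + 2 ≤ T) : Ok w G S (ancLoop P.k P.side) σ T
    (fun σ' => (∀ i, i < 44 ∨ 46 < i → σ'.reg i = σ.reg i) ∧ σ'.mem = σ.mem ∧ σ'.E = σ.E ∧ σ'.reg 46 = ind (∀ i
    < P.dep, ∀ f < P.k, A (A.anc P.k g i) f ≠ x)) := by
  have hw := hP.hw
  have hN := hP.hN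
  have hdep := hP.hdep
  have hside := hP.hside
  have hk := hP.hk
  have hadr : ∀ i f, f < P.k + 2 → A.anc P.k g i * (P.k + 2) + f < B := by
    intro i f hf
    have h1 : (A.anc P.k g i + 1) * (P.k + 2) ≤ cap * (P.k + 2) :=
      Nat.mul_le_mul_right _ (hanc i)
    rw [add_mul] at h1
    omega
  refine Ok.forN (K := P.dep) (T := 2)
    (fun i σ' => σ'.reg 44 = i ∧ σ'.reg 45 = A.anc P.k g i ∧
      (∀ i, i < 44 ∨ 46 < i → σ'.reg i = σ.reg i) ∧ σ'.mem = σ.mem ∧ σ'.E = σ.E ∧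
      σ'.reg 46 = ind (∀ i' < i, ∀ f < P.k, A (A.anc P.k g i') f ≠ x)) (by omega) ?_ ?_ ?_ ?_ ?_ hT
  · refine ⟨by simp, by simpa [Nodes.anc] using h45, ?_, rfl, rfl, ?_⟩
    · aesop
    · rw [ind_true (by simp)]
      simpa using h46
  · exact fun i σ' h => h.1
  · rintro i σ' ⟨-, -, h, -⟩
    rw [eval_reg, h 6 (by omega), henv.r6]
  · rintro i hi σ1 ⟨h1, h2, h3, h4, h5, h6⟩
    have hr1 : σ1.reg 1 = B := by rw [h3 1 (by omega), henv.r1]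
    have hA1 : Slots B (1 + P.side) (P.k + 2) A σ1 := hA.same (M := []) (sameMem_of_eq h4) (by simp)
    refine Ok.seq (T := 1) (T' := 1) (Ok.set le_rfl (Q := fun σ2 => σ2 = σ1.setReg 46
      (ind (∀ i' < i + 1, ∀ f < P.k, A (A.anc P.k g i') f ≠ x))) ?_) ?_
    · congr 1
      have h7 : (allE ((List.range P.k).map fun f =>
          neE (slotE (1 + P.side) (P.k + 2) (.reg 45) f) (.reg 41))).eval w σ1 =
          ind (∀ f ∈ List.range P.k, A (A.anc P.k g i) f ≠ x) := by
        refine eval_allE' (by omega) _ _ _ fun f hf => ?_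
        have hf' := List.mem_range.1 hf
        refine eval_neE ?_ ?_ (by omega)
        · exact eval_slotE hr1 hw (by omega) h2 (by omega) (by omega) (hadr i f (by omega)) hA1
        simp_all
      rw [eval_and (p := ∀ i' < i, ∀ f < P.k, A (A.anc P.k g i') f ≠ x) (eval_reg.trans h6) h7]
      apply ind_congr
      grind
    · rintro _ rfl
      refine Ok.set le_rfl ?_
      have h7 : (slotE (1 + P.side) (P.k + 2) (.reg 45) P.k).eval w (σ1.setReg 46
          (ind (∀ i' < i + 1, ∀ f < P.k, A (A.anc P.k g i') f ≠ x))) = A.anc P.k g (i + 1) := by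
        refine eval_slotE (g := A.anc P.k g i) (B := B) (by simpa using hr1) hw (by omega) (by simpa using h2) (by omega)
          (by omega) (hadr i P.k (by omega)) hA1
      rw [h7]
      refine ⟨by simpa using h1, by simp, by simp, ?_, by simpa using h4, by simpa using h5, by simp⟩
      grind [setReg_reg]
  simp

/-- There are two sides, three levels and `k` positions, hence `6 * k` classes of `q` vertices. -/
theorem class_index_lt {side l q : ℕ} (hside : side < 2) (hl : l < 3) (hj : j < k) (hi : i < q) :
    ((side * 3 + l) * k + j) * q + i < 6 * k * q := by
  have h1 : (side * 3 + l) * k + j + 1 ≤ 6 * k := by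
    have : (side * 3 + l) * k ≤ 5 * k := Nat.mul_le_mul_right _ (by omega)
    omega
  have h2 : ((side * 3 + l) * k + j + 1) * q ≤ 6 * k * q := Nat.mul_le_mul_right _ h1
  grind

theorem Sized.vtx_lt (hP : Sized w B P) {lev : ℕ} (hj : j < P.k) (hi : i < P.q) : P.vtx lev j i < P.n :=
  hP.sl_lt _ (class_index_lt hP.hside (Nat.mod_lt _ (by omega)) hj hi)

theorem map_eval_slots {t s : ℕ} {e : RamExpr} (h1 : σ.reg 1 = B) (hw : 8 * B < 2 ^ w) (ht : t < 7)
    (he : e.eval w σ = g) (hs : s < B) (hi : i ≤ s) (hgs : (g + 1) * s ≤ B) (hA : Slots B t s A σ) :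
    ((List.range i).map (slotE t s e)).map (RamExpr.eval w σ) = A.pre g i := by
  rw [Nodes.pre, List.map_map]
  apply List.map_congr_left
  intro f hf
  have := List.mem_range.1 hf
  rw [add_mul] at hgs
  exact eval_slotE h1 hw ht he hs (by omega) (by omega) hA

theorem mem_pre : x ∈ A.pre p i ↔ ∃ f < i, A p f = x := by
  simp [Nodes.pre]

@[simp] theorem length_pre : (A.pre p i).length = i := by simp [Nodes.pre]

/-- The subsequences are formed from the list of expressions when the program is written, and
evaluation commutes with taking sublists. So the whole test is one expression of a size depending on
`k` only. -/
theorem eval_testE {rg : ℕ} (hP : Sized w B P) (henv : Env B P σ) (hx : x < P.n) (h41 : σ.reg 41 = x)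
    (hb : (baseE P.k P.side rg rc j).map (RamExpr.eval w σ) = A.base P.k g c j)
    (hbn : ∀ y ∈ A.base P.k g c j, y < P.n) : (testE P.k P.side rg rc j).eval w σ = ind
    (∀ Q ∈ (A.base P.k g c j).sublists, Q.length + 1 ≤ P.k → ¬ Over P.n P.thrE P.UE (P.k - (Q.length + 1)) (Q
    ++ [x])) := by
  have hw := hP.hw
  have hN := hP.hN
  have hBk := hP.hB
  rw [testE, eval_allE' (by omega) _ _ (fun Q => ¬ Over P.n P.thrE P.UE (P.k - (Q.length + 1))
    (Q.map (RamExpr.eval w σ) ++ [x]))]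
  · rw [← hb, List.sublists_map]
    simp
  · intro Q hQ
    simp only [List.mem_filter, List.mem_sublists, decide_eq_true_eq] at hQ
    have hQn : ∀ y ∈ Q.map (RamExpr.eval w σ) ++ [x], y < P.n := by
      grind
    have hlen : (Q.map (RamExpr.eval w σ) ++ [x]).length = Q.length + 1 := by simp
    have hc : (codeE (Q ++ [.reg 41])).eval w σ = code P.n (Q.map (RamExpr.eval w σ) ++ [x]) := by
      refine eval_codeE henv.r0 _ _ (by simp [h41]) hQn ?_ (by omega)
      refine lt_of_le_of_lt ((Nat.pow_le_pow_right (by omega) ?_).trans hBk) (by omega)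
      rw [hlen]; exact hQ.2
    have hm : (RamExpr.mem (addrE 3 (codeE (Q ++ [.reg 41])))).eval w σ =
        cell P.n P.thrE P.UE (P.k - (Q.length + 1)) (Q.map (RamExpr.eval w σ) ++ [x]) := by
      rw [eval_mem, eval_addrE henv.r1 hw (by omega) hc
        (code_lt_of_le hBk (by rw [hlen]; exact hQ.2) hQn),
        henv.hE _ (by rw [hlen]; exact hQ.2) hQn, hlen]
    rw [eval_lt' hm (eval_limE henv.r4 (by omega))]
    apply ind_congr
    unfold Over
    omega

theorem eval_testU (hP : Sized w B P) (henv : Env B P σ) (hx : x < P.n) (h41 : σ.reg 41 = x)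
    (hb : ((List.range j).map (slotE (1 + P.side) (P.k + 2) (.reg rc))).map (RamExpr.eval w σ) = A.pre c j)
    (hbn : ∀ y ∈ A.pre c j, y < P.n) (hU : Tab B (4 + P.side) P.n P.thrU P.h U σ) :
    (testU P.k P.h P.side rc j).eval w σ = ind
    (j < P.h → ¬ Over P.n P.thrU U (P.h - (j + 1)) (A.pre c j ++ [x])) := by
  have hw := hP.hw
  have hN := hP.hN
  have hside := hP.hside
  have hBk : (P.n + 1) ^ P.h ≤ B := (Nat.pow_le_pow_right (by omega) hP.hhk).trans hP.hB
  unfold testU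
  split_ifs with hj
  · have hQn : ∀ y ∈ A.pre c j ++ [x], y < P.n := by
      grind
    have hlen : (A.pre c j ++ [x]).length = j + 1 := by simp
    have hc : (codeE ((List.range j).map (slotE (1 + P.side) (P.k + 2) (.reg rc)) ++
        [.reg 41])).eval w σ = code P.n (A.pre c j ++ [x]) := by
      refine eval_codeE henv.r0 _ _ (by simp_all) hQn ?_ (by omega)
      refine lt_of_le_of_lt ((Nat.pow_le_pow_right (by omega) ?_).trans hBk) (by omega)
      rw [hlen]; exact hj
    have hm : (RamExpr.mem (addrE (4 + P.side) (codeE ((List.range j).map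
        (slotE (1 + P.side) (P.k + 2) (.reg rc)) ++ [.reg 41])))).eval w σ =
        cell P.n P.thrU U (P.h - (j + 1)) (A.pre c j ++ [x]) := by
      rw [eval_mem, eval_addrE henv.r1 hw (by omega) hc
        (code_lt_of_le hBk (by rw [hlen]; exact hj) hQn), hU _ (by rw [hlen]; exact hj) hQn, hlen]
    rw [eval_lt' hm (eval_limE henv.r5 (by omega))]
    apply ind_congr
    unfold Over
    omega
  grind [ind_true, eval_const]

end Scan

/-- `E'` arises from `E` by adding at most `c` sets, all of size `k` and contained in `V`. -/
def Exposed {n : ℕ} (k : ℕ) (V : Finset (Fin n)) (c : ℕ) (E E' : Finset (Finset (Fin n))) : Prop :=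
  E ⊆ E' ∧ E'.card ≤ E.card + c ∧ ∀ e ∈ E', e ∉ E → e.card = k ∧ e ⊆ V

theorem Exposed.refl {n k : ℕ} {V : Finset (Fin n)} (c : ℕ) (E : Finset (Finset (Fin n))) :
    Exposed k V c E E := ⟨subset_rfl, by omega, fun e h h' => absurd h h'⟩

theorem Exposed.trans {n k c c' c'' : ℕ} {V : Finset (Fin n)} {E E' E'' : Finset (Finset (Fin n))}
    (h : Exposed k V c E E') (h' : Exposed k V c' E' E'') (hc : c + c' ≤ c'') :
    Exposed k V c'' E E'' := by
  refine ⟨h.1.trans h'.1, ?_, ?_⟩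
  · have := h.2.1
    have := h'.2.1
    omega
  · intro e he he'
    by_cases h3 : e ∈ E'
    · exact h.2.2 e h3 he'
    · exact h'.2.2 e he h3

theorem Exposed.mono {n k c c' : ℕ} {V : Finset (Fin n)} {E E' : Finset (Finset (Fin n))}
    (h : Exposed k V c E E') (hc : c ≤ c') : Exposed k V c' E E' :=
  h.trans (Exposed.refl 0 _) hc

section Scan

variable {w B : ℕ} {P : Par} {G : Finset (Finset (Fin P.n))} {S V : Finset (Fin P.n)}

open Classical in
theorem hits_succ (A : Nodes) (U : Finset (List ℕ)) (g c j I : ℕ) :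
    P.hits G A U g c j (I + 1) = P.hits G A U g c j I ++
      if P.Test A U g c j (P.vtx (A g (P.k + 1) + 1) j I) ∧
        vset P.n (A.base P.k g c j ++ [P.vtx (A g (P.k + 1) + 1) j I]) ∈ G
      then [P.vtx (A g (P.k + 1) + 1) j I] else [] := by
  simp only [Par.hits, Par.cands, List.range_succ, List.map_append, List.filter_append,
    List.map_cons, List.map_nil]
  grind

/-- What has to hold for a search to be run for entry `j` of children of `g`, stored from `c` on. -/
structure ScanPre (B : ℕ) (P : Par) (A : Nodes) (g c j s cap : ℕ) : Prop where
  hj : j < P.k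
  hcap : cap * (P.k + 2) ≤ B
  hcs : c + s ≤ cap
  hc : c < cap
  hanc : ∀ i, A.anc P.k g i < c
  hgn : ∀ f < P.k, A g f < P.n
  hcn : ∀ f < j, A c f < P.n
  hlev : A g (P.k + 1) + 1 < B

/-- The program stops revealing after `s` hits, whereas `Par.hits` lists all of them; truncating the
list reconciles the two. All reveals of a scan use the same base, so at most one set is exposed. -/
theorem Ok.scan {σ : RamState P.n} {A : Nodes} {U : Finset (List ℕ)} {g c j s cap rg rc T : ℕ}
    {sE : RamExpr} (hP : Sized w B P) (hpre : ScanPre B P A g c j s cap)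
    (henv : Env B P σ) (hA : Slots B (1 + P.side) (P.k + 2) A σ)
    (hU : Tab B (4 + P.side) P.n P.thrU P.h U σ)
    (hrg : σ.reg rg = g) (hrg' : rg < 40 ∧ rg ≠ 20) (hrc : σ.reg rc = c) (hrc' : rc < 40 ∧ rc ≠ 20)
    (hsE : ∀ σ' : RamState P.n, (∀ i < 40, i ≠ 20 → σ'.reg i = σ.reg i) → sE.eval w σ' = s)
    (hV : vset P.n (A.base P.k g c j) ⊆ V) (hT : P.q * (P.dep * 4 + 12) + 8 ≤ T) :
    Ok w G S (scanC P.k P.h P.side rg rc j sE) σ T (fun σ' =>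
      (∀ i < 40, i ≠ 20 → σ'.reg i = σ.reg i) ∧ SameMem B [1 + P.side] σ σ' ∧
      Exposed P.k V 1 σ.E σ'.E ∧
      (∀ A', P.scan G s U g c j A = some A' →
        σ'.reg 20 = σ.reg 20 ∧ Slots B (1 + P.side) (P.k + 2) A' σ') ∧
      (P.scan G s U g c j A = none → σ'.reg 20 = 0)) := by
  have hw := hP.hw
  have hN := hP.hN
  have hside := hP.hside
  have hk := hP.hk
  have hq := hP.hq
  have hsl := hP.hsl
  obtain ⟨hj, hcap, hcs, hc, hanc, hgn, hcn, hlev⟩ := hpre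
  have hadr : ∀ p < cap, (p + 1) * (P.k + 2) ≤ B := fun p hp =>
    (Nat.mul_le_mul_right _ hp).trans hcap
  have hadr' : ∀ p < cap, ∀ f < P.k + 2, p * (P.k + 2) + f < B := by
    grind
  have hcapB : cap ≤ B := le_trans (Nat.le_mul_of_pos_right _ (by omega)) hcap
  set lev := A g (P.k + 1) + 1 with hlevdef
  set cb := ((P.side * 3 + lev % 3) * P.k + j) * P.q with hcb
  have hgc : g < c := hanc 0
  have hclass : ∀ I < P.q, cb + I < 6 * P.k * P.q := fun I hI =>
    class_index_lt hside (Nat.mod_lt _ (by omega)) hj hI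
  -- the first entry of the class
  have h47 : (RamExpr.op .mul (.op .add (.op .mul (.op .add (.const (P.side * 3))
      (.op .sub (levE P.k P.side rg) (.op .mul (.op .div (levE P.k P.side rg) (.const 3))
        (.const 3)))) (.const P.k)) (.const j)) (.reg 2)).eval w σ = cb := by
    have hl : (levE P.k P.side rg).eval w σ = lev :=
      eval_add (eval_slotE henv.r1 hw (by omega) hrg (by omega) (by omega)
        (hadr' g (by omega) _ (by omega)) hA) eval_const
    have hmod : lev - lev / 3 * 3 = lev % 3 := by omega
    have h1 := eval_sub hl (eval_mul (eval_div hl (eval_const (show 3 < 2 ^ w by omega))) (eval_const (show 3 < 2 ^ w by omega)))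
    rw [hmod] at h1
    have h3 : (P.side * 3 + lev % 3) * P.k ≤ 5 * P.k := Nat.mul_le_mul_right _ (by omega)
    have h4 : cb ≤ B := by
      refine le_trans ?_ hsl
      exact Nat.mul_le_mul_right _ (by omega)
    exact eval_mul (eval_add (eval_mul (eval_add eval_const h1)
      eval_const) eval_const) henv.r2
  refine Ok.set_seq (T - 1) cb h47 ?_
  refine Ok.set_seq (T - 2) 0 eval_const ?_
  set Aw : ℕ → Nodes := fun I => A.write c j ((P.hits G A U g c j I).take s) with hAw
  -- After `I` vertices of the class, register 42 counts the hits stored so far, the array holds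
  -- them in the fields `j` from `c` on, and the exposure hypergraph has gained nothing but possibly
  -- the one base.
  let Inv : ℕ → RamState P.n → Prop := fun I σ' => σ'.reg 40 = I ∧
    (∀ i < 40, σ'.reg i = σ.reg i) ∧ σ'.reg 47 = cb ∧
    σ'.reg 42 = ((P.hits G A U g c j I).take s).length ∧ SameMem B [1 + P.side] σ σ' ∧
    Slots B (1 + P.side) (P.k + 2) (Aw I) σ' ∧
    (σ'.E = σ.E ∨ ((vset P.n (A.base P.k g c j)).card = P.k ∧
      σ'.E = insert (vset P.n (A.base P.k g c j)) σ.E))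
  have hexp : ∀ σ' : RamState P.n, (σ'.E = σ.E ∨ ((vset P.n (A.base P.k g c j)).card = P.k ∧
      σ'.E = insert (vset P.n (A.base P.k g c j)) σ.E)) → Exposed P.k V 1 σ.E σ'.E := by
    rintro σ' (h | ⟨h1, h2⟩)
    · rw [h]; exact Exposed.refl _ _
    · rw [h2]
      refine ⟨Finset.subset_insert _ _, Finset.card_insert_le _ _, ?_⟩
      grind
  refine Ok.seq (T := P.q * (P.dep * 4 + 12) + 2) (T' := 3) (P := Inv P.q)
    (Ok.forN (K := P.q) (T := P.dep * 4 + 10) Inv (by omega) ?_ (fun I σ' h => h.1) ?_ ?_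
      (fun σ' h => h) le_rfl) ?_
  · refine ⟨by simp, ?_, by simp, by simp [Par.hits, Par.cands], sameMem_of_eq rfl, ?_, Or.inl rfl⟩
    · intro i hi
      simp only [setReg_reg]
      rw [if_neg (by omega), if_neg (by omega), if_neg (by omega)]
    · have : Aw 0 = A := by simp [hAw, Par.hits, Par.cands, write_nil]
      rw [this]
      exact hA
  · rintro I σ' ⟨-, h, -⟩
    rw [eval_reg, h 2 (by omega), henv.r2]
  · rintro I hI σ1 ⟨h1, h2, h3, h4, h5, h6, h7⟩
    set x := P.vtx lev j I with hxdef
    have hx : x < P.n := hP.vtx_lt hj hI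
    have henv1 : Env B P σ1 := henv.same hP (fun i hi => h2 i (by omega)) h5 (by simp; omega)
      (by simp; omega)
    have hxv : (RamExpr.mem (addrE 6 (.op .add (.reg 47) (.reg 40)))).eval w σ1 = x := by
      have h8 : (addrE 6 (.op .add (.reg 47) (.reg 40))).eval w σ1 = 6 * B + (cb + I) := by
        have := hclass I hI
        exact eval_addrE henv1.r1 hw (by omega) (eval_add h3 h1) (by omega)
      rw [eval_mem, h8, henv1.hsl _ (hclass I hI)]
      rfl
    refine Ok.set_seq (P.dep * 4 + 9) x hxv ?_
    refine Ok.set_seq (P.dep * 4 + 8) 1 eval_const ?_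
    have hrg2 : ((σ1.setReg 41 x).setReg 46 1).reg rg = g := by
      simp only [setReg_reg]
      grind
    refine Ok.set_seq (P.dep * 4 + 7) g (by rw [eval_reg, hrg2]) ?_
    set σ2 := ((σ1.setReg 41 x).setReg 46 1).setReg 45 g with hσ2
    have hr2 : ∀ i < 44, i ≠ 41 → σ2.reg i = σ1.reg i := by
      intro i hi hi'
      simp only [hσ2, setReg_reg]
      rw [if_neg (by omega), if_neg (by omega), if_neg (by omega)]
    have h472 : σ2.reg 47 = cb := by simp [hσ2, h3]
    have henv2 : Env B P σ2 := henv1.same hP (fun i hi => hr2 i (by omega) (by omega))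
      (SameMem.refl [] _) (by simp) (by simp)
    have hkj : ∀ p, Aw I p P.k = A p P.k := fun p => write_of_ne (Or.inr (by omega))
    have hancI : ∀ i, (Aw I).anc P.k g i = A.anc P.k g i := anc_congr hkj
    refine Ok.seq (T := P.dep * 4 + 2) (T' := 5) (Ok.ancLoop (A := Aw I) (g := g) (x := x)
      (cap := cap) hP henv2 (by exact h6) (by simp [hσ2]) (by simp [hσ2]) (by simp [hσ2]) hcap
      (fun i => by grind) le_rfl) ?_
    rintro σ3 ⟨hr3, hm3, hE3, h46⟩
    have henv3 : Env B P σ3 := henv2.same hP (fun i hi => hr3 i (by omega))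
      (sameMem_of_eq (M := []) hm3) (by simp) (by simp)
    have hA3 : Slots B (1 + P.side) (P.k + 2) (Aw I) σ3 := by
      intro p i hi hpi
      rw [hm3]
      exact h6 p i hi hpi
    have hlow : ∀ i < 40, σ3.reg i = σ.reg i := fun i hi => by
      grind
    have hm3' : SameMem B [1 + P.side] σ σ3 := fun t o ht ho => by
      rw [hm3]; exact h5 t o ht ho
    have h41 : σ3.reg 41 = x := by rw [hr3 41 (by omega)]; simp [hσ2]
    have h42 : σ3.reg 42 = ((P.hits G A U g c j I).take s).length := by
      grind
    have hAg : ∀ p < c, ∀ f, Aw I p f = A p f := fun p hp f => write_of_ne (Or.inl hp)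
    have hAc : ∀ f < j, Aw I c f = A c f := fun f hf => write_of_ne (Or.inr (by omega))
    have hbase : (Aw I).base P.k g c j = A.base P.k g c j := by
      grind [Nodes.base, pre_congr]
    have hpreg := map_eval_slots (i := P.k - j) henv3.r1 hw (show 1 + P.side < 7 by omega)
      (show (RamExpr.reg rg).eval w σ3 = g by rw [eval_reg, hlow rg hrg'.1, hrg])
      (by omega) (by omega) (hadr g (by omega)) hA3
    have hprec := map_eval_slots (i := j) henv3.r1 hw (show 1 + P.side < 7 by omega)
      (show (RamExpr.reg rc).eval w σ3 = c by rw [eval_reg, hlow rc hrc'.1, hrc])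
      (by omega) (by omega) (hadr c hc) hA3
    have hbe : (baseE P.k P.side rg rc j).map (RamExpr.eval w σ3) = A.base P.k g c j := by
      rw [← hbase, baseE, List.map_append, hpreg, hprec]
      rfl
    have hbn : ∀ y ∈ A.base P.k g c j, y < P.n := by
      intro y hy
      rcases List.mem_append.1 hy with h | h
      · grind [mem_pre]
      grind [mem_pre]
    have hprec' : (Aw I).pre c j = A.pre c j := pre_congr hAc
    have htE := eval_testE (A := A) (rg := rg) (rc := rc) (g := g) (c := c) (j := j) hP henv3 hx
      h41 hbe hbn
    have htU := eval_testU (A := A) (rc := rc) (c := c) (j := j) hP henv3 hx h41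
      (by rw [hprec, hprec']) (fun y hy => hbn y (List.mem_append_right _ hy))
      (hU.same ((Nat.pow_le_pow_right (by omega) hP.hhk).trans hP.hB) hm3' (by simp))
    have hs3 : sE.eval w σ3 = s := hsE σ3 fun i hi _ => hlow i hi
    have h42' : (RamExpr.reg 42).eval w σ3 = ((P.hits G A U g c j I).take s).length := h42
    have h46' : (RamExpr.reg 46).eval w σ3 =
        ind (∀ i < P.dep, ∀ f < P.k, A (A.anc P.k g i) f ≠ x) := by
      rw [eval_reg, h46]
      simp only [hancI, hAg _ (hanc _)]
    have hcond := eval_and (eval_lt' h42' hs3) (eval_and htE (eval_and htU h46'))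
    have htest : ((∀ Q ∈ (A.base P.k g c j).sublists, Q.length + 1 ≤ P.k →
      ¬ Over P.n P.thrE P.UE (P.k - (Q.length + 1)) (Q ++ [x])) ∧
      (j < P.h → ¬ Over P.n P.thrU U (P.h - (j + 1)) (A.pre c j ++ [x])) ∧
      (∀ i < P.dep, ∀ f < P.k, A (A.anc P.k g i) f ≠ x)) ↔ P.Test A U g c j x := Iff.rfl
    have hlen : ((P.hits G A U g c j I).take s).length = min s (P.hits G A U g c j I).length :=
      List.length_take
    have hsucc := hits_succ (G := G) (P := P) A U g c j I
    have hb0 : decodeSet P.n (fun i : Fin P.k =>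
        ((baseE P.k P.side rg rc j).getD i (.const 0)).eval w σ3) = vset P.n (A.base P.k g c j) :=
      decodeSet_getD hbe (by simp [baseE]; omega)
    refine Ok.ite (T := 4) ?_ ?_
    · intro hne
      rw [hcond, ind_ne_zero] at hne
      obtain ⟨hlt, hte⟩ := hne
      have htake : (P.hits G A U g c j I).take s = P.hits G A U g c j I :=
        List.take_of_length_le (by omega)
      refine Ok.seq (T := 1) (T' := 3) (Ok.reveal le_rfl (Q := fun σ4 => σ4 =
        (σ3.setReg 43 (if vset P.n (A.base P.k g c j ++ [x]) ∈ G then 1 else 0)).expose P.k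
          (vset P.n (A.base P.k g c j))) ?_) ?_
      · rw [hb0, eval_reg, h41, vset_concat]
      · rintro _ rfl
        set σ4 := (σ3.setReg 43 (if vset P.n (A.base P.k g c j ++ [x]) ∈ G then 1 else 0)).expose P.k
          (vset P.n (A.base P.k g c j)) with hσ4
        have hr4 : ∀ i, i ≠ 43 → σ4.reg i = σ3.reg i := by
          intro i hi
          rw [hσ4, expose_reg, setReg_ne hi]
        have hm4 : σ4.mem = σ3.mem := by rw [hσ4, expose_mem, setReg_mem]
        have hE4 : σ4.E = σ.E ∨ ((vset P.n (A.base P.k g c j)).card = P.k ∧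
            σ4.E = insert (vset P.n (A.base P.k g c j)) σ.E) := by
          have h8 : σ4.E = if (vset P.n (A.base P.k g c j)).card = P.k then
              insert (vset P.n (A.base P.k g c j)) σ1.E else σ1.E := by
            grind [RamState.expose, setReg_E]
          split_ifs at h8 with h9
          · refine Or.inr ⟨h9, ?_⟩
            rw [h8]
            rcases h7 with h7 | ⟨-, h7⟩ <;> rw [h7]
            rw [Finset.insert_idem]
          grind
        have h434 : (RamExpr.reg 43).eval w σ4 =
            if vset P.n (A.base P.k g c j ++ [x]) ∈ G then 1 else 0 := by
          simp [hσ4]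
        refine Ok.ite (T := 2) ?_ ?_
        · intro hne
          rw [h434] at hne
          have hedge : vset P.n (A.base P.k g c j ++ [x]) ∈ G := by
            by_contra h10; simp [h10] at hne
          rw [if_pos ⟨hte, hedge⟩] at hsucc
          have htake' : (P.hits G A U g c j (I + 1)).take s = P.hits G A U g c j I ++ [x] := by
            rw [hsucc, List.take_of_length_le (by simp; omega)]
          have hcc : c + (P.hits G A U g c j I).length < cap := by omega
          have hav : (addrE (1 + P.side) (.op .add (.op .mul (.op .add (.reg rc) (.reg 42))
              (.const (P.k + 2))) (.const j))).eval w σ4 = (1 + P.side) * B +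
                ((c + (P.hits G A U g c j I).length) * (P.k + 2) + j) := by
            refine eval_slotAddr (by rw [hr4 1 (by omega), henv3.r1]) hw (by omega) ?_ (by omega)
              (by omega) (hadr' _ hcc _ (by omega))
            refine eval_add ?_ ?_
            · grind [eval_reg]
            · rw [eval_reg, hr4 42 (by omega), h42, htake]
          have hxv4 : (RamExpr.reg 41).eval w σ4 = x := by rw [eval_reg, hr4 41 (by omega), h41]
          refine Ok.seq (T := 1) (T' := 1) (Ok.store le_rfl (Q := fun σ5 => σ5 = σ4.setMem
            ((1 + P.side) * B + ((c + (P.hits G A U g c j I).length) * (P.k + 2) + j)) x)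
            (by rw [hav, hxv4])) ?_
          rintro _ rfl
          refine Ok.set le_rfl ?_
          rw [eval_add (a := (P.hits G A U g c j I).length) (b := 1) (by
            rw [eval_reg, setMem_reg, hr4 42 (by omega), h42, htake]) eval_const]
          have hr5 : ∀ i, i < 40 ∨ i = 40 ∨ i = 47 → σ4.reg i = if i < 40 then σ.reg i else
              σ1.reg i := by
            intro i hi
            rw [hr4 i (by omega)]
            split_ifs with h10
            · exact hlow i h10
            · rcases hi with hi | rfl | rfl
              · omega
              · grind
              grind
          refine ⟨?_, ?_, ?_, ?_, ?_, ?_, ?_, ?_⟩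
          · simp [hr5, h1]
          · simp
          · intro i hi
            simp only [setReg_reg, setMem_reg]
            rw [if_neg (by omega), if_neg (by omega), hr5 i (by omega), if_pos hi]
          · simp [hr5, h3]
          · simp [htake']
          · refine SameMem.trans (M' := [1 + P.side]) hm3' ?_ (fun x => id) (fun x => id)
            intro t o ht ho
            simp only [setReg_mem]
            rw [sameMem_setMem (M := [1 + P.side]) (B := B) (by simp) (hadr' _ hcc _ (by omega)) t o ht ho, hm4]
          · have hA4 : Slots B (1 + P.side) (P.k + 2) (Aw I) σ4 := fun p i hi hpi => by
              exact hA3 p i hi hpi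
            have h10 := hA4.setMem (p := c + (P.hits G A U g c j I).length) (i := j) (v := x)
              (by omega) (hadr' _ hcc _ (by omega))
            have h11 : Aw (I + 1) = (Aw I).upd (c + (P.hits G A U g c j I).length) j x := by
              grind [write_concat]
            rw [h11]
            exact h10
          · simpa using hE4
        · intro heq
          rw [h434] at heq
          have hedge : vset P.n (A.base P.k g c j ++ [x]) ∉ G := by
            intro h10; simp [h10] at heq
          rw [if_neg (fun h => hedge h.2), List.append_nil] at hsucc
          refine Ok.skip (by omega) ⟨?_, ?_, ?_, ?_, ?_, ?_, ?_, ?_⟩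
          · rw [hr4 40 (by omega), hr3 40 (by omega), hr2 40 (by omega) (by omega), h1]
          · simp
          · intro i hi
            rw [setReg_ne (by omega), hr4 i (by omega), hlow i hi]
          · grind [setReg_ne]
          · grind [setReg_ne]
          · intro t o ht ho
            exact hm3' t o ht ho
          · intro p i hi hpi
            rw [setReg_mem, hm4, hA3 p i hi hpi]
            simp only [hAw, hsucc]
          · simpa using hE4
    · intro heq
      have hno : ¬ (((P.hits G A U g c j I).take s).length < s ∧ P.Test A U g c j x) := by
        grind [ind_true]
      have htake' : (P.hits G A U g c j (I + 1)).take s = (P.hits G A U g c j I).take s := by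
        grind
      refine Ok.skip (by omega) ⟨?_, ?_, ?_, ?_, ?_, ?_, ?_, ?_⟩
      · grind
      · simp
      · grind [setReg_ne]
      · rw [setReg_ne (by omega), hr3 47 (by omega), h472]
      · rw [setReg_ne (by omega), h42, htake']
      · intro t o ht ho
        exact hm3' t o ht ho
      · intro p i hi hpi
        rw [setReg_mem, hA3 p i hi hpi]
        simp only [hAw, htake']
      grind [setReg_E]
  · rintro σ1 ⟨h1, h2, h3, h4, h5, h6, h7⟩
    have hs1 : sE.eval w σ1 = s := hsE σ1 fun i hi _ => h2 i hi
    have h42' : (RamExpr.reg 42).eval w σ1 = ((P.hits G A U g c j P.q).take s).length := h4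
    have hcond := eval_lt' h42' hs1 (show 1 < 2 ^ w by omega)
    rw [List.length_take] at hcond
    refine Ok.ite (T := 1) ?_ ?_
    · intro hne
      rw [hcond, ind_ne_zero] at hne
      refine Ok.set le_rfl ⟨?_, ?_, ?_, ?_, ?_⟩
      · intro i hi hi'
        rw [setReg_ne hi', h2 i hi]
      · exact h5
      · exact hexp _ h7
      · intro A' hA'
        rw [Par.scan, if_neg (by omega)] at hA'
        simp at hA'
      · intro _
        simp [RamExpr.eval]
    · intro heq
      have hno : ¬ (min s (P.hits G A U g c j P.q).length < s) := by
        grind [ind_true]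
      refine Ok.skip le_rfl ⟨fun i hi _ => h2 i hi, h5, hexp _ h7, ?_, ?_⟩
      · intro A' hA'
        rw [Par.scan, if_pos (by omega), Option.some_inj] at hA'
        grind
      · intro hA'
        rw [Par.scan, if_pos (by omega)] at hA'
        simp at hA'

end Scan

/-! ### Properties of the search tree -/

section Tree

variable {P : Par} {G : Finset (Finset (Fin P.n))}
variable {f i i' j j' k lev x : ℕ}

/-- The vertex `x` is a correct entry `j` of a child `c` of `g`. -/
def Par.Ent (P : Par) (G : Finset (Finset (Fin P.n))) (A : Nodes) (g c j x : ℕ) : Prop :=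
  (∃ i < P.q, x = P.vtx (A g (P.k + 1) + 1) j i) ∧
  vset P.n (A.base P.k g c j ++ [x]) ∈ G ∧
  (∀ Q ∈ (A.base P.k g c j).sublists, Q.length + 1 ≤ P.k →
    ¬ Over P.n P.thrE P.UE (P.k - (Q.length + 1)) (Q ++ [x])) ∧
  (∀ i < P.dep, ∀ f < P.k, A (A.anc P.k g i) f ≠ x)

theorem Par.Ent.mono {G' : Finset (Finset (Fin P.n))} (hG : G' ⊆ G) {A : Nodes} {g c : ℕ}
    (h : P.Ent G' A g c j x) : P.Ent G A g c j x :=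
  ⟨h.1, hG h.2.1, h.2.2⟩

theorem anc_le {A : Nodes} {g c : ℕ} (hg : g < c) (h : ∀ p < c, A p k ≤ p) (i : ℕ) : A.anc k g i ≤ g := by
  induction i with
  | zero => exact le_rfl
  | succ i ih => exact (h _ (by omega)).trans ih

theorem anc_congr_lt {A A' : Nodes} {g c : ℕ} (hg : g < c) (h : ∀ p < c, A p k ≤ p)
    (hA : ∀ p < c, ∀ f, A p f = A' p f) (i : ℕ) : A.anc k g i = A'.anc k g i := by
  induction i with
  | zero => rfl
  | succ i ih =>
    grind [anc_le, Nodes.anc]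

/-- Being a correct entry involves only `g`, its ancestors and the earlier entries of the child.
Parents have smaller numbers, so all later writes leave old entries correct. -/
theorem ent_congr {A A' : Nodes} {g b c c' : ℕ} (hg : g < b) (h : ∀ p < b, A p P.k ≤ p)
    (hA : ∀ p < b, ∀ f, A p f = A' p f) (hc : ∀ f < j, A c f = A' c' f) (he : P.Ent G A g c j x) : P.Ent G A' g
    c' j x := by
  have h1 : A.base P.k g c j = A'.base P.k g c' j := by
    rw [Nodes.base, Nodes.base, pre_congr fun f _ => hA g hg f]
    congr 1
    exact List.map_congr_left fun f hf => hc f (List.mem_range.1 hf)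
  obtain ⟨e1, e2, e3, e4⟩ := he
  refine ⟨?_, ?_, ?_, ?_⟩
  · rw [← hA g hg]; exact e1
  · rw [← h1]; exact e2
  · rw [← h1]; exact e3
  grind [anc_le, anc_congr_lt]

/-- Numerical facts about the parameters, and facts about the list of vertices. -/
structure Par.Valid (P : Par) : Prop where
  hside : P.side < 2
  hh1 : 1 ≤ P.h
  hhk : 2 * P.h ≤ P.k + 1
  hk2 : 2 ≤ P.k
  sl_lt : ∀ i < 6 * P.k * P.q, P.sl i < P.n
  sl_inj : ∀ i < 6 * P.k * P.q, ∀ i' < 6 * P.k * P.q, P.sl i = P.sl i' → i = i'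
  rt_lt : ∀ f < P.k, P.rt f < P.n
  rt_inj : ∀ f < P.k, ∀ f' < P.k, P.rt f = P.rt f' → f = f'
  rt_sl : ∀ f < P.k, ∀ i < 6 * P.k * P.q, P.rt f ≠ P.sl i

theorem Par.Valid.vtx_lt (hP : P.Valid) (hj : j < P.k) (hi : i < P.q) : P.vtx lev j i < P.n :=
  hP.sl_lt _ (class_index_lt hP.hside (Nat.mod_lt _ (by omega)) hj hi)

theorem index_inj {s s' l l' q : ℕ} (hl : l < 3) (hl' : l' < 3) (hj : j < k) (hj' : j' < k) (hi : i < q)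
    (hi' : i' < q) (h : ((s * 3 + l) * k + j) * q + i = ((s' * 3 + l') * k + j') * q + i') : s = s' ∧ l = l' ∧
    j = j' ∧ i = i' := by
  grind [addr_inj]

theorem Par.Valid.vtx_inj (hP : P.Valid) {lev' : ℕ} (hj : j < P.k) (hj' : j' < P.k) (hi : i < P.q)
    (hi' : i' < P.q) (h : P.vtx lev j i = P.vtx lev' j' i') : lev % 3 = lev' % 3 ∧ j = j' ∧ i = i' := by
  have h1 := hP.sl_inj _ (class_index_lt hP.hside (Nat.mod_lt lev (by omega)) hj hi) _
    (class_index_lt hP.hside (Nat.mod_lt lev' (by omega)) hj' hi') h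
  exact (index_inj (Nat.mod_lt _ (by omega)) (Nat.mod_lt _ (by omega)) hj hj' hi hi' h1).2

theorem Par.Ent.lt (hP : P.Valid) {A : Nodes} {g c : ℕ} (hj : j < P.k) (h : P.Ent G A g c j x) : x < P.n := by
  obtain ⟨⟨i, hi, rfl⟩, -⟩ := h
  exact hP.vtx_lt hj hi

theorem nodup_cands (hP : P.Valid) {A : Nodes} {U : Finset (List ℕ)} {g c I : ℕ} (hj : j < P.k) (hI : I ≤ P.q) :
    (P.cands A U g c j I).Nodup := by
  refine List.Nodup.filter _ (List.Nodup.map_on ?_ List.nodup_range)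
  intro i hi i' hi' h
  rw [List.mem_range] at hi hi'
  exact (hP.vtx_inj hj hj (by omega) (by omega) h).2.2

theorem mem_cands {A : Nodes} {U : Finset (List ℕ)} {g c : ℕ} : x ∈ P.cands A U g c j P.q ↔
    (∃ i < P.q, x = P.vtx (A g (P.k + 1) + 1) j i) ∧ P.Test A U g c j x := by
  simp only [Par.cands, List.mem_filter, List.mem_map, List.mem_range, decide_eq_true_eq]
  grind

theorem mem_hits {A : Nodes} {U : Finset (List ℕ)} {g c : ℕ} : x ∈ P.hits G A U g c j P.q ↔ x ∈ P.cands A U g c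
    j P.q ∧ vset P.n (A.base P.k g c j ++ [x]) ∈ G := by
  simp [Par.hits, List.mem_filter]

theorem ent_of_mem_cands {A : Nodes} {U : Finset (List ℕ)} {g c : ℕ} (h : x ∈ P.cands A U g c j P.q)
    (hG : vset P.n (A.base P.k g c j ++ [x]) ∈ G) : P.Ent G A g c j x :=
  ⟨(mem_cands.1 h).1, hG, (mem_cands.1 h).2.1, (mem_cands.1 h).2.2.2⟩

theorem scan_eq_some {A A' : Nodes} {U : Finset (List ℕ)} {g c s : ℕ} (h : P.scan G s U g c j A = some A') : s ≤
    (P.hits G A U g c j P.q).length ∧ A' = A.write c j ((P.hits G A U g c j P.q).take s) := by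
  simp_all [Par.scan, Option.some_inj, symm]

theorem scan_spec (hP : P.Valid) {A A' : Nodes} {U : Finset (List ℕ)} {g c s : ℕ} (hj : j < P.k)
    (h : P.scan G s U g c j A = some A') : ∃ xs : List ℕ, xs.length = s ∧ xs.Nodup ∧ A' = A.write c j xs ∧ ∀ x ∈
    xs, P.Ent G A g c j x ∧ (j < P.h → ¬ Over P.n P.thrU U (P.h - (j + 1)) (A.pre c j ++ [x])) := by
  obtain ⟨h1, h2⟩ := scan_eq_some h
  refine ⟨_, by simp [h1], ?_, h2, ?_⟩
  · exact (List.take_sublist _ _).nodup (((nodup_cands hP hj le_rfl)).filter _)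
  · intro x hx
    have h3 := mem_hits.1 (List.mem_of_mem_take hx)
    exact ⟨ent_of_mem_cands h3.1 h3.2, (mem_cands.1 h3.1).2.2.1⟩

/-- The nodes below `tot` form a correct search tree, and `U` is the set of the beginnings of their
tuples (except the root). -/
structure WF (P : Par) (G : Finset (Finset (Fin P.n))) (A : Nodes) (U : Finset (List ℕ))
    (tot : ℕ) : Prop where
  pos : 0 < tot
  par : ∀ p < tot, A p P.k ≤ p
  lev : ∀ p < tot, A p (P.k + 1) ≤ p
  root : ∀ f < P.k, A 0 f = P.rt f
  rootlev : A 0 (P.k + 1) = 0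
  node : ∀ p, 0 < p → p < tot → A p P.k < p ∧ A p (P.k + 1) = A (A p P.k) (P.k + 1) + 1 ∧
    ∀ j < P.k, P.Ent G A (A p P.k) p j (A p j)
  uniq : ∀ p p', 0 < p → 0 < p' → p < tot → p' < tot → A.pre p P.h = A.pre p' P.h → p = p'
  used : ∀ l, l ∈ U ↔ ∃ p, 0 < p ∧ p < tot ∧ l = A.pre p P.h

theorem WF.vert {A : Nodes} {U : Finset (List ℕ)} {tot : ℕ} (h : WF P G A U tot) (hP : P.Valid) {p : ℕ}
    (hp : p < tot) (hf : f < P.k) : A p f < P.n := by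
  rcases Nat.eq_zero_or_pos p with rfl | hp0
  · rw [h.root f hf]; exact hP.rt_lt f hf
  · exact ((h.node p hp0 hp).2.2 f hf).lt hP hf

/-- The first `J` entries shared by the children of `g` have been found. -/
structure Stem (P : Par) (G : Finset (Finset (Fin P.n))) (A₀ : Nodes) (g c J : ℕ)
    (A : Nodes) : Prop where
  old : ∀ p < c, ∀ f, A p f = A₀ p f
  ent : ∀ j < J, P.Ent G A g c j (A c j)

/-- The beginnings of `s` children of `g` have been found, and the first `t` children have been
completed. -/
structure Mid (P : Par) (G : Finset (Finset (Fin P.n))) (A₀ : Nodes) (U : Finset (List ℕ))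
    (g c s t : ℕ) (A : Nodes) (U' : Finset (List ℕ)) : Prop where
  old : ∀ p < c, ∀ f, A p f = A₀ p f
  stem : ∀ j < P.h - 1, P.Ent G A g c j (A c j)
  br : ∀ i < s, P.Ent G A g c (P.h - 1) (A (c + i) (P.h - 1))
  inj : ∀ i < s, ∀ i' < s, A (c + i) (P.h - 1) = A (c + i') (P.h - 1) → i = i'
  new : ∀ i < s, A.pre c (P.h - 1) ++ [A (c + i) (P.h - 1)] ∉ U
  done : ∀ i < t, A (c + i) P.k = g ∧ A (c + i) (P.k + 1) = A g (P.k + 1) + 1 ∧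
    (∀ f < P.h - 1, A (c + i) f = A c f) ∧ ∀ j < P.k, P.Ent G A g (c + i) j (A (c + i) j)
  used : ∀ l, l ∈ U' ↔ l ∈ U ∨ ∃ i < t, l = A.pre c (P.h - 1) ++ [A (c + i) (P.h - 1)]

/-- Additionally, the first `J` entries of the next child have been found. -/
structure Tail (P : Par) (G : Finset (Finset (Fin P.n))) (A₀ : Nodes) (U : Finset (List ℕ))
    (g c s t J : ℕ) (A : Nodes) (U' : Finset (List ℕ)) : Prop extends
    Mid P G A₀ U g c s t A U' where
  par : A (c + t) P.k = g
  lev : A (c + t) (P.k + 1) = A g (P.k + 1) + 1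
  copy : ∀ f < P.h - 1, A (c + t) f = A c f
  ent : ∀ j < J, P.Ent G A g (c + t) j (A (c + t) j)

variable {A₀ A A' : Nodes} {U U' U'' : Finset (List ℕ)} {g c s t J : ℕ}

theorem write_get {A : Nodes} {c : ℕ} {xs : List ℕ} (hi : i < xs.length) : A.write c j xs (c + i) j =
    xs[i] := by
  unfold Nodes.write
  grind

theorem old_par (h0 : WF P G A₀ U c) (hA : ∀ p < c, ∀ f, A p f = A₀ p f) : ∀ p < c, A p P.k ≤ p := fun p hp => by rw [hA p hp]; exact h0.par p hp

/-- The hypergraph `G'` that is searched may be smaller than the one for which correctness is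
claimed. The program uses equality; the probabilistic part takes `G` to be everything, so that its
invariants do not depend on the outcome. -/
theorem Stem.step (hP : P.Valid) (h0 : WF P G A₀ U c) (hg : g < c) (hJ : J < P.k)
    (h : Stem P G A₀ g c J A) {G' : Finset (Finset (Fin P.n))}
    (hs : P.scan G' 1 U' g c J A = some A')
    (hG : G' ⊆ G := by exact Finset.Subset.refl _) :
    Stem P G A₀ g c (J + 1) A' := by
  obtain ⟨xs, hl, -, rfl, hx⟩ := scan_spec hP hJ hs
  have hold : ∀ p < c, ∀ f, A p f = A.write c J xs p f := fun p hp f =>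
    (write_of_ne (Or.inl hp)).symm
  refine ⟨fun p hp f => by rw [← hold p hp, h.old p hp], ?_⟩
  intro j hj
  rcases Nat.lt_succ_iff_lt_or_eq.1 hj with hj' | rfl
  · rw [write_of_ne (Or.inr (by omega))]
    exact ent_congr hg (old_par h0 h.old) hold
      (fun f hf => (write_of_ne (Or.inr (by omega))).symm) (h.ent j hj')
  · have h1 : A.write c j xs c j = xs[0] := by
      have := write_get (A := A) (c := c) (j := j) (i := 0) (xs := xs) (by omega)
      simpa using this
    rw [h1]
    exact ent_congr hg (old_par h0 h.old) hold
      (fun f hf => (write_of_ne (Or.inr (by omega))).symm) ((hx _ (List.getElem_mem _)).1.mono hG)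

/-- With the entry `P.h - 1` a beginning is complete, and for it not being overloaded means not
belonging to `U`. This, with the distinctness of the hits, is what makes the beginnings of all nodes
different. -/
theorem Stem.branch (hP : P.Valid) (h0 : WF P G A₀ U c) (hg : g < c)
    (h : Stem P G A₀ g c (P.h - 1) A) {G' : Finset (Finset (Fin P.n))}
    (hs : P.scan G' s U g c (P.h - 1) A = some A')
    (hG : G' ⊆ G := by exact Finset.Subset.refl _) :
    Mid P G A₀ U g c s 0 A' U := by
  have hh1 := hP.hh1
  have hhk := hP.hhk
  obtain ⟨xs, hl, hnd, rfl, hx⟩ := scan_spec hP (by omega) hs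
  have hold : ∀ p < c, ∀ f, A p f = A.write c (P.h - 1) xs p f := fun p hp f =>
    (write_of_ne (Or.inl hp)).symm
  have hpre : (A.write c (P.h - 1) xs).pre c (P.h - 1) = A.pre c (P.h - 1) :=
    pre_congr fun f hf => write_of_ne (Or.inr (by omega))
  refine ⟨fun p hp f => by rw [← hold p hp, h.old p hp], ?_, ?_, ?_, ?_, ?_, ?_⟩
  · intro j hj
    rw [write_of_ne (Or.inr (by omega))]
    exact ent_congr hg (old_par h0 h.old) hold
      (fun f hf => (write_of_ne (Or.inr (by omega))).symm) (h.ent j hj)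
  · intro i hi
    rw [write_get (by omega)]
    exact ent_congr hg (old_par h0 h.old) hold
      (fun f hf => (write_of_ne (Or.inr (by omega))).symm) ((hx _ (List.getElem_mem _)).1.mono hG)
  · simp_all [write_get, List.Nodup.getElem_inj_iff]
  · intro i hi hm
    rw [hpre, write_get (by omega)] at hm
    refine (hx _ (List.getElem_mem (l := xs) (n := i) (by omega))).2 (by omega) ?_
    simp_all [over_zero]
  · intro i hi; omega
  · intro l
    simp

theorem Mid.congr (h0 : WF P G A₀ U c) (hg : g < c) (h : Mid P G A₀ U g c s t A U')
    (hold : ∀ p < c, ∀ f, A p f = A' p f) (hdone : ∀ i < t, ∀ f, A (c + i) f = A' (c + i) f)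
    (hst : ∀ f < P.h - 1, A c f = A' c f) (hbr : ∀ i, A (c + i) (P.h - 1) = A' (c + i) (P.h - 1)) : Mid P G A₀ U
    g c s t A' U' := by
  have hpre : A'.pre c (P.h - 1) = A.pre c (P.h - 1) := pre_congr fun f hf => (hst f hf).symm
  refine ⟨fun p hp f => by rw [← hold p hp, h.old p hp], ?_, ?_, ?_, ?_, ?_, ?_⟩
  · intro j hj
    rw [← hst j hj]
    exact ent_congr hg (old_par h0 h.old) hold (fun f hf => hst f (by omega)) (h.stem j hj)
  · intro i hi
    rw [← hbr i]
    exact ent_congr hg (old_par h0 h.old) hold (fun f hf => hst f (by omega)) (h.br i hi)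
  · intro i hi i' hi' he
    rw [← hbr i, ← hbr i'] at he
    exact h.inj i hi i' hi' he
  · intro i hi
    rw [hpre, ← hbr i]
    exact h.new i hi
  · intro i hi
    obtain ⟨h1, h2, h3, h4⟩ := h.done i hi
    refine ⟨by rw [← hdone i hi, h1], by grind, ?_, ?_⟩
    · grind
    · intro j hj
      rw [← hdone i hi]
      exact ent_congr hg (old_par h0 h.old) hold (fun f hf => hdone i hi f) (h4 j hj)
  · intro l
    rw [h.used, hpre]
    simp only [hbr]

/-- The stem is stored only in the first child. Copying it transfers correctness of the entries,
since the branching entry was found with that very stem in its base. -/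
theorem Mid.prep (hP : P.Valid) (h0 : WF P G A₀ U c) (hg : g < c) (ht : t < s) (h : Mid P G A₀ U g c s t A U') :
    Tail P G A₀ U g c s t P.h (P.prep A g c (c + t)) U' := by
  have hhk := hP.hhk
  have hk2 := hP.hk2
  have hne : ∀ p ≠ c + t, ∀ f, A p f = P.prep A g c (c + t) p f := by
    intro p hp f
    unfold Par.prep
    rw [if_neg hp]
  have hold : ∀ p < c, ∀ f, A p f = P.prep A g c (c + t) p f := fun p hp f => hne p (by omega) f
  have hst : ∀ f < P.h - 1, A c f = P.prep A g c (c + t) c f := by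
    grind [Par.prep]
  have hcp : ∀ f < P.h - 1, P.prep A g c (c + t) (c + t) f = A c f := by
    intro f hf
    unfold Par.prep
    rw [if_pos rfl, if_pos hf]
  have hbr : ∀ i, A (c + i) (P.h - 1) = P.prep A g c (c + t) (c + i) (P.h - 1) := by
    grind [Par.prep]
  have hm := h.congr h0 hg hold (fun i hi f => hne _ (by omega) f) hst hbr
  refine ⟨hm, ?_, ?_, fun f hf => by rw [hcp f hf, hst f hf], ?_⟩
  · unfold Par.prep
    grind
  · unfold Par.prep
    grind
  · intro j hj
    have hpar := old_par h0 hm.old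
    rcases Nat.lt_or_ge j (P.h - 1) with hj' | hj'
    · have := hm.stem j hj'
      grind [ent_congr]
    · obtain rfl : j = P.h - 1 := by omega
      exact ent_congr hg hpar (fun _ _ _ => rfl)
        (fun f hf => by grind) (hm.br t ht)

theorem Tail.step (hP : P.Valid) (h0 : WF P G A₀ U c) (hg : g < c) (hJ : J < P.k) (hhJ : P.h ≤ J)
    (h : Tail P G A₀ U g c s t J A U') {G' : Finset (Finset (Fin P.n))}
    (hs : P.scan G' 1 U'' g (c + t) J A = some A')
    (hG : G' ⊆ G := by exact Finset.Subset.refl _) :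
    Tail P G A₀ U g c s t (J + 1) A' U' := by
  have hh1 := hP.hh1
  obtain ⟨xs, hl, -, rfl, hx⟩ := scan_spec hP hJ hs
  have hold : ∀ p < c + t, ∀ f, A p f = A.write (c + t) J xs p f := fun p hp f =>
    (write_of_ne (Or.inl hp)).symm
  have hfld : ∀ p, ∀ f ≠ J, A p f = A.write (c + t) J xs p f := fun p f hf =>
    (write_of_ne (Or.inr hf)).symm
  have hm := h.toMid.congr h0 hg (fun p hp f => hold p (by omega) f)
    (fun i hi f => hold _ (by omega) f) (fun f hf => hfld _ f (by omega))
    (fun i => hfld _ _ (by omega))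
  refine ⟨hm, ?_, ?_, ?_, ?_⟩
  · rw [← hfld _ _ (by omega), h.par]
  · rw [← hfld _ _ (by omega), ← hfld _ _ (by omega), h.lev]
  · intro f hf
    rw [← hfld _ _ (by omega), ← hfld _ _ (by omega), h.copy f hf]
  · intro j hj
    rcases Nat.lt_succ_iff_lt_or_eq.1 hj with hj' | rfl
    · rw [← hfld _ _ (by omega)]
      exact ent_congr hg (old_par h0 h.old) (fun p hp f => hold p (by omega) f)
        (fun f hf => hfld _ _ (by omega)) (h.ent j hj')
    · have h1 : A.write (c + t) j xs (c + t) j = xs[0] := by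
        have := write_get (A := A) (c := c + t) (j := j) (i := 0) (xs := xs) (by omega)
        simpa using this
      rw [h1]
      exact ent_congr hg (old_par h0 h.old) (fun p hp f => hold p (by omega) f)
        (fun f hf => hfld _ _ (by omega)) ((hx _ (List.getElem_mem _)).1.mono hG)

theorem Tail.pre_eq (hP : P.Valid) (h : Tail P G A₀ U g c s t J A U') : A.pre (c + t) P.h = A.pre c (P.h - 1) ++
    [A (c + t) (P.h - 1)] := by
  have hh1 := hP.hh1
  rw [show P.h = P.h - 1 + 1 by omega, Nodes.pre, List.range_succ, List.map_append]
  congr 1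
  exact List.map_congr_left fun f hf => h.copy f (List.mem_range.1 hf)

theorem Mid.pre_eq (hP : P.Valid) (h : Mid P G A₀ U g c s t A U') (hi : i < t) : A.pre (c + i) P.h = A.pre c
    (P.h - 1) ++ [A (c + i) (P.h - 1)] := by
  have hh1 := hP.hh1
  rw [show P.h = P.h - 1 + 1 by omega, Nodes.pre, List.range_succ, List.map_append]
  congr 1
  exact List.map_congr_left fun f hf => (h.done i hi).2.2.1 f (List.mem_range.1 hf)

theorem Tail.complete (hP : P.Valid) (h : Tail P G A₀ U g c s t P.k A U') : Mid P G A₀ U g c s (t + 1) A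
    (insert (A.pre (c + t) P.h) U') := by
  refine ⟨h.old, h.stem, h.br, h.inj, h.new, ?_, ?_⟩
  · intro i hi
    rcases Nat.lt_succ_iff_lt_or_eq.1 hi with hi' | rfl
    · exact h.toMid.done i hi'
    · exact ⟨h.par, h.lev, h.copy, h.ent⟩
  · intro l
    rw [Finset.mem_insert, h.used, h.pre_eq hP]
    grind

/-- Beginnings stay distinct: a new one is not in `U`, hence differs from the old ones, and two new
ones share the stem but differ in the branching entry. -/
theorem Mid.wf (hP : P.Valid) (h0 : WF P G A₀ U c) (hg : g < c) (h : Mid P G A₀ U g c s s A U') : WF P G A U'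
    (c + s) := by
  have hpos := h0.pos
  have hpold : ∀ p < c, ∀ i, A.pre p i = A₀.pre p i := fun p hp i =>
    pre_congr fun f _ => h.old p hp f
  have hcase : ∀ p, p < c + s → p < c ∨ ∃ i < s, p = c + i := by
    intro p hp
    rcases Nat.lt_or_ge p c with h1 | h1
    · exact Or.inl h1
    · exact Or.inr ⟨p - c, by omega, by omega⟩
  refine ⟨by omega, ?_, ?_, ?_, ?_, ?_, ?_, ?_⟩
  · intro p hp
    rcases hcase p hp with h1 | ⟨i, hi, rfl⟩
    · rw [h.old p h1]; exact h0.par p h1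
    · rw [(h.done i hi).1]; omega
  · intro p hp
    rcases hcase p hp with h1 | ⟨i, hi, rfl⟩
    · rw [h.old p h1]; exact h0.lev p h1
    · rw [(h.done i hi).2.1, h.old g hg]
      have := h0.lev g hg
      omega
  · intro f hf
    rw [h.old 0 hpos, h0.root f hf]
  · rw [h.old 0 hpos, h0.rootlev]
  · intro p hp0 hp
    rcases hcase p hp with h1 | ⟨i, hi, rfl⟩
    · obtain ⟨h2, h3, h4⟩ := h0.node p hp0 h1
      rw [h.old p h1, h.old p h1]
      refine ⟨h2, by rw [h3, h.old _ (by omega)], ?_⟩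
      intro j hj
      rw [h.old p h1]
      exact ent_congr (b := c) (by omega) h0.par (fun p hp f => (h.old p hp f).symm)
        (fun f hf => (h.old p h1 f).symm) (h4 j hj)
    · obtain ⟨h2, h3, h4, h5⟩ := h.done i hi
      grind
  · intro p p' hp0 hp0' hp hp' he
    have hu : ∀ p < c, 0 < p → ∀ i < s, A.pre p P.h ≠ A.pre (c + i) P.h := by
      intro p h1 h2 i hi he
      apply h.new i hi
      rw [← h.pre_eq hP hi, ← he, hpold p h1]
      exact (h0.used _).2 ⟨p, h2, h1, rfl⟩
    rcases hcase p hp with h1 | ⟨i, hi, rfl⟩ <;> rcases hcase p' hp' with h2 | ⟨i', hi', rfl⟩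
    · rw [hpold p h1, hpold p' h2] at he
      exact h0.uniq p p' hp0 hp0' h1 h2 he
    · grind
    · grind
    · rw [h.pre_eq hP hi, h.pre_eq hP hi'] at he
      have := List.append_cancel_left he
      rw [h.inj i hi i' hi' (by simpa using this)]
  · intro l
    rw [h.used, h0.used]
    constructor
    · rintro (⟨p, h1, h2, rfl⟩ | ⟨i, hi, rfl⟩)
      · exact ⟨p, h1, by omega, (hpold p h2 _).symm⟩
      · exact ⟨c + i, by omega, by omega, (h.pre_eq hP hi).symm⟩
    · rintro ⟨p, hp0, hp, rfl⟩
      rcases hcase p hp with h1 | ⟨i, hi, rfl⟩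
      · exact Or.inl ⟨p, hp0, h1, hpold p h1 _⟩
      · exact Or.inr ⟨i, hi, h.pre_eq hP hi⟩

end Tree

/-! ### The program growing a search tree -/

/-- The effect of a partial computation: only registers from `lo` on and the regions in `M` change,
at most `cnt` sets are exposed, and register `20` tells whether the result `res` is defined. -/
def Res {n : ℕ} {α : Type*} (k B : ℕ) (V : Finset (Fin n)) (lo cnt : ℕ) (M : List ℕ)
    (σ : RamState n) (res : Option α) (R : α → RamState n → Prop) (σ' : RamState n) : Prop :=
  (∀ i < lo, i ≠ 20 → σ'.reg i = σ.reg i) ∧ SameMem B M σ σ' ∧ Exposed k V cnt σ.E σ'.E ∧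
  (∀ a, res = some a → σ'.reg 20 = 1 ∧ R a σ') ∧ (res = none → σ'.reg 20 = 0)

/-- Run a command unless the computation has failed. -/
def guardC {k : ℕ} (d : RamCmd k) : RamCmd k := .ite (.reg 20) d .skip

section Res

variable {n k : ℕ} {w B : ℕ} {G : Finset (Finset (Fin n))} {S V : Finset (Fin n)}
variable {σ : RamState n} {T c1 cnt lo lo' : ℕ} {M : List ℕ}

/-- Register 20 acts as an exception flag: a guarded command is skipped once the flag is cleared,
which mirrors `Option.bind`. -/
theorem Ok.bind {α β : Type*} {c d : RamCmd k} {c2 T1 T2 : ℕ} {res : Option α} {f : α → Option β}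
    {R : α → RamState n → Prop} {R' : β → RamState n → Prop} (hc : Ok w G S c σ T1 (Res k B V lo c1 M σ res R))
    (hd : ∀ a σ1, res = some a → σ1.reg 20 = 1 → R a σ1 → (∀ i < lo, i ≠ 20 → σ1.reg i = σ.reg i) → SameMem B M
    σ σ1 → Ok w G S d σ1 T2 (Res k B V lo c2 M σ1 (f a) R')) (hT : T1 + T2 + 2 ≤ T) (hcnt : c1 + c2 ≤ cnt) : Ok
    w G S (.seq c (guardC d)) σ T (Res k B V lo cnt M σ (res.bind f) R') := by
  refine Ok.seq (T' := T2 + 2) hc ?_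
  rintro σ1 ⟨h1, h2, h3, h4, h5⟩
  refine Ok.ite (T := T2 + 1) ?_ ?_
  · intro h20
    cases hres : res with
    | none => exact absurd (h5 hres) h20
    | some a =>
      obtain ⟨h6, h7⟩ := h4 a hres
      refine (hd a σ1 hres h6 h7 h1 h2).mono (by omega) ?_
      rintro σ2 ⟨g1, g2, g3, g4, g5⟩
      exact ⟨fun i hi hi' => (g1 i hi hi').trans (h1 i hi hi'),
        h2.trans g2 (fun x => id) (fun x => id), h3.trans g3 hcnt, g4, g5⟩
  · intro h20
    cases hres : res with
    | none =>
      refine Ok.skip (by omega) ⟨h1, h2, h3.mono (by omega), ?_, fun _ => h5 hres⟩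
      intro a ha
      simp at ha
    | some a =>
      simp_all

/-- After a failure the remaining rounds idle, so the time bound holds in either case. The body may
use registers from `lo'` on, which lie above the counter `ri`. -/
theorem Ok.loopM {α : Type*} {body : RamCmd k} {K T' ri : ℕ} {f : ℕ → α → Option α} {a₀ : α}
    {R : ℕ → α → RamState n → Prop} {bound : RamExpr} (hlo : lo ≤ ri) (hlo' : ri < lo') (h20 : 20 < lo)
    (hK : K + 1 < 2 ^ w) (hT1 : 1 ≤ T) (hR : ∀ i a σ v, R i a σ → R i a (σ.setReg ri v))
    (hb : ∀ σ1 : RamState n, (∀ i < lo, i ≠ 20 → σ1.reg i = σ.reg i) → SameMem B M σ σ1 → bound.eval w σ1 = K)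
    (h0 : R 0 a₀ σ) (hok : σ.reg 20 = 1) (hs : ∀ i < K, ∀ a σ1, SpikeLemma.loopM f i a₀ = some a → R i a σ1 →
    σ1.reg 20 = 1 → σ1.reg ri = i → (∀ i < lo, i ≠ 20 → σ1.reg i = σ.reg i) → SameMem B M σ σ1 → Ok w G S body
    σ1 T (Res k B V lo' c1 M σ1 (f i a) (R (i + 1)))) (hT : K * (T + 3) + 2 ≤ T') (hcnt : K * c1 ≤ cnt) : Ok w G
    S (SpikeLemma.forN ri bound (guardC body)) σ T' (Res k B V lo cnt M σ (SpikeLemma.loopM f K a₀) (R K)) := by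
  refine Ok.forN (K := K) (T := T + 1) (fun i σ1 => σ1.reg ri = i ∧
    Res k B V lo (i * c1) M σ (SpikeLemma.loopM f i a₀) (R i) σ1) hK ?_ (fun i σ1 h => h.1) ?_ ?_ ?_
    (by omega)
  · refine ⟨by simp, ?_, sameMem_of_eq rfl, Exposed.refl _ _, ?_, ?_⟩
    · intro i hi _
      rw [setReg_ne (by omega)]
    · grind [SpikeLemma.loopM, Option.some_inj, setReg_ne]
    · intro ha
      simp [SpikeLemma.loopM] at ha
  · rintro i σ1 ⟨-, h1, h2, -⟩
    exact hb σ1 h1 h2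
  · rintro i hi σ1 ⟨hri, h1, h2, h3, h4, h5⟩
    have hcc : (i + 1) * c1 = i * c1 + c1 := by ring
    refine Ok.ite (T := T) ?_ ?_ le_rfl
    · intro hne
      cases hres : SpikeLemma.loopM f i a₀ with
      | none => exact absurd (h5 hres) hne
      | some a =>
        obtain ⟨h6, h7⟩ := h4 a hres
        refine (hs i hi a σ1 hres h7 h6 hri h1 h2).mono le_rfl ?_
        rintro σ2 ⟨g1, g2, g3, g4, g5⟩
        refine ⟨by rw [g1 ri hlo' (by omega), hri], by simp, ?_, ?_, ?_, ?_, ?_⟩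
        · grind [setReg_ne]
        · exact h2.trans g2 (fun x => id) (fun x => id)
        · exact h3.trans g3 (by omega)
        · grind [SpikeLemma.loopM, setReg_ne]
        grind [SpikeLemma.loopM, setReg_ne]
    · intro heq
      cases hres : SpikeLemma.loopM f i a₀ with
      | some a =>
        rw [eval_reg, (h4 a hres).1] at heq
        omega
      | none =>
        have hnone : SpikeLemma.loopM f (i + 1) a₀ = none := by
          rw [SpikeLemma.loopM, hres]; rfl
        refine Ok.skip hT1 ⟨hri, by simp, ?_, h2, h3.mono (by omega), ?_, ?_⟩
        · grind [setReg_ne]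
        · grind
        grind [setReg_ne]
  · rintro σ1 ⟨-, h1, h2, h3, h4, h5⟩
    exact ⟨h1, h2, h3.mono hcnt, h4, h5⟩

theorem Res.trans_left {α : Type*} {σ1 σ2 : RamState n} {M' M'' : List ℕ} {res : Option α}
    {R : α → RamState n → Prop} (h : Res k B V lo cnt M σ1 res R σ2)
    (hreg : ∀ i < lo', i ≠ 20 → σ1.reg i = σ.reg i) (hm : SameMem B M' σ σ1) (hE : σ1.E = σ.E) (hlo : lo' ≤ lo)
    (hM : M ⊆ M'') (hM' : M' ⊆ M'') : Res k B V lo' cnt M'' σ res R σ2 := by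
  obtain ⟨h1, h2, h3, h4, h5⟩ := h
  exact ⟨fun i hi hi' => (h1 i (by omega) hi').trans (hreg i hi hi'), hm.trans h2 hM' hM,
    hE ▸ h3, h4, h5⟩

end Res

/-! ### Programs for the children of a node. -/

section Expand

/-- Search for the entries `js` in turn. -/
def scansC (k h side rg rc : ℕ) : List ℕ → RamCmd k
  | [] => .skip
  | j :: js => .seq (scanC k h side rg rc j (.const 1)) (guardC (scansC k h side rg rc js))

/-- Copy the first entries of the node in register `24` to the node in register `31`. -/
def copyC (k side : ℕ) : ℕ → RamCmd k
  | 0 => .skip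
  | f + 1 => .seq (copyC k side f)
      (.store (addrE (1 + side) (.op .add (.op .mul (.reg 31) (.const (k + 2))) (.const f)))
        (slotE (1 + side) (k + 2) (.reg 24) f))

/-- Complete the child of the node in register `23` with the number in register `30`. -/
def childC (k h side : ℕ) : RamCmd k :=
  .seq (.set 31 (.op .add (.reg 24) (.reg 30)))
  (.seq (copyC k side (h - 1))
  (.seq (.store (addrE (1 + side) (.op .add (.op .mul (.reg 31) (.const (k + 2))) (.const k)))
    (.reg 23))
  (.seq (.store (addrE (1 + side) (.op .add (.op .mul (.reg 31) (.const (k + 2)))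
    (.const (k + 1)))) (levE k side 23))
  (.seq (bump (4 + side) 5 ((List.range h).map (slotE (1 + side) (k + 2) (.reg 31))))
    (scansC k h side 23 31 (List.range' h (k - h)))))))

/-- Find children of the node in register `23`, to be stored from the one in register `24` on. -/
def expandC (k h side : ℕ) (sE : RamExpr) : RamCmd k :=
  .seq (scansC k h side 23 24 (List.range (h - 1)))
    (guardC (.seq (scanC k h side 23 24 (h - 1) sE)
      (guardC (forN 30 sE (guardC (childC k h side))))))

variable {w B : ℕ} {P : Par} {G : Finset (Finset (Fin P.n))} {S V : Finset (Fin P.n)}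
variable {T c c' g : ℕ} {A : Nodes} {σ : RamState P.n}

/-- The memory holds the search tree `A` and the counters of `U`. -/
def Rel (B : ℕ) (P : Par) (A : Nodes) (U : Finset (List ℕ)) (σ : RamState P.n) : Prop :=
  Slots B (1 + P.side) (P.k + 2) A σ ∧ Tab B (4 + P.side) P.n P.thrU P.h U σ

theorem Sized.hBh (hP : Sized w B P) : (P.n + 1) ^ P.h ≤ B :=
  (Nat.pow_le_pow_right (by omega) hP.hhk).trans hP.hB

/-- A bound for the running time of a search. -/
def scanTime (P : Par) : ℕ := P.q * (P.dep * 4 + 12) + 8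

/-- The invariant `I` of the search tree is a parameter, because the same program builds stems
(`Stem`) and completes children (`Tail`). -/
theorem Ok.scans {U : Finset (List ℕ)} {cap rg rc : ℕ} (hP : Sized w B P) (hrg' : rg < 40 ∧ rg ≠ 20)
    (hrc' : rc < 40 ∧ rc ≠ 20) (I : ℕ → Nodes → Prop) (len j0 : ℕ)
    (hI : ∀ j A, j0 ≤ j → j < j0 + len → I j A → ScanPre B P A g c j 1 cap ∧ vset P.n (A.base P.k g c j) ⊆ V)
    (hstep : ∀ j A A', j0 ≤ j → j < j0 + len → I j A → P.scan G 1 U g c j A = some A' → I (j + 1) A')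
    (hA : I j0 A) (henv : Env B P σ) (hrel : Rel B P A U σ) (hok : σ.reg 20 = 1) (hrg : σ.reg rg = g)
    (hrc : σ.reg rc = c) (hT : len * (scanTime P + 2) + 1 ≤ T) : Ok w G S
    (scansC P.k P.h P.side rg rc (List.range' j0 len)) σ T (Res P.k B V 40 len [1 + P.side] σ (P.scans G U g c
    (List.range' j0 len) A) (fun A' σ' => Rel B P A' U σ' ∧ I (j0 + len) A')) := by
  have hside := hP.hside
  induction len generalizing j0 A σ T with
  | zero =>
    refine Ok.skip (by omega) ⟨fun _ _ _ => rfl, SameMem.refl _ _, Exposed.refl _ _, ?_, ?_⟩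
    · grind [Par.scans, Option.some_inj]
    · intro h
      simp [Par.scans] at h
  | succ len ih =>
    obtain ⟨hpre, hVb⟩ := hI j0 A le_rfl (by omega) hA
    have hw := hP.hw
    have hN := hP.hN
    have h1 := Ok.scan (G := G) (S := S) (sE := .const 1) (T := scanTime P) hP hpre henv hrel.1
      hrel.2 hrg hrg' hrc hrc' (fun σ' _ => eval_const (by omega)) hVb le_rfl
    have hmul : (len + 1) * (scanTime P + 2) = len * (scanTime P + 2) + (scanTime P + 2) := by ring
    refine Ok.bind (T1 := scanTime P) (T2 := len * (scanTime P + 2) + 1) (c1 := 1) (c2 := len)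
      (R := fun A' σ' => Rel B P A' U σ' ∧ I (j0 + 1) A') (h1.mono le_rfl ?_) ?_ (by omega)
      (by omega)
    · rintro σ' ⟨g1, g2, g3, g4, g5⟩
      refine ⟨g1, g2, g3, ?_, g5⟩
      intro A' hA'
      refine ⟨by rw [(g4 A' hA').1, hok], ⟨(g4 A' hA').2, ?_⟩,
        hstep j0 A A' le_rfl (by omega) hA hA'⟩
      exact hrel.2.same hP.hBh g2 (by simp)
    · rintro A' σ1 hA' h20 ⟨hrel1, hI1⟩ hreg hm
      rw [show j0 + (len + 1) = j0 + 1 + len by omega]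
      exact ih (j0 + 1) (fun j A h2 h3 => hI j A (by omega) (by omega))
        (fun j A A' h2 h3 => hstep j A A' (by omega) (by omega)) hI1
        (henv.same hP (fun i hi => hreg i (by omega) (by omega)) hm (by simp; omega)
          (by simp; omega)) hrel1 h20
        (by rw [hreg rg hrg'.1 hrg'.2, hrg]) (by rw [hreg rc hrc'.1 hrc'.2, hrc]) le_rfl

/-- The first `f` entries have been copied from `c` to `c'`. -/
def Nodes.cp (A : Nodes) (c c' f : ℕ) : Nodes := fun p i => if p = c' ∧ i < f then A c i else A p i

theorem cp_succ (A : Nodes) (c c' f : ℕ) : A.cp c c' (f + 1) = (A.cp c c' f).upd c' f (A c f) := by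
  unfold Nodes.cp Nodes.upd
  grind

theorem Ok.copy {f : ℕ} (hP : Sized w B P) (h1 : σ.reg 1 = B) (hA : Slots B (1 + P.side) (P.k + 2) A σ)
    (h24 : σ.reg 24 = c) (h31 : σ.reg 31 = c') (hf : f ≤ P.k) (hc : (c + 1) * (P.k + 2) ≤ B)
    (hc' : (c' + 1) * (P.k + 2) ≤ B) (hT : f + 1 ≤ T) : Ok w G S (copyC P.k P.side f) σ T
    (fun σ' => σ'.reg = σ.reg ∧ σ'.E = σ.E ∧ SameMem B [1 + P.side] σ σ' ∧ Slots B (1 + P.side) (P.k + 2) (A.cp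
    c c' f) σ') := by
  have hside := hP.hside
  have hk := hP.hk
  rw [add_mul, one_mul] at hc hc'
  induction f generalizing T with
  | zero =>
    refine Ok.skip (by omega) ⟨rfl, rfl, SameMem.refl _ _, hA.congr ?_⟩
    intro p i _
    simp [Nodes.cp]
  | succ f ih =>
    refine Ok.seq (ih (by omega) le_rfl) (T' := 1) ?_
    rintro σ' ⟨g1, g2, g3, g4⟩
    have hv := eval_slotE (e := .reg 24) (w := w) (i := f) (by rw [g1, h1]) hP.hw
      (show 1 + P.side < 7 by omega) (show (RamExpr.reg 24).eval w σ' = c by rw [eval_reg, g1, h24])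
      (by omega) (by omega) (by omega) g4
    have hav := eval_slotAddr (e := .reg 31) (w := w) (i := f) (σ := σ') (by rw [g1, h1]) hP.hw
      (show 1 + P.side < 7 by omega) (show (RamExpr.reg 31).eval w σ' = c' by rw [eval_reg, g1, h31])
      (show P.k + 2 < B by omega) (by omega) (by omega)
    refine Ok.store le_rfl ?_
    rw [hv, hav]
    refine ⟨g1, g2, g3.trans (sameMem_setMem (M := [1 + P.side]) (by simp) (by omega))
      (fun x => id) (fun x => id), ?_⟩
    rw [cp_succ]
    have : A.cp c c' f c f = A c f := by
      unfold Nodes.cp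
      rw [if_neg (by omega)]
    rw [this]
    exact g4.setMem (by omega) (by omega)

theorem prep_eq (hP : P.Valid) (A : Nodes) : P.prep A g c c' =
    (((A.cp c c' (P.h - 1)).upd c' P.k g).upd c' (P.k + 1) (A g (P.k + 1) + 1)) := by
  have hhk := hP.hhk
  grind [Par.prep, Nodes.upd, Nodes.cp]

end Expand

/-! ### Correctness and cost of growing a search tree. -/

section Grow

variable {w B : ℕ} {P : Par} {G : Finset (Finset (Fin P.n))} {S V : Finset (Fin P.n)}
variable {A A' A₀ : Nodes} {U U' : Finset (List ℕ)} {T c cap e g j s : ℕ} {σ : RamState P.n}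

/-- All vertices that may occur in the search tree belong to `V`. -/
structure InV (P : Par) (V : Finset (Fin P.n)) : Prop where
  sl : ∀ i < 6 * P.k * P.q, ∀ x : Fin P.n, x.val = P.sl i → x ∈ V
  rt : ∀ f < P.k, ∀ x : Fin P.n, x.val = P.rt f → x ∈ V

theorem Par.Ent.mem_V (hP : P.Valid) (hV : InV P V) {x : ℕ} (hj : j < P.k) (h : P.Ent G A g c j x) (y : Fin P.n)
    (hy : y.val = x) : y ∈ V := by
  obtain ⟨⟨i, hi, rfl⟩, -⟩ := h
  exact hV.sl _ (class_index_lt hP.hside (Nat.mod_lt _ (by omega)) hj hi) y hy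

theorem WF.mem_V {tot : ℕ} (h : WF P G A U tot) (hP : P.Valid) (hV : InV P V) {p f : ℕ} (hp : p < tot)
    (hf : f < P.k) (y : Fin P.n) (hy : y.val = A p f) : y ∈ V := by
  rcases Nat.eq_zero_or_pos p with rfl | hp0
  · exact hV.rt f hf y (by rw [hy, h.root f hf])
  · exact ((h.node p hp0 hp).2.2 f hf).mem_V hP hV hf y hy

theorem scanPre_of {c' : ℕ} (hP : P.Valid) (hV : InV P V) (hcap : cap * (P.k + 2) ≤ B) (h0 : WF P G A₀ U c)
    (hg : g < c) (hc : c ≤ c') (hcs : c' + s ≤ cap) (hc' : c' < cap) (hj : j < P.k)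
    (hold : ∀ p < c, ∀ f, A p f = A₀ p f) (hent : ∀ f < j, P.Ent G A g c' f (A c' f)) : ScanPre B P A g c' j s
    cap ∧ vset P.n (A.base P.k g c' j) ⊆ V := by
  have hcB : cap * 2 ≤ B := (Nat.mul_le_mul_left _ (by omega)).trans hcap
  refine ⟨⟨hj, hcap, hcs, hc', ?_, ?_, ?_, ?_⟩, ?_⟩
  · intro i
    have := anc_le hg (old_par h0 hold) i
    omega
  · intro f hf
    rw [hold g hg]
    exact h0.vert hP hg hf
  · exact fun f hf => (hent f hf).lt hP (by omega)
  · rw [hold g hg]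
    have := h0.lev g hg
    omega
  · intro y hy
    rw [mem_vset] at hy
    rcases List.mem_append.1 hy with h | h
    · obtain ⟨f, hf, h1⟩ := mem_pre.1 h
      rw [hold g hg] at h1
      exact h0.mem_V hP hV hg (by omega) y h1.symm
    · obtain ⟨f, hf, h1⟩ := mem_pre.1 h
      exact (hent f hf).mem_V hP hV (by omega) y h1.symm

theorem Rel.congr {σ' : RamState P.n} (hm : σ'.mem = σ.mem) (h : Rel B P A U σ) (hA : A = A') : Rel B P A' U
    σ' := by
  subst hA
  exact ⟨fun p i hi hpi => by rw [hm]; exact h.1 p i hi hpi,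
    fun l hl hn => by rw [hm]; exact h.2 l hl hn⟩

/-- The beginning of the child is registered before its remaining entries are sought. This changes
nothing for them: from position `P.h` on the test of beginnings is vacuous. -/
theorem Ok.child {t : ℕ} (hP : Sized w B P) (hv : P.Valid) (hV : InV P V) (hcap : cap * (P.k + 2) ≤ B)
    (h0 : WF P G A₀ U c) (hg : g < c) (hcs : c + s ≤ cap) (ht : t < s) (hmid : Mid P G A₀ U g c s t A U')
    (henv : Env B P σ) (hrel : Rel B P A U' σ) (hok : σ.reg 20 = 1) (h23 : σ.reg 23 = g) (h24 : σ.reg 24 = c)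
    (h30 : σ.reg 30 = t) (hT : P.k * (scanTime P + 5) + 6 ≤ T) : Ok w G S (childC P.k P.h P.side) σ T
    (Res P.k B V 31 P.k [1 + P.side, 4 + P.side] σ (P.child G g c t (A, U')) (fun a σ' => Rel B P a.1 a.2 σ' ∧
    Mid P G A₀ U g c s (t + 1) a.1 a.2)) := by
  have hside := hP.hside
  have hk := hP.hk
  have hw := hP.hw
  have hN := hP.hN
  have hh1 := hv.hh1
  have hhk := hv.hhk
  have hadr : ∀ p < cap, (p + 1) * (P.k + 2) ≤ B := fun p hp =>
    (Nat.mul_le_mul_right _ hp).trans hcap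
  have hadr' : ∀ p < cap, ∀ f < P.k + 2, p * (P.k + 2) + f < B := by
    grind
  have hcB : cap * 2 ≤ B := (Nat.mul_le_mul_left _ (by omega)).trans hcap
  have hkT : P.k * (scanTime P + 5) = P.k * (scanTime P + 2) + 3 * P.k := by ring
  have hkh : (P.k - P.h) * (scanTime P + 2) ≤ P.k * (scanTime P + 2) :=
    Nat.mul_le_mul_right _ (by omega)
  refine Ok.set_seq (T - 1) (c + t) ?_ ?_
  · rw [eval_add (x := .reg 24) (y := .reg 30) (show (RamExpr.reg 24).eval w σ = c from h24)
      (show (RamExpr.reg 30).eval w σ = t from h30)]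
  refine Ok.seq (T' := T - 1 - P.h) (Ok.copy (A := A) (c := c) (c' := c + t) (f := P.h - 1)
    (T := P.h) hP (by simpa using henv.r1) hrel.1 (by simpa using h24) (by simp) (by omega)
    (hadr _ (by omega)) (hadr _ (by omega)) (by omega)) ?_
  rintro σ1 ⟨hr1, hE1, hm1, hA1⟩
  have hreg1 : ∀ i < 31, σ1.reg i = σ.reg i := by
    intro i hi
    rw [hr1, setReg_ne (by omega)]
  have h311 : σ1.reg 31 = c + t := by rw [hr1]; simp
  have hav : ∀ f < P.k + 2, ∀ σ' : RamState P.n, σ'.reg = σ1.reg →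
      (addrE (1 + P.side) (.op .add (.op .mul (.reg 31) (.const (P.k + 2))) (.const f))).eval w σ' =
      (1 + P.side) * B + ((c + t) * (P.k + 2) + f) := fun f hf σ' hr =>
    eval_slotAddr (by rw [hr, hreg1 1 (by omega), henv.r1]) hw (by omega)
      (by rw [eval_reg, hr, h311]) (by omega) hf (hadr' _ (by omega) _ hf)
  refine Ok.seq (T := 1) (T' := T - 2 - P.h) (Ok.store le_rfl (Q := fun σ2 => σ2 = σ1.setMem
    ((1 + P.side) * B + ((c + t) * (P.k + 2) + P.k)) g) ?_) ?_
  · grind [eval_reg]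
  rintro _ rfl
  have hA2 := hA1.setMem (p := c + t) (i := P.k) (v := g) (by omega) (hadr' _ (by omega) _ (by omega))
  have hAg : ((A.cp c (c + t) (P.h - 1)).upd (c + t) P.k g) g (P.k + 1) = A g (P.k + 1) := by
    unfold Nodes.upd Nodes.cp
    grind
  have hlev : A g (P.k + 1) ≤ g := by
    rw [hmid.old g hg]
    exact h0.lev g hg
  refine Ok.seq (T := 1) (T' := T - 3 - P.h) (Ok.store le_rfl (Q := fun σ2 => σ2 = (σ1.setMem
    ((1 + P.side) * B + ((c + t) * (P.k + 2) + P.k)) g).setMem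
    ((1 + P.side) * B + ((c + t) * (P.k + 2) + (P.k + 1))) (A g (P.k + 1) + 1)) ?_) ?_
  · rw [hav (P.k + 1) (by omega) (σ1.setMem
      ((1 + P.side) * B + ((c + t) * (P.k + 2) + P.k)) g) rfl]
    congr 1
    refine eval_add ?_ eval_const
    rw [← hAg]
    exact eval_slotE (by rw [setMem_reg, hreg1 1 (by omega), henv.r1]) hw (by omega)
      (by simp_all) (by omega) (by omega)
      (hadr' _ (by omega) _ (by omega)) hA2
  rintro _ rfl
  set σ2 := (σ1.setMem ((1 + P.side) * B + ((c + t) * (P.k + 2) + P.k)) g).setMem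
    ((1 + P.side) * B + ((c + t) * (P.k + 2) + (P.k + 1))) (A g (P.k + 1) + 1) with hσ2
  have hA3 : Slots B (1 + P.side) (P.k + 2) (P.prep A g c (c + t)) σ2 := by
    rw [prep_eq hv]
    exact hA2.setMem (by omega) (hadr' _ (by omega) _ (by omega))
  have hm2 : SameMem B [1 + P.side] σ σ2 := by
    have h1 : SameMem B [1 + P.side] σ σ1 := hm1
    refine (h1.trans (M' := [1 + P.side]) (M'' := [1 + P.side]) (sameMem_setMem (by simp)
      (hadr' _ (by omega) _ (by omega))) (fun x => id) (fun x => id)).trans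
      (sameMem_setMem (M := [1 + P.side]) (by simp) (hadr' _ (by omega) _ (by omega)))
      (fun x => id) (fun x => id)
  have hr2 : ∀ i < 31, σ2.reg i = σ.reg i := hreg1
  have hE2 : σ2.E = σ.E := hE1
  have htail := hmid.prep hv h0 hg ht
  set A3 := P.prep A g c (c + t) with hA3def
  have hU2 : Tab B (4 + P.side) P.n P.thrU P.h U' σ2 := hrel.2.same hP.hBh hm2 (by simp)
  have henv2 : Env B P σ2 := henv.same hP (fun i hi => hr2 i (by omega)) hm2 (by simp <;> omega)
    (by simp <;> omega)
  have hlp : (A3.pre (c + t) P.h).length = P.h := length_pre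
  have hlt3 : ∀ x ∈ A3.pre (c + t) P.h, x < P.n := by
    intro x hx
    obtain ⟨f, hf, rfl⟩ := mem_pre.1 hx
    exact (htail.ent f hf).lt hv (by omega)
  refine Ok.seq (T := 2 * P.h + 2) (T' := T - 5 - 3 * P.h) (Ok.bump (U := U')
    (l := A3.pre (c + t) P.h) (thr := P.thrU) (N := P.n) hw (by omega) hN (by rw [hlp]; exact hP.hBh)
    ?_ hlt3 henv2.r0 henv2.r1 henv2.r5 ?_ (by rw [hlp]; exact hU2) (by rw [hlp])) ?_
  -- A table may only be updated with a sequence it does not contain yet; the beginning is new with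
  -- respect to `U` and differs from those of its earlier siblings.
  · rw [htail.pre_eq hv, htail.toMid.used]
    rintro (h1 | ⟨i, hi, h1⟩)
    · exact htail.new t ht h1
    · have := List.append_cancel_left h1
      have := htail.inj t ht i (by omega) (by simpa using this)
      omega
  · intro σ' hr hm
    exact map_eval_slots (by rw [hr, henv2.r1]) hw (by omega)
      (by rw [eval_reg, hr]; exact h311) (by omega) (by omega) (hadr _ (by omega))
      (hA3.same hm (by simp))
  rintro σ3 ⟨hr3, hE3, hm3, hU3⟩
  rw [hlp] at hU3
  have hrel3 : Rel B P A3 (insert (A3.pre (c + t) P.h) U') σ3 :=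
    ⟨hA3.same hm3 (by simp), hU3⟩
  have henv3 : Env B P σ3 := henv2.same hP (fun i hi => by rw [hr3]) hm3 (by simp <;> omega)
    (by simp <;> omega)
  have hscans := Ok.scans (G := G) (S := S) (V := V) (U := insert (A3.pre (c + t) P.h) U') (g := g)
    (c := c + t) (cap := cap) (rg := 23) (rc := 31) (σ := σ3) (A := A3) hP (by omega) (by omega)
    (fun j A' => Tail P G A₀ U g c s t j A' U' ∧ A'.pre (c + t) P.h = A3.pre (c + t) P.h)
    (P.k - P.h) P.h
    (fun j A' h1 h2 h3 => scanPre_of hv hV hcap h0 hg (by omega) (by omega) (by omega) (by omega)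
      h3.1.old h3.1.ent)
    (fun j A' A'' h1 h2 h3 h4 => ⟨h3.1.step hv h0 hg (by omega) h1 h4, by
      rw [← h3.2]
      obtain ⟨xs, -, -, rfl, -⟩ := scan_spec hv (by omega) h4
      exact pre_congr fun f hf => write_of_ne (Or.inr (by omega))⟩)
    ⟨htail, rfl⟩ henv3 hrel3 (by rw [hr3, hr2 20 (by omega), hok])
    (by rw [hr3, hr2 23 (by omega), h23]) (by rw [hr3]; exact h311) le_rfl
  refine hscans.mono (by omega) ?_
  intro σ4 h4
  have h5 := h4.trans_left (σ := σ) (lo' := 31) (M' := [1 + P.side, 4 + P.side])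
    (M'' := [1 + P.side, 4 + P.side])
    (fun i hi _ => by rw [hr3, hr2 i hi])
    (hm2.trans hm3 (by simp) (by simp)) (by rw [hE3, hE2]) (by omega) (by simp) (by simp)
  obtain ⟨g1, g2, g3, g4, g5⟩ := h5
  have hdef : P.child G g c t (A, U') = (P.scans G (insert (A3.pre (c + t) P.h) U') g (c + t)
      (List.range' P.h (P.k - P.h)) A3).map fun A' => (A', insert (A3.pre (c + t) P.h) U') := rfl
  refine ⟨g1, g2, g3.mono (by omega), ?_, ?_⟩
  · intro a ha
    obtain ⟨A', hA', rfl⟩ := Option.map_eq_some_iff.1 ha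
    obtain ⟨g6, g7, g8, g9⟩ := g4 A' hA'
    rw [show P.h + (P.k - P.h) = P.k by omega] at g8
    refine ⟨g6, g7, ?_⟩
    have := g8.complete hv
    rw [g9] at this
    exact this
  · intro ha
    exact g5 (Option.map_eq_none_iff.1 ha)

/-- A bound for the running time of completing a child. -/
def childTime (P : Par) : ℕ := P.k * (scanTime P + 5) + 6

/-- A bound for the running time of finding `s` children. -/
def expandTime (P : Par) (s : ℕ) : ℕ := (s + 1) * (childTime P + 3) + 10

/-- The stem and the branching entry cost `P.h` scans together and each child at most `P.k` more;
since a scan exposes at most one set, `P.k * (s + 1)` sets suffice. -/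
theorem Ok.expand {sE : RamExpr} (hP : Sized w B P) (hv : P.Valid) (hV : InV P V) (hcap : cap * (P.k + 2) ≤ B)
    (h0 : WF P G A U c) (hg : g < c) (hcs : c + s ≤ cap) (hs0 : 0 < s) (henv : Env B P σ) (hrel : Rel B P A U σ)
    (hok : σ.reg 20 = 1) (h23 : σ.reg 23 = g) (h24 : σ.reg 24 = c)
    (hsE : ∀ σ' : RamState P.n, (∀ i < 30, i ≠ 20 → σ'.reg i = σ.reg i) → sE.eval w σ' = s)
    (hT : expandTime P s ≤ T) : Ok w G S (expandC P.k P.h P.side sE) σ T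
    (Res P.k B V 30 (P.k * (s + 1)) [1 + P.side, 4 + P.side] σ (P.expand G s g c (A, U)) (fun a σ' => Rel B P
    a.1 a.2 σ' ∧ Mid P G A U g c s s a.1 a.2)) := by
  have hside := hP.hside
  have hw := hP.hw
  have hh1 := hv.hh1
  have hhk := hv.hhk
  have hcB : cap * 2 ≤ B := (Nat.mul_le_mul_left _ (by omega)).trans hcap
  have hT' : expandTime P s = s * (childTime P + 3) + childTime P + 13 := by
    unfold expandTime; ring
  have hcT : childTime P = P.k * (scanTime P + 2) + 3 * P.k + 6 := by
    unfold childTime; ring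
  have hhT : P.h * (scanTime P + 2) ≤ P.k * (scanTime P + 2) := Nat.mul_le_mul_right _ (by omega)
  have hhT' : P.h * (scanTime P + 2) = (P.h - 1) * (scanTime P + 2) + (scanTime P + 2) := by
    conv_lhs => rw [show P.h = P.h - 1 + 1 by omega]
    ring
  have hcnt : P.k * (s + 1) = s * P.k + P.k := by ring
  have h1 := Ok.scans (G := G) (S := S) (V := V) (U := U) (g := g) (c := c) (cap := cap) (rg := 23)
    (rc := 24) (σ := σ) (A := A) hP (by omega) (by omega)
    (fun j A' => Stem P G A g c j A') (P.h - 1) 0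
    (fun j A' _ h2 h3 => scanPre_of hv hV hcap h0 hg le_rfl (by omega) (by omega) (by omega)
      h3.old h3.ent)
    (fun j A' A'' _ h2 h3 h4 => h3.step hv h0 hg (by omega) h4)
    ⟨fun _ _ _ => rfl, fun j hj => absurd hj (by omega)⟩ henv hrel hok h23 h24 le_rfl
  rw [← List.range_eq_range'] at h1
  refine Ok.bind (T1 := (P.h - 1) * (scanTime P + 2) + 1)
    (T2 := scanTime P + s * (childTime P + 3) + 4) (c1 := P.h - 1) (c2 := 1 + s * P.k)
    (R := fun A' σ' => Rel B P A' U σ' ∧ Stem P G A g c (P.h - 1) A') (h1.mono le_rfl ?_) ?_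
    (by omega) (by omega)
  · intro σ' h2
    have := h2.trans_left (σ := σ) (lo' := 30) (M' := []) (M'' := [1 + P.side, 4 + P.side])
      (fun i _ _ => rfl) (SameMem.refl _ _) rfl (by omega) (by simp) (by simp)
    grind
  rintro A1 σ1 - hok1 ⟨hrel1, hstem⟩ hreg1 hm1
  have henv1 : Env B P σ1 := henv.same hP (fun i hi => hreg1 i (by omega) (by omega)) hm1 (by simp; omega)
    (by simp; omega)
  obtain ⟨hpre, hVb⟩ := scanPre_of (j := P.h - 1) (s := s) hv hV hcap h0 hg le_rfl hcs (by omega)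
    (by omega) hstem.old hstem.ent
  have h2 := Ok.scan (G := G) (S := S) (V := V) (sE := sE) (rg := 23) (rc := 24)
    (T := scanTime P) (U := U) (σ := σ1) (A := A1) hP hpre
    henv1 hrel1.1 hrel1.2 (by grind) (by omega)
    (by grind) (by omega)
    (fun σ' hσ' => hsE σ' fun i hi hi' => by
      grind) hVb le_rfl
  refine Ok.bind (T1 := scanTime P) (T2 := s * (childTime P + 3) + 2) (c1 := 1) (c2 := s * P.k)
    (R := fun A' σ' => Rel B P A' U σ' ∧ Mid P G A U g c s 0 A' U) (h2.mono le_rfl ?_) ?_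
    (by omega) (by omega)
  · rintro σ' ⟨g1, g2, g3, g4, g5⟩
    refine ⟨fun i hi hi' => g1 i (by omega) hi', g2.mono (by simp), g3, ?_, g5⟩
    intro A' hA'
    refine ⟨by rw [(g4 A' hA').1, hok1], ⟨(g4 A' hA').2, ?_⟩, hstem.branch hv h0 hg hA'⟩
    exact hrel1.2.same hP.hBh g2 (by simp)
  rintro A2 σ2 - hok2 ⟨hrel2, hmid⟩ hreg2 hm2
  have henv2 : Env B P σ2 := henv1.same hP (fun i hi => hreg2 i (by omega) (by omega)) hm2
    (by simp; omega) (by simp; omega)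
  have hreg : ∀ i < 30, i ≠ 20 → σ2.reg i = σ.reg i := fun i hi hi' => by
    grind
  refine Ok.loopM (α := Nodes × Finset (List ℕ)) (ri := 30) (K := s) (lo := 30) (lo' := 31) (c1 := P.k) (T := childTime P)
    (R := fun i a σ' => Rel B P a.1 a.2 σ' ∧ Mid P G A U g c s i a.1 a.2) le_rfl (by omega)
    (by omega) (by omega) (by omega) (fun i a σ' v h => ⟨h.1.congr (by simp) rfl, h.2⟩)
    (fun σ' h _ => hsE σ' fun i hi hi' => by rw [h i hi hi', hreg i hi hi']) ⟨hrel2, hmid⟩ hok2 ?_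
    le_rfl le_rfl
  rintro i hi ⟨A3, U3⟩ σ3 - ⟨hrel3, hmid3⟩ hok3 h30 hreg3 hm3
  have henv3 : Env B P σ3 := henv2.same hP (fun i hi => hreg3 i (by omega) (by omega)) hm3
    (by simp; omega) (by simp; omega)
  grind [Ok.child, le_rfl]

/-- The parent of a node in the search tree. -/
def parent (e m p : ℕ) : ℕ := if p ≤ e then p - 1 else (p - e - 1) / m + e

/-- Invariant of growing the tree. -/
structure Tree (P : Par) (G : Finset (Finset (Fin P.n))) (e : ℕ) (A : Nodes) (U : Finset (List ℕ))
    (tot : ℕ) : Prop extends WF P G A U tot where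
  parent_eq : ∀ p, 0 < p → p < tot → A p P.k = parent e P.m p

/-- Keeping the explicit parent function in the invariant makes the shape of the tree known in
advance, so that levels and leaves can be located by arithmetic. -/
theorem Mid.tree (hP : P.Valid) (h0 : Tree P G e A U c) (hg : g < c) (h : Mid P G A U g c s s A' U')
    (hp : ∀ i < s, parent e P.m (c + i) = g) : Tree P G e A' U' (c + s) := by
  refine ⟨h.wf hP h0.toWF hg, ?_⟩
  intro p hp0 hpc
  rcases Nat.lt_or_ge p c with h1 | h1
  · rw [h.old p h1]
    exact h0.parent_eq p hp0 h1
  · obtain ⟨i, rfl⟩ := Nat.exists_eq_add_of_le h1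
    rw [(h.done i (by omega)).1, hp i (by omega)]

/-- Grow the search tree; register `rX` holds the number of nodes that get several children. -/
def growC (k h side re rX : ℕ) : RamCmd k :=
  .seq (forN 21 (.reg re) (guardC (.seq (.set 23 (.reg 21))
      (.seq (.set 24 (.op .add (.reg 21) (.const 1))) (expandC k h side (.const 1))))))
    (guardC (forN 22 (.reg rX) (guardC (.seq (.set 23 (.op .add (.reg re) (.reg 22)))
      (.seq (.set 24 (.op .add (.op .add (.reg re) (.const 1)) (.op .mul (.reg 22) (.reg 3))))
        (expandC k h side (.reg 3)))))))

/-- A bound for the running time of growing the tree. -/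
def growTime (P : Par) (e X : ℕ) : ℕ :=
  e * (expandTime P 1 + 5) + X * (expandTime P P.m + 5) + 6

/-- Nodes are numbered as in a heap: after the initial path `0, …, e`, the children of node `e + i`
are the `P.m` nodes from `e + 1 + i * P.m` on. Nodes are expanded in the order of their numbers, so
the next free place is always known. -/
theorem Ok.grow {X re rX : ℕ} (hP : Sized w B P) (hv : P.Valid) (hV : InV P V) (hcap : cap * (P.k + 2) ≤ B)
    (hre : re < 20) (hrX : rX < 20) (h0 : WF P G A U 1) (hcs : e + 1 + X * P.m ≤ cap) (hm : 0 < P.m)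
    (henv : Env B P σ) (hrel : Rel B P A U σ) (hok : σ.reg 20 = 1) (hE : σ.reg re = e) (hX : σ.reg rX = X)
    (hT : growTime P e X ≤ T) : Ok w G S (growC P.k P.h P.side re rX) σ T
    (Res P.k B V 21 (e * (2 * P.k) + X * (P.k * (P.m + 1))) [1 + P.side, 4 + P.side] σ (P.grow G e X (A, U))
    (fun a σ' => Rel B P a.1 a.2 σ' ∧ Tree P G e a.1 a.2 (e + 1 + X * P.m))) := by
  have hside := hP.hside
  have hw := hP.hw
  have hcB : cap * 2 ≤ B := (Nat.mul_le_mul_left _ (by omega)).trans hcap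
  have hXm : X ≤ X * P.m := Nat.le_mul_of_pos_right _ hm
  have hT' : growTime P e X = e * (expandTime P 1 + 2 + 3) + X * (expandTime P P.m + 2 + 3) + 6 := rfl
  have hmem : ∀ M : List ℕ, M = [1 + P.side, 4 + P.side] → 3 ∉ M ∧ 6 ∉ M := by
    simp
    omega
  refine Ok.bind (T1 := e * (expandTime P 1 + 2 + 3) + 2) (T2 := X * (expandTime P P.m + 2 + 3) + 2)
    (c1 := e * (2 * P.k)) (c2 := X * (P.k * (P.m + 1)))
    (R := fun a σ' => Rel B P a.1 a.2 σ' ∧ Tree P G e a.1 a.2 (e + 1)) ?_ ?_ (by omega) le_rfl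
  · refine (Ok.loopM (α := Nodes × Finset (List ℕ)) (ri := 21) (K := e) (lo := 21) (lo' := 22) (c1 := 2 * P.k) (T := expandTime P 1 + 2)
      (R := fun i a σ' => Rel B P a.1 a.2 σ' ∧ Tree P G e a.1 a.2 (i + 1)) le_rfl (by omega)
      (by omega) (by omega) (by omega) (fun i a σ' v h => ⟨h.1.congr (by simp) rfl, h.2⟩)
      (fun σ' h _ => by rw [eval_reg, h re (by omega) (by omega), hE])
      ⟨hrel, h0, fun p h1 h2 => by omega⟩ hok ?_ le_rfl le_rfl)
    rintro i hi ⟨A1, U1⟩ σ1 - ⟨hrel1, htree⟩ hok1 h21 hreg1 hm1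
    have henv1 : Env B P σ1 := henv.same hP (fun i hi => hreg1 i (by omega) (by omega)) hm1
      (hmem _ rfl).1 (hmem _ rfl).2
    refine Ok.set_seq (expandTime P 1 + 1) i (by rw [eval_reg, h21]) ?_
    refine Ok.set_seq (expandTime P 1) (i + 1) ?_ ?_
    · rw [eval_add (x := .reg 21) (a := i) (b := 1) (by simpa using h21)
        eval_const]
    have hreg2 : ∀ i' < 23, ((σ1.setReg 23 i).setReg 24 (i + 1)).reg i' = σ1.reg i' := by
      intro i' hi'
      rw [setReg_ne (by omega), setReg_ne (by omega)]
    have := Ok.expand (G := G) (S := S) (V := V) (A := A1) (U := U1) (g := i) (c := i + 1) (s := 1)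
      (sE := .const 1) (σ := (σ1.setReg 23 i).setReg 24 (i + 1)) hP hv hV hcap htree.toWF
      (by omega) (by omega) one_pos (henv1.same hP (M := []) (fun i' hi' => hreg2 i' (by omega))
        (sameMem_of_eq (by simp)) (by simp) (by simp)) (hrel1.congr (by simp) rfl)
      (by rw [hreg2 20 (by omega), hok1]) (by simp) (by simp) (fun σ' _ => eval_const (by omega))
      le_rfl
    refine this.mono le_rfl fun σ2 h2 => ?_
    obtain ⟨g1, g2, g3, g4, g5⟩ := h2.trans_left (σ := σ1) (lo' := 22) (M' := [])
      (M'' := [1 + P.side, 4 + P.side]) (fun i' hi' _ => hreg2 i' (by omega))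
      (sameMem_of_eq (by simp)) (by simp) (by omega) (by simp) (by simp)
    refine ⟨g1, g2, g3.mono (by omega), ?_, g5⟩
    intro a ha
    obtain ⟨g6, g7, g8⟩ := g4 a ha
    refine ⟨g6, g7, g8.tree hv htree (by omega) ?_⟩
    simp_all [parent]
  · rintro ⟨A0, U0⟩ σ0 - hok0 ⟨hrel0, htree0⟩ hreg0 hm0
    have henv0 : Env B P σ0 := henv.same hP (fun i hi => hreg0 i (by omega) (by omega)) hm0
      (hmem _ rfl).1 (hmem _ rfl).2
    refine (Ok.loopM (α := Nodes × Finset (List ℕ)) (ri := 22) (K := X) (lo := 21) (lo' := 23) (c1 := P.k * (P.m + 1)) (T := expandTime P P.m + 2)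
      (R := fun i a σ' => Rel B P a.1 a.2 σ' ∧ Tree P G e a.1 a.2 (e + 1 + i * P.m)) (by omega)
      (by omega) (by omega) (by omega) (by omega)
      (fun i a σ' v h => ⟨h.1.congr (by simp) rfl, h.2⟩)
      (fun σ' h _ => by
        grind [eval_reg])
      ⟨hrel0, by simpa using htree0⟩ hok0 ?_ le_rfl le_rfl)
    rintro i hi ⟨A1, U1⟩ σ1 - ⟨hrel1, htree⟩ hok1 h22 hreg1 hm1
    have henv1 : Env B P σ1 := henv0.same hP (fun i hi => hreg1 i (by omega) (by omega)) hm1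
      (hmem _ rfl).1 (hmem _ rfl).2
    have him : (i + 1) * P.m ≤ X * P.m := Nat.mul_le_mul_right _ hi
    have him' : (i + 1) * P.m = i * P.m + P.m := by ring
    have hii : i ≤ i * P.m := Nat.le_mul_of_pos_right _ hm
    have hee : σ1.reg re = e := by
      grind
    have h3 : σ1.reg 3 = P.m := henv1.r3
    refine Ok.set_seq (expandTime P P.m + 1) (e + i) ?_ ?_
    · rw [eval_add (x := .reg re) (y := .reg 22) (a := e) (b := i) hee h22]
    refine Ok.set_seq (expandTime P P.m) (e + 1 + i * P.m) ?_ ?_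
    · rw [eval_add (a := e + 1) (b := i * P.m) (eval_add (x := .reg re) (a := e) (b := 1) ?_
        eval_const) (eval_mul (x := .reg 22) (y := .reg 3) (a := i) (b := P.m)
          ?_ ?_)]
      · rw [eval_reg, setReg_ne (by omega), hee]
      · simp_all
      simp_all
    have hreg2 : ∀ i' < 23, ((σ1.setReg 23 (e + i)).setReg 24 (e + 1 + i * P.m)).reg i' =
        σ1.reg i' := by
      intro i' hi'
      rw [setReg_ne (by omega), setReg_ne (by omega)]
    have := Ok.expand (G := G) (S := S) (V := V) (A := A1) (U := U1) (g := e + i)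
      (c := e + 1 + i * P.m) (s := P.m) (sE := .reg 3)
      (σ := (σ1.setReg 23 (e + i)).setReg 24 (e + 1 + i * P.m)) hP hv hV hcap htree.toWF
      (by omega) (by omega) hm (henv1.same hP (M := []) (fun i' hi' => hreg2 i' (by omega))
        (sameMem_of_eq (by simp)) (by simp) (by simp)) (hrel1.congr (by simp) rfl)
      (by rw [hreg2 20 (by omega), hok1]) (by simp) (by simp)
      (fun σ' h => by grind [eval_reg])
      le_rfl
    refine this.mono le_rfl fun σ2 h2 => ?_
    obtain ⟨g1, g2, g3, g4, g5⟩ := h2.trans_left (σ := σ1) (lo' := 23) (M' := [])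
      (M'' := [1 + P.side, 4 + P.side]) (fun i' hi' _ => hreg2 i' (by omega))
      (sameMem_of_eq (by simp)) (by simp) (by omega) (by simp) (by simp)
    refine ⟨g1, g2, g3, ?_, g5⟩
    intro a ha
    obtain ⟨g6, g7, g8⟩ := g4 a ha
    refine ⟨g6, g7, ?_⟩
    have := g8.tree hv htree (by omega) ?_
    · grind
    intro i' hi'
    unfold parent
    rw [if_neg (by omega), show e + 1 + i * P.m + i' - e - 1 = i' + i * P.m by omega,
      Nat.add_mul_div_right _ _ hm, Nat.div_eq_of_lt hi']
    omega

end Grow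

/-! ### The input and the parameters computed from it -/

/-- The input of the algorithm, with tuples given as sequences of numbers, and two constants. -/
structure Inp where
  n : ℕ
  k : ℕ
  /-- the inverse density of the leaves -/
  D : ℕ
  /-- the inverse density of overloaded extensions -/
  D1 : ℕ
  u : ℕ → ℕ
  v : ℕ → ℕ
  S : Finset (Fin n)
  E : Finset (Finset (Fin n))

structure Inp.Valid (I : Inp) : Prop where
  hk2 : 2 ≤ I.k
  hkn : I.k ≤ I.n
  u_lt : ∀ f < I.k, I.u f < I.n
  v_lt : ∀ f < I.k, I.v f < I.n
  u_inj : ∀ f < I.k, ∀ f' < I.k, I.u f = I.u f' → f = f'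
  v_inj : ∀ f < I.k, ∀ f' < I.k, I.v f = I.v f' → f = f'

namespace Inp

variable (I : Inp)

/-- Whether the vertex with number `x` may be used inside the path. -/
def Usable (x : ℕ) : Prop := x ∈ I.S.map Fin.valEmbedding ∧ ∀ f < I.k, I.u f ≠ x ∧ I.v f ≠ x

open Classical in
/-- The usable vertices with number below `i`. -/
noncomputable def slUpTo (i : ℕ) : List ℕ := (List.range i).filter fun x => I.Usable x

noncomputable def sl : List ℕ := I.slUpTo I.n

noncomputable def s : ℕ := I.sl.length

noncomputable def q : ℕ := I.s / (6 * I.k)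

def m : ℕ := Nat.log 2 I.n

/-- The length of the beginnings of tuples that have to differ. -/
def h (side : ℕ) : ℕ := (I.k + 1 - side) / 2

/-- The number of leaves of a search tree. -/
noncomputable def N (side : ℕ) : ℕ := I.q ^ I.h side / I.D

/-- The depth of the branching part of a search tree. -/
noncomputable def d (side : ℕ) : ℕ := Nat.clog I.m (I.N side)

/-- The length of the initial path of a search tree. -/
noncomputable def e (side : ℕ) : ℕ := if side = 0 then 0 else (I.d 0 + I.d 1) % 2

noncomputable def dep : ℕ := I.d 0 + I.d 1 + 3

end Inp

/-- The number of nodes of depth less than `d` in the `m`-ary tree. -/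
def start (m : ℕ) : ℕ → ℕ
  | 0 => 0
  | d + 1 => m * start m d + 1

/-- The geometric series without division. -/
theorem start_mul (m d : ℕ) : start (m + 1) d * m + 1 = (m + 1) ^ d := by
  induction d with
  | zero => simp [start]
  | succ d ih =>
    rw [pow_succ, ← ih, start]
    ring

theorem start_lt {m d : ℕ} (hm : 2 ≤ m) : start m d < m ^ d := by
  obtain ⟨m, rfl⟩ : ∃ m', m = m' + 1 := ⟨m - 1, by omega⟩
  rw [← start_mul]
  have : start (m + 1) d * 1 ≤ start (m + 1) d * m := Nat.mul_le_mul_left _ (by omega)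
  omega

/-- The last inner level has fewer than `N` nodes by minimality of the depth, and the levels above
it form a geometric series. So inner nodes do not dominate the leaves. -/
theorem start_clog_le {m N : ℕ} (hm : 2 ≤ m) (hN : 2 ≤ N) : start m (Nat.clog m N) ≤ 2 * N := by
  have h0 : 0 < Nat.clog m N := Nat.clog_pos hm hN
  obtain ⟨d, hd⟩ : ∃ d, Nat.clog m N = d + 1 := ⟨Nat.clog m N - 1, by omega⟩
  have h1 : m ^ d < N := by
    have := Nat.pow_pred_clog_lt_self hm hN
    rwa [hd] at this
  obtain ⟨m, rfl⟩ : ∃ m', m = m' + 1 := ⟨m - 1, by omega⟩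
  have h2 := start_mul m d
  have h3 : start (m + 1) d ≤ start (m + 1) d * m := Nat.le_mul_of_pos_right _ (by omega)
  grind [start, add_mul, mul_comm]

namespace Inp

variable (I : Inp)

/-- The number of nodes above the leaves in the branching part of a search tree. -/
noncomputable def L (side : ℕ) : ℕ := start I.m (I.d side)

/-- The number of nodes with several children. -/
noncomputable def X (side : ℕ) : ℕ := (I.L side + I.N side) / I.m + 1

/-- The number of nodes. -/
noncomputable def tot (side : ℕ) : ℕ := I.e side + 1 + I.X side * I.m

/-- The leaf with number `i`. -/
noncomputable def leaf (side i : ℕ) : ℕ := I.L side + I.e side + i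

/-- The sequence of usable vertices with number `c`. -/
noncomputable def seq (c : ℕ) : List ℕ :=
  (List.range I.k).map fun i => I.sl.getD (c / I.s ^ i % I.s) 0

/-- Those among the first `c` sequences that are search bases used before. -/
noncomputable def UEUpTo (c : ℕ) : Finset (List ℕ) :=
  ((range c).filter fun c => vset I.n (I.seq c) ∈ I.E).image I.seq

noncomputable def UE : Finset (List ℕ) := I.UEUpTo (I.s ^ I.k)

def rt (side : ℕ) : ℕ → ℕ := if side = 0 then I.u else I.v

/-- The parameters of the search from one of the ends. -/
noncomputable def P (side : ℕ) : Par where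
  n := I.n
  k := I.k
  q := I.q
  m := I.m
  thrE := I.q / I.D1 + 1
  thrU := I.q / 8 + 1
  dep := I.dep
  sl := fun i => I.sl.getD i 0
  UE := I.UE
  h := I.h side
  side := side
  rt := I.rt side

/-- The search tree with only the root. -/
def root (side : ℕ) : Nodes := fun p i => if p = 0 ∧ i < I.k then I.rt side i else 0

/-- The conditions for the search, except for the bound on the depth. -/
def Chk₁ : Prop := (∀ f < I.k, ∀ f' < I.k, I.u f ≠ I.v f') ∧ 2 ≤ I.m ∧ I.m ≤ I.q ∧ 2 ≤ I.N 0 ∧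
  2 ≤ I.N 1

/-- The conditions for the search. -/
def Chk : Prop := I.Chk₁ ∧ I.s * I.dep ≤ I.n

/-- The result of the search from one of the ends. -/
noncomputable def tree (G : Finset (Finset (Fin I.n))) (side : ℕ) : Option (Nodes × Finset (List ℕ)) :=
  (I.P side).grow G (I.e side) (I.X side) (I.root side, ∅)

/-- The tuples in the nodes `a` and `b` can follow each other. -/
def Conn (G : Finset (Finset (Fin I.n))) (A A' : Nodes) (a b : ℕ) : Prop :=
  ∀ j < I.k, vset I.n (A.pre a (I.k - j) ++ A'.pre b (j + 1)) ∈ G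

/-- The search succeeds. -/
def Succ (G : Finset (Finset (Fin I.n))) : Prop :=
  I.Chk ∧ ∃ a b, I.tree G 0 = some a ∧ I.tree G 1 = some b ∧
    ∃ i < I.N 0, ∃ j < I.N 1, I.Conn G a.1 b.1 (I.leaf 0 i) (I.leaf 1 j)

variable {I}

theorem mem_slUpTo {i x : ℕ} : x ∈ I.slUpTo i ↔ x < i ∧ I.Usable x := by
  simp [slUpTo]

theorem nodup_sl : I.sl.Nodup := List.Nodup.filter _ List.nodup_range

theorem sl_lt {i : ℕ} (hi : i < I.s) : I.sl.getD i 0 < I.n := by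
  rw [List.getD_eq_getElem _ _ hi]
  exact (mem_slUpTo.1 (List.getElem_mem hi)).1

theorem sl_usable {i : ℕ} (hi : i < I.s) : I.Usable (I.sl.getD i 0) := by
  rw [List.getD_eq_getElem _ _ hi]
  exact (mem_slUpTo.1 (List.getElem_mem hi)).2

theorem sl_inj {i i' : ℕ} (hi : i < I.s) (hi' : i' < I.s) (h : I.sl.getD i 0 = I.sl.getD i' 0) :
    i = i' := by
  rw [List.getD_eq_getElem _ _ hi, List.getD_eq_getElem _ _ hi'] at h
  exact (List.Nodup.getElem_inj_iff nodup_sl).1 h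

theorem s_le_card : I.s ≤ I.S.card := by
  have h1 : I.sl.toFinset ⊆ I.S.map Fin.valEmbedding := fun x hx =>
    (mem_slUpTo.1 (List.mem_toFinset.1 hx)).2.1
  have h2 := Finset.card_le_card h1
  rwa [Finset.card_map, List.toFinset_card_of_nodup nodup_sl] at h2

theorem s_le : I.s ≤ I.n := by
  have := I.S.card_le_univ
  rw [Fintype.card_fin] at this
  exact s_le_card.trans this

theorem kq_le : 6 * I.k * I.q ≤ I.s := Nat.mul_div_le _ _

theorem q_le : I.q ≤ I.s := Nat.div_le_self _ _

/-- This inequality lets every search base contain a full beginning: of the parent for entries `j <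
h`, as then `k - j ≥ h`, and of the child for entries `j ≥ h`. -/
theorem h_le (side : ℕ) : 2 * I.h side ≤ I.k + 1 := by
  unfold h; omega

theorem one_le_h (hI : I.Valid) {side : ℕ} (hs : side < 2) : 1 ≤ I.h side := by
  have := hI.hk2
  unfold h
  omega

theorem rt_lt (hI : I.Valid) (side : ℕ) : ∀ f < I.k, I.rt side f < I.n := by
  unfold rt
  split_ifs
  · exact hI.u_lt
  · exact hI.v_lt

theorem valid_P (hI : I.Valid) {side : ℕ} (hs : side < 2) : (I.P side).Valid := by
  refine ⟨hs, one_le_h hI hs, h_le side, hI.hk2, ?_, ?_, rt_lt hI side, ?_, ?_⟩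
  · exact fun i hi => sl_lt (hi.trans_le kq_le)
  · exact fun i hi i' hi' h => sl_inj (hi.trans_le kq_le) (hi'.trans_le kq_le) h
  · show ∀ f < I.k, ∀ f' < I.k, I.rt side f = I.rt side f' → f = f'
    unfold rt
    split_ifs
    · exact hI.u_inj
    · exact hI.v_inj
  · intro f hf i hi
    have := (sl_usable (hi.trans_le kq_le)).2 f hf
    show I.rt side f ≠ _
    unfold rt
    split_ifs
    · exact this.1
    · exact this.2

/-- For `k ≥ 2` half of `k`, even rounded up, is at most `k - 1`; this is where `r ≥ 3` is needed
for the number of search bases. -/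
theorem pow_h_le (hI : I.Valid) {side : ℕ} (hs : side < 2) : I.q ^ I.h side ≤ I.s ^ (I.k - 1) := by
  have := hI.hk2
  rcases Nat.eq_zero_or_pos I.s with h0 | h0
  · have : I.q = 0 := by
      have := I.q_le
      omega
    grind [zero_pow, one_le_h]
  · exact (Nat.pow_le_pow_left q_le _).trans (Nat.pow_le_pow_right h0 (by have := I.h_le side; omega))

theorem N_le {side : ℕ} : I.N side ≤ I.q ^ I.h side := Nat.div_le_self _ _

/-- A crude bound, sufficient for the depth to be computed by a loop of `n` rounds. -/
theorem d_le (hm : 2 ≤ I.m) {side : ℕ} : I.d side ≤ I.n := by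
  refine Nat.clog_le_of_le_pow ?_
  have h1 : I.q ≤ 2 ^ I.q := Nat.lt_two_pow_self.le
  have h2 : I.q * I.h side ≤ I.n := by
    have h3 := I.h_le side
    have h4 : I.q * I.h side ≤ I.q * (6 * I.k) := Nat.mul_le_mul_left _ (by omega)
    have h5 := I.kq_le
    have h6 := I.s_le
    grind
  calc I.N side ≤ I.q ^ I.h side := N_le
    _ ≤ (2 ^ I.q) ^ I.h side := Nat.pow_le_pow_left h1 _
    _ = 2 ^ (I.q * I.h side) := (pow_mul _ _ _).symm
    _ ≤ 2 ^ I.n := Nat.pow_le_pow_right (by omega) h2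
    _ ≤ I.m ^ I.n := Nat.pow_le_pow_left hm _

theorem e_le {side : ℕ} : I.e side ≤ 1 := by
  unfold e
  split_ifs <;> omega

/-- At most `2 * N` nodes lie above the leaves and `N` leaves are wanted; rounding up to whole
families of children adds at most `m`. -/
theorem X_mul_le (hc : I.Chk₁) {side : ℕ} (hs : side < 2) : I.X side * I.m ≤ 3 * I.N side + I.m := by
  obtain ⟨-, hm, -, h0, h1⟩ := hc
  have hN : 2 ≤ I.N side := by grind
  have h2 : I.L side ≤ 2 * I.N side := start_clog_le hm hN
  have h3 : (I.L side + I.N side) / I.m * I.m ≤ I.L side + I.N side := Nat.div_mul_le_self _ _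
  unfold X
  rw [add_mul]
  omega

theorem leaf_lt (hc : I.Chk₁) {side i : ℕ} (hi : i < I.N side) : I.leaf side i < I.tot side := by
  obtain ⟨-, hm, -, h0, h1⟩ := hc
  have h3 : I.L side + I.N side < I.X side * I.m := by
    unfold X
    exact Nat.lt_mul_of_div_lt (by omega) (by omega)
  unfold leaf tot
  omega

end Inp

/-! ### The first phases of the program -/

section Init

variable {w B : ℕ} {I : Inp} {G : Finset (Finset (Fin I.n))}
variable {σ : RamState I.n} {T : ℕ}

/-- The words are long enough, and `B` is the size of a memory region. -/
structure Big (I : Inp) (w B : ℕ) : Prop where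
  hB : B = (I.n + 2) ^ (I.k + 4)
  hw : 8 * B < 2 ^ w

theorem Big.pow_le (h : Big I w B) {j : ℕ} (hj : j ≤ I.k + 4) : (I.n + 2) ^ j ≤ B := by
  rw [h.hB]
  exact Nat.pow_le_pow_right (by omega) hj

theorem Big.small (h : Big I w B) (hI : I.Valid) : 1000 * (I.n + 2) ≤ B ∧ 1000 * (I.k + 2) ≤ B := by
  have h1 := hI.hk2
  have h2 := hI.hkn
  have h3 := h.pow_le (j := 6) (by omega)
  have h4 : 4 ^ 5 ≤ (I.n + 2) ^ 5 := Nat.pow_le_pow_left (by omega) 5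
  have h5 : (I.n + 2) ^ 6 = (I.n + 2) ^ 5 * (I.n + 2) := pow_succ _ _
  have h6 : 1024 * (I.n + 2) ≤ (I.n + 2) ^ 5 * (I.n + 2) := Nat.mul_le_mul_right _ h4
  constructor <;> omega

theorem Big.mul_n (h : Big I w B) : I.n ^ I.k * (4 * I.n) ≤ B := by
  have h1 : I.n ^ I.k * (4 * I.n) ≤ (I.n + 2) ^ I.k * ((I.n + 2) ^ 3) := by
    refine Nat.mul_le_mul (Nat.pow_le_pow_left (by omega) _) ?_
    grind
  rw [← pow_add] at h1
  exact h1.trans (h.pow_le (by omega))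

/-- The program copying a tuple to the root of a search tree. -/
def copyRootC {k : ℕ} (t off : ℕ) : ℕ → RamCmd k
  | 0 => .skip
  | f + 1 => .seq (copyRootC t off f) (.store (addrE t (.const f)) (.mem (.const (off + f))))

theorem Ok.copyRoot {k : ℕ} {t off s f : ℕ} {x : ℕ → ℕ} (hw : 8 * B < 2 ^ w) (ht : t = 1 ∨ t = 2)
    (h1 : σ.reg 1 = B) (hf : off + f ≤ B) (hfs : f ≤ s) (hx : ∀ i < f, σ.mem (off + i) = x i)
    (h0 : Slots B t s (fun _ _ => 0) σ) (hT : f + 1 ≤ T) : Ok w G I.S (copyRootC t off f : RamCmd k) σ T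
    (fun σ' => σ'.reg = σ.reg ∧ σ'.E = σ.E ∧ SameMem B [t] σ σ' ∧ Slots B t s (fun p i => if p = 0 ∧ i < f then
    x i else 0) σ') := by
  induction f generalizing T with
  | zero =>
    exact Ok.skip (by omega) ⟨rfl, rfl, SameMem.refl _ _, h0.congr (by simp)⟩
  | succ f ih =>
    refine Ok.seq (ih (by omega) (by omega) (fun i hi => hx i (by omega)) le_rfl) (T' := 1) ?_
    rintro σ' ⟨g1, g2, g3, g4⟩
    refine Ok.store le_rfl ?_
    have hv : (RamExpr.mem (.const (off + f))).eval w σ' = x f := by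
      rw [eval_mem, eval_const (by omega)]
      have := g3 0 (off + f) (by simp; omega) (by omega)
      grind
    rw [hv, eval_addrE (o := f) (by rw [g1, h1]) hw (by omega) eval_const (by omega)]
    refine ⟨g1, g2, g3.trans (sameMem_setMem (M := [t]) (by simp) (by omega)) (fun x => id)
      (fun x => id), ?_⟩
    have := g4.setMem (p := 0) (i := f) (v := x f) (by omega) (by omega)
    rw [zero_mul, zero_add] at this
    refine this.congr ?_
    intro p i _
    unfold Nodes.upd
    grind

/-- Compute the size of the memory regions and copy the two tuples. -/
def initC (k : ℕ) : RamCmd k :=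
  .seq (.set 1 (powE (.op .add (.reg 0) (.const 2)) (k + 4)))
    (.seq (copyRootC 1 0 k) (copyRootC 2 k k))

/-- The initial states. -/
structure Start (I : Inp) (σ : RamState I.n) : Prop where
  r0 : σ.reg 0 = I.n
  mem : ∀ i, σ.mem i = if i < I.k then I.u i else if i - I.k < I.k then I.v (i - I.k) else 0
  E : σ.E = I.E

/-- The contents of the memory after the tuples have been copied. -/
structure Mem₁ (I : Inp) (B : ℕ) (σ : RamState I.n) : Prop where
  E : σ.E = I.E
  u : ∀ f < I.k, σ.mem f = I.u f
  v : ∀ f < I.k, σ.mem (I.k + f) = I.v f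
  slots : ∀ side < 2, Slots B (1 + side) (I.k + 2) (I.root side) σ
  zero : ∀ t o, 3 ≤ t → o < B → σ.mem (t * B + o) = 0

theorem Ok.init (hI : I.Valid) (hb : Big I w B) (hσ : Start I σ) (hT : 2 * I.k + 3 ≤ T) : Ok w G I.S (initC I.k)
    σ T (fun σ' => σ'.reg 0 = I.n ∧ σ'.reg 1 = B ∧ Mem₁ I B σ') := by
  have hw := hb.hw
  obtain ⟨hn, hk⟩ := hb.small hI
  have hB0 : ∀ t o, 1 ≤ t → σ.mem (t * B + o) = 0 := by
    intro t o ht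
    have : 1 * B ≤ t * B := Nat.mul_le_mul_right _ ht
    rw [hσ.mem, if_neg (by omega), if_neg (by omega)]
  refine Ok.set_seq (T - 1) B ?_ ?_
  · rw [eval_powE (a := I.n + 2) (eval_add (x := .reg 0) (a := I.n) (b := 2)
      (show (RamExpr.reg 0).eval w σ = I.n from hσ.r0) eval_const) _ (by omega) (by rw [← hb.hB]; omega), ← hb.hB]
  refine Ok.seq (T' := I.k + 1) (Ok.copyRoot (s := I.k + 2) (x := I.u) hw (Or.inl rfl) (by simp) (by omega)
    (by omega) ?_ ?_ (le_refl (I.k + 1))) ?_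
  · intro i hi
    rw [setReg_mem, hσ.mem, if_pos (by omega), zero_add]
  · intro p i _ _
    exact hB0 _ _ le_rfl
  rintro σ1 ⟨g1, g2, g3, g4⟩
  refine (Ok.copyRoot (s := I.k + 2) (x := I.v) hw (Or.inr rfl) (by rw [g1]; simp) (by omega)
    (by omega) ?_ ?_ (le_refl (I.k + 1))).mono le_rfl ?_
  · intro i hi
    have := g3 0 (I.k + i) (by simp) (by omega)
    rw [zero_mul, zero_add] at this
    rw [this, setReg_mem, hσ.mem, if_neg (by omega), if_pos (by omega), Nat.add_sub_cancel_left]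
  · intro p i _ hpi
    rw [g3 2 _ (by simp) hpi]
    exact hB0 _ _ (by omega)
  rintro σ2 ⟨f1, f2, f3, f4⟩
  have hall : SameMem B [1, 2] σ σ2 := (g3.trans f3 (by simp) (by simp) :
    SameMem B [1, 2] (σ.setReg 1 B) σ2)
  have hm0 : ∀ o < B, σ2.mem o = σ.mem o := fun o ho => by
    have := hall 0 o (by simp) ho
    simpa using this
  refine ⟨by rw [f1, g1]; simpa using hσ.r0, by rw [f1, g1]; simp, ?_, ?_, ?_, ?_, ?_⟩
  · rw [f2, g2]; exact hσ.E
  · intro f hf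
    rw [hm0 f (by omega), hσ.mem, if_pos hf]
  · intro f hf
    rw [hm0 _ (by omega), hσ.mem, if_neg (by omega), if_pos (by omega), Nat.add_sub_cancel_left]
  · intro side hs
    interval_cases side
    · exact (g4.same f3 (by simp)).congr fun p i _ => rfl
    aesop
  · intro t o ht ho
    rw [hall t o (by simp; omega) ho]
    exact hB0 t o (by omega)

/-- List the usable vertices. -/
def slistC (k : ℕ) : RamCmd k :=
  .seq (.set 7 (.const 0)) (forN 22 (.reg 0)
    (.seq (.inS 40 (.reg 22))
      (.ite (.op .mul (.reg 40) (allE ((List.range (2 * k)).map fun j => neE (.mem (.const j)) (.reg 22))))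
        (.seq (.store (addrE 6 (.reg 7)) (.reg 22)) (.set 7 (.op .add (.reg 7) (.const 1))))
        .skip)))

/-- The contents of the memory after the usable vertices have been listed. -/
structure Mem₂ (I : Inp) (B : ℕ) (σ : RamState I.n) : Prop where
  E : σ.E = I.E
  u : ∀ f < I.k, σ.mem f = I.u f
  v : ∀ f < I.k, σ.mem (I.k + f) = I.v f
  slots : ∀ side < 2, Slots B (1 + side) (I.k + 2) (I.root side) σ
  zero : ∀ t o, 3 ≤ t → t < 6 → o < B → σ.mem (t * B + o) = 0
  sl : ∀ i < I.s, σ.mem (6 * B + i) = I.sl.getD i 0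

theorem decodeVertex_inter (x : ℕ) : (decodeVertex I.n x ∩ I.S).Nonempty ↔ x ∈ I.S.map Fin.valEmbedding := by
  simp only [Finset.Nonempty, mem_inter, decodeVertex, mem_filter, mem_univ, true_and,
    Finset.mem_map, Fin.valEmbedding_apply]
  grind

open Classical in
theorem Ok.slist (hI : I.Valid) (hb : Big I w B) (h0 : σ.reg 0 = I.n) (h1 : σ.reg 1 = B) (hσ : Mem₁ I B σ)
    (hT : I.n * 7 + 4 ≤ T) : Ok w G I.S (slistC I.k) σ T
    (fun σ' => σ'.reg 0 = I.n ∧ σ'.reg 1 = B ∧ σ'.reg 7 = I.s ∧ Mem₂ I B σ') := by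
  have hw := hb.hw
  obtain ⟨hn, hk⟩ := hb.small hI
  have hlen : ∀ i, (I.slUpTo i).length ≤ i := fun i =>
    (List.length_filter_le _ _).trans (by simp)
  refine Ok.set_seq (T - 1) 0 eval_const ?_
  refine Ok.forN (K := I.n) (T := 5) (fun i σ' => σ'.reg 22 = i ∧ σ'.reg 0 = I.n ∧ σ'.reg 1 = B ∧
    σ'.reg 7 = (I.slUpTo i).length ∧ σ'.E = σ.E ∧ SameMem B [6] σ σ' ∧
    ∀ j < (I.slUpTo i).length, σ'.mem (6 * B + j) = (I.slUpTo i).getD j 0) (by omega) ?_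
    (fun i σ' h => h.1) (fun i σ' h => h.2.1) ?_ ?_ (by omega)
  · refine ⟨by simp, by simpa using h0, by simpa using h1, by simp [Inp.slUpTo], rfl,
      SameMem.refl _ _, ?_⟩
    grind
  · rintro i hi σ1 ⟨g22, g0, g1, g7, gE, gm, gl⟩
    have hli := hlen i
    refine Ok.seq (T := 1) (T' := 4) (Ok.inS le_rfl (Q := fun σ2 => σ2 = σ1.setReg 40
      (ind (i ∈ I.S.map Fin.valEmbedding))) ?_) ?_
    · simp_all [ind, decodeVertex_inter]
    rintro _ rfl
    have hmem : ∀ j < 2 * I.k, σ1.mem j = σ.mem j := fun j hj => by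
      have := gm 0 j (by simp) (by omega)
      simpa using this
    have hcond : (RamExpr.op .mul (.reg 40) (allE ((List.range (2 * I.k)).map fun j =>
        neE (.mem (.const j)) (.reg 22)))).eval w (σ1.setReg 40 (ind (i ∈ I.S.map Fin.valEmbedding))) =
        ind (I.Usable i) := by
      rw [eval_and (p := i ∈ I.S.map Fin.valEmbedding) (p' := ∀ j ∈ List.range (2 * I.k), σ.mem j ≠ i)
        (by simp) (eval_allE' (by omega) _ _ _ ?_)]
      · refine ind_congr (and_congr_right fun _ => ?_)
        constructor
        · intro h f hf
          have a1 := h f (List.mem_range.2 (by omega))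
          have a2 := h (I.k + f) (List.mem_range.2 (by omega))
          rw [hσ.u f hf] at a1
          rw [hσ.v f hf] at a2
          exact ⟨a1, a2⟩
        · intro h j hj
          rw [List.mem_range] at hj
          rcases Nat.lt_or_ge j I.k with h3 | h3
          · rw [hσ.u j h3]
            exact (h j h3).1
          · have := (h (j - I.k) (by omega)).2
            rwa [← hσ.v _ (by omega), show I.k + (j - I.k) = j by omega] at this
      · intro j hj
        rw [List.mem_range] at hj
        refine eval_neE ?_ (by simpa using g22) (by omega)
        rw [eval_mem, eval_const (by omega), setReg_mem]
        exact hmem j hj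
    have hsucc : I.slUpTo (i + 1) = I.slUpTo i ++ if I.Usable i then [i] else [] := by
      grind [Inp.slUpTo, List.range_succ]
    refine Ok.ite (T := 3) ?_ ?_
    · rw [hcond, ind_ne_zero]
      intro hu
      rw [if_pos hu] at hsucc
      refine Ok.seq (T := 1) (T' := 1) (Ok.store le_rfl (Q := fun σ2 => σ2 = (σ1.setReg 40
        (ind (i ∈ I.S.map Fin.valEmbedding))).setMem (6 * B + (I.slUpTo i).length) i) ?_) ?_
      · rw [eval_addrE (o := (I.slUpTo i).length) (by simpa using g1) hw (by omega)
          (by simpa using g7) (by omega)]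
        simp [g22]
      rintro _ rfl
      refine Ok.set le_rfl ?_
      rw [eval_add (a := (I.slUpTo i).length) (b := 1) (by simpa using g7) eval_const]
      refine ⟨by simp [g22], by simp, by simp [g0], by simp [g1], by simp [hsucc], by simp [gE], ?_, ?_⟩
      · refine gm.trans (M' := [6]) (M'' := [6]) ?_ (fun x => id) (fun x => id)
        exact sameMem_setMem (σ := σ1) (by simp) (by omega)
      · intro j hj
        simp only [setReg_mem, setMem_mem]
        grind
    · rw [hcond]
      intro hu
      have hu' : ¬ I.Usable i := fun h => by rw [ind_true h] at hu; omega
      rw [if_neg hu', List.append_nil] at hsucc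
      refine Ok.skip (by omega) ⟨by simp [g22], by simp, by simp [g0], by simp [g1],
        by simp [hsucc, g7], by simp [gE], gm, ?_⟩
      rw [hsucc]
      exact gl
  · rintro σ1 ⟨-, g0, g1, g7, gE, gm, gl⟩
    have hmem : ∀ j < B, σ1.mem j = σ.mem j := fun j hj => by
      have := gm 0 j (by simp) (by omega)
      simpa using this
    refine ⟨g0, g1, g7, gE.trans hσ.E, ?_, ?_, ?_, ?_, gl⟩
    · intro f hf
      rw [hmem f (by omega), hσ.u f hf]
    · intro f hf
      rw [hmem _ (by omega), hσ.v f hf]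
    · exact fun side hs => (hσ.slots side hs).same gm (by simp; omega)
    · intro t o h3 h6 ho
      rw [gm t o (by simp; omega) ho, hσ.zero t o h3 ho]

end Init

/-! ### Computing the parameters -/

section Params

variable {k w B : ℕ} {I : Inp} {G : Finset (Finset (Fin I.n))} {S : Finset (Fin I.n)}
variable {σ : RamState I.n} {l : List ℕ} {T i side v : ℕ}

/-- The intended contents of the registers. -/
noncomputable def Inp.regs (I : Inp) (B : ℕ) : ℕ → ℕ
  | 0 => I.n
  | 1 => B
  | 2 => I.q
  | 3 => I.m
  | 4 => I.q / I.D1 + 1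
  | 5 => I.q / 8 + 1
  | 6 => I.dep
  | 7 => I.s
  | 8 => I.N 0
  | 9 => I.N 1
  | 10 => I.L 0
  | 11 => I.L 1
  | 12 => I.e 1
  | 13 => I.d 0
  | 14 => I.d 1
  | 15 => I.X 0
  | 16 => I.X 1
  | _ => 0

/-- The registers in `l` have their intended contents. -/
def Has (I : Inp) (B : ℕ) (l : List ℕ) (σ : RamState I.n) : Prop := ∀ i ∈ l, σ.reg i = I.regs B i

theorem Has.keep (h : Has I B l σ) (hi : i ∉ l) : Has I B l (σ.setReg i v) := fun j hj => by
  aesop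

theorem Has.set (h : Has I B l σ) (hv : v = I.regs B i) : Has I B (i :: l) (σ.setReg i v) := fun j hj => by
  aesop

theorem Ok.setHas {e : RamExpr} {d : RamCmd k} {Q : RamState I.n → Prop} (h : Has I B l σ)
    (he : e.eval w σ = I.regs B i)
    (hd : ∀ σ', Has I B (i :: l) σ' → σ'.mem = σ.mem → σ'.E = σ.E → Ok w G S d σ' T Q) : Ok w G S
    (.seq (.set i e) d) σ (T + 1) Q :=
  Ok.seq (T := 1) (Ok.set le_rfl (Q := fun σ' => Has I B (i :: l) σ' ∧ σ'.mem = σ.mem ∧ σ'.E = σ.E)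
    ⟨h.set he, rfl, rfl⟩) (fun σ' h' => hd σ' h'.1 h'.2.1 h'.2.2)

/-- Compute the binary logarithm of the number of vertices. -/
def logC (k : ℕ) : RamCmd k :=
  .seq (.set 3 (.const 0)) (.seq (.set 40 (.const 1)) (forN 22 (.reg 0)
    (.ite (.op .lt (.op .mul (.reg 40) (.const 2)) (.op .add (.reg 0) (.const 1)))
      (.seq (.set 40 (.op .mul (.reg 40) (.const 2))) (.set 3 (.op .add (.reg 3) (.const 1))))
      .skip)))

/-- Register 40 holds the power of two belonging to the exponent in register 3. Once doubling would
exceed `n` the rounds do nothing, whence the minima in the invariant. -/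
theorem Ok.log (hI : I.Valid) (hb : Big I w B) (hσ : Has I B l σ) (h0 : 0 ∈ l) (hl : 3 ∉ l ∧ 40 ∉ l ∧ 22 ∉ l)
    (hT : I.n * 5 + 4 ≤ T) : Ok w G S (logC k) σ T
    (fun σ' => Has I B (3 :: l) σ' ∧ σ'.mem = σ.mem ∧ σ'.E = σ.E) := by
  have hw := hb.hw
  obtain ⟨hn, hk⟩ := hb.small hI
  have hk2 := hI.hk2
  have hkn := hI.hkn
  have hlog : ∀ i, 2 ^ (min i (Nat.log 2 I.n)) ≤ I.n := fun i =>
    (Nat.pow_le_pow_right (by omega) (min_le_right _ _)).trans (Nat.pow_log_le_self 2 (by omega))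
  have hlogn : Nat.log 2 I.n ≤ I.n := Nat.log_le_self _ _
  refine Ok.set_seq (T - 1) 0 eval_const ?_
  refine Ok.set_seq (T - 2) 1 eval_const ?_
  refine Ok.forN (K := I.n) (T := 3) (fun i σ' => σ'.reg 22 = i ∧ Has I B l σ' ∧
    σ'.reg 3 = min i (Nat.log 2 I.n) ∧ σ'.reg 40 = 2 ^ (min i (Nat.log 2 I.n)) ∧ σ'.E = σ.E ∧
    σ'.mem = σ.mem) (by omega) ?_ (fun i σ' h => h.1) (fun i σ' h => h.2.1 0 h0) ?_ ?_ (by omega)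
  · exact ⟨by simp, ((hσ.keep hl.1).keep hl.2.1).keep hl.2.2, by simp, by simp, rfl, rfl⟩
  · rintro i hi σ1 ⟨g22, g0, g3, g40, gE, gm⟩
    have h2 := hlog i
    have hcond : (RamExpr.op .lt (.op .mul (.reg 40) (.const 2)) (.op .add (.reg 0) (.const 1))).eval
        w σ1 = ind (2 ^ (min i (Nat.log 2 I.n)) * 2 < I.n + 1) :=
      eval_lt' (eval_mul (x := .reg 40) (b := 2) g40 eval_const)
        (eval_add (x := .reg 0) (b := 1) (g0 0 h0) eval_const (by omega))
    have hiff : 2 ^ (min i (Nat.log 2 I.n)) * 2 < I.n + 1 ↔ i < Nat.log 2 I.n := by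
      rw [← pow_succ, Nat.lt_succ_iff, ← Nat.le_log_iff_pow_le (by omega) (by omega)]
      omega
    refine Ok.ite (T := 2) ?_ ?_
    · rw [hcond, ind_ne_zero, hiff]
      intro hlt
      rw [min_eq_left hlt.le] at g3 g40 h2
      refine Ok.set_seq 1 (2 ^ (i + 1)) ?_ ?_
      · rw [eval_mul (x := .reg 40) (a := 2 ^ i) (b := 2) g40 eval_const, pow_succ]
      refine Ok.set le_rfl ?_
      rw [eval_add (x := .reg 3) (a := i) (b := 1) (by simpa using g3) eval_const]
      rw [min_eq_left (show i + 1 ≤ Nat.log 2 I.n from hlt)]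
      exact ⟨by simp [g22], by simp, ((g0.keep hl.2.1).keep hl.1).keep hl.2.2, by simp, by simp, gE, gm⟩
    · rw [hcond]
      intro h
      have hlt : ¬ i < Nat.log 2 I.n := fun hlt => by
        rw [ind_true (hiff.2 hlt)] at h; omega
      rw [min_eq_right (by omega)] at g3 g40
      refine Ok.skip (by omega) ?_
      rw [min_eq_right (show Nat.log 2 I.n ≤ i + 1 by omega)]
      exact ⟨g22, by simp, g0.keep hl.2.2, by simpa using g3, by simpa using g40, gE, gm⟩
  · rintro σ1 ⟨-, g0, g3, -, gE, gm⟩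
    rw [min_eq_right hlogn] at g3
    refine ⟨?_, gm, gE⟩
    intro i hi
    rcases List.mem_cons.1 hi with rfl | hi
    · exact g3
    · exact g0 i hi

/-- Compute the depth and the number of inner nodes of the branching part of a search tree. -/
def depthC {k : ℕ} (rN rL rd : ℕ) : RamCmd k :=
  .seq (.set rL (.const 0)) (.seq (.set rd (.const 0)) (.seq (.set 40 (.const 1)) (forN 22 (.reg 0)
    (.ite (.op .lt (.reg 40) (.reg rN))
      (.seq (.set rL (.op .add (.op .mul (.reg 3) (.reg rL)) (.const 1)))
        (.seq (.set 40 (.op .mul (.reg 3) (.reg 40))) (.set rd (.op .add (.reg rd) (.const 1)))))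
      .skip))))

theorem Inp.m_le : I.m ≤ I.n := Nat.log_le_self _ _

theorem Big.N_mul_le (hb : Big I w B) (hI : I.Valid) (hs : side < 2) : 4 * I.n * I.N side ≤ B := by
  have h1 : I.N side ≤ I.n ^ I.k := by
    refine (Inp.N_le.trans (Inp.pow_h_le hI hs)).trans ?_
    exact (Nat.pow_le_pow_left Inp.s_le _).trans (Nat.pow_le_pow_right (by have := hI.hk2; have := hI.hkn; omega) (by omega))
  calc 4 * I.n * I.N side ≤ 4 * I.n * I.n ^ I.k := Nat.mul_le_mul_left _ h1
    _ = I.n ^ I.k * (4 * I.n) := by ring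
    _ ≤ B := hb.mul_n

/-- The depth, the power `m ^ depth` and the number of nodes of smaller depth are increased in
parallel until the power reaches the number of leaves. -/
theorem Ok.depth {rN rL rd : ℕ} (hI : I.Valid) (hb : Big I w B) (hm : 2 ≤ I.m) (hside : side < 2)
    (hσ : Has I B l σ) (h0 : 0 ∈ l) (h3 : 3 ∈ l) (hN : rN ∈ l) (hrN : I.regs B rN = I.N side)
    (hrL : I.regs B rL = I.L side) (hrd : I.regs B rd = I.d side) (hl : 40 ∉ l ∧ 22 ∉ l ∧ rL ∉ l ∧ rd ∉ l)
    (hne : rL ≠ 40 ∧ rL ≠ 22 ∧ rd ≠ 40 ∧ rd ≠ 22 ∧ rL ≠ rd) (hT : I.n * 6 + 5 ≤ T) : Ok w G S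
    (depthC rN rL rd : RamCmd k) σ T (fun σ' => Has I B (rL :: rd :: l) σ' ∧ σ'.mem = σ.mem ∧ σ'.E = σ.E) := by
  have hw := hb.hw
  obtain ⟨hn, hk⟩ := hb.small hI
  have hNB := hb.N_mul_le hI hside
  have hmn : I.m ≤ I.n := Inp.m_le
  have hNm : I.m * I.N side ≤ I.n * I.N side := Nat.mul_le_mul_right _ hmn
  have hNn : I.n * I.N side * 4 ≤ B := by
    grind
  obtain ⟨l40, l22, lL, ld⟩ := hl
  obtain ⟨n1, n2, n3, n4, n5⟩ := hne
  refine Ok.set_seq (T - 1) 0 eval_const ?_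
  refine Ok.set_seq (T - 2) 0 eval_const ?_
  refine Ok.set_seq (T - 3) 1 eval_const ?_
  refine Ok.forN (K := I.n) (T := 4) (fun i σ' => σ'.reg 22 = i ∧ Has I B l σ' ∧
    σ'.reg rd = min i (I.d side) ∧ σ'.reg 40 = I.m ^ (min i (I.d side)) ∧
    σ'.reg rL = start I.m (min i (I.d side)) ∧ σ'.E = σ.E ∧
    σ'.mem = σ.mem) (by omega) ?_ (fun i σ' h => h.1) (fun i σ' h => h.2.1 0 h0) ?_ ?_ (by omega)
  · refine ⟨by simp, (((hσ.keep lL).keep ld).keep l40).keep l22, ?_, ?_, ?_, rfl, rfl⟩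
    · simp [n4, n3]
    · simp
    · simp [n5, n1, n2, start]
  · rintro i hi σ1 ⟨g22, g0, gd, g40, gL, gE, gm⟩
    have hcond : (RamExpr.op .lt (.reg 40) (.reg rN)).eval w σ1 =
        ind (I.m ^ (min i (I.d side)) < I.N side) :=
      eval_lt' (x := .reg 40) g40 ((g0 rN hN).trans hrN)
    have hiff : I.m ^ (min i (I.d side)) < I.N side ↔ i < I.d side := by
      grind [min_eq_right, Nat.le_pow_clog, min_eq_left, Nat.clog_le_of_le_pow, Inp.d]
    refine Ok.ite (T := 3) ?_ ?_
    · rw [hcond, ind_ne_zero]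
      intro hlt'
      have hlt := hiff.1 hlt'
      rw [min_eq_left hlt.le] at gd g40 gL hlt'
      have hst := start_lt (d := i) hm
      have hmm : I.m * I.m ^ i ≤ I.m * I.N side := Nat.mul_le_mul_left _ hlt'.le
      have hms : I.m * start I.m i ≤ I.m * I.N side := Nat.mul_le_mul_left _ (by omega)
      have h3' : σ1.reg 3 = I.m := g0 3 h3
      refine Ok.set_seq 2 (start I.m (i + 1)) ?_ ?_
      · rw [eval_add (a := I.m * start I.m i) (b := 1) (eval_mul (x := .reg 3) (y := .reg rL) h3' gL) eval_const, start]
      have h3L : rL ≠ 3 := fun h => lL (h ▸ h3)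
      refine Ok.set_seq 1 (I.m ^ (i + 1)) ?_ ?_
      · rw [eval_mul (x := .reg 3) (y := .reg 40) (a := I.m) (b := I.m ^ i)
          (by rw [eval_reg, setReg_ne h3L.symm, h3'])
          (by rw [eval_reg, setReg_ne n1.symm, g40]), pow_succ, mul_comm]
      refine Ok.set le_rfl ?_
      rw [eval_add (x := .reg rd) (a := i) (b := 1)
        (by rw [eval_reg, setReg_ne n3, setReg_ne n5.symm, gd])
        eval_const]
      rw [min_eq_left (show i + 1 ≤ I.d side from hlt)]
      refine ⟨?_, by simp, (((g0.keep lL).keep l40).keep ld).keep l22, ?_, ?_, ?_, gE, gm⟩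
      · simp [n4.symm, n2.symm, g22]
      · simp [n4]
      · simp [n3.symm]
      · simp [n2, n5, n1]
    · rw [hcond]
      intro h
      have hlt : ¬ i < I.d side := fun hlt => by
        rw [ind_true (hiff.2 hlt)] at h; omega
      rw [min_eq_right (by omega)] at gd g40 gL
      refine Ok.skip (by omega) ?_
      rw [min_eq_right (show I.d side ≤ i + 1 by omega)]
      refine ⟨g22, by simp, g0.keep l22, ?_, by simpa using g40, ?_, gE, gm⟩
      · simp [n4, gd]
      · simp [n2, gL]
  · rintro σ1 ⟨-, g0, gd, -, gL, gE, gm⟩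
    rw [min_eq_right (Inp.d_le hm)] at gd gL
    refine ⟨?_, gm, gE⟩
    intro i hi
    rcases List.mem_cons.1 hi with rfl | hi
    · exact gL.trans hrL.symm
    rcases List.mem_cons.1 hi with rfl | hi
    · exact gd.trans hrd.symm
    · exact g0 i hi

/-- Compute the parameters that do not depend on the depths. -/
def constsC (k D D1 : ℕ) (d : RamCmd k) : RamCmd k :=
  .seq (.set 2 (.op .div (.reg 7) (.const (6 * k))))
  (.seq (.set 4 (.op .add (.op .div (.reg 2) (.const D1)) (.const 1)))
  (.seq (.set 5 (.op .add (.op .div (.reg 2) (.const 8)) (.const 1)))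
  (.seq (.set 8 (.op .div (powE (.reg 2) ((k + 1) / 2)) (.const D)))
  (.seq (.set 9 (.op .div (powE (.reg 2) (k / 2)) (.const D)))
  (.seq (.set 17 (.const 0)) (.seq (logC k) d))))))

/-- A version of `eval_powE` allowing `a = 0`: the class size may vanish when the parameters are
computed, because the conditions on them are checked only afterwards. -/
theorem eval_powE' {x : RamExpr} {a j : ℕ} (hx : x.eval w σ = a) (h : ∀ i ≤ j, a ^ i < 2 ^ w) : (powE x j).eval
    w σ = a ^ j := by
  induction j with
  | zero => exact eval_const (h 0 le_rfl)
  | succ j ih =>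
    have := h (j + 1) le_rfl
    exact eval_mul (ih fun i hi => h i (by omega)) hx this

theorem Ok.consts {d : RamCmd I.k} {Q : RamState I.n → Prop} (hI : I.Valid) (hb : Big I w B) (hD : I.D < 2 ^ w)
    (hD1 : I.D1 < 2 ^ w) (hσ : Has I B [0, 1, 7] σ)
    (hd : ∀ σ', Has I B [3, 17, 9, 8, 5, 4, 2, 0, 1, 7] σ' → σ'.mem = σ.mem → σ'.E = σ.E → Ok w G S d σ' T Q) :
    Ok w G S (constsC I.k I.D I.D1 d) σ (T + (I.n * 5 + 10)) Q := by
  have hw := hb.hw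
  obtain ⟨hn, hk⟩ := hb.small hI
  have hsn := I.s_le
  have hqs := I.q_le
  have hqpow : ∀ i ≤ I.k, I.q ^ i < 2 ^ w := fun i hi => by
    have h1 : I.q ^ i ≤ (I.n + 2) ^ i := Nat.pow_le_pow_left (by omega) _
    have h2 := hb.pow_le (j := i) (by omega)
    omega
  have hdiv : I.q / I.D1 ≤ I.q := Nat.div_le_self _ _
  refine (Ok.setHas (T := T + (I.n * 5 + 9)) hσ ?_ ?_)
  · exact eval_div (x := .reg 7) (hσ 7 (by simp)) eval_const (by omega)
  intro σ1 h1 m1 E1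
  refine (Ok.setHas (T := T + (I.n * 5 + 8)) h1 ?_ ?_)
  · exact eval_add (eval_div (x := .reg 2) (h1 2 (by simp)) (eval_const hD1) (by omega))
      eval_const (by omega)
  intro σ2 h2 m2 E2
  refine (Ok.setHas (T := T + (I.n * 5 + 7)) h2 ?_ ?_)
  · exact eval_add (eval_div (x := .reg 2) (h2 2 (by simp)) eval_const
      (by omega)) eval_const (by omega)
  intro σ3 h3 m3 E3
  refine (Ok.setHas (T := T + (I.n * 5 + 6)) h3 ?_ ?_)
  · exact eval_div (eval_powE' (x := .reg 2) (h3 2 (by simp)) fun i hi => hqpow i (by omega))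
      (eval_const hD) (hqpow _ (by unfold Inp.h; omega))
  intro σ4 h4 m4 E4
  refine (Ok.setHas (T := T + (I.n * 5 + 5)) h4 ?_ ?_)
  · exact eval_div (eval_powE' (x := .reg 2) (h4 2 (by simp)) fun i hi => hqpow i (by omega))
      (eval_const hD) (hqpow _ (by unfold Inp.h; omega))
  intro σ5 h5 m5 E5
  refine (Ok.setHas (T := T + (I.n * 5 + 4)) h5 eval_const ?_)
  intro σ6 h6 m6 E6
  refine Ok.seq (Ok.log hI hb h6 (by simp) (by simp) le_rfl) (T' := T) ?_
  grind

/-- Check the conditions that do not involve the depths. -/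
def chkE (k : ℕ) : RamExpr :=
  .op .mul (allE ((List.range k).map fun f => allE ((List.range k).map fun f' =>
      neE (.mem (.const f)) (.mem (.const (k + f'))))))
    (.op .mul (.op .lt (.const 1) (.reg 3)) (.op .mul (.op .lt (.reg 3) (.op .add (.reg 2) (.const 1)))
      (.op .mul (.op .lt (.const 1) (.reg 8)) (.op .lt (.const 1) (.reg 9)))))

theorem eval_chkE (hI : I.Valid) (hb : Big I w B) (hσ : Has I B l σ) (hl : 2 ∈ l ∧ 3 ∈ l ∧ 8 ∈ l ∧ 9 ∈ l)
    (hu : ∀ f < I.k, σ.mem f = I.u f) (hv : ∀ f < I.k, σ.mem (I.k + f) = I.v f) : (chkE I.k).eval w σ = ind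
    I.Chk₁ := by
  have hw := hb.hw
  obtain ⟨hn, hk⟩ := hb.small hI
  have hsn := I.s_le
  have hqs := I.q_le
  unfold chkE
  rw [eval_and (p := ∀ f ∈ List.range I.k, ∀ f' ∈ List.range I.k, I.u f ≠ I.v f')
    (p' := 1 < I.m ∧ I.m < I.q + 1 ∧ 1 < I.N 0 ∧ 1 < I.N 1) ?_ ?_]
  · aesop
  · refine eval_allE' (by omega) _ _ _ fun f hf => eval_allE' (by omega) _ _ _ fun f' hf' => ?_
    rw [List.mem_range] at hf hf'
    refine eval_neE ?_ ?_ (by omega)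
    · rw [eval_mem, eval_const (by omega), hu f hf]
    · rw [eval_mem, eval_const (by omega), hv f' hf']
  · refine eval_and (eval_lt' eval_const (y := .reg 3) (hσ 3 hl.2.1))
      (eval_and (eval_lt' (x := .reg 3) (hσ 3 hl.2.1) (eval_add (x := .reg 2) (hσ 2 hl.1)
        eval_const (by omega)))
      (eval_and (eval_lt' eval_const (y := .reg 8) (hσ 8 hl.2.2.1))
        (eval_lt' eval_const (y := .reg 9) (hσ 9 hl.2.2.2)))
        (by omega))

/-- Compute the parameters that depend on the depths. -/
def constsC' {k : ℕ} (d : RamCmd k) : RamCmd k :=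
  .seq (depthC 8 10 13) (.seq (depthC 9 11 14)
  (.seq (.set 12 (.op .sub (.op .add (.reg 13) (.reg 14))
    (.op .mul (.op .div (.op .add (.reg 13) (.reg 14)) (.const 2)) (.const 2))))
  (.seq (.set 6 (.op .add (.op .add (.reg 13) (.reg 14)) (.const 3)))
  (.seq (.set 15 (.op .add (.op .div (.op .add (.reg 10) (.reg 8)) (.reg 3)) (.const 1)))
  (.seq (.set 16 (.op .add (.op .div (.op .add (.reg 11) (.reg 9)) (.reg 3)) (.const 1)))
    d)))))

theorem Ok.consts' {d : RamCmd k} {Q : RamState I.n → Prop} (hI : I.Valid) (hb : Big I w B) (hc : I.Chk₁)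
    (hσ : Has I B [3, 17, 9, 8, 5, 4, 2, 0, 1, 7] σ)
    (hd : ∀ σ', (∀ i < 18, σ'.reg i = I.regs B i) → σ'.mem = σ.mem → σ'.E = σ.E → Ok w G S d σ' T Q) : Ok w G S
    (constsC' d) σ (T + (I.n * 12 + 14)) Q := by
  have hw := hb.hw
  obtain ⟨hn, hk⟩ := hb.small hI
  obtain ⟨-, hm, -, hN0, hN1⟩ := id hc
  have hk2 := hI.hk2
  have hkn := hI.hkn
  have hd0 := Inp.d_le hm (side := 0)
  have hd1 := Inp.d_le hm (side := 1)
  have hL0 : I.L 0 ≤ 2 * I.N 0 := start_clog_le hm hN0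
  have hL1 : I.L 1 ≤ 2 * I.N 1 := start_clog_le hm hN1
  have hNB0 := hb.N_mul_le hI (side := 0) (by omega)
  have hNB1 := hb.N_mul_le hI (side := 1) (by omega)
  have hn4 : ∀ N, 8 * N ≤ 4 * I.n * N := fun N => Nat.mul_le_mul_right _ (by omega)
  have h80 := hn4 (I.N 0)
  have h81 := hn4 (I.N 1)
  refine Ok.seq (T' := T + (I.n * 6 + 9)) (Ok.depth (side := 0) (T := I.n * 6 + 5) hI hb hm (by omega) hσ (by simp)
    (by simp) (by simp) rfl rfl rfl (by simp) (by simp) le_rfl) ?_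
  rintro σ1 ⟨h1, m1, E1⟩
  refine Ok.seq (T' := T + 4) (Ok.depth (side := 1) (T := I.n * 6 + 5) hI hb hm (by omega) h1 (by simp)
    (by simp) (by simp) rfl rfl rfl (by simp) (by simp) le_rfl) ?_
  rintro σ2 ⟨h2, m2, E2⟩
  have hsum : ∀ σ' : RamState I.n, σ'.reg 13 = I.d 0 → σ'.reg 14 = I.d 1 →
      (RamExpr.op .add (.reg 13) (.reg 14)).eval w σ' = I.d 0 + I.d 1 := fun σ' h h' =>
    eval_add (x := .reg 13) (y := .reg 14) h h'
  refine Ok.setHas (T := T + 3) h2 ?_ ?_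
  · have h12 := hsum σ2 (h2 13 (by simp)) (h2 14 (by simp))
    rw [eval_sub h12 (eval_mul (eval_div h12 eval_const) eval_const)]
    show _ = I.e 1
    unfold Inp.e
    rw [if_neg (by omega)]
    omega
  intro σ3 h3 m3 E3
  refine Ok.setHas (T := T + 2) h3 ?_ ?_
  · exact eval_add (hsum σ3 (h3 13 (by simp)) (h3 14 (by simp))) eval_const
  intro σ4 h4 m4 E4
  have hX : ∀ σ' : RamState I.n, ∀ rL rN L N, σ'.reg rL = L → σ'.reg rN = N → σ'.reg 3 = I.m →
      L ≤ 2 * N → 8 * N ≤ B →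
      (RamExpr.op .add (.op .div (.op .add (.reg rL) (.reg rN)) (.reg 3)) (.const 1)).eval w σ' =
        (L + N) / I.m + 1 := fun σ' rL rN L N h h' h'' hL hN => by
    have := Nat.div_le_self (L + N) I.m
    exact eval_add (eval_div (eval_add (x := .reg rL) (y := .reg rN) h h') (y := .reg 3)
      h'') eval_const
  refine Ok.setHas (T := T + 1) h4 ?_ ?_
  · exact hX σ4 10 8 _ _ (h4 10 (by simp)) (h4 8 (by simp)) (h4 3 (by simp)) hL0 (by
      omega)
  intro σ5 h5 m5 E5
  refine Ok.setHas (T := T) h5 ?_ ?_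
  · exact hX σ5 11 9 _ _ (h5 11 (by simp)) (h5 9 (by simp)) (h5 3 (by simp)) hL1 (by
      omega)
  intro σ6 h6 m6 E6
  refine hd σ6 (fun i hi => h6 i ?_) (by rw [m6, m5, m4, m3, m2, m1]) (by rw [E6, E5, E4, E3, E2, E1])
  interval_cases i <;> simp

end Params

/-! ### The table of overloaded sequences -/

section Table

variable {w B : ℕ} {I : Inp} {G : Finset (Finset (Fin I.n))} {S : Finset (Fin I.n)}
variable {c c' thr : ℕ} {σ : RamState I.n}

theorem cell_empty {n : ℕ} (h : 1 ≤ thr) (j : ℕ) (l : List ℕ) : cell n thr ∅ j l = 0 := by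
  induction j generalizing l with
  | zero => simp [cell]
  | succ j ih =>
    simp only [cell, ih]
    rw [Finset.card_eq_zero, Finset.filter_eq_empty_iff]
    intro x _
    cases j <;> simp [lim]
    omega

theorem tab_empty {t d : ℕ} (h : 1 ≤ thr) (hB : (I.n + 1) ^ d ≤ B) (h0 : ∀ o < B, σ.mem (t * B + o) = 0) : Tab B
    t I.n thr d ∅ σ := fun l hl hn => by
  rw [cell_empty h, h0 _ (code_lt_of_le hB hl hn)]

/-- Numbers below `s ^ k` stand for the sequences of `k` usable vertices through their digits in
base `s`. Injectivity guarantees that the table is never updated twice with the same sequence. -/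
theorem digits_inj {s k : ℕ} (hc : c < s ^ k) (hc' : c' < s ^ k) (h : ∀ i < k, c / s ^ i % s = c' / s ^ i % s) :
    c = c' := by
  induction k generalizing c c' with
  | zero => rw [pow_zero] at hc hc'; omega
  | succ k ih =>
    have hs : 0 < s := by
      grind
    have h0 := h 0 (by omega)
    have h1 : c / s = c' / s := by
      refine ih ((Nat.div_lt_iff_lt_mul hs).2 hc) ((Nat.div_lt_iff_lt_mul hs).2 hc') ?_
      grind [pow_succ', Nat.div_div_eq_div_mul]
    grind [Nat.div_add_mod]

theorem Inp.seq_inj (hc : c < I.s ^ I.k) (hc' : c' < I.s ^ I.k) (h : I.seq c = I.seq c') : c = c' := by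
  refine digits_inj hc hc' ?_
  intro i hi
  have hs : 0 < I.s := by
    grind [Nat.eq_zero_or_pos, zero_pow]
  have h1 := List.map_inj_left.1 h i (List.mem_range.2 hi)
  exact Inp.sl_inj (Nat.mod_lt _ hs) (Nat.mod_lt _ hs) h1

/-- The entry `i` of the sequence whose number is in register `22`. -/
def digE (i : ℕ) : RamExpr :=
  .mem (addrE 6 (.op .sub (.op .div (.reg 22) (powE (.reg 7) i))
    (.op .mul (.op .div (.op .div (.reg 22) (powE (.reg 7) i)) (.reg 7)) (.reg 7))))

/-- Set up the table of overloaded sequences. -/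
def tableC (k : ℕ) : RamCmd k :=
  forN 22 (powE (.reg 7) k)
    (.seq (.inE 40 fun i => ((List.range k).map digE).getD i (.const 0))
      (.ite (.reg 40) (bump 3 4 ((List.range k).map digE)) .skip))

theorem Big.s_pow_le (hb : Big I w B) {i : ℕ} (hi : i ≤ I.k) : I.s ^ i ≤ B :=
  (Nat.pow_le_pow_left (by have := I.s_le; omega) i).trans (hb.pow_le (by omega))

-- All `s ^ k` sequences of usable vertices are tested for membership in the exposure hypergraph.
-- Nothing has been revealed so far, so this is still the one of the input.
open Classical in
theorem Ok.table {T : ℕ} (hI : I.Valid) (hb : Big I w B) (hs : 0 < I.s) (hσ : ∀ i < 18, σ.reg i = I.regs B i)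
    (hE : σ.E = I.E) (hsl : ∀ i < I.s, σ.mem (6 * B + i) = I.sl.getD i 0)
    (htab : Tab B 3 I.n (I.q / I.D1 + 1) I.k ∅ σ) (hT : I.s ^ I.k * (2 * I.k + 6) + 2 ≤ T) : Ok w G S
    (tableC I.k) σ T (fun σ' => (∀ i < 18, σ'.reg i = I.regs B i) ∧ σ'.E = I.E ∧ SameMem B [3] σ σ' ∧ Tab B 3
    I.n (I.q / I.D1 + 1) I.k I.UE σ') := by
  have hw := hb.hw
  obtain ⟨hn, hk⟩ := hb.small hI
  have hsn := I.s_le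
  have hpow : ∀ i ≤ I.k, I.s ^ i < 2 ^ w := fun i hi => by
    have := hb.s_pow_le hi
    omega
  have hsk := hpow I.k le_rfl
  have hskB := hb.s_pow_le (le_refl I.k)
  have hlt : ∀ c, ∀ x ∈ I.seq c, x < I.n := by
    intro c x hx
    obtain ⟨i, -, rfl⟩ := List.mem_map.1 hx
    exact Inp.sl_lt (Nat.mod_lt _ hs)
  have hlen : ∀ c, (I.seq c).length = I.k := fun c => by simp [Inp.seq]
  have hBk : (I.n + 1) ^ I.k ≤ B := (Nat.pow_le_pow_left (by omega) _).trans (hb.pow_le (by omega))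
  refine Ok.forN (K := I.s ^ I.k) (T := 2 * I.k + 4) (fun c σ' => σ'.reg 22 = c ∧
    (∀ i < 18, σ'.reg i = I.regs B i) ∧ σ'.E = I.E ∧ SameMem B [3] σ σ' ∧
    Tab B 3 I.n (I.q / I.D1 + 1) I.k (I.UEUpTo c) σ') (by omega) ?_ (fun c σ' h => h.1) ?_ ?_ ?_ hT
  · refine ⟨by simp, ?_, hE, SameMem.refl _ _, ?_⟩
    · grind [setReg_ne]
    aesop
  · rintro c σ' ⟨-, h, -⟩
    exact eval_powE (x := .reg 7) (h 7 (by omega)) _ hs hsk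
  · rintro c hc σ1 ⟨h22, h18, hE1, hm1, htab1⟩
    have hdig : ∀ σ' : RamState I.n, σ'.reg 22 = c → σ'.reg 1 = B → σ'.reg 7 = I.s →
        (∀ i < I.s, σ'.mem (6 * B + i) = I.sl.getD i 0) →
        ((List.range I.k).map digE).map (RamExpr.eval w σ') = I.seq c := by
      intro σ' g22 g1 g7 gsl
      rw [List.map_map]
      refine List.map_congr_left fun i hi => ?_
      rw [List.mem_range] at hi
      have hci : c / I.s ^ i ≤ c := Nat.div_le_self _ _
      have hx : (RamExpr.op .div (.reg 22) (powE (.reg 7) i)).eval w σ' = c / I.s ^ i :=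
        eval_div (x := .reg 22) g22 (eval_powE (x := .reg 7) g7 _ hs (hpow i hi.le))
      have hdm := Nat.div_mul_le_self (c / I.s ^ i) I.s
      have hmod : c / I.s ^ i - c / I.s ^ i / I.s * I.s = c / I.s ^ i % I.s := by
        have := Nat.div_add_mod' (c / I.s ^ i) I.s
        omega
      have hml : c / I.s ^ i % I.s < I.s := Nat.mod_lt _ hs
      show σ'.mem _ = _
      rw [eval_addrE (o := c / I.s ^ i % I.s) g1 hw (by omega) ?_ (by omega)]
      · exact gsl _ hml
      · rw [eval_sub hx (eval_mul (eval_div hx (y := .reg 7) g7) (y := .reg 7) g7), hmod]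
    have hsl1 : ∀ σ' : RamState I.n, SameMem B [3] σ1 σ' →
        ∀ i < I.s, σ'.mem (6 * B + i) = I.sl.getD i 0 := by
      intro σ' h i hi
      rw [h 6 i (by simp) (by omega), hm1 6 i (by simp) (by omega), hsl i hi]
    have hd1 := hdig σ1 h22 (h18 1 (by omega)) (h18 7 (by omega)) (hsl1 σ1 (SameMem.refl _ _))
    refine Ok.seq (T := 1) (T' := 2 * I.k + 3) (Ok.inE le_rfl (Q := fun σ2 => σ2 = σ1.setReg 40
      (ind (vset I.n (I.seq c) ∈ I.E))) ?_) ?_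
    · grind [decodeSet_getD, ind]
    rintro _ rfl
    have hsucc : I.UEUpTo (c + 1) = if vset I.n (I.seq c) ∈ I.E then
        insert (I.seq c) (I.UEUpTo c) else I.UEUpTo c := by
      grind [Inp.UEUpTo, Finset.range_add_one, Finset.filter_insert, Finset.image_insert]
    refine Ok.ite (T := 2 * I.k + 2) ?_ ?_
    · intro h
      have hin : vset I.n (I.seq c) ∈ I.E := by
        rw [eval_reg, setReg_reg, if_pos rfl, ind_ne_zero] at h
        exact h
      rw [if_pos hin] at hsucc
      refine (Ok.bump (U := I.UEUpTo c) (l := I.seq c) (thr := I.q / I.D1 + 1) (N := I.n) hw (by omega)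
        (by omega) (by rw [hlen]; exact hBk) ?_ (hlt c) (by simp [h18 0]; rfl) (by simp [h18 1]; rfl)
        (by simp [h18 4]; rfl) ?_ ?_ (by rw [hlen])).mono le_rfl ?_
      · intro hmem
        obtain ⟨c', h1, h2⟩ := Finset.mem_image.1 hmem
        have h3 := Finset.mem_range.1 (Finset.mem_filter.1 h1).1
        have := Inp.seq_inj (by omega) hc h2
        omega
      · intro σ' hr hm
        exact hdig σ' (by rw [hr]; simpa using h22) (by rw [hr]; exact h18 1 (by omega))
          (by rw [hr]; exact h18 7 (by omega)) (hsl1 σ' hm)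
      · rw [hlen]
        exact htab1
      · rintro σ2 ⟨hr2, hE2, hm2, htab2⟩
        rw [hlen, ← hsucc] at htab2
        refine ⟨by rw [hr2]; simpa using h22, by simp, ?_, by rw [setReg_E, hE2]; exact hE1, ?_, htab2⟩
        · intro i hi
          rw [setReg_ne (by omega), hr2, setReg_ne (by omega), h18 i hi]
        · exact hm1.trans (M' := [3]) hm2 (fun x => id) (fun x => id)
    · intro h
      have hin : ¬ vset I.n (I.seq c) ∈ I.E := by
        intro h'
        rw [eval_reg, setReg_reg, if_pos rfl, ind_true h'] at h
        omega
      rw [if_neg hin] at hsucc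
      refine Ok.skip (by omega) ⟨by simpa using h22, by simp, ?_, hE1, hm1, by rw [hsucc]; exact htab1⟩
      grind [setReg_ne]
  · aesop

end Table

/-! ### Growing the two search trees -/

section Main

variable {w B : ℕ} {I : Inp} {G : Finset (Finset (Fin I.n))} {S : Finset (Fin I.n)}
variable {side : ℕ} {σ : RamState I.n}

theorem Inp.s_pos (hc : I.Chk) : 0 < I.s := by
  have h1 := hc.1.2.1
  have h2 := hc.1.2.2.1
  have h3 := I.q_le
  omega

theorem Inp.dep_le (hc : I.Chk) : I.dep ≤ I.n :=
  (Nat.le_mul_of_pos_left _ (Inp.s_pos hc)).trans hc.2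

theorem Inp.sized (hI : I.Valid) (hc : I.Chk) (hb : Big I w B) (hs : side < 2) : Sized w B (I.P side) := by
  obtain ⟨hn, hk⟩ := hb.small hI
  have hsn := I.s_le
  have hkq := I.kq_le
  have hv := Inp.valid_P hI hs
  exact ⟨hb.hw, by show I.n + 2 ≤ B; omega,
    (Nat.pow_le_pow_left (show I.n + 1 ≤ I.n + 2 by omega) I.k).trans (hb.pow_le (by omega)),
    by show 20 * (I.k + 2) ≤ B; omega, by show 6 * I.k * I.q ≤ B; omega, hs, hv.hh1,
    by have := hv.hhk; omega,
    hv.sl_lt, I.q_le.trans hsn, Inp.dep_le hc, Inp.m_le⟩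

theorem Inp.N_le_pow (hI : I.Valid) (hs : side < 2) : I.N side ≤ I.s ^ (I.k - 1) :=
  N_le.trans (pow_h_le hI hs)

theorem Inp.m_le_pow (hI : I.Valid) (hc : I.Chk) : I.m ≤ I.s ^ (I.k - 1) := by
  have h1 := hc.1.2.2.1
  have h2 := I.q_le
  have h3 : I.s ^ 1 ≤ I.s ^ (I.k - 1) := Nat.pow_le_pow_right (s_pos hc) (by have := hI.hk2; omega)
  rw [pow_one] at h3
  omega

/-- The trees have the size of their sets of leaves up to a constant, and `m` is absorbed because it
is at most `q`. -/
theorem Inp.tot_le (hI : I.Valid) (hc : I.Chk) (hs : side < 2) : I.tot side ≤ 6 * I.s ^ (I.k - 1) := by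
  have h1 := X_mul_le hc.1 hs
  have h2 := N_le_pow hI hs
  have h3 := m_le_pow hI hc
  have h4 : I.e side ≤ 1 := e_le
  have h5 := hc.1.2.1
  unfold tot
  omega

theorem Inp.tot_mul_le (hI : I.Valid) (hc : I.Chk) (hb : Big I w B) (hs : side < 2) : I.tot side * (I.k + 2) ≤
    B := by
  have hk := hI.hk2
  have h1 := tot_le hI hc hs
  have h2 : I.s ^ (I.k - 1) ≤ (I.n + 2) ^ (I.k - 1) := Nat.pow_le_pow_left (by have := I.s_le; omega) _
  calc I.tot side * (I.k + 2) ≤ (6 * (I.n + 2) ^ (I.k - 1)) * (I.n + 2) :=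
        Nat.mul_le_mul (by omega) (by have := hI.hkn; omega)
    _ = 6 * (I.n + 2) ^ I.k := by
        rw [mul_assoc, ← pow_succ, show I.k - 1 + 1 = I.k by omega]
    _ ≤ (I.n + 2) ^ 3 * (I.n + 2) ^ I.k := by
        grind
    _ = (I.n + 2) ^ (3 + I.k) := (pow_add _ _ _).symm
    _ ≤ B := hb.pow_le (by omega)

open Classical in
/-- The vertices that may be used. -/
noncomputable def Inp.V (I : Inp) : Finset (Fin I.n) :=
  univ.filter fun x => x ∈ I.S ∨ ∃ f < I.k, I.u f = x.val ∨ I.v f = x.val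

theorem Inp.mem_V {x : Fin I.n} : x ∈ I.V ↔ x ∈ I.S ∨ ∃ f < I.k, I.u f = x.val ∨ I.v f = x.val := by
  simp [Inp.V]

theorem Inp.inV : InV (I.P side) I.V := by
  constructor
  · intro i hi x hx
    have h1 := (sl_usable (I := I) (hi.trans_le kq_le)).1
    rw [← show x.val = I.sl.getD i 0 from hx] at h1
    obtain ⟨y, h2, h3⟩ := Finset.mem_map.1 h1
    have : y = x := Fin.ext h3
    subst this
    exact Inp.mem_V.2 (Or.inl h2)
  · intro f hf x hx
    refine Inp.mem_V.2 (Or.inr ⟨f, hf, ?_⟩)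
    have hx' : x.val = I.rt side f := hx
    unfold rt at hx'
    grind

theorem Inp.wf_root (side : ℕ) : WF (I.P side) G (I.root side) ∅ 1 := by
  have h0 : ∀ p ≥ I.k, ∀ q, I.root side q p = 0 := fun p hp q => if_neg (by omega)
  have hP : (I.P side).k = I.k := rfl
  refine ⟨one_pos, ?_, ?_, ?_, ?_, ?_, ?_, ?_⟩
  · intro p _; rw [h0 _ (by omega)]; omega
  · intro p _; rw [h0 _ (by omega)]; omega
  · intro f hf; exact if_pos ⟨rfl, hf⟩
  · rw [h0 _ (by omega)]
  · intro p h1 h2; omega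
  · intro p p' h1 _ h2; omega
  simp

/-- A bound for the running time of growing the two trees. -/
noncomputable def Inp.growT (I : Inp) (side : ℕ) : ℕ := growTime (I.P side) (I.e side) (I.X side)

/-- The state when the search begins. -/
structure Ready (I : Inp) (B : ℕ) (σ : RamState I.n) : Prop where
  regs : ∀ i < 18, σ.reg i = I.regs B i
  E : σ.E = I.E
  slots : ∀ side < 2, Slots B (1 + side) (I.k + 2) (I.root side) σ
  tabs : ∀ side < 2, Tab B (4 + side) I.n (I.q / 8 + 1) (I.h side) ∅ σ
  sl : ∀ i < I.s, σ.mem (6 * B + i) = I.sl.getD i 0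
  tabE : Tab B 3 I.n (I.q / I.D1 + 1) I.k I.UE σ

theorem Ready.env (h : Ready I B σ) (side : ℕ) : Env B (I.P side) σ :=
  ⟨h.regs 0 (by omega), h.regs 1 (by omega), h.regs 2 (by omega), h.regs 3 (by omega),
    h.regs 4 (by omega), h.regs 5 (by omega), h.regs 6 (by omega),
    fun i hi => h.sl i (hi.trans_le Inp.kq_le), h.tabE⟩

/-- Grow both trees. -/
def growsC (k : ℕ) : RamCmd k :=
  .seq (.set 20 (.const 1)) (.seq (growC k ((k + 1) / 2) 0 17 15) (guardC (growC k (k / 2) 1 12 16)))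

/-- The state after the search. -/
structure Grown (I : Inp) (B : ℕ) (G : Finset (Finset (Fin I.n))) (a b : Nodes × Finset (List ℕ))
    (σ : RamState I.n) : Prop where
  slots₀ : Slots B 1 (I.k + 2) a.1 σ
  slots₁ : Slots B 2 (I.k + 2) b.1 σ
  tree₀ : Tree (I.P 0) G (I.e 0) a.1 a.2 (I.tot 0)
  tree₁ : Tree (I.P 1) G (I.e 1) b.1 b.2 (I.tot 1)

/-- A bound for the number of search bases used by a search. -/
noncomputable def Inp.cnt (I : Inp) (side : ℕ) : ℕ :=
  I.e side * (2 * I.k) + I.X side * (I.k * (I.m + 1))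

theorem Ok.grows {T : ℕ} (hI : I.Valid) (hc : I.Chk) (hb : Big I w B) (hσ : Ready I B σ)
    (hT : I.growT 0 + I.growT 1 + 4 ≤ T) : Ok w G S (growsC I.k) σ T (Res I.k B I.V 20 (I.cnt 0 + I.cnt 1) [1,
    4, 2, 5] σ ((I.tree G 0).bind fun a => (I.tree G 1).map fun b => (a, b)) (fun p => Grown I B G p.1 p.2)) :=
    by
  have hw := hb.hw
  obtain ⟨hn, hk⟩ := hb.small hI
  refine Ok.set_seq (I.growT 0 + I.growT 1 + 2) 1 eval_const ?_
  have hreg : ∀ i < 20, (σ.setReg 20 1).reg i = σ.reg i := fun i hi => by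
    rw [setReg_ne (by omega)]
  have henv : ∀ side < 2, Env B (I.P side) (σ.setReg 20 1) := fun side hs =>
    (hσ.env side).same (M := []) (Inp.sized hI hc hb hs) (fun i hi => hreg i (by omega))
      (sameMem_of_eq rfl) (by simp) (by simp)
  have hrel : ∀ side < 2, Rel B (I.P side) (I.root side) ∅ (σ.setReg 20 1) := fun side hs =>
    Rel.congr (P := I.P side) (σ := σ) rfl ⟨hσ.slots side hs, hσ.tabs side hs⟩ rfl
  have hm : 0 < I.m := by have := hc.1.2.1; omega
  -- Register 17 was set to 0 and stands for the length of the initial path of the first tree; only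
  -- the second tree may have one.
  have h0 := Ok.grow (G := G) (S := S) (P := I.P 0) (V := I.V) (A := I.root 0) (U := ∅) (e := I.e 0)
    (X := I.X 0) (cap := I.tot 0) (re := 17) (rX := 15) (σ := σ.setReg 20 1)
    (Inp.sized hI hc hb (by omega)) (Inp.valid_P hI (by omega)) Inp.inV
    (Inp.tot_mul_le hI hc hb (by omega)) (by omega) (by omega) (Inp.wf_root 0) le_rfl hm
    (henv 0 (by omega)) (hrel 0 (by omega)) (by simp) ((hreg 17 (by omega)).trans (hσ.regs 17 (by omega)))
    ((hreg 15 (by omega)).trans (hσ.regs 15 (by omega))) le_rfl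
  have key : Ok w G S (.seq (growC I.k ((I.k + 1) / 2) 0 17 15) (guardC (growC I.k (I.k / 2) 1 12 16)) :
      RamCmd I.k) (σ.setReg 20 1) (I.growT 0 + I.growT 1 + 2) (Res I.k B I.V 21 (I.cnt 0 + I.cnt 1)
      [1, 4, 2, 5] (σ.setReg 20 1)
      ((I.tree G 0).bind fun a => (I.tree G 1).map fun b => (a, b))
      (fun p => Grown I B G p.1 p.2)) := by
    refine Ok.bind (T1 := I.growT 0) (T2 := I.growT 1) (c1 := I.cnt 0) (c2 := I.cnt 1)
      (R := fun a σ' => Slots B 1 (I.k + 2) a.1 σ' ∧ Tree (I.P 0) G (I.e 0) a.1 a.2 (I.tot 0) ∧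
        SameMem B [1, 4] (σ.setReg 20 1) σ')
      (h0.mono le_rfl ?_) ?_ (by omega) le_rfl
    · rintro σ' ⟨g1, g2, g3, g4, g5⟩
      refine ⟨g1, g2.mono (by intro x hx; simp [Inp.P] at hx ⊢; tauto), g3, ?_, g5⟩
      intro a ha
      obtain ⟨h6, h7, h8⟩ := g4 a ha
      exact ⟨h6, h7.1, h8, g2⟩
    · rintro a σ1 ha h20 ⟨hs1, ht1, hm1⟩ hreg1 -
      have hreg1' : ∀ i < 20, σ1.reg i = σ.reg i := fun i hi => by
        grind
      have h1 := Ok.grow (G := G) (S := S) (P := I.P 1) (V := I.V) (A := I.root 1) (U := ∅)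
        (e := I.e 1) (X := I.X 1) (cap := I.tot 1) (re := 12) (rX := 16) (σ := σ1)
        (Inp.sized hI hc hb (by omega)) (Inp.valid_P hI (by omega)) Inp.inV
        (Inp.tot_mul_le hI hc hb (by omega)) (by omega) (by omega) (Inp.wf_root 1) le_rfl hm
        ((henv 1 (by omega)).same (M := [1, 4]) (Inp.sized hI hc hb (by omega))
          (fun i hi => hreg1 i (by omega) (by omega)) hm1 (by simp) (by simp))
        ⟨(hrel 1 (by omega)).1.same hm1 (by simp [Inp.P]), (hrel 1 (by omega)).2.same
          (Inp.sized hI hc hb (side := 1) (by omega)).hBh hm1 (by simp [Inp.P])⟩ h20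
        ((hreg1' 12 (by omega)).trans (hσ.regs 12 (by omega)))
        ((hreg1' 16 (by omega)).trans (hσ.regs 16 (by omega))) le_rfl
      refine h1.mono le_rfl ?_
      rintro σ' ⟨g1, g2, g3, g4, g5⟩
      refine ⟨g1, g2.mono (by intro x hx; tauto), g3, ?_, ?_⟩
      · intro p hp
        obtain ⟨b, hb', rfl⟩ := Option.map_eq_some_iff.1 hp
        obtain ⟨h6, h7, h8⟩ := g4 b hb'
        exact ⟨h6, hs1.same g2 (by simp [Inp.P]), h7.1, ht1, h8⟩
      · intro hp
        exact g5 (Option.map_eq_none_iff.1 hp)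
  refine key.mono le_rfl fun σ' h => ?_
  exact h.trans_left (σ := σ) (lo' := 20) (M' := []) (fun i hi _ => hreg i hi) (sameMem_of_eq rfl)
    (by simp) (by omega) (fun x => id) (by simp)

end Main

/-! ### Connecting the two search trees -/

section Connect

variable {w B : ℕ} {I : Inp} {G : Finset (Finset (Fin I.n))} {S : Finset (Fin I.n)}
variable {A A' : Nodes} {T a b i j k n p : ℕ} {σ : RamState I.n}

/-- The sets in `E'` that are not in `E` are `k`-sets in `V` belonging to `Z`. -/
def Within {n : ℕ} (k : ℕ) (V : Finset (Fin n)) (Z E E' : Finset (Finset (Fin n))) : Prop :=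
  E ⊆ E' ∧ ∀ e ∈ E', e ∉ E → e.card = k ∧ e ⊆ V ∧ e ∈ Z

theorem Within.exposed {c : ℕ} {V : Finset (Fin n)} {Z E E' : Finset (Finset (Fin n))} (h : Within k V Z E E')
    (hc : Z.card ≤ c) : Exposed k V c E E' := by
  refine ⟨h.1, ?_, fun e he he' => ⟨(h.2 e he he').1, (h.2 e he he').2.1⟩⟩
  have h1 : E' ⊆ E ∪ Z := by
    intro e he
    by_cases he' : e ∈ E
    · exact mem_union_left _ he'
    · exact mem_union_right _ (h.2 e he he').2.2
  exact (card_le_card h1).trans ((card_union_le _ _).trans (by omega))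

theorem Within.expose {V b : Finset (Fin I.n)} {Z E : Finset (Finset (Fin I.n))} (h : Within k V Z E σ.E)
    (hV : b ⊆ V) (hZ : b ∈ Z) : Within k V Z E (σ.expose k b).E := by
  unfold RamState.expose
  split_ifs with hk
  · refine ⟨h.1.trans (subset_insert _ _), ?_⟩
    intro e he he'
    rcases mem_insert.1 he with rfl | he
    · exact ⟨hk, hV, hZ⟩
    · exact h.2 e he he'
  · exact h

/-- The search base for the edge `j` joining two tuples, and the remaining vertex. -/
def linkBase (A A' : Nodes) (k h a b j : ℕ) : List ℕ :=
  if j < h then A.pre a (k - j) ++ A'.pre b j else A.pre a (k - j - 1) ++ A'.pre b (j + 1)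

def linkVertex (A A' : Nodes) (k h a b j : ℕ) : ℕ := if j < h then A' b j else A a (k - j - 1)

/-- The joining set may be revealed by leaving out either the last vertex taken from `b` or the last
one taken from `a`; the choice matters only for the number of bases. -/
theorem link_eq {h : ℕ} (hj : j < k) : vset n (linkBase A A' k h a b j ++ [linkVertex A A' k h a b j]) = vset n
    (A.pre a (k - j) ++ A'.pre b (j + 1)) := by
  ext x
  unfold linkBase linkVertex
  have h1 : A'.pre b (j + 1) = A'.pre b j ++ [A' b j] := by
    simp [Nodes.pre, List.range_succ]
  have h2 : A.pre a (k - j) = A.pre a (k - j - 1) ++ [A a (k - j - 1)] := by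
    conv_lhs => rw [show k - j = k - j - 1 + 1 by omega]
    simp [Nodes.pre, List.range_succ]
  split_ifs
  · rw [h1]; simp
  · rw [h2]; simp; tauto

def linkBaseE (k j : ℕ) : List RamExpr :=
  if j < k / 2 then (List.range (k - j)).map (slotE 1 (k + 2) (.reg 26)) ++
    (List.range j).map (slotE 2 (k + 2) (.reg 27))
  else (List.range (k - j - 1)).map (slotE 1 (k + 2) (.reg 26)) ++
    (List.range (j + 1)).map (slotE 2 (k + 2) (.reg 27))

def linkVertexE (k j : ℕ) : RamExpr :=
  if j < k / 2 then slotE 2 (k + 2) (.reg 27) j else slotE 1 (k + 2) (.reg 26) (k - j - 1)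

/-- Test the edges joining the tuples of the nodes in registers `26` and `27`. -/
def revealsC (k : ℕ) : ℕ → RamCmd k
  | 0 => .skip
  | j + 1 => .seq (revealsC k j)
    (.seq (.reveal 40 (fun i => (linkBaseE k j).getD i (.const 0)) (linkVertexE k j))
      (.set 25 (.op .mul (.reg 25) (.reg 40))))

theorem Ok.reveals {J : ℕ} {Z E : Finset (Finset (Fin I.n))} (hw : 8 * B < 2 ^ w) (hk : 1000 * (I.k + 2) ≤ B)
    (h1 : σ.reg 1 = B) (hA : Slots B 1 (I.k + 2) A σ) (hA' : Slots B 2 (I.k + 2) A' σ)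
    (ha : (a + 1) * (I.k + 2) ≤ B) (hb : (b + 1) * (I.k + 2) ≤ B) (h26 : σ.reg 26 = a) (h27 : σ.reg 27 = b)
    (h25 : σ.reg 25 = 1) (hE : Within I.k I.V Z E σ.E) (hZ : ∀ j < J, vset I.n (linkBase A A' I.k (I.k / 2) a b
    j) ⊆ I.V ∧ vset I.n (linkBase A A' I.k (I.k / 2) a b j) ∈ Z) (hJ : J ≤ I.k) (hT : 2 * J + 1 ≤ T) : Ok w G S
    (revealsC I.k J) σ T (fun σ' => (∀ i, i ≠ 25 → i ≠ 40 → σ'.reg i = σ.reg i) ∧ σ'.mem = σ.mem ∧ Within I.k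
    I.V Z E σ'.E ∧ σ'.reg 25 = ind (∀ j < J, vset I.n (A.pre a (I.k - j) ++ A'.pre b (j + 1)) ∈ G)) := by
  induction J generalizing T with
  | zero => exact Ok.skip (by omega) ⟨fun _ _ _ => rfl, rfl, hE, by rw [h25, ind_true (by simp)]⟩
  | succ J ih =>
    refine Ok.seq (ih (fun j hj => hZ j (by omega)) (by omega) le_rfl) (T' := 2) ?_
    rintro σ1 ⟨hr1, hm1, hE1, h251⟩
    have hs1 : Slots B 1 (I.k + 2) A σ1 := hA.same (M := []) (sameMem_of_eq hm1) (by simp)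
    have hs2 : Slots B 2 (I.k + 2) A' σ1 := hA'.same (M := []) (sameMem_of_eq hm1) (by simp)
    have h11 : σ1.reg 1 = B := by grind
    have ha1 : (RamExpr.reg 26).eval w σ1 = a := by rw [eval_reg, hr1 26 (by omega) (by omega), h26]
    have hb1 : (RamExpr.reg 27).eval w σ1 = b := by rw [eval_reg, hr1 27 (by omega) (by omega), h27]
    have hbase : (linkBaseE I.k J).map (RamExpr.eval w σ1) = linkBase A A' I.k (I.k / 2) a b J := by
      unfold linkBaseE linkBase
      split_ifs <;>
      rw [List.map_append, map_eval_slots h11 hw (by omega) ha1 (by omega) (by omega) ha hs1,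
        map_eval_slots h11 hw (by omega) hb1 (by omega) (by omega) hb hs2]
    have hx : (linkVertexE I.k J).eval w σ1 = linkVertex A A' I.k (I.k / 2) a b J := by
      unfold linkVertexE linkVertex
      rw [add_mul] at ha hb
      split_ifs
      · exact eval_slotE h11 hw (by omega) hb1 (by omega) (by omega) (by omega) hs2
      · exact eval_slotE h11 hw (by omega) ha1 (by omega) (by omega) (by omega) hs1
    have hlen : (linkBaseE I.k J).length = I.k := by
      unfold linkBaseE
      split_ifs <;> simp <;> omega
    refine Ok.seq (T := 1) (T' := 1) (Ok.reveal le_rfl (Q := fun σ2 => σ2 = (σ1.setReg 40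
      (ind (vset I.n (A.pre a (I.k - J) ++ A'.pre b (J + 1)) ∈ G))).expose I.k
        (vset I.n (linkBase A A' I.k (I.k / 2) a b J))) ?_) ?_
    · rw [decodeSet_getD hbase hlen, hx, ← vset_concat, link_eq (by omega)]
      congr
    rintro _ rfl
    refine Ok.set le_rfl ?_
    rw [eval_and (p := ∀ j < J, vset I.n (A.pre a (I.k - j) ++ A'.pre b (j + 1)) ∈ G)
      (p' := vset I.n (A.pre a (I.k - J) ++ A'.pre b (J + 1)) ∈ G) (by simpa using h251) (by simp)]
    refine ⟨?_, hm1, ?_, ?_⟩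
    · intro i h25 h40
      rw [setReg_ne h25, expose_reg, setReg_ne h40, hr1 i h25 h40]
    · grind [setReg_E, Within.expose]
    · rw [setReg_reg, if_pos rfl]
      grind [ind_congr, Nat.lt_succ_iff_lt_or_eq]

/-- The search bases that may be used for the edges `j` joining the two trees. -/
noncomputable def Inp.links (I : Inp) (A A' : Nodes) (j : ℕ) : Finset (Finset (Fin I.n)) :=
  if j < I.k / 2 then
    (range (I.N 0) ×ˢ (univ : Finset (Fin j → Fin I.s))).image fun x =>
      vset I.n (A.pre (I.leaf 0 x.1) (I.k - j) ++ List.ofFn fun i => I.sl.getD (x.2 i) 0)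
  else
    (range (I.N 1) ×ˢ (univ : Finset (Fin (I.k - j - 1) → Fin I.s))).image fun x =>
      vset I.n ((List.ofFn fun i => I.sl.getD (x.2 i) 0) ++ A'.pre (I.leaf 1 x.1) (j + 1))

/-- For `j < k / 2` a base is a beginning of one of at most `s ^ h 0` leaves of the first tree and
`j` free vertices, with `h 0 + j ≤ k - 1`. For larger `j` the vertex left out belongs to the first
tree, and `h 1 + (k - j - 1) ≤ k - 1`. -/
theorem Inp.card_links (hs : 0 < I.s) (hj : j < I.k) : (I.links A A' j).card ≤ I.s ^
    (I.k - 1) := by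
  have hN : ∀ side, I.N side ≤ I.s ^ I.h side := fun side =>
    Inp.N_le.trans (Nat.pow_le_pow_left Inp.q_le _)
  unfold links
  split_ifs with h
  · refine card_image_le.trans ?_
    rw [card_product, card_range, card_univ, Fintype.card_fun, Fintype.card_fin, Fintype.card_fin]
    refine (Nat.mul_le_mul_right _ (hN 0)).trans ?_
    rw [← pow_add]
    exact Nat.pow_le_pow_right hs (by unfold Inp.h; omega)
  · refine card_image_le.trans ?_
    rw [card_product, card_range, card_univ, Fintype.card_fun, Fintype.card_fin, Fintype.card_fin]
    refine (Nat.mul_le_mul_right _ (hN 1)).trans ?_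
    rw [← pow_add]
    exact Nat.pow_le_pow_right hs (by unfold Inp.h; omega)

/-- Forgets everything about a beginning except that it consists of listed vertices, which suffices
for counting bases. -/
theorem exists_ofFn {P : Par} {G : Finset (Finset (Fin P.n))} {U : Finset (List ℕ)} {tot f s : ℕ} (hv : P.Valid)
    (h : WF P G A U tot) (hp0 : 0 < p) (hp : p < tot) (hf : f ≤ P.k) (hs : 6 * P.k * P.q ≤ s) : ∃ x : Fin f →
    Fin s, A.pre p f = List.ofFn fun i => P.sl (x i) := by
  have h1 : ∀ i : Fin f, ∃ x : Fin s, A p i = P.sl x := by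
    intro i
    obtain ⟨⟨l, hl, hx⟩, -⟩ := (h.node p hp0 hp).2.2 i (by omega)
    have := class_index_lt (l := (A (A p P.k) (P.k + 1) + 1) % 3) hv.hside (Nat.mod_lt _ (by omega))
      (show i.val < P.k by omega) hl
    exact ⟨⟨_, this.trans_le hs⟩, hx⟩
  choose x hx using h1
  refine ⟨x, ?_⟩
  rw [Nodes.pre]
  apply List.ext_getElem
  · simp
  grind

theorem Inp.leaf_pos (hc : I.Chk₁) {side : ℕ} (hs : side < 2) : 0 < I.leaf side i := by
  have h1 : 2 ≤ I.N side := by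
    obtain ⟨-, -, -, h0, h1⟩ := hc
    grind
  have h2 : 0 < I.d side := Nat.clog_pos hc.2.1 h1
  have h3 : 0 < I.L side := by
    unfold Inp.L
    obtain ⟨d, hd⟩ : ∃ d, I.d side = d + 1 := ⟨I.d side - 1, by omega⟩
    rw [hd, start]
    omega
  unfold leaf
  omega

theorem Inp.linkBase_mem (hI : I.Valid) (hc : I.Chk₁) {a b : Nodes × Finset (List ℕ)}
    (h0 : WF (I.P 0) G a.1 a.2 (I.tot 0)) (h1 : WF (I.P 1) G b.1 b.2 (I.tot 1)) {i' : ℕ} (hi : i < I.N 0)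
    (hi' : i' < I.N 1) (hj : j < I.k) : vset I.n (linkBase a.1 b.1 I.k (I.k / 2) (I.leaf 0 i) (I.leaf 1 i') j) ∈
    I.links a.1 b.1 j := by
  unfold linkBase links
  split_ifs with h
  · obtain ⟨x, hx⟩ := exists_ofFn (f := j) (s := I.s) (Inp.valid_P hI (by omega)) h1
      (Inp.leaf_pos hc (by omega)) (Inp.leaf_lt hc hi') (show j ≤ I.k by omega) Inp.kq_le
    rw [hx]
    exact mem_image.2 ⟨(i, x), by simp [hi], rfl⟩
  · obtain ⟨x, hx⟩ := exists_ofFn (f := I.k - j - 1) (s := I.s) (Inp.valid_P hI (by omega)) h0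
      (Inp.leaf_pos hc (by omega)) (Inp.leaf_lt hc hi) (show I.k - j - 1 ≤ I.k by omega) Inp.kq_le
    rw [hx]
    exact mem_image.2 ⟨(i', x), by simp [hi'], rfl⟩

theorem Inp.linkBase_subset (hI : I.Valid) {a b : Nodes × Finset (List ℕ)} (h0 : WF (I.P 0) G a.1 a.2 (I.tot 0))
    (h1 : WF (I.P 1) G b.1 b.2 (I.tot 1)) {p' : ℕ} (hp : p < I.tot 0) (hp' : p' < I.tot 1) (hj : j < I.k) : vset
    I.n (linkBase a.1 b.1 I.k (I.k / 2) p p' j) ⊆ I.V := by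
  have e0 : ∀ f < I.k, ∀ y : Fin I.n, a.1 p f = y.val → y ∈ I.V := fun f hf y hy =>
    h0.mem_V (Inp.valid_P hI (by omega)) Inp.inV hp hf y hy.symm
  have e1 : ∀ f < I.k, ∀ y : Fin I.n, b.1 p' f = y.val → y ∈ I.V := fun f hf y hy =>
    h1.mem_V (Inp.valid_P hI (by omega)) Inp.inV hp' hf y hy.symm
  grind [mem_vset, linkBase, h, mem_pre]

/-- Look for a pair of leaves that can be joined. -/
def connC (k : ℕ) : RamCmd k :=
  .seq (.set 25 (.const 0)) (forN 22 (.op .mul (.reg 8) (.reg 9))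
    (.ite (.reg 25) .skip
      (.seq (.set 26 (.op .add (.reg 10) (.op .div (.reg 22) (.reg 9))))
      (.seq (.set 27 (.op .add (.op .add (.reg 11) (.reg 12))
        (.op .sub (.reg 22) (.op .mul (.op .div (.reg 22) (.reg 9)) (.reg 9)))))
      (.seq (.set 25 (.const 1)) (revealsC k k))))))

/-- The two lengths of beginnings add up to `k`; so examining all pairs of leaves fits into the time
bound. -/
theorem Inp.N_mul_N : I.N 0 * I.N 1 ≤ I.q ^ I.k := by
  have h := Nat.mul_le_mul (I.N_le (side := 0)) (I.N_le (side := 1))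
  rwa [← pow_add, show I.h 0 + I.h 1 = I.k by unfold Inp.h; omega] at h

/-- Counting exposed sets per pair of leaves would be too wasteful by a factor of order `s`. Instead
all bases are confined to a set `Z` of possible bases fixed in advance, which is what `Within` keeps
track of. -/
theorem Ok.conn {a b : Nodes × Finset (List ℕ)} (hI : I.Valid) (hc : I.Chk) (hb : Big I w B)
    (hσ : Grown I B G a b σ) (hr : ∀ i < 18, σ.reg i = I.regs B i)
    (hT : I.N 0 * I.N 1 * (2 * I.k + 7) + 3 ≤ T) : Ok w G S (connC I.k) σ T
    (fun σ' => (∀ i < 18, σ'.reg i = I.regs B i) ∧ σ'.mem = σ.mem ∧ Exposed I.k I.V (I.k * I.s ^ (I.k - 1)) σ.E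
    σ'.E ∧ ((σ'.reg 25 = 0 ∧ ¬ ∃ i < I.N 0, ∃ j < I.N 1, I.Conn G a.1 b.1 (I.leaf 0 i) (I.leaf 1 j)) ∨ (σ'.reg
    25 = 1 ∧ ∃ i < I.N 0, ∃ j < I.N 1, I.Conn G a.1 b.1 (I.leaf 0 i) (I.leaf 1 j) ∧ σ'.reg 26 = I.leaf 0 i ∧
    σ'.reg 27 = I.leaf 1 j))) := by
  have hw := hb.hw
  obtain ⟨hn, hk⟩ := hb.small hI
  have hs := Inp.s_pos hc
  have hN0 := hc.1.2.2.2.1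
  have hN1 := hc.1.2.2.2.2
  have hNB : I.N 0 * I.N 1 ≤ B := by
    refine Inp.N_mul_N.trans ((Nat.pow_le_pow_left Inp.q_le _).trans (hb.s_pow_le le_rfl))
  have ht0 := Inp.tot_mul_le hI hc hb (side := 0) (by omega)
  have ht1 := Inp.tot_mul_le hI hc hb (side := 1) (by omega)
  have htB : ∀ t, t * (I.k + 2) ≤ B → t ≤ B := fun t h => (Nat.le_mul_of_pos_right _ (by omega)).trans h
  have htB0 := htB _ ht0
  have htB1 := htB _ ht1
  set Z := (range I.k).biUnion fun j => I.links a.1 b.1 j with hZ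
  have hZcard : Z.card ≤ I.k * I.s ^ (I.k - 1) := by
    refine card_biUnion_le.trans ?_
    refine (sum_le_card_nsmul _ _ (I.s ^ (I.k - 1)) fun j hj => Inp.card_links hs (mem_range.1 hj)).trans ?_
    simp
  refine Ok.set_seq (T - 1) 0 eval_const ?_
  have hmul : ∀ σ' : RamState I.n, (∀ i < 18, σ'.reg i = I.regs B i) →
      (RamExpr.op .mul (.reg 8) (.reg 9)).eval w σ' = I.N 0 * I.N 1 := fun σ' h =>
    eval_mul (x := .reg 8) (y := .reg 9) (h 8 (by omega)) (h 9 (by omega))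
  refine Ok.forN (K := I.N 0 * I.N 1) (T := 2 * I.k + 5) (fun c σ' => σ'.reg 22 = c ∧
    (∀ i < 18, σ'.reg i = I.regs B i) ∧ σ'.mem = σ.mem ∧ Within I.k I.V Z σ.E σ'.E ∧
    ((σ'.reg 25 = 0 ∧ ∀ i < I.N 0, ∀ j < I.N 1, i * I.N 1 + j < c →
        ¬ I.Conn G a.1 b.1 (I.leaf 0 i) (I.leaf 1 j)) ∨
      (σ'.reg 25 = 1 ∧ ∃ i < I.N 0, ∃ j < I.N 1, I.Conn G a.1 b.1 (I.leaf 0 i) (I.leaf 1 j) ∧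
        σ'.reg 26 = I.leaf 0 i ∧ σ'.reg 27 = I.leaf 1 j))) (by omega) ?_ (fun c σ' h => h.1)
    (fun c σ' h => hmul σ' h.2.1) ?_ ?_ (by
      grind)
  · refine ⟨by simp, ?_, rfl, ⟨subset_rfl, fun e he he' => absurd he he'⟩, Or.inl ⟨by simp, ?_⟩⟩
    · grind [setReg_ne]
    · intro i _ j _ h
      omega
  · rintro c hcN σ1 ⟨h22, hr1, hm1, hE1, hfnd⟩
    refine Ok.ite (T := 2 * I.k + 4) ?_ ?_
    · intro h25
      refine Ok.skip (by omega) ⟨h22, by simp, ?_, hm1, hE1, Or.inr ?_⟩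
      · grind [setReg_ne]
      aesop
    intro h25
    have hnone : ∀ i < I.N 0, ∀ j < I.N 1, i * I.N 1 + j < c →
        ¬ I.Conn G a.1 b.1 (I.leaf 0 i) (I.leaf 1 j) := by
      grind [eval_reg]
    have hdm := Nat.div_add_mod' c (I.N 1)
    have hml : c % I.N 1 < I.N 1 := Nat.mod_lt _ (by omega)
    have hdl : c / I.N 1 < I.N 0 := (Nat.div_lt_iff_lt_mul (by omega)).2 hcN
    have hl0 := Inp.leaf_lt hc.1 hdl
    have hl1 := Inp.leaf_lt hc.1 hml
    have hdiv : ∀ σ' : RamState I.n, (∀ i < 23, σ'.reg i = σ1.reg i) →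
        (RamExpr.op .div (.reg 22) (.reg 9)).eval w σ' = c / I.N 1 := fun σ' h =>
      eval_div (x := .reg 22) (y := .reg 9) ((h 22 (by omega)).trans h22)
        ((h 9 (by omega)).trans (hr1 9 (by omega)))
    have hla : I.leaf 0 (c / I.N 1) = I.L 0 + c / I.N 1 := by simp [Inp.leaf, Inp.e]
    have hlb : I.leaf 1 (c % I.N 1) = I.L 1 + I.e 1 + c % I.N 1 := rfl
    refine Ok.set_seq (2 * I.k + 3) (I.leaf 0 (c / I.N 1)) ?_ ?_
    · rw [eval_add (x := .reg 10) (hr1 10 (by omega)) (hdiv σ1 fun _ _ => rfl)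
        (by show I.L 0 + _ < _; omega), hla]
      rfl
    have hr2 : ∀ i < 23, (σ1.setReg 26 (I.leaf 0 (c / I.N 1))).reg i = σ1.reg i := fun i hi => by
      rw [setReg_ne (by omega)]
    refine Ok.set_seq (2 * I.k + 2) (I.leaf 1 (c % I.N 1)) ?_ ?_
    · have h9 : (RamExpr.reg 9).eval w (σ1.setReg 26 (I.leaf 0 (c / I.N 1))) = I.N 1 :=
        (hr2 9 (by omega)).trans (hr1 9 (by omega))
      have h2 : (RamExpr.reg 22).eval w (σ1.setReg 26 (I.leaf 0 (c / I.N 1))) = c :=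
        (hr2 22 (by omega)).trans h22
      have h11 : (RamExpr.op .add (.reg 11) (.reg 12)).eval w (σ1.setReg 26 (I.leaf 0 (c / I.N 1))) =
          I.L 1 + I.e 1 := eval_add (x := .reg 11) (y := .reg 12)
          ((hr2 11 (by omega)).trans (hr1 11 (by omega)))
          ((hr2 12 (by omega)).trans (hr1 12 (by omega))) (by omega)
      rw [eval_add h11 (eval_sub h2 (eval_mul (hdiv _ hr2) h9)), hlb]
      omega
    refine Ok.set_seq (2 * I.k + 1) 1 eval_const ?_
    refine (Ok.reveals (A := a.1) (A' := b.1) (a := I.leaf 0 (c / I.N 1)) (b := I.leaf 1 (c % I.N 1))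
      (σ := ((σ1.setReg 26 (I.leaf 0 (c / I.N 1))).setReg 27 (I.leaf 1 (c % I.N 1))).setReg 25 1)
      (B := B) (Z := Z) (E := σ.E) hw hk
      (by exact hr1 1 (by omega))
      (hσ.slots₀.same (M := []) (sameMem_of_eq hm1) (by simp))
      (hσ.slots₁.same (M := []) (sameMem_of_eq hm1) (by simp))
      ((Nat.mul_le_mul_right _ hl0).trans ht0) ((Nat.mul_le_mul_right _ hl1).trans ht1) (by simp)
      (by simp) (by simp) hE1 ?_ le_rfl le_rfl).mono le_rfl ?_
    · intro j hj
      exact ⟨Inp.linkBase_subset hI hσ.tree₀.toWF hσ.tree₁.toWF hl0 hl1 hj, mem_biUnion.2 ⟨j, mem_range.2 hj,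
        Inp.linkBase_mem hI hc.1 hσ.tree₀.toWF hσ.tree₁.toWF hdl hml hj⟩⟩
    rintro σ2 ⟨g1, g2, g3, g4⟩
    refine ⟨by rw [g1 22 (by omega) (by omega)]; simpa using h22, by simp, ?_, g2.trans hm1, g3, ?_⟩
    · grind [setReg_ne]
    · by_cases hconn : I.Conn G a.1 b.1 (I.leaf 0 (c / I.N 1)) (I.leaf 1 (c % I.N 1))
      · refine Or.inr ⟨g4.trans (ind_true hconn), c / I.N 1, hdl, c % I.N 1, hml, hconn, ?_, ?_⟩
        · rw [setReg_ne (by omega), g1 26 (by omega) (by omega)]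
          simp
        · rw [setReg_ne (by omega), g1 27 (by omega) (by omega)]
          simp
      · refine Or.inl ⟨g4.trans (ind_false hconn), ?_⟩
        grind [Nat.lt_succ_iff_lt_or_eq, addr_inj]
  · rintro σ1 ⟨-, g1, g2, g3, g4⟩
    refine ⟨g1, g2, g3.exposed hZcard, ?_⟩
    rcases g4 with ⟨g4, g5⟩ | g4
    · refine Or.inl ⟨g4, ?_⟩
      rintro ⟨i, hi, j, hj, hconn⟩
      refine g5 i hi j hj ?_ hconn
      have : (i + 1) * I.N 1 ≤ I.N 0 * I.N 1 := Nat.mul_le_mul_right _ hi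
      grind
    · exact Or.inr g4

end Connect

/-! ### The output and the whole program -/

section Output

variable {w B : ℕ} {I : Inp} {G : Finset (Finset (Fin I.n))} {S : Finset (Fin I.n)}
variable {σ : RamState I.n} {T side t z : ℕ} {A : Nodes} {posE : RamExpr}

/-- Copy the tuple of the node in register `24` to the position `posE` of the path. -/
def putC (k t : ℕ) (posE : RamExpr) : ℕ → RamCmd k
  | 0 => .skip
  | f + 1 => .seq (putC k t posE f)
      (.store (.op .add (.op .mul posE (.const k)) (.const f)) (slotE t (k + 2) (.reg 24) f))

/-- Copy the tuples of the ancestors of the node in register `24`. -/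
def branchC (k t : ℕ) (bound posE : RamExpr) : RamCmd k :=
  forN 22 bound (.seq (putC k t posE k) (.set 24 (slotE t (k + 2) (.reg 24) k)))

theorem sameMem_low {o v : ℕ} (ho : o < B) : SameMem B [0] σ (σ.setMem o v) := by
  have := sameMem_setMem (M := [0]) (σ := σ) (t := 0) (v := v) (by simp) ho
  rwa [zero_mul, zero_add] at this

theorem Ok.put {pos f : ℕ} (hw : 8 * B < 2 ^ w) (hk : 1000 * (I.k + 2) ≤ B) (ht : t = 1 ∨ t = 2)
    (h1 : σ.reg 1 = B) (hA : Slots B t (I.k + 2) A σ) (h24 : σ.reg 24 = z) (hz : (z + 1) * (I.k + 2) ≤ B)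
    (hpos : ∀ σ' : RamState I.n, σ'.reg = σ.reg → posE.eval w σ' = pos) (hpB : (pos + 1) * I.k ≤ B)
    (hf : f ≤ I.k) (hT : f + 1 ≤ T) : Ok w G S (putC I.k t posE f) σ T (fun σ' => σ'.reg = σ.reg ∧ σ'.E = σ.E ∧
    SameMem B [0] σ σ' ∧ (∀ i < f, σ'.mem (pos * I.k + i) = A z i) ∧ ∀ o, (∀ i < f, o ≠ pos * I.k + i) → σ'.mem
    o = σ.mem o) := by
  induction f generalizing T with
  | zero => exact Ok.skip (by omega) ⟨rfl, rfl, SameMem.refl _ _, fun i hi => absurd hi (by omega),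
      fun _ _ => rfl⟩
  | succ f ih =>
    rw [add_mul, one_mul] at hpB hz
    refine Ok.seq (ih (by omega) le_rfl) (T' := 1) ?_
    rintro σ' ⟨g1, g2, g3, g4, g5⟩
    refine Ok.store le_rfl ?_
    have hv := eval_slotE (e := .reg 24) (w := w) (i := f) (by rw [g1, h1]) hw
      (show t < 7 by omega) (show (RamExpr.reg 24).eval w σ' = z by rw [eval_reg, g1, h24])
      (by omega) (by omega) (by omega) (hA.same g3 (by simp; omega))
    have hp : (RamExpr.op .add (.op .mul posE (.const I.k)) (.const f)).eval w σ' = pos * I.k + f :=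
      eval_add (eval_mul (hpos σ' g1) eval_const) eval_const
    rw [hv, hp]
    refine ⟨g1, g2, g3.trans (sameMem_low (by omega)) (fun x => id) (fun x => id), ?_, ?_⟩
    · grind [setMem_mem]
    · intro o ho
      rw [setMem_mem, if_neg (ho f (by omega))]
      exact g5 o fun i hi => ho i (by omega)

/-- The output is written into region 0 while the tree is read from another region, so the array
stays intact although the input tuples may be overwritten. Injectivity of `pos` prevents a tuple
from being overwritten by a later one. -/
theorem Ok.branch {N cap : ℕ} {bound : RamExpr} {pos : ℕ → ℕ} (hw : 8 * B < 2 ^ w) (hk : 1000 * (I.k + 2) ≤ B)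
    (hk2 : 2 ≤ I.k) (ht : t = 1 ∨ t = 2) (h1 : σ.reg 1 = B) (hA : Slots B t (I.k + 2) A σ) (h24 : σ.reg 24 = z)
    (hcap : cap * (I.k + 2) ≤ B) (hz : ∀ i, A.anc I.k z i < cap)
    (hb : ∀ σ' : RamState I.n, (∀ i < 18, σ'.reg i = σ.reg i) → bound.eval w σ' = N)
    (hpos : ∀ i < N, ∀ σ' : RamState I.n, (∀ i < 18, σ'.reg i = σ.reg i) → σ'.reg 22 = i → posE.eval w σ' = pos
    i) (hpB : ∀ i < N, (pos i + 1) * I.k ≤ B) (hinj : ∀ i < N, ∀ j < N, pos i = pos j → i = j) (hNB : N ≤ B)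
    (hT : N * (I.k + 4) + 2 ≤ T) : Ok w G S (branchC I.k t bound posE) σ T
    (fun σ' => (∀ i, i ≠ 22 → i ≠ 24 → σ'.reg i = σ.reg i) ∧ σ'.E = σ.E ∧ SameMem B [0] σ σ' ∧ (∀ i < N, ∀ f <
    I.k, σ'.mem (pos i * I.k + f) = A (A.anc I.k z i) f) ∧ ∀ o, (∀ i < N, ∀ f < I.k, o ≠ pos i * I.k + f) →
    σ'.mem o = σ.mem o) := by
  refine Ok.forN (K := N) (T := I.k + 2) (fun i σ' => σ'.reg 22 = i ∧
    (∀ j, j ≠ 22 → j ≠ 24 → σ'.reg j = σ.reg j) ∧ σ'.reg 24 = A.anc I.k z i ∧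
      σ'.E = σ.E ∧ SameMem B [0] σ σ' ∧
      (∀ j < i, ∀ f < I.k, σ'.mem (pos j * I.k + f) = A (A.anc I.k z j) f) ∧
      ∀ o, (∀ j < i, ∀ f < I.k, o ≠ pos j * I.k + f) → σ'.mem o = σ.mem o) (by omega) ?_
    (fun i σ' h => h.1) (fun i σ' h => hb σ' fun j hj => h.2.1 j (by omega) (by omega)) ?_ ?_ hT
  · refine ⟨by simp, ?_, by simp [Nodes.anc, h24], rfl, SameMem.refl _ _, ?_, fun _ _ => rfl⟩
    · intro j h22 _
      rw [setReg_ne h22]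
    · intro j hj; omega
  · rintro i hi σ1 ⟨h22, hr1, h241, hE1, hm1, hdone, hrest⟩
    have hzi : (A.anc I.k z i + 1) * (I.k + 2) ≤ B := (Nat.mul_le_mul_right (I.k + 2) (hz i)).trans hcap
    refine Ok.seq (T := I.k + 1) (T' := 1) (Ok.put (z := A.anc I.k z i) (pos := pos i) (A := A) hw hk ht
      (by grind) (hA.same hm1 (by simp; omega)) h241
      hzi (fun σ' h => hpos i hi σ' (fun j hj => by grind)
        (by rw [h, h22])) (hpB i hi) le_rfl le_rfl) ?_
    rintro σ2 ⟨g1, g2, g3, g4, g5⟩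
    have hm2 : SameMem B [0] σ σ2 := hm1.trans g3 (fun x => id) (fun x => id)
    refine Ok.set le_rfl ?_
    rw [add_mul] at hzi
    have hv := eval_slotE (e := .reg 24) (w := w) (i := I.k) (σ := σ2)
      (by grind) hw
      (show t < 7 by omega) (show (RamExpr.reg 24).eval w σ2 = A.anc I.k z i by rw [eval_reg, g1, h241])
      (by omega) (by omega) (by omega) (hA.same hm2 (by simp; omega))
    rw [hv]
    refine ⟨by simp [g1, h22], by simp, ?_, by simp [Nodes.anc], g2.trans hE1, hm2, ?_, ?_⟩
    · grind [setReg_ne]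
    · intro j hj f hf
      rcases Nat.lt_succ_iff_lt_or_eq.1 hj with h | rfl
      · refine (g5 _ ?_).trans (hdone j h f hf)
        grind [addr_inj]
      · exact g4 f hf
    · intro o ho
      exact (g5 o (ho i (by omega))).trans (hrest o fun j hj => ho j (by omega))
  grind

/-- The entry `f` of the tuple `p` of the path through the leaves `a` and `b`. -/
noncomputable def Inp.path (I : Inp) (A A' : Nodes) (a b p f : ℕ) : ℕ :=
  if p ≤ I.d 0 then A (A.anc I.k a (I.d 0 - p)) f else A' (A'.anc I.k b (p - I.d 0 - 1)) f

/-- The length of the path. -/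
noncomputable def Inp.len (I : Inp) : ℕ := I.d 0 + I.d 1 + I.e 1 + 2

/-- Write down the path. -/
def outC (k : ℕ) : RamCmd k :=
  .seq (.set 24 (.reg 26)) (.seq (branchC k 1 (.op .add (.reg 13) (.const 1)) (.op .sub (.reg 13) (.reg 22)))
  (.seq (.set 24 (.reg 27)) (.seq (branchC k 2 (.op .add (.op .add (.reg 14) (.reg 12)) (.const 1))
    (.op .add (.op .add (.reg 13) (.const 1)) (.reg 22)))
    (.set 0 (.op .add (.op .add (.op .add (.reg 13) (.reg 14)) (.reg 12)) (.const 2))))))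

theorem Inp.len_le (I : Inp) : I.len ≤ I.dep := by
  have : I.e 1 ≤ 1 := Inp.e_le
  unfold len dep
  omega

/-- Ancestors are met from the leaf towards the root. Hence the first half of the path is written
backwards, at the positions `d 0 - i`, and the second half forwards from `d 0 + 1` on. -/
theorem Ok.out {i j : ℕ} {a b : Nodes × Finset (List ℕ)} (hI : I.Valid) (hc : I.Chk) (hb : Big I w B)
    (hσ : Grown I B G a b σ) (hr : ∀ i < 18, σ.reg i = I.regs B i) (hi : i < I.N 0) (hj : j < I.N 1)
    (h26 : σ.reg 26 = I.leaf 0 i) (h27 : σ.reg 27 = I.leaf 1 j) (hT : I.n * (I.k + 4) + 7 ≤ T) : Ok w G S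
    (outC I.k) σ T (fun σ' => σ'.E = σ.E ∧ σ'.reg 0 = I.len ∧ ∀ p < I.len, ∀ f < I.k, σ'.mem (p * I.k + f) =
    I.path a.1 b.1 (I.leaf 0 i) (I.leaf 1 j) p f) := by
  have hw := hb.hw
  obtain ⟨hn, hk⟩ := hb.small hI
  have hk2 := hI.hk2
  have hkn := hI.hkn
  have hdep := Inp.dep_le hc
  have hlen := I.len_le
  have hd : I.d 0 + I.d 1 + I.e 1 + 2 = I.len := rfl
  have hnB : ∀ p < I.len, (p + 1) * I.k ≤ B := by
    intro p hp
    have h1 : (p + 1) * I.k ≤ I.n * I.n := Nat.mul_le_mul (by omega) hkn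
    have h2 : I.n * I.n ≤ (I.n + 2) * (I.n + 2) := Nat.mul_le_mul (by omega) (by omega)
    have h3 := hb.pow_le (j := 2) (by omega)
    rw [pow_two] at h3
    omega
  have hanc : ∀ (side : ℕ) (A : Nodes) (U : Finset (List ℕ)) (z : ℕ), z < I.tot side →
      WF (I.P side) G A U (I.tot side) → ∀ i, A.anc I.k z i < I.tot side := by
    intro side A U z hz h i
    exact (anc_le (k := I.k) hz h.par i).trans_lt hz
  have hTd : (I.d 0 + 1) * (I.k + 4) + (I.d 1 + I.e 1 + 1) * (I.k + 4) ≤ I.n * (I.k + 4) := by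
    rw [← add_mul]
    exact Nat.mul_le_mul_right _ (by omega)
  refine Ok.set_seq (T - 1) (I.leaf 0 i) ?_ ?_
  · rw [eval_reg, h26]
  have hr1 : ∀ i' < 18, (σ.setReg 24 (I.leaf 0 i)).reg i' = I.regs B i' := fun i' hi' => by
    aesop
  refine Ok.seq (T := (I.d 0 + 1) * (I.k + 4) + 2) (T' := (I.d 1 + I.e 1 + 1) * (I.k + 4) + 4)
    (Ok.branch (A := a.1) (z := I.leaf 0 i) (N := I.d 0 + 1) (cap := I.tot 0)
      (pos := fun i => I.d 0 - i) hw hk hk2 (Or.inl rfl) (hr1 1 (by omega))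
      (hσ.slots₀.same (M := []) (sameMem_of_eq rfl) (by simp)) (by simp)
      (Inp.tot_mul_le hI hc hb (by omega))
      (hanc 0 a.1 a.2 _ (Inp.leaf_lt hc.1 hi) hσ.tree₀.toWF) ?_ ?_ ?_ ?_ (by omega) le_rfl) ?_
  · intro σ' h
    exact eval_add (x := .reg 13) (a := I.d 0) ((h 13 (by omega)).trans (hr1 13 (by omega)))
      eval_const
  · intro i' hi' σ' h h22
    exact eval_sub (x := .reg 13) (y := .reg 22) (a := I.d 0) ((h 13 (by omega)).trans (hr1 13 (by omega)))
      h22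
  · intro i' hi'
    exact hnB _ (by omega)
  · intro i' hi' j' hj' h
    omega
  rintro σ1 ⟨g1, g2, g3, g4, -⟩
  have hr2 : ∀ i' < 18, σ1.reg i' = I.regs B i' := fun i' hi' => by
    grind
  refine Ok.set_seq ((I.d 1 + I.e 1 + 1) * (I.k + 4) + 3) (I.leaf 1 j) ?_ ?_
  · grind [eval_reg, setReg_ne]
  have hr3 : ∀ i' < 18, (σ1.setReg 24 (I.leaf 1 j)).reg i' = I.regs B i' := fun i' hi' => by
    rw [setReg_ne (by omega), hr2 i' hi']
  have g3' : SameMem B [0] σ (σ1.setReg 24 (I.leaf 1 j)) := g3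
  refine Ok.seq (T := (I.d 1 + I.e 1 + 1) * (I.k + 4) + 2) (T' := 1)
    (Ok.branch (A := b.1) (z := I.leaf 1 j) (N := I.d 1 + I.e 1 + 1) (cap := I.tot 1)
      (pos := fun i => I.d 0 + 1 + i) hw hk hk2 (Or.inr rfl) (hr3 1 (by omega))
      (hσ.slots₁.same g3' (by simp)) (by simp)
      (Inp.tot_mul_le hI hc hb (by omega))
      (hanc 1 b.1 b.2 _ (Inp.leaf_lt hc.1 hj) hσ.tree₁.toWF) ?_ ?_ ?_ ?_ (by omega) le_rfl) ?_
  · intro σ' h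
    exact eval_add (a := I.d 1 + I.e 1) (eval_add (x := .reg 14) (y := .reg 12)
      ((h 14 (by omega)).trans (hr3 14 (by omega))) ((h 12 (by omega)).trans (hr3 12 (by omega)))) eval_const
  · intro i' hi' σ' h h22
    exact eval_add (y := .reg 22) (a := I.d 0 + 1) (eval_add (x := .reg 13) (a := I.d 0)
      ((h 13 (by omega)).trans (hr3 13 (by omega))) eval_const) h22
  · intro i' hi'
    exact hnB _ (by omega)
  · intro i' hi' j' hj' h
    omega
  rintro σ2 ⟨f1, f2, f3, f4, f5⟩
  have hr4 : ∀ i' < 18, σ2.reg i' = I.regs B i' := fun i' hi' => by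
    grind
  refine Ok.set le_rfl ?_
  refine ⟨by rw [setReg_E, f2, setReg_E, g2]; rfl, ?_, ?_⟩
  · exact eval_add (a := I.d 0 + I.d 1 + I.e 1) (eval_add (a := I.d 0 + I.d 1) (y := .reg 12)
      (eval_add (x := .reg 13) (y := .reg 14) (hr4 13 (by omega)) (hr4 14 (by omega)))
      (hr4 12 (by omega))) eval_const
  · intro p hp f hf
    rw [setReg_mem]
    unfold Inp.path
    split_ifs with hpd
    · rw [f5, setReg_mem]
      · grind
      grind [addr_inj]
    · have := f4 (p - I.d 0 - 1) (by omega) f hf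
      rwa [show I.d 0 + 1 + (p - I.d 0 - 1) = p by omega] at this

/-- Report failure. -/
def failC {k : ℕ} : RamCmd k := .set 0 (.const 0)

/-- The search proper. -/
def mainC (k : ℕ) : RamCmd k :=
  .seq (tableC k) (.seq (growsC k) (.ite (.reg 20)
    (.seq (connC k) (.ite (.reg 25) (outC k) failC)) failC))

/-- The whole algorithm. -/
def program (k D D1 : ℕ) : RamCmd k :=
  .seq (initC k) (.seq (slistC k) (constsC k D D1 (.ite (chkE k) (constsC' (.ite
    (.op .lt (.op .mul (.reg 7) (.reg 6)) (.op .add (.reg 0) (.const 1))) (mainC k) failC)) failC)))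

/-- The final state is as intended. -/
structure Final (I : Inp) (G : Finset (Finset (Fin I.n))) (K' : ℕ) (σ : RamState I.n) : Prop where
  E : Exposed I.k I.V (K' * I.s ^ (I.k - 1)) I.E σ.E
  fail : ¬ I.Succ G → σ.reg 0 = 0
  succ : I.Succ G → ∃ a b i j, I.tree G 0 = some a ∧ I.tree G 1 = some b ∧ i < I.N 0 ∧ j < I.N 1 ∧
    I.Conn G a.1 b.1 (I.leaf 0 i) (I.leaf 1 j) ∧
    Tree (I.P 0) G (I.e 0) a.1 a.2 (I.tot 0) ∧ Tree (I.P 1) G (I.e 1) b.1 b.2 (I.tot 1) ∧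
    σ.reg 0 = I.len ∧ ∀ p < I.len, ∀ f < I.k, σ.mem (p * I.k + f) =
      I.path a.1 b.1 (I.leaf 0 i) (I.leaf 1 j) p f

theorem Ok.fail {K' : ℕ} (hE : Exposed I.k I.V (K' * I.s ^ (I.k - 1)) I.E σ.E) (h : ¬ I.Succ G) (hT : 1 ≤ T) :
    Ok w G S (failC : RamCmd I.k) σ T (Final I G K') := by
  refine Ok.set hT ⟨hE, fun _ => ?_, fun h' => absurd h' h⟩
  simp [RamExpr.eval]

/-- At most `k` scans per node and `k` per family, each with one base, and `O(s ^ (k - 1))` nodes.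
-/
theorem Inp.cnt_le (hI : I.Valid) (hc : I.Chk) (hs : side < 2) : I.cnt side ≤ 10 * I.k * I.s ^ (I.k - 1) := by
  have h1 := X_mul_le hc.1 hs
  have h2 := N_le_pow hI hs
  have h3 := m_le_pow hI hc
  have h4 : I.e side ≤ 1 := e_le
  have h5 := hc.1.2.1
  have h6 : I.X side ≤ I.X side * I.m := Nat.le_mul_of_pos_right _ (by omega)
  have h7 : I.cnt side = I.k * (2 * I.e side + I.X side * I.m + I.X side) := by
    unfold cnt; ring
  rw [h7, mul_comm 10, mul_assoc]
  exact Nat.mul_le_mul_left _ (by omega)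

/-- A scan compares each of `q` vertices with the ancestors; the condition `s * dep ≤ n`, checked by
the program, makes this linear in `n`. There are `O(n ^ (k - 1))` nodes. -/
theorem Inp.growT_le (hI : I.Valid) (hc : I.Chk) (hs : side < 2) : I.growT side ≤ 500 * I.k * I.n ^ I.k := by
  have hk2 := hI.hk2
  have hkn := hI.hkn
  have h1 := X_mul_le hc.1 hs
  have hsn := Nat.pow_le_pow_left I.s_le (I.k - 1)
  have h2 := (N_le_pow hI hs).trans hsn
  have h3 := (m_le_pow hI hc).trans hsn
  have h4 : I.e side ≤ 1 := e_le
  have h5 := hc.1.2.1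
  have h6 : I.X side ≤ I.X side * I.m := Nat.le_mul_of_pos_right _ (by omega)
  have hq := I.q_le
  have hqd : I.q * I.dep ≤ I.n := (Nat.mul_le_mul_right _ hq).trans hc.2
  have hsl := I.s_le
  have hs1 : scanTime (I.P side) ≤ 20 * I.n := by
    show I.q * (I.dep * 4 + 12) + 8 ≤ _
    grind
  have hs2 : childTime (I.P side) + 3 ≤ 30 * (I.k * I.n) := by
    show I.k * (scanTime (I.P side) + 5) + 6 + 3 ≤ _
    have h7 : I.k * (scanTime (I.P side) + 5) ≤ I.k * (23 * I.n) := Nat.mul_le_mul_left _ (by omega)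
    have h8 : I.k * (23 * I.n) = 23 * (I.k * I.n) := by ring
    have h9 : 2 * 2 ≤ I.k * I.n := Nat.mul_le_mul hk2 (by omega)
    omega
  have hkn4 : 2 * 2 ≤ I.k * I.n := Nat.mul_le_mul hk2 (by omega)
  have hs3 : ∀ s, expandTime (I.P side) s + 5 ≤ (s + 1) * (35 * (I.k * I.n)) := by
    intro s
    unfold expandTime
    have h7 : (s + 1) * (childTime (I.P side) + 3) ≤ (s + 1) * (30 * (I.k * I.n)) :=
      Nat.mul_le_mul_left _ hs2
    grind
  have hpn : I.n ^ (I.k - 1) * I.n = I.n ^ I.k := by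
    rw [← pow_succ, show I.k - 1 + 1 = I.k by omega]
  have hXm : I.X side * (I.m + 1) ≤ 8 * I.n ^ (I.k - 1) := by
    rw [mul_add, mul_one]
    omega
  have hp1 : 1 ≤ I.n ^ (I.k - 1) := Nat.one_le_pow _ _ (by omega)
  calc I.e side * (expandTime (I.P side) 1 + 5) + I.X side * (expandTime (I.P side) I.m + 5) + 6
      ≤ 1 * ((1 + 1) * (35 * (I.k * I.n))) + I.X side * ((I.m + 1) * (35 * (I.k * I.n))) + 2 * (I.k * I.n) :=
        Nat.add_le_add (Nat.add_le_add (Nat.mul_le_mul h4 (hs3 1)) (Nat.mul_le_mul_left _ (hs3 I.m)))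
          (by omega)
    _ = (I.X side * (I.m + 1)) * (35 * (I.k * I.n)) + 1 * (72 * (I.k * I.n)) := by ring
    _ ≤ (8 * I.n ^ (I.k - 1)) * (35 * (I.k * I.n)) + I.n ^ (I.k - 1) * (72 * (I.k * I.n)) :=
        Nat.add_le_add (Nat.mul_le_mul_right _ hXm) (Nat.mul_le_mul_right _ hp1)
    _ = 352 * I.k * (I.n ^ (I.k - 1) * I.n) := by ring
    _ ≤ 500 * I.k * I.n ^ I.k := by
        rw [hpn]
        grind

theorem Ok.main (hI : I.Valid) (hc : I.Chk) (hb : Big I w B) (hσ : Mem₂ I B σ)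
    (hr : ∀ i < 18, σ.reg i = I.regs B i) (hT : 2000 * I.k * I.n ^ I.k ≤ T) : Ok w G I.S (mainC I.k) σ T
    (Final I G (21 * I.k)) := by
  obtain ⟨hn, hk⟩ := hb.small hI
  have hk2 := hI.hk2
  have hkn := hI.hkn
  have hs := Inp.s_pos hc
  have hskn : I.s ^ I.k ≤ I.n ^ I.k := Nat.pow_le_pow_left I.s_le _
  have hNN : I.N 0 * I.N 1 ≤ I.n ^ I.k := Inp.N_mul_N.trans
    (Nat.pow_le_pow_left (I.q_le.trans I.s_le) _)
  have hnn : I.n ≤ I.n ^ I.k := Nat.le_self_pow (by omega) _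
  have hg0 := Inp.growT_le hI hc (side := 0) (by omega)
  have hg1 := Inp.growT_le hI hc (side := 1) (by omega)
  have hc0 := Inp.cnt_le hI hc (side := 0) (by omega)
  have hc1 := Inp.cnt_le hI hc (side := 1) (by omega)
  have hkN : ∀ x ≤ I.n ^ I.k, x * (2 * I.k + 7) ≤ 8 * (I.k * I.n ^ I.k) := by
    intro x hx
    calc x * (2 * I.k + 7) ≤ I.n ^ I.k * (8 * I.k) := Nat.mul_le_mul hx (by omega)
      _ = _ := by ring
  have t1 := hkN _ hskn
  have t2 := hkN _ hNN
  have t3 := hkN _ hnn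
  have t4 : I.n ^ I.k * 2 ≤ I.n ^ I.k * I.k := Nat.mul_le_mul_left _ hk2
  have t4' : I.n ^ I.k * I.k = I.k * I.n ^ I.k := mul_comm _ _
  have t1' : I.s ^ I.k * (2 * I.k + 6) ≤ I.s ^ I.k * (2 * I.k + 7) := Nat.mul_le_mul_left _ (by omega)
  have t3' : I.n * (I.k + 4) ≤ I.n * (2 * I.k + 7) := Nat.mul_le_mul_left _ (by omega)
  have e1 : 2000 * I.k * I.n ^ I.k = 2000 * (I.k * I.n ^ I.k) := by ring
  have e2 : 500 * I.k * I.n ^ I.k = 500 * (I.k * I.n ^ I.k) := by ring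
  have hBk : (I.n + 1) ^ I.k ≤ B := (Nat.pow_le_pow_left (by omega) _).trans (hb.pow_le (by omega))
  refine Ok.seq (T := I.s ^ I.k * (2 * I.k + 6) + 2) (T' := 1500 * (I.k * I.n ^ I.k)) (Ok.table hI hb hs
    hr hσ.E hσ.sl (tab_empty (Nat.le_add_left 1 _) hBk fun o ho => hσ.zero 3 o (by omega) (by omega) ho) le_rfl) ?_
  rintro σ1 ⟨hr1, hE1, hm1, htab1⟩
  have hready : Ready I B σ1 := by
    refine ⟨hr1, hE1, fun side hs => (hσ.slots side hs).same hm1 (by simp; omega), ?_, ?_, htab1⟩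
    · intro side hs
      refine tab_empty (by omega) (Inp.sized hI hc hb hs).hBh fun o ho => ?_
      rw [hm1 _ o (by simp; omega) ho]
      exact hσ.zero _ o (by omega) (by omega) ho
    · intro i hi
      have := I.s_le
      rw [hm1 6 i (by simp) (by omega), hσ.sl i hi]
  refine Ok.seq (T := I.growT 0 + I.growT 1 + 4) (T' := 400 * (I.k * I.n ^ I.k)) (Ok.grows hI hc hb hready
    le_rfl) ?_
  rintro σ2 ⟨g1, -, g3, g4, g5⟩
  rw [hE1] at g3
  have hcnt : I.cnt 0 + I.cnt 1 ≤ 20 * I.k * I.s ^ (I.k - 1) := by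
    grind
  have hcnt' : 20 * I.k * I.s ^ (I.k - 1) + I.k * I.s ^ (I.k - 1) = 21 * I.k * I.s ^ (I.k - 1) := by ring
  refine Ok.ite (T := 400 * (I.k * I.n ^ I.k) - 1) ?_ ?_
  · intro h20
    cases h0 : I.tree G 0 with
    | none => simp_all
    | some a =>
    cases h1 : I.tree G 1 with
    | none => simp_all
    | some b =>
    obtain ⟨-, hgr⟩ := g4 (a, b) (by rw [h0, h1]; rfl)
    have hr2 : ∀ i < 18, σ2.reg i = I.regs B i := fun i hi => by
      grind
    refine Ok.seq (T := I.N 0 * I.N 1 * (2 * I.k + 7) + 3) (T' := 300 * (I.k * I.n ^ I.k))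
      (Ok.conn hI hc hb hgr hr2 le_rfl) ?_
    rintro σ3 ⟨hr3, hm3, hE3, hfnd⟩
    have hEx : Exposed I.k I.V (21 * I.k * I.s ^ (I.k - 1)) I.E σ3.E := g3.trans hE3 (by omega)
    have hgr3 : Grown I B G a b σ3 := ⟨hgr.slots₀.same (M := []) (sameMem_of_eq hm3) (by simp),
      hgr.slots₁.same (M := []) (sameMem_of_eq hm3) (by simp), hgr.tree₀, hgr.tree₁⟩
    rcases hfnd with ⟨h25, hno⟩ | ⟨h25, i, hi, j, hj, hconn, h26, h27⟩
    · refine Ok.ite (T := 1) (fun h => absurd h25 h) (fun _ => Ok.fail hEx ?_ le_rfl)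
      rintro ⟨-, a', b', ha', hb', i, hi, j, hj, hconn⟩
      grind
    · refine Ok.ite (T := I.n * (I.k + 4) + 7) (fun _ => ?_)
        (fun h => by rw [eval_reg, h25] at h; omega)
      refine (Ok.out hI hc hb hgr3 hr3 hi hj h26 h27 le_rfl).mono le_rfl ?_
      rintro σ4 ⟨f1, f2, f3⟩
      exact ⟨by rw [f1]; exact hEx, fun h => absurd ⟨hc, a, b, h0, h1, i, hi, j, hj, hconn⟩ h,
        fun _ => ⟨a, b, i, j, h0, h1, hi, hj, hconn, hgr.tree₀, hgr.tree₁, f2, f3⟩⟩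
  · intro h20
    refine Ok.fail (g3.mono (by omega)) ?_ (by omega)
    rintro ⟨-, a, b, ha, hb', -⟩
    grind [eval_reg]

theorem Ok.program (hI : I.Valid) (hb : Big I w B) (hD : I.D < 2 ^ w) (hD1 : I.D1 < 2 ^ w) (hσ : Start I σ)
    (hT : 2100 * I.k * I.n ^ I.k ≤ T) : Ok w G I.S (program I.k I.D I.D1) σ T (Final I G (21 * I.k)) := by
  have hw := hb.hw
  obtain ⟨hn, hk⟩ := hb.small hI
  have hk2 := hI.hk2
  have hkn := hI.hkn
  have hnn : I.n ≤ I.n ^ I.k := Nat.le_self_pow (by omega) _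
  have t1 : 2 * I.n ^ I.k ≤ I.k * I.n ^ I.k := Nat.mul_le_mul_right _ hk2
  have t2 : 2100 * I.k * I.n ^ I.k = 2100 * (I.k * I.n ^ I.k) := by ring
  have t3 : 2000 * I.k * I.n ^ I.k = 2000 * (I.k * I.n ^ I.k) := by ring
  refine Ok.seq (T := 2 * I.k + 3) (T' := 2080 * (I.k * I.n ^ I.k)) (Ok.init hI hb hσ le_rfl) ?_
  rintro σ1 ⟨h0, h1, hm1⟩
  refine Ok.seq (T := I.n * 7 + 4) (T' := 2070 * (I.k * I.n ^ I.k)) (Ok.slist hI hb h0 h1 hm1 le_rfl) ?_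
  rintro σ2 ⟨f0, f1, f7, hm2⟩
  have hmem : ∀ σ' : RamState I.n, σ'.mem = σ2.mem → σ'.E = σ2.E → Mem₂ I B σ' := fun σ' h h' =>
    ⟨h'.trans hm2.E, by rw [h]; exact hm2.u, by rw [h]; exact hm2.v,
      fun side hs => (hm2.slots side hs).same (M := []) (sameMem_of_eq h) (by simp),
      by rw [h]; exact hm2.zero, by rw [h]; exact hm2.sl⟩
  have hEx : ∀ σ' : RamState I.n, σ'.E = σ2.E →
      Exposed I.k I.V (21 * I.k * I.s ^ (I.k - 1)) I.E σ'.E := fun σ' h => by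
    rw [h, hm2.E]
    exact Exposed.refl _ _
  refine (Ok.consts (T := 2040 * (I.k * I.n ^ I.k)) hI hb hD hD1 (by simp [Has, f0, f1, f7, Inp.regs]) ?_).mono
    (by omega) (fun _ h => h)
  intro σ3 h3 m3 E3
  have hchk := eval_chkE (σ := σ3) hI hb h3 (by simp) (by rw [m3]; exact hm2.u) (by rw [m3]; exact hm2.v)
  refine Ok.ite (T := 2039 * (I.k * I.n ^ I.k)) ?_ ?_
  · rw [hchk, ind_ne_zero]
    intro hc
    refine (Ok.consts' (T := 2020 * (I.k * I.n ^ I.k)) hI hb hc h3 ?_).mono (by omega) (fun _ h => h)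
    intro σ4 h4 m4 E4
    have hd0 := Inp.d_le hc.2.1 (side := 0)
    have hd1 := Inp.d_le hc.2.1 (side := 1)
    have hsd : I.s * I.dep ≤ (I.n + 2) * (2 * (I.n + 2)) := by
      have := I.s_le
      exact Nat.mul_le_mul (by omega) (by unfold Inp.dep; omega)
    have hB2 := hb.pow_le (j := 2) (by omega)
    have hB2' : (I.n + 2) * (2 * (I.n + 2)) = 2 * (I.n + 2) ^ 2 := by ring
    have hcond : (RamExpr.op .lt (.op .mul (.reg 7) (.reg 6)) (.op .add (.reg 0) (.const 1))).eval w σ4 =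
        ind (I.s * I.dep < I.n + 1) :=
      eval_lt' (eval_mul (x := .reg 7) (y := .reg 6) (h4 7 (by omega)) (h4 6 (by omega))
        (by omega)) (eval_add (x := .reg 0) (h4 0 (by omega)) eval_const
          (by omega))
    refine Ok.ite (T := 2010 * (I.k * I.n ^ I.k)) ?_ ?_
    · rw [hcond, ind_ne_zero]
      intro hlt
      exact Ok.main hI ⟨hc, by omega⟩ hb (hmem σ4 (by rw [m4, m3]) (by rw [E4, E3])) h4 (by omega)
    · rw [hcond]
      intro h
      refine Ok.fail (hEx σ4 (by rw [E4, E3])) ?_ (by omega)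
      rintro ⟨⟨-, h'⟩, -⟩
      rw [ind_true (by omega)] at h
      omega
  · rw [hchk]
    intro h
    refine Ok.fail (hEx σ3 E3) ?_ (by omega)
    rintro ⟨⟨h', -⟩, -⟩
    rw [ind_true h'] at h
    omega

end Output

/-! ### The path found by the search -/

section Levels

variable {P : Par} {G : Finset (Finset (Fin P.n))} {A : Nodes} {U : Finset (List ℕ)} {tot e : ℕ}
variable {i z : ℕ}

theorem anc_shift (A : Nodes) (k z i : ℕ) : A.anc k (A z k) i = A.anc k z (i + 1) := by
  induction i with
  | zero => rfl
  | succ i ih => rw [Nodes.anc, ih]; rfl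

theorem anc_add (A : Nodes) (k z i j : ℕ) : A.anc k (A.anc k z i) j = A.anc k z (i + j) := by
  induction j with
  | zero => rfl
  | succ j ih => rw [Nodes.anc, ih]; rfl

theorem WF.anc_lt (h : WF P G A U tot) (hz : z < tot) (i : ℕ) : A.anc P.k z i < tot :=
  (anc_le hz h.par i).trans_lt hz

/-- The level drops by one from a node to its parent, so a node reaches the root after exactly as
many steps as its level says. -/
theorem WF.lev_anc (h : WF P G A U tot) (hz : z < tot) (hi : i ≤ A z (P.k + 1)) : A (A.anc P.k z i) (P.k + 1) =
    A z (P.k + 1) - i := by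
  induction i with
  | zero => rfl
  | succ i ih =>
    have h1 := ih (by omega)
    have h2 := h.anc_lt hz i
    have h3 : 0 < A.anc P.k z i := by
      rcases Nat.eq_zero_or_pos (A.anc P.k z i) with h0 | h0
      · rw [h0, h.rootlev] at h1; omega
      · exact h0
    have h4 := (h.node _ h3 h2).2.1
    rw [Nodes.anc]
    omega

theorem WF.lev_pos (h : WF P G A U tot) (hz : z < tot) : 0 < z ↔ 0 < A z (P.k + 1) := by
  constructor
  · intro h0
    rw [(h.node z h0 hz).2.1]
    omega
  · intro h0
    rcases Nat.eq_zero_or_pos z with rfl | h1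
    · rw [h.rootlev] at h0; omega
    · exact h1

theorem WF.anc_lev (h : WF P G A U tot) (hz : z < tot) : A.anc P.k z (A z (P.k + 1)) = 0 := by
  have h1 := h.lev_anc hz le_rfl
  have h2 := h.lev_pos (h.anc_lt hz (A z (P.k + 1)))
  omega

theorem WF.anc_pos (h : WF P G A U tot) (hz : z < tot) (hi : i < A z (P.k + 1)) : 0 < A.anc P.k z i := by
  rw [h.lev_pos (h.anc_lt hz i), h.lev_anc hz hi.le]
  omega

theorem start_succ {m : ℕ} (hm : 1 ≤ m) (d : ℕ) : start m (d + 1) = start m d + m ^ d := by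
  obtain ⟨m, rfl⟩ : ∃ m', m = m' + 1 := ⟨m - 1, by omega⟩
  rw [← start_mul, start]
  ring

theorem Tree.lev_stem (h : Tree P G e A U tot) {p : ℕ} (hp : p ≤ e) (hpt : p < tot) : A p (P.k + 1) = p := by
  induction p with
  | zero => exact h.rootlev
  | succ p ih =>
    obtain ⟨-, h2, -⟩ := h.node (p + 1) (by omega) hpt
    rw [h2, h.parent_eq _ (by omega) hpt, parent, if_pos hp, Nat.add_sub_cancel,
      ih (by omega) (by omega)]

/-- Heap numbering: dividing `y - 1` by `P.m` takes the block of numbers of depth `d + 1` to the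
block of depth `d`. So all leaves lie on the same level. -/
theorem Tree.lev_eq (h : Tree P G e A U tot) (hm : 1 ≤ P.m) {d y : ℕ} (h1 : start P.m d ≤ y)
    (h2 : y < start P.m (d + 1)) (hy : e + y < tot) : A (e + y) (P.k + 1) = e + d := by
  induction d generalizing y with
  | zero =>
    simp only [start] at h2
    obtain rfl : y = 0 := by omega
    exact h.lev_stem le_rfl hy
  | succ d ih =>
    rw [start] at h1 h2
    obtain ⟨-, h3, -⟩ := h.node (e + y) (by omega) hy
    have hpar : A (e + y) P.k = e + (y - 1) / P.m := by
      rw [h.parent_eq _ (by omega) hy, parent, if_neg (by omega),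
        show e + y - e - 1 = y - 1 by omega, add_comm]
    have hle : (y - 1) / P.m ≤ y - 1 := Nat.div_le_self _ _
    grind [Nat.le_div_iff_mul_le, mul_comm, Nat.div_lt_iff_lt_mul]

end Levels

section Path

variable {I : Inp} {G : Finset (Finset (Fin I.n))}
variable {f f' i j p p' side tot : ℕ}

theorem Inp.lev_leaf (hc : I.Chk) {A : Nodes} {U : Finset (List ℕ)}
    (h : Tree (I.P side) G (I.e side) A U (I.tot side)) (hi : i < I.N side) : A (I.leaf side i) (I.k + 1) = I.e
    side + I.d side := by
  have hm : 2 ≤ I.m := hc.1.2.1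
  have h1 := leaf_lt hc.1 hi
  have h2 : I.N side ≤ I.m ^ I.d side := Nat.le_pow_clog (by omega) _
  have h3 : I.leaf side i = I.e side + (I.L side + i) := by unfold leaf; omega
  rw [h3] at h1 ⊢
  refine h.lev_eq (show 1 ≤ I.m by omega) (Nat.le_add_right _ _) ?_ h1
  show I.L side + i < start I.m (I.d side + 1)
  rw [start_succ (show 1 ≤ I.m by omega)]
  show I.L side + i < I.L side + I.m ^ I.d side
  omega

/-- The vertices of different sides, levels and positions in the search trees are different. -/
theorem Inp.ent_class (hs : side < 2) {A : Nodes} {U : Finset (List ℕ)}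
    (h : WF (I.P side) G A U tot) (hp0 : 0 < p) (hp : p < tot) (hf : f < I.k) : ∃ i < I.q, A p f = I.sl.getD
    (((side * 3 + A p (I.k + 1) % 3) * I.k + f) * I.q + i) 0 ∧ ((side * 3 + A p (I.k + 1) % 3) * I.k + f) *
    I.q + i < I.s := by
  obtain ⟨h1, h2, h3⟩ := h.node p hp0 hp
  obtain ⟨⟨i, hi, hx⟩, -⟩ := h3 f hf
  rw [← h2] at hx
  exact ⟨i, hi, hx, (class_index_lt hs (Nat.mod_lt _ (by omega)) hf hi).trans_le kq_le⟩

theorem Inp.node_inj (hI : I.Valid) (hs : side < 2) {A : Nodes} {U : Finset (List ℕ)}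
    (h : WF (I.P side) G A U tot) (hp : p < tot) (hf : f < I.k) (hf' : f' < I.k) (he : A p f = A p f') : f =
    f' := by
  rcases Nat.eq_zero_or_pos p with rfl | hp0
  · rw [h.root f hf, h.root f' hf'] at he
    exact (valid_P hI hs).rt_inj f hf f' hf' he
  · obtain ⟨i, hi, h1, h2⟩ := ent_class hs h hp0 hp hf
    obtain ⟨i', hi', h1', h2'⟩ := ent_class hs h hp0 hp hf'
    rw [h1, h1'] at he
    exact (index_inj (Nat.mod_lt _ (by omega)) (Nat.mod_lt _ (by omega)) hf hf' hi hi'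
      (sl_inj h2 h2' he)).2.2.1

/-- The sides use different classes, usable vertices avoid both end tuples, and the end tuples are
disjoint by the check. -/
theorem Inp.side_ne (hI : I.Valid) (hc : I.Chk₁) {A A' : Nodes} {U U' : Finset (List ℕ)} {tot' : ℕ}
    (h : WF (I.P 0) G A U tot) (h' : WF (I.P 1) G A' U' tot') (hp : p < tot) (hp' : p' < tot') (hf : f < I.k)
    (hf' : f' < I.k) : A p f ≠ A' p' f' := by
  intro he
  rcases Nat.eq_zero_or_pos p with rfl | hp0 <;> rcases Nat.eq_zero_or_pos p' with rfl | hp0'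
  · rw [h.root f hf, h'.root f' hf'] at he
    exact hc.1 f hf f' hf' he
  · obtain ⟨i', hi', h1', h2'⟩ := ent_class (by omega) h' hp0' hp' hf'
    rw [h1', h.root f hf] at he
    exact ((sl_usable h2').2 f hf).1 he
  · obtain ⟨i, hi, h1, h2⟩ := ent_class (by omega) h hp0 hp hf
    rw [h1, h'.root f' hf'] at he
    exact ((sl_usable h2).2 f' hf').2 he.symm
  · obtain ⟨i, hi, h1, h2⟩ := ent_class (by omega) h hp0 hp hf
    obtain ⟨i', hi', h1', h2'⟩ := ent_class (by omega) h' hp0' hp' hf'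
    rw [h1, h1'] at he
    have := (index_inj (Nat.mod_lt _ (by omega)) (Nat.mod_lt _ (by omega)) hf hf' hi hi'
      (sl_inj h2 h2' he)).1
    omega

/-- Classes repeat with period 3 along a branch, so disjointness of tuples on the same branch comes
from the test against ancestors, not from the classes. -/
theorem Inp.anc_ne {A : Nodes} {U : Finset (List ℕ)} {z i' : ℕ} (h : WF (I.P side) G A U tot) (hz : z < tot)
    (hi : i < i') (hi' : i' ≤ A z (I.k + 1)) (hdep : i' ≤ I.dep) (hf : f < I.k) (hf' : f' < I.k) : A
    (A.anc I.k z i) f ≠ A (A.anc I.k z i') f' := by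
  have h0 := h.anc_pos (i := i) hz (show i < A z (I.k + 1) by omega)
  have h1 := ((h.node _ h0 (h.anc_lt hz i)).2.2 f hf).2.2.2 (i' - i - 1) (show _ < I.dep by omega) f' hf'
  rw [anc_shift, anc_add] at h1
  intro he
  apply h1
  show A (A.anc I.k z (i + (i' - i - 1 + 1))) f' = A (A.anc I.k z i) f
  rw [he]
  congr 2
  omega

/-- The data of a successful search. -/
structure Found (I : Inp) (G : Finset (Finset (Fin I.n))) (A A' : Nodes) (U U' : Finset (List ℕ))
    (a b : ℕ) : Prop where
  tree₀ : WF (I.P 0) G A U (I.tot 0)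
  tree₁ : WF (I.P 1) G A' U' (I.tot 1)
  ha : a < I.tot 0
  hb : b < I.tot 1
  la : A a (I.k + 1) = I.d 0
  lb : A' b (I.k + 1) = I.d 1 + I.e 1
  conn : I.Conn G A A' a b

variable {A A' : Nodes} {U U' : Finset (List ℕ)} {a b : ℕ}

/-- The tuples of the path are those of nodes of the search trees. -/
theorem Found.path_eq (h : Found I G A A' U U' a b) (hp : p < I.len) :
    (p ≤ I.d 0 ∧ I.path A A' a b p = A (A.anc I.k a (I.d 0 - p))) ∨
    (I.d 0 < p ∧ p - I.d 0 - 1 ≤ I.d 1 + I.e 1 ∧ I.path A A' a b p = A' (A'.anc I.k b (p - I.d 0 - 1))) := by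
  unfold Inp.len at hp
  rcases Nat.lt_or_ge (I.d 0) p with h1 | h1
  · refine Or.inr ⟨h1, by omega, ?_⟩
    funext f
    rw [Inp.path, if_neg (by omega)]
  · refine Or.inl ⟨h1, ?_⟩
    funext f
    rw [Inp.path, if_pos h1]

theorem Found.path_lt (hI : I.Valid) (h : Found I G A A' U U' a b) (hp : p < I.len) (hf : f < I.k) : I.path A A'
    a b p f < I.n := by
  rcases h.path_eq hp with ⟨-, h1⟩ | ⟨-, -, h1⟩ <;> rw [h1]
  · exact h.tree₀.vert (Inp.valid_P hI (by omega)) (h.tree₀.anc_lt h.ha _) hf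
  · exact h.tree₁.vert (Inp.valid_P hI (by omega)) (h.tree₁.anc_lt h.hb _) hf

theorem Found.path_inj (hI : I.Valid) (hc : I.Chk₁) (h : Found I G A A' U U' a b) (hp : p < I.len)
    (hp' : p' < I.len) (hf : f < I.k) (hf' : f' < I.k) (he : I.path A A' a b p f = I.path A A' a b p' f') : p =
    p' ∧ f = f' := by
  have hla := h.la
  have hlb := h.lb
  have he1 : I.e 1 ≤ 1 := Inp.e_le
  have hd : I.dep = I.d 0 + I.d 1 + 3 := rfl
  rcases h.path_eq hp with ⟨g1, h1⟩ | ⟨g1, g1', h1⟩ <;>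
    rcases h.path_eq hp' with ⟨g2, h2⟩ | ⟨g2, g2', h2⟩ <;> rw [h1, h2] at he
  · rcases lt_trichotomy p p' with hlt | rfl | hlt
    · exact absurd he.symm (Inp.anc_ne h.tree₀ h.ha (by omega) (by omega) (by omega) hf' hf)
    · exact ⟨rfl, Inp.node_inj hI (by omega) h.tree₀ (h.tree₀.anc_lt h.ha _) hf hf' he⟩
    · exact absurd he (Inp.anc_ne h.tree₀ h.ha (by omega) (by omega) (by omega) hf hf')
  · exact absurd he (Inp.side_ne hI hc h.tree₀ h.tree₁ (h.tree₀.anc_lt h.ha _)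
      (h.tree₁.anc_lt h.hb _) hf hf')
  · exact absurd he.symm (Inp.side_ne hI hc h.tree₀ h.tree₁ (h.tree₀.anc_lt h.ha _)
      (h.tree₁.anc_lt h.hb _) hf' hf)
  · rcases lt_trichotomy p p' with hlt | rfl | hlt
    · exact absurd he (Inp.anc_ne h.tree₁ h.hb (by omega) (by omega) (by omega) hf hf')
    · exact ⟨rfl, Inp.node_inj hI (by omega) h.tree₁ (h.tree₁.anc_lt h.hb _) hf hf' he⟩
    · exact absurd he.symm (Inp.anc_ne h.tree₁ h.hb (by omega) (by omega) (by omega) hf' hf)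

theorem WF.edge {P : Par} {G : Finset (Finset (Fin P.n))} {U : Finset (List ℕ)} (h : WF P G A U tot)
    (hp0 : 0 < p) (hp : p < tot) (h1 : 1 ≤ j) (hj : j ≤ P.k) : vset P.n
    ((List.range (P.k + 1 - j)).map (A (A p P.k)) ++ (List.range j).map (A p)) ∈ G := by
  have h2 := ((h.node p hp0 hp).2.2 (j - 1) (by omega)).2.1
  convert h2 using 2
  rw [Nodes.base, List.append_assoc, show P.k - (j - 1) = P.k + 1 - j by omega]
  congr 1
  conv_lhs => rw [show j = j - 1 + 1 by omega]
  simp [Nodes.pre, List.range_succ]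

/-- Inside a tree the edges are those found by the scans, and between the trees those tested by
`Inp.Conn`. -/
theorem Found.path_edge (h : Found I G A A' U U' a b) (hp : p + 1 < I.len) (h1 : 1 ≤ j) (hj : j ≤ I.k) : vset
    I.n ((List.range (I.k + 1 - j)).map (I.path A A' a b p) ++ (List.range j).map (I.path A A' a b (p + 1))) ∈
    G := by
  have hla := h.la
  have hlb := h.lb
  rcases h.path_eq (p := p) (by omega) with ⟨g1, e1⟩ | ⟨g1, g1', e1⟩ <;>
    rcases h.path_eq hp with ⟨g2, e2⟩ | ⟨g2, g2', e2⟩ <;> rw [e1, e2]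
  · have h3 : A.anc I.k a (I.d 0 - p) = A (A.anc I.k a (I.d 0 - (p + 1))) I.k := by
      rw [show I.d 0 - p = I.d 0 - (p + 1) + 1 by omega]; rfl
    rw [h3]
    exact h.tree₀.edge (h.tree₀.anc_pos h.ha (show _ < A a (I.k + 1) by omega)) (h.tree₀.anc_lt h.ha _) h1 hj
  · obtain rfl : p = I.d 0 := by omega
    have h3 := h.conn (j - 1) (by omega)
    rw [show I.k - (j - 1) = I.k + 1 - j by omega, show j - 1 + 1 = j by omega] at h3
    aesop
  · omega
  · have h3 : A'.anc I.k b (p + 1 - I.d 0 - 1) = A' (A'.anc I.k b (p - I.d 0 - 1)) I.k := by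
      rw [show p + 1 - I.d 0 - 1 = p - I.d 0 - 1 + 1 by omega]; rfl
    rw [h3]
    -- In the second tree the path runs from child to parent, so the roles of the two tuples are
    -- exchanged and edge `j` becomes edge `k + 1 - j`.
    have h4 := h.tree₁.edge (j := I.k + 1 - j) (h.tree₁.anc_pos h.hb
      (show p - I.d 0 - 1 < A' b (I.k + 1) by omega)) (h.tree₁.anc_lt h.hb _) (by omega)
      (show _ ≤ I.k by omega)
    have h5 : (I.P 1).k + 1 - (I.k + 1 - j) = j := by
      show I.k + 1 - (I.k + 1 - j) = j
      omega
    rw [h5] at h4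
    change vset I.n ((List.range j).map (A' (A' (A'.anc I.k b (p - I.d 0 - 1)) I.k)) ++
      (List.range (I.k + 1 - j)).map (A' (A'.anc I.k b (p - I.d 0 - 1)))) ∈ G at h4
    refine (congrArg (· ∈ G) ?_).mpr h4
    ext x
    rw [mem_vset, mem_vset, List.mem_append, List.mem_append, or_comm]

theorem Found.path_first (h : Found I G A A' U U' a b) (hf : f < I.k) : I.path A A' a b 0 f = I.u f := by
  have h1 := h.tree₀.anc_lev h.ha
  have h2 : A.anc I.k a (A a (I.k + 1)) = 0 := h1
  rw [h.la] at h2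
  rw [Inp.path, if_pos (by omega), Nat.sub_zero, h2]
  exact h.tree₀.root f hf

theorem Found.path_last (h : Found I G A A' U U' a b) (hf : f < I.k) : I.path A A' a b (I.len - 1) f = I.v
    f := by
  have h1 := h.tree₁.anc_lev h.hb
  have h2 : A'.anc I.k b (A' b (I.k + 1)) = 0 := h1
  rw [h.lb] at h2
  unfold Inp.len
  rw [Inp.path, if_neg (by omega), show I.d 0 + I.d 1 + I.e 1 + 2 - 1 - I.d 0 - 1 = I.d 1 + I.e 1 by omega,
    h2]
  exact h.tree₁.root f hf

theorem Found.path_mem (hI : I.Valid) (h : Found I G A A' U U' a b) (hp0 : 0 < p) (hp : p + 1 < I.len)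
    (hf : f < I.k) (x : Fin I.n) (hx : x.val = I.path A A' a b p f) : x ∈ I.S := by
  have key : I.Usable (I.path A A' a b p f) := by
    have hla := h.la
    have hlb := h.lb
    have hlen : I.len = I.d 0 + I.d 1 + I.e 1 + 2 := rfl
    rcases h.path_eq (p := p) (by omega) with ⟨g1, e1⟩ | ⟨g1, g1', e1⟩ <;> rw [e1]
    · obtain ⟨i, hi, h1, h2⟩ := Inp.ent_class (by omega) h.tree₀ (h.tree₀.anc_pos h.ha
        (show I.d 0 - p < A a (I.k + 1) by omega)) (h.tree₀.anc_lt h.ha _) hf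
      have h1' := Inp.sl_usable h2
      rw [← h1] at h1'
      exact h1'
    · obtain ⟨i, hi, h1, h2⟩ := Inp.ent_class (by omega) h.tree₁ (h.tree₁.anc_pos h.hb
        (show p - I.d 0 - 1 < A' b (I.k + 1) by omega)) (h.tree₁.anc_lt h.hb _) hf
      have h1' := Inp.sl_usable h2
      rw [← h1] at h1'
      exact h1'
  rw [← hx] at key
  obtain ⟨y, h1, h2⟩ := Finset.mem_map.1 key.1
  rwa [show y = x from Fin.ext h2] at h1

/-- The initial path of the second tree has length 0 or 1, the parity of the sum of the two depths.
-/
theorem Inp.len_even (I : Inp) : Even I.len := by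
  rw [Nat.even_iff]
  unfold len e
  rw [if_neg (by omega)]
  omega

/-- The bound for the length of the path. -/
def lenBound (k n : ℕ) : ℕ := 2 * (k * Nat.clog (Nat.log 2 n) n) + 3

/-- There are at most `n ^ k` leaves and the branching number is `log₂ n`, so each depth is at most
`k` times the logarithm of `n` to that base. -/
theorem Inp.len_le_bound (hI : I.Valid) (hc : I.Chk) : I.len ≤ lenBound I.k I.n := by
  have hm : 2 ≤ I.m := hc.1.2.1
  have h1 : ∀ side < 2, I.d side ≤ I.k * Nat.clog (Nat.log 2 I.n) I.n := by
    intro side hs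
    refine Nat.clog_le_of_le_pow ?_
    calc I.N side ≤ I.s ^ (I.k - 1) := N_le_pow hI hs
      _ ≤ I.n ^ (I.k - 1) := Nat.pow_le_pow_left s_le _
      _ ≤ I.n ^ I.k := Nat.pow_le_pow_right (by have := hI.hk2; have := hI.hkn; omega) (by omega)
      _ ≤ (I.m ^ Nat.clog I.m I.n) ^ I.k := Nat.pow_le_pow_left (Nat.le_pow_clog (by omega) _) _
      _ = I.m ^ (I.k * Nat.clog (Nat.log 2 I.n) I.n) := by rw [← pow_mul, mul_comm]; rfl
  have h2 := h1 0 (by omega)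
  have h3 := h1 1 (by omega)
  have h4 := I.len_le
  unfold dep at h4
  unfold lenBound
  omega

/-- The logarithm of `n` to base `log₂ n` is at most `log n / log (log₂ n) + 1`, and the denominator
tends to infinity. -/
theorem lenBound_isLittleO (k : ℕ) : (fun n : ℕ => (lenBound k n : ℝ)) =o[Filter.atTop] fun n : ℕ => Real.log
    n := by
  have hlogn : Filter.Tendsto (fun n : ℕ => Real.log (n : ℝ)) Filter.atTop Filter.atTop :=
    Real.tendsto_log_atTop.comp tendsto_natCast_atTop_atTop
  have hlog2 : Filter.Tendsto (fun n : ℕ => Nat.log 2 n) Filter.atTop Filter.atTop := by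
    refine Filter.tendsto_atTop.2 fun b => ?_
    filter_upwards [Filter.eventually_ge_atTop (2 ^ b)] with n hn
    exact Nat.le_log_of_pow_le (by omega) hn
  have hm : Filter.Tendsto (fun n : ℕ => Real.log (Nat.log 2 n : ℝ)) Filter.atTop Filter.atTop :=
    hlogn.comp hlog2
  rw [Asymptotics.isLittleO_iff]
  intro c hc
  filter_upwards [hm.eventually_ge_atTop (4 * k / c + 1), hlogn.eventually_ge_atTop
    ((4 * k + 6) / c), hlog2.eventually_ge_atTop 2, Filter.eventually_ge_atTop 2] with n h1 h2 h3 h4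
  have hlog0 : 0 ≤ Real.log (n : ℝ) := Real.log_nonneg (by exact_mod_cast (by omega : 1 ≤ n))
  rw [Real.norm_of_nonneg (by positivity), Real.norm_of_nonneg hlog0]
  have hk0 : 0 ≤ 4 * (k : ℝ) / c := by positivity
  set M := Real.log (Nat.log 2 n : ℝ) with hM
  have hM0 : 0 < M := by linarith
  have hcl : (Nat.clog (Nat.log 2 n) n : ℝ) * M ≤ Real.log n + M := by
    have h5 : 0 < Nat.clog (Nat.log 2 n) n := Nat.clog_pos (by omega) h4
    have h6 := Nat.pow_pred_clog_lt_self (b := Nat.log 2 n) (by omega) (x := n) (by omega)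
    have h7 : Real.log (((Nat.log 2 n) ^ (Nat.clog (Nat.log 2 n) n).pred : ℕ) : ℝ) ≤ Real.log n :=
      Real.log_le_log (by simp_all) (by exact_mod_cast h6.le)
    rw [Nat.cast_pow, Real.log_pow] at h7
    have h8 : (Nat.clog (Nat.log 2 n) n : ℝ) = ((Nat.clog (Nat.log 2 n) n).pred : ℝ) + 1 := by
      simp_all
    rw [h8]
    linarith
  have h9 : (Nat.clog (Nat.log 2 n) n : ℝ) ≤ Real.log n / M + 1 := by
    rw [← sub_nonneg]
    have : Real.log n / M + 1 - (Nat.clog (Nat.log 2 n) n : ℝ) =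
      (Real.log n + M - (Nat.clog (Nat.log 2 n) n : ℝ) * M) / M := by
      field_simp
    rw [this]
    exact div_nonneg (by linarith) hM0.le
  have h10 : 4 * (k : ℝ) * (Real.log n / M) ≤ c * Real.log n := by
    have h11 : 4 * (k : ℝ) ≤ c * M := by
      have h12 : 4 * (k : ℝ) / c ≤ M := by linarith
      rw [div_le_iff₀ hc] at h12
      linarith
    calc 4 * (k : ℝ) * (Real.log n / M) ≤ (c * M) * (Real.log n / M) :=
          mul_le_mul_of_nonneg_right h11 (by positivity)
      _ = c * Real.log n := by field_simp
  have h13 : 4 * (k : ℝ) + 6 ≤ c * Real.log n := by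
    rw [div_le_iff₀ hc] at h2
    linarith
  unfold lenBound
  push_cast
  nlinarith

end Path

/-! ### The output of the algorithm -/

section Bridge

variable {r n : ℕ}
variable {f : ℕ}

/-- The instance with tuples given as sequences of numbers. -/
abbrev Instance.toInp (I : Instance r n) (D D1 : ℕ) : Inp where
  n := n
  k := r - 1
  D := D
  D1 := D1
  u := fun f => if h : f < r - 1 then (I.u ⟨f, h⟩).val else 0
  v := fun f => if h : f < r - 1 then (I.v ⟨f, h⟩).val else 0
  S := I.S
  E := I.E

variable (I : Instance r n) (D D1 : ℕ)

theorem Instance.toInp_u (hf : f < r - 1) : (I.toInp D D1).u f = (I.u ⟨f, hf⟩).val := dif_pos hf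

theorem Instance.toInp_v (hf : f < r - 1) : (I.toInp D D1).v f = (I.v ⟨f, hf⟩).val := dif_pos hf

theorem Instance.valid_toInp (hr : 3 ≤ r) : (I.toInp D D1).Valid := by
  refine ⟨?_, ?_, ?_, ?_, ?_, ?_⟩
  · show 2 ≤ r - 1
    omega
  · have := Fintype.card_le_of_embedding I.u
    simp_all
  · grind
  · grind
  · grind
  grind

/-- The number of bits of a word as a multiple of the size of the number of vertices. -/
def wordFactor (r D D1 : ℕ) : ℕ := 2 * (r - 1 + 4) + 4 + D + D1

/-- `n + 2` fits into twice the size of `n`, which gives the bits for `8 * (n + 2) ^ (k + 4)`; the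
summands `D` and `D1` of the factor make these constants fit as well. -/
theorem Instance.big_toInp (hr : 3 ≤ r) : Big (I.toInp D D1) (wordFactor r D D1 * Nat.size n)
    ((n + 2) ^ (r - 1 + 4)) ∧ D < 2 ^ (wordFactor r D D1 * Nat.size n) ∧ D1 < 2 ^
    (wordFactor r D D1 * Nat.size n) := by
  have hn : r - 1 ≤ n := (I.valid_toInp D D1 hr).hkn
  have hs : 2 ≤ Nat.size n := Nat.lt_size.2 (by omega)
  have h1 : n < 2 ^ Nat.size n := Nat.lt_size_self n
  have h4 : 2 ^ 2 ≤ 2 ^ Nat.size n := Nat.pow_le_pow_right (by omega) hs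
  have h2 : n + 2 ≤ 2 ^ (2 * Nat.size n) := by
    rw [two_mul, pow_add]
    nlinarith
  have hle : ∀ a, a ≤ wordFactor r D D1 → a ≤ wordFactor r D D1 * Nat.size n := fun a ha =>
    ha.trans (Nat.le_mul_of_pos_right _ (by omega))
  refine ⟨⟨rfl, ?_⟩, ?_, ?_⟩
  · calc 8 * (n + 2) ^ (r - 1 + 4) ≤ 8 * (2 ^ (2 * Nat.size n)) ^ (r - 1 + 4) :=
          Nat.mul_le_mul_left _ (Nat.pow_le_pow_left h2 _)
      _ = 2 ^ (3 + 2 * Nat.size n * (r - 1 + 4)) := by rw [← pow_mul, pow_add]; rfl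
      _ < 2 ^ (wordFactor r D D1 * Nat.size n) := by
        refine Nat.pow_lt_pow_right (by omega) ?_
        unfold wordFactor
        nlinarith
  · exact (Nat.lt_two_pow_self).trans_le (Nat.pow_le_pow_right (by omega) (hle _ (by unfold wordFactor; omega)))
  · exact (Nat.lt_two_pow_self).trans_le (Nat.pow_le_pow_right (by omega) (hle _ (by unfold wordFactor; omega)))

theorem Instance.start_toInp : Start (I.toInp D D1) (initState I) := by
  refine ⟨rfl, ?_, rfl⟩
  intro i
  show (if h : i < r - 1 then _ else _) = if i < r - 1 then _ else if i - (r - 1) < r - 1 then _ else 0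
  grind

theorem Instance.V_toInp : (I.toInp D D1).V ⊆ I.S ∪ verts I.u ∪ verts I.v := by
  grind [Inp.mem_V, verts, Fin.ext]

theorem mem_firstVerts {k m : ℕ} {a : Fin k → Fin n} {g : ℕ → ℕ} (hg : ∀ f : Fin k, (a f).val = g f)
    (hm : m ≤ k) {x : Fin n} : x ∈ firstVerts a m ↔ x.val ∈ (List.range m).map g := by
  rw [firstVerts, mem_image, List.mem_map]
  constructor
  · grind
  · rintro ⟨l, hl, h⟩
    have h1 := List.mem_range.1 hl
    exact ⟨⟨l, by omega⟩, mem_filter.2 ⟨mem_univ _, h1⟩, Fin.ext ((hg _).trans h)⟩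

theorem Instance.isSpikePath_of_found (hr : 3 ≤ r) {G : Finset (Finset (Fin n))} {A A' : Nodes}
    {U U' : Finset (List ℕ)} {x y t : ℕ} (hc : (I.toInp D D1).Chk) (h : Found (I.toInp D D1) G A A' U U' x y)
    (a : Fin t → Fin (r - 1) → Fin n) (ht : t = (I.toInp D D1).len)
    (ha : ∀ i f, (a i f).val = (I.toInp D D1).path A A' x y i f) : IsSpikePath r G t a ∧ Even t ∧ t ≤ lenBound
    (r - 1) n ∧ HasEnds a I.u I.v ∧ InteriorIn a I.S := by
  have hI := I.valid_toInp D D1 hr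
  have hlen : 2 ≤ (I.toInp D D1).len := by unfold Inp.len; omega
  subst ht
  refine ⟨⟨?_, ?_, ?_⟩, Inp.len_even _, Inp.len_le_bound hI hc, ⟨by omega, ?_, ?_⟩, ?_⟩
  · intro i f f' hff
    have h1 := congrArg Fin.val hff
    rw [ha, ha] at h1
    exact Fin.ext (h.path_inj hI hc.1 i.2 i.2 f.2 f'.2 h1).2
  · intro i i' hne
    rw [Finset.disjoint_left]
    intro z hz hz'
    obtain ⟨f, -, rfl⟩ := mem_image.1 hz
    obtain ⟨f', -, h1⟩ := mem_image.1 hz'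
    have h1 := congrArg Fin.val h1
    rw [ha, ha] at h1
    exact hne (Fin.ext (h.path_inj hI hc.1 i.2 i'.2 f.2 f'.2 h1.symm).1)
  · intro i i' hii j hj1 hj2
    have h1 := h.path_edge (p := i) (j := j) (by rw [← hii]; exact i'.2) hj1 hj2
    refine (congrArg (· ∈ G) ?_).mpr h1
    ext z
    rw [mem_union, mem_firstVerts (ha i) (by omega), mem_firstVerts (ha i') hj2, mem_vset,
      List.mem_append, hii, show r - j = (I.toInp D D1).k + 1 - j from by
        grind]
  · funext f
    refine Fin.ext ?_
    rw [ha, h.path_first f.2, I.toInp_u D D1 f.2]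
  · funext f
    refine Fin.ext ?_
    rw [ha, h.path_last f.2, I.toInp_v D D1 f.2]
  · intro i hi0 hi1 z hz
    obtain ⟨f, -, rfl⟩ := mem_image.1 hz
    exact h.path_mem hI hi0 hi1 f.2 _ (ha i f)

/-- What the program computes. -/
theorem Instance.exists_output (hr : 3 ≤ r) (G : Finset (Finset (Fin n))) : ∃ o : Output r n,
    (∃ (T : ℕ) (σ : RamState n), Exec (wordFactor r D D1 * Nat.size n) G I.S (program (r - 1) D D1) (initState
    I) T σ ∧ T ≤ 2100 * (r - 1) * n ^ (r - 1) ∧ Represents σ o) ∧ (∀ (t : ℕ) (a : Fin t → Fin (r - 1) → Fin n),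
    o.path = some ⟨t, a⟩ → IsSpikePath r G t a ∧ Even t ∧ t ≤ lenBound (r - 1) n ∧ HasEnds a I.u I.v ∧
    InteriorIn a I.S) ∧ IsUniform (r - 1) o.E' ∧ I.E ⊆ o.E' ∧ o.E'.card ≤ I.E.card + 21 * (r - 1) * I.S.card ^
    (r - 2) ∧ (∀ e ∈ o.E', e ∉ I.E → e ⊆ I.S ∪ verts I.u ∪ verts I.v) ∧
    (o.path = none → ¬ (I.toInp D D1).Succ G) := by
  have hI := I.valid_toInp D D1 hr
  obtain ⟨hb, hD, hD1⟩ := I.big_toInp D D1 hr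
  obtain ⟨T, σ, h1, h2, h3⟩ := Ok.program (G := G) hI hb hD hD1 (I.start_toInp D D1) le_rfl
  have hE : ∀ o : Output r n, o.E' = σ.E → IsUniform (r - 1) o.E' ∧ I.E ⊆ o.E' ∧
      o.E'.card ≤ I.E.card + 21 * (r - 1) * I.S.card ^ (r - 2) ∧
      (∀ e ∈ o.E', e ∉ I.E → e ⊆ I.S ∪ verts I.u ∪ verts I.v) := by
    rintro o ho
    obtain ⟨g1, g2, g3⟩ := h3.E
    rw [ho]
    refine ⟨fun e he => ?_, g1, g2.trans ?_, fun e he he' => (g3 e he he').2.trans (I.V_toInp D D1)⟩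
    · by_cases h : e ∈ I.E
      · exact I.uniform e h
      · exact (g3 e he h).1
    · refine Nat.add_le_add_left (Nat.mul_le_mul_left _ ?_) _
      exact Nat.pow_le_pow_left Inp.s_le_card _
  by_cases hS : (I.toInp D D1).Succ G
  · obtain ⟨A, A', i, j, -, -, hi, hj, hconn, t0, t1, hr0, hmem⟩ := h3.succ hS
    have hc := hS.1
    have hf : Found (I.toInp D D1) G A.1 A'.1 A.2 A'.2 ((I.toInp D D1).leaf 0 i)
        ((I.toInp D D1).leaf 1 j) := by
      refine ⟨t0.toWF, t1.toWF, Inp.leaf_lt hc.1 hi, Inp.leaf_lt hc.1 hj, ?_, ?_, hconn⟩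
      · rw [Inp.lev_leaf hc t0 hi, Inp.e, if_pos rfl, zero_add]
      · rw [Inp.lev_leaf hc t1 hj, add_comm]
    set path : Fin (I.toInp D D1).len → Fin (r - 1) → Fin n := fun p f =>
      ⟨(I.toInp D D1).path A.1 A'.1 ((I.toInp D D1).leaf 0 i) ((I.toInp D D1).leaf 1 j) p f,
        hf.path_lt hI p.2 f.2⟩
    refine ⟨⟨some ⟨(I.toInp D D1).len, path⟩, σ.E⟩, ⟨T, σ, h1, h2, rfl, ?_, hr0, ?_⟩, ?_, ?_⟩
    · unfold Inp.len; omega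
    · exact fun p f => hmem p p.2 f f.2
    · intro t a h
      have h' := Option.some.inj h
      obtain ⟨rfl, h''⟩ := Sigma.mk.inj h'
      obtain rfl := eq_of_heq h''
      exact I.isSpikePath_of_found D D1 hr hc hf path rfl fun _ _ => rfl
    · obtain ⟨g1, g2, g3, g4⟩ := hE ⟨some ⟨(I.toInp D D1).len, path⟩, σ.E⟩ rfl
      grind
  · obtain ⟨g1, g2, g3, g4⟩ := hE ⟨none, σ.E⟩ rfl
    exact ⟨⟨none, σ.E⟩, ⟨T, σ, h1, h2, rfl, h3.fail hS⟩, fun t a h => by simp at h, g1, g2, g3, g4,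
      fun _ => hS⟩

end Bridge

/-! ### Random subsets -/

section Random

variable {α : Type*} [DecidableEq α] {p : ℝ}
variable {δ δ' : ℝ}

/-- The expectation of `φ` for a random subset of `W` with density `p`. -/
noncomputable def Pr (p : ℝ) (W : Finset α) (φ : Finset α → ℝ) : ℝ :=
  ∑ H ∈ W.powerset, p ^ H.card * (1 - p) ^ (W \ H).card * φ H

theorem weight_nonneg (h0 : 0 ≤ p) (h1 : p ≤ 1) (a b : ℕ) : 0 ≤ p ^ a * (1 - p) ^ b :=
  mul_nonneg (pow_nonneg h0 _) (pow_nonneg (by linarith) _)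

theorem Pr_mono (h0 : 0 ≤ p) (h1 : p ≤ 1) {W : Finset α} {φ ψ : Finset α → ℝ} (h : ∀ H ⊆ W, φ H ≤ ψ H) : Pr p W
    φ ≤ Pr p W ψ :=
  Finset.sum_le_sum fun H hH =>
    mul_le_mul_of_nonneg_left (h H (mem_powerset.1 hH)) (weight_nonneg h0 h1 _ _)

theorem Pr_congr {W : Finset α} {φ ψ : Finset α → ℝ} (h : ∀ H ⊆ W, φ H = ψ H) : Pr p W φ = Pr p W ψ :=
  Finset.sum_congr rfl fun H hH => by rw [h H (mem_powerset.1 hH)]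

/-- The generating function of the binomial distribution. `x = 1` gives total mass one, and `x = 1 /
2` the tail bound for scans. -/
theorem Pr_pow (W : Finset α) (x : ℝ) : Pr p W (fun H => x ^ H.card) = (p * x + (1 - p)) ^ W.card := by
  rw [← Finset.sum_pow_mul_eq_add_pow]
  refine Finset.sum_congr rfl fun H hH => ?_
  rw [Finset.card_sdiff_of_subset (mem_powerset.1 hH), mul_pow]
  ring

theorem Pr_mul_left (W : Finset α) (a : ℝ) (φ : Finset α → ℝ) : Pr p W (fun H => a * φ H) = a * Pr p W φ := by
  rw [Pr, Pr, Finset.mul_sum]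
  exact Finset.sum_congr rfl fun H _ => by ring

theorem Pr_const (W : Finset α) (a : ℝ) : Pr p W (fun _ => a) = a := by
  have h1 := Pr_mul_left (p := p) W a fun H => 1 ^ H.card
  rw [Pr_pow] at h1
  simpa using h1

theorem Pr_add (W : Finset α) (φ ψ : Finset α → ℝ) : Pr p W (fun H => φ H + ψ H) = Pr p W φ + Pr p W ψ := by
  rw [Pr, Pr, Pr, ← Finset.sum_add_distrib]
  exact Finset.sum_congr rfl fun H _ => by ring

theorem Pr_sum {ι : Type*} (s : Finset ι) (W : Finset α) (φ : ι → Finset α → ℝ) : Pr p W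
    (fun H => ∑ i ∈ s, φ i H) = ∑ i ∈ s, Pr p W (φ i) := by
  simp only [Pr]
  rw [Finset.sum_comm]
  exact Finset.sum_congr rfl fun H _ => by rw [Finset.mul_sum]

/-- A random subset is made of independent parts. -/
theorem Pr_split {Z W : Finset α} (hZ : Z ⊆ W) (φ : Finset α → ℝ) : Pr p W φ = Pr p Z fun H₁ => Pr p (W \ Z) fun
    H₂ => φ (H₁ ∪ H₂) := by
  simp only [Pr, Finset.mul_sum]
  rw [← Finset.sum_product']
  refine Finset.sum_nbij' (fun H => (H ∩ Z, H \ Z)) (fun q => q.1 ∪ q.2) ?_ ?_ ?_ ?_ ?_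
  · grind
  · grind
  · grind
  · rintro ⟨H₁, H₂⟩ hH
    rw [mem_product, mem_powerset, mem_powerset] at hH
    have h2 : Disjoint H₂ Z := disjoint_of_subset_left hH.2 sdiff_disjoint
    rw [union_inter_distrib_right, inter_eq_left.2 hH.1, disjoint_iff_inter_eq_empty.1 h2, union_empty,
      union_sdiff_distrib, sdiff_eq_empty_iff_subset.2 hH.1, empty_union, sdiff_eq_self_of_disjoint h2]
  · intro H hH
    have h2 : (W \ H).card = (Z \ (H ∩ Z)).card + ((W \ Z) \ (H \ Z)).card := by
      rw [← card_inter_add_card_sdiff (W \ H) Z]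
      congr 2
      · grind
      grind
    grind [union_comm, sdiff_union_inter, pow_add]

open Classical in
/-- The probability that a random set contains a given set. -/
theorem Pr_subset {K W : Finset α} (hK : K ⊆ W) : Pr p W (fun H => if K ⊆ H then 1 else 0) = p ^ K.card := by
  rw [Pr_split hK]
  have h1 : ∀ H₁ ⊆ K, (Pr p (W \ K) fun H₂ => if K ⊆ H₁ ∪ H₂ then (1 : ℝ) else 0) = if H₁ = K then 1 else 0 := by
    intro H₁ h₁
    rw [← Pr_const (p := p) (W \ K) (if H₁ = K then (1 : ℝ) else 0)]
    refine Pr_congr fun H₂ h₂ => if_congr ?_ rfl rfl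
    grind
  rw [Pr_congr h1, Pr, Finset.sum_eq_single K]
  · simp
  · intro H _ hH
    simp [hH]
  grind

open Classical in
/-- The probability that a random set contains none of some disjoint sets of size `k`. -/
theorem Pr_none (h0 : 0 ≤ p) (h1 : p ≤ 1) {ι : Type*} (s : Finset ι) (K : ι → Finset α) {k : ℕ} {W : Finset α}
    (hK : ∀ i ∈ s, K i ⊆ W) (hk : ∀ i ∈ s, (K i).card ≤ k)
    (hd : ∀ i ∈ s, ∀ j ∈ s, i ≠ j → Disjoint (K i) (K j)) : Pr p W
    (fun H => if ∃ i ∈ s, K i ⊆ H then 0 else 1) ≤ (1 - p ^ k) ^ s.card := by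
  induction s using Finset.induction_on generalizing W with
  | empty => simp [Pr_const]
  | insert i s hi ih =>
    have hKi : K i ⊆ W := hK i (mem_insert_self _ _)
    rw [Pr_split hKi, card_insert_of_notMem hi, pow_succ]
    have h2 : ∀ H₁ ⊆ K i, (Pr p (W \ K i) fun H₂ => if ∃ j ∈ insert i s, K j ⊆ H₁ ∪ H₂ then (0 : ℝ) else 1) ≤
        (1 - p ^ k) ^ s.card * (1 - if K i ⊆ H₁ then 1 else 0) := by
      intro H₁ h₁
      split_ifs with h3
      · rw [← Pr_const (p := p) (W \ K i) ((1 - p ^ k) ^ s.card * (1 - 1))]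
        refine Pr_mono h0 h1 fun H₂ h₂ => ?_
        rw [if_pos ⟨i, mem_insert_self _ _, h3.trans subset_union_left⟩]
        simp
      · rw [sub_zero, mul_one]
        refine le_trans (Pr_mono h0 h1 fun H₂ h₂ => ?_) (ih (W := W \ K i) ?_ ?_ ?_)
        · split_ifs with h4 h5 h5
          · exact le_rfl
          · exact zero_le_one
          · grind
          · exact le_rfl
        · grind [subset_sdiff, mem_insert_of_mem, mem_insert_self]
        · grind
        grind
    refine (Pr_mono h0 h1 h2).trans ?_
    rw [Pr_mul_left]
    refine mul_le_mul_of_nonneg_left ?_ (pow_nonneg (by have := pow_le_one₀ (n := k) h0 h1; linarith) _)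
    have h5 := Pr_add (p := p) (K i) (fun H => 1 - if K i ⊆ H then 1 else 0) (fun H => if K i ⊆ H then 1 else 0)
    simp only [sub_add_cancel] at h5
    rw [Pr_const, Pr_subset subset_rfl] at h5
    have h6 : p ^ k ≤ p ^ (K i).card := pow_le_pow_of_le_one h0 h1 (hk i (mem_insert_self _ _))
    linarith

/-! ### Failure of searches in a random set -/

/-- The search `c` in a set containing a random subset of `W` fails with probability at most `δ`;
if it does not fail, then it leaves a random subset of a set `W'` with the property `Q`. -/
def Tri {σ : Type*} (p : ℝ) (W : Finset α) (c : Finset α → Option σ) (δ : ℝ)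
    (Q : σ → Finset α → Prop) : Prop :=
  ∀ (F : Finset α) (φ : σ → Finset α → ℝ) (ε : ℝ), 0 ≤ ε → (∀ s G, 0 ≤ φ s G) → (∀ s G, φ s G ≤ 1) →
    (∀ s F' W', Q s W' → Pr p W' (fun H => φ s (F' ∪ H)) ≤ ε) →
    Pr p W (fun H => (c (F ∪ H)).elim 1 fun s => φ s (F ∪ H)) ≤ δ + ε

/-- The second search followed by `φ` is again a test function with values in [0, 1]. This is the
reason for quantifying over `φ` in the definition of `Tri`: failure bounds of searches done in
sequence add up without conditioning. -/
theorem Tri.bind {σ τ : Type*} {W : Finset α} {c : Finset α → Option σ} {c' : Finset α → σ → Option τ}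
    {Q : σ → Finset α → Prop} {Q' : τ → Finset α → Prop} (hδ : 0 ≤ δ') (h : Tri p W c δ Q)
    (h' : ∀ s W', Q s W' → Tri p W' (fun G => c' G s) δ' Q') : Tri p W (fun G => (c G).bind (c' G)) (δ + δ')
    Q' := by
  intro F φ ε hε hφ hφ1 hQ
  have h1 := h F (fun s G => (c' G s).elim 1 fun t => φ t G) (δ' + ε) (by linarith) ?_ ?_ ?_
  · rw [add_assoc]
    refine le_trans (le_of_eq (Pr_congr fun H _ => ?_)) h1
    dsimp only
    cases c (F ∪ H) <;> rfl
  · intro s G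
    cases c' G s
    · exact zero_le_one
    · exact hφ _ _
  · intro s G
    cases c' G s
    · exact le_rfl
    · exact hφ1 _ _
  · intro s F' W' hs
    exact h' s W' hs F' φ ε hε hφ hφ1 hQ

theorem Tri.mono {σ : Type*} {W : Finset α} {c : Finset α → Option σ} {Q Q' : σ → Finset α → Prop}
    (h : Tri p W c δ Q) (hδ : δ ≤ δ') (hQ : ∀ s W', Q s W' → Q' s W') : Tri p W c δ' Q' := by
  intro F φ ε hε hφ hφ1 h'
  exact (h F φ ε hε hφ hφ1 fun s F' W' hs => h' s F' W' (hQ s W' hs)).trans (by linarith)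

theorem Tri.some {σ : Type*} {W : Finset α} {s : σ} {Q : σ → Finset α → Prop} (hQ : Q s W) : Tri p W
    (fun _ => Option.some s) 0 Q := by
  intro F φ ε _ _ _ h
  rw [zero_add]
  exact h s F W hQ

theorem Tri.map {σ τ : Type*} {W : Finset α} {c : Finset α → Option σ} {f : σ → τ} {Q : σ → Finset α → Prop}
    {Q' : τ → Finset α → Prop} (h : Tri p W c δ Q) (hQ : ∀ s W', Q s W' → Q' (f s) W') : Tri p W
    (fun G => (c G).map f) δ Q' := by
  have h1 := h.bind (c' := fun _ s => Option.some (f s)) (δ' := 0) (Q' := Q') le_rfl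
    fun s W' hs => Tri.some (hQ s W' hs)
  rw [add_zero] at h1
  simp only [Option.map_eq_bind]
  exact h1

theorem Tri.loopM {σ : Type*} {W : Finset α} {f : Finset α → ℕ → σ → Option σ} {a : σ} {N : ℕ} (hδ : 0 ≤ δ)
    (Q : ℕ → σ → Finset α → Prop) (h0 : Q 0 a W)
    (h : ∀ i < N, ∀ s W', Q i s W' → Tri p W' (fun G => f G i s) δ (Q (i + 1))) : Tri p W
    (fun G => loopM (f G) N a) (N * δ) (Q N) := by
  induction N with
  | zero =>
    rw [Nat.cast_zero, zero_mul]
    exact Tri.some h0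
  | succ N ih =>
    rw [Nat.cast_succ, add_mul, one_mul]
    exact (ih fun i hi => h i (by omega)).bind hδ (h N (by omega))

end Random

/-! ### A single scan in a random hypergraph -/

section Scan

variable {P : Par} {p : ℝ} {A : Nodes} {U : Finset (List ℕ)} {g c j s : ℕ}
  {W : Finset (Finset (Fin P.n))}

/-- The sets that are inspected by a scan. -/
noncomputable def Par.asked (P : Par) (A : Nodes) (U : Finset (List ℕ)) (g c j : ℕ) :
    Finset (Finset (Fin P.n)) :=
  (P.cands A U g c j P.q).toFinset.image fun x => vset P.n (A.base P.k g c j ++ [x])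

/-- The outcome of a scan depends on the asked sets only, so everything else stays random
afterwards. -/
theorem scan_congr {G G' : Finset (Finset (Fin P.n))}
    (h : ∀ z ∈ P.asked A U g c j, z ∈ G ↔ z ∈ G') : P.scan G s U g c j A = P.scan G' s U g c j A := by
  have : P.hits G A U g c j P.q = P.hits G' A U g c j P.q := by
    refine List.filter_congr fun x hx => ?_
    rw [decide_eq_decide]
    exact h _ (mem_image.2 ⟨x, List.mem_toFinset.2 hx, rfl⟩)
  rw [Par.scan, Par.scan, this]

/-- With `H₁` the random part of the asked sets, failure means fewer than `s` hits, so `|H₁| < s`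
and `2 ^ s * (1 / 2) ^ |H₁| ≥ 1`. The expectation of this weight is `2 ^ s * (1 - p / 2) ^ |Z|`, by
the generating function. The known part `F` can only contribute further hits. -/
theorem Tri.scan (h0 : 0 ≤ p) (h1 : p ≤ 1) (hP : P.Valid) (hj : j < P.k) {N : ℕ}
    (hN : N ≤ (P.cands A U g c j P.q).length) (hW : P.asked A U g c j ⊆ W)
    (hinj : ∀ x ∈ P.cands A U g c j P.q, ∀ y ∈ P.cands A U g c j P.q,
      vset P.n (A.base P.k g c j ++ [x]) = vset P.n (A.base P.k g c j ++ [y]) → x = y) :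
    Tri p W (fun G => P.scan G s U g c j A) (2 ^ s * (1 - p / 2) ^ N)
      (fun A' W' => (∃ G', P.scan G' s U g c j A = Option.some A') ∧ W' = W \ P.asked A U g c j) := by
  intro F φ ε hε hφ hφ1 hQ
  set Z := P.asked A U g c j with hZ
  have hcard : (P.cands A U g c j P.q).length = Z.card := by
    rw [hZ, Par.asked, Finset.card_image_of_injOn, List.toFinset_card_of_nodup (nodup_cands hP hj le_rfl)]
    intro x hx y hy
    grind [List.mem_toFinset]
  rw [Pr_split hW]
  have key : ∀ H₁ ⊆ Z, (Pr p (W \ Z) fun H₂ => (P.scan (F ∪ (H₁ ∪ H₂)) s U g c j A).elim 1 fun s =>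
      φ s (F ∪ (H₁ ∪ H₂))) ≤ 2 ^ s * (1 / 2) ^ H₁.card + ε := by
    intro H₁ h₁
    have hsc : ∀ H₂ ⊆ W \ Z, P.scan (F ∪ (H₁ ∪ H₂)) s U g c j A = P.scan (F ∪ H₁) s U g c j A := by
      grind [scan_congr]
    by_cases hs : s ≤ (P.hits (F ∪ H₁) A U g c j P.q).length
    · have h3 : P.scan (F ∪ H₁) s U g c j A = Option.some _ := if_pos hs
      have h4 := hQ _ (F ∪ H₁) (W \ Z) ⟨⟨_, h3⟩, rfl⟩
      have h5 : (0 : ℝ) ≤ 2 ^ s * (1 / 2) ^ H₁.card := by positivity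
      grind [le_trans, le_of_eq, Pr_congr, union_assoc]
    · have h3 : P.scan (F ∪ H₁) s U g c j A = none := if_neg hs
      have h4 : H₁.card ≤ (P.hits (F ∪ H₁) A U g c j P.q).length := by
        have h5 : H₁ ⊆ (P.hits (F ∪ H₁) A U g c j P.q).toFinset.image
            fun x => vset P.n (A.base P.k g c j ++ [x]) := by
          intro z hz
          obtain ⟨x, hx, rfl⟩ := mem_image.1 (h₁ hz)
          grind [List.mem_toFinset, mem_hits, mem_union_right]
        exact (Finset.card_le_card h5).trans (Finset.card_image_le.trans (List.toFinset_card_le _))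
      have h5 : (1 : ℝ) ≤ 2 ^ s * (1 / 2) ^ H₁.card := by
        have h6 : ((1 : ℝ) / 2) ^ s ≤ (1 / 2) ^ H₁.card :=
          pow_le_pow_of_le_one (by norm_num) (by norm_num) (by omega)
        calc (1 : ℝ) = 2 ^ s * (1 / 2) ^ s := by rw [← mul_pow]; norm_num
          _ ≤ _ := mul_le_mul_of_nonneg_left h6 (by positivity)
      refine le_trans (le_of_eq (Pr_congr (ψ := fun _ => 1) fun H₂ h₂ => ?_)) ?_
      · rw [hsc H₂ h₂, h3, Option.elim_none]
      · rw [Pr_const]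
        linarith
  refine (Pr_mono h0 h1 key).trans ?_
  rw [Pr_add, Pr_mul_left, Pr_const, Pr_pow, show p * (1 / 2) + (1 - p) = 1 - p / 2 by ring]
  have h6 : (1 - p / 2) ^ Z.card ≤ (1 - p / 2) ^ N :=
    pow_le_pow_of_le_one (by linarith) (by linarith) (by omega)
  have h7 : (2 : ℝ) ^ s * (1 - p / 2) ^ Z.card ≤ 2 ^ s * (1 - p / 2) ^ N :=
    mul_le_mul_of_nonneg_left h6 (by positivity)
  linarith

end Scan

/-! ### Classes of vertices -/

section Classes

variable (I : Inp)
variable {X X' Y Y' f i j j' side κ : ℕ} {l l' : List ℕ}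

open Classical in
/-- The number of the class of a vertex; the end tuples make up further classes. -/
noncomputable def Inp.cls (x : ℕ) : ℕ :=
  if x ∈ I.sl then I.sl.idxOf x / I.q
  else if x ∈ (List.range I.k).map I.u then 6 * I.k + ((List.range I.k).map I.u).idxOf x
  else 7 * I.k + ((List.range I.k).map I.v).idxOf x

/-- The first `a` classes of block `X`. -/
def Inp.blk (X a : ℕ) : List ℕ := (List.range a).map fun f => X * I.k + f

variable {I}

theorem Inp.mem_sl {x : ℕ} : x ∈ I.sl ↔ I.Usable x := by
  rw [Inp.sl, mem_slUpTo]
  refine ⟨fun h => h.2, fun h => ⟨?_, h⟩⟩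
  obtain ⟨y, -, rfl⟩ := Finset.mem_map.1 h.1
  exact y.2

theorem Inp.cls_sl (hi : i < I.q) (hκ : κ < 6 * I.k) : I.cls (I.sl.getD (κ * I.q + i) 0) = κ := by
  have h1 : κ * I.q + i < I.sl.length := by
    refine lt_of_lt_of_le ?_ I.kq_le
    calc κ * I.q + i < κ * I.q + I.q := by omega
      _ = (κ + 1) * I.q := by ring
      _ ≤ _ := Nat.mul_le_mul_right _ hκ
  rw [List.getD_eq_getElem _ _ h1, Inp.cls, if_pos (List.getElem_mem h1), List.Nodup.idxOf_getElem nodup_sl,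
    mul_comm, Nat.mul_add_div (by omega), Nat.div_eq_of_lt hi, add_zero]

theorem idxOf_map_range {k : ℕ} {u : ℕ → ℕ} (hf : f < k) (hu : ∀ f < k, ∀ f' < k, u f = u f' → f = f') :
    ((List.range k).map u).idxOf (u f) = f := by
  have hn : ((List.range k).map u).Nodup := List.Nodup.map_on
    (fun a ha b hb h => hu a (List.mem_range.1 ha) b (List.mem_range.1 hb) h) List.nodup_range
  have h1 := hn.idxOf_getElem f (by simpa using hf)
  simpa using h1

theorem Inp.cls_rt (hI : I.Valid) (hd : ∀ f < I.k, ∀ f' < I.k, I.u f ≠ I.v f') (hs : side < 2) (hf : f < I.k) :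
    I.cls (I.rt side f) = (6 + side) * I.k + f := by
  interval_cases side
  · show I.cls (I.u f) = _
    rw [Inp.cls, if_neg (fun h => ((mem_sl.1 h).2 f hf).1 rfl),
      if_pos (List.mem_map.2 ⟨f, List.mem_range.2 hf, rfl⟩), idxOf_map_range hf hI.u_inj]
  · show I.cls (I.v f) = _
    rw [Inp.cls, if_neg (fun h => ((mem_sl.1 h).2 f hf).2 rfl), if_neg, idxOf_map_range hf hI.v_inj]
    grind

theorem Inp.cls_vtx {lev : ℕ} (hs : side < 2) (hj : j < I.k) (hi : i < I.q) : I.cls ((I.P side).vtx lev j i) =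
    (side * 3 + lev % 3) * I.k + j := by
  refine cls_sl hi ?_
  show (side * 3 + lev % 3) * I.k + j < 6 * I.k
  have : (side * 3 + lev % 3) * I.k ≤ 5 * I.k := Nat.mul_le_mul_right _ (by omega)
  omega

theorem Inp.mem_blk {a : ℕ} : κ ∈ I.blk X a ↔ ∃ f < a, κ = X * I.k + f := by
  simp only [Inp.blk, List.mem_map, List.mem_range]
  exact ⟨fun ⟨f, h, h'⟩ => ⟨f, h, h'.symm⟩, fun ⟨f, h, h'⟩ => ⟨f, h, h'.symm⟩⟩

/-- The classes of a list consisting of parts of two tuples. -/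
def Inp.Shape (I : Inp) (X Y j : ℕ) (l : List ℕ) : Prop :=
  X ≠ Y ∧ j < I.k ∧ (∀ x ∈ l, x < I.n) ∧ l.map I.cls = I.blk X (I.k - j) ++ I.blk Y (j + 1)

theorem Inp.Shape.nodup_cls (h : I.Shape X Y j l) : (l.map I.cls).Nodup := by
  obtain ⟨hne, hj, -, h⟩ := h
  rw [h, List.nodup_append]
  refine ⟨?_, ?_, ?_⟩
  · exact List.Nodup.map (fun a b h => by simpa using h) List.nodup_range
  · exact List.Nodup.map (fun a b h => by simpa using h) List.nodup_range
  · intro a ha b hb hab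
    obtain ⟨f, hf, rfl⟩ := mem_blk.1 ha
    obtain ⟨f', hf', rfl⟩ := mem_blk.1 hb
    exact hne (addr_inj (by omega) (by omega) hab).1

theorem Inp.Shape.nodup (h : I.Shape X Y j l) : l.Nodup :=
  List.Nodup.of_map I.cls h.nodup_cls

theorem Inp.Shape.length (h : I.Shape X Y j l) : l.length = I.k + 1 := by
  obtain ⟨hne, hj, -, h⟩ := h
  have h1 := congrArg List.length h
  simp only [List.length_map, List.length_append, Inp.blk, List.length_range] at h1
  omega

/-- Lists with the same set of vertices are equal if the blocks are in the same order. -/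
theorem Inp.Shape.inj (h : I.Shape X Y j l) (h' : I.Shape X' Y' j' l') (hXY : ¬ (X = Y' ∧ Y = X'))
    (hv : vset I.n l = vset I.n l') : j = j' ∧ X = X' ∧ Y = Y' ∧ l = l' := by
  have hnc := h'.nodup_cls
  obtain ⟨hne, hj, hl, hc⟩ := h
  obtain ⟨hne', hj', hl', hc'⟩ := h'
  rw [vset_eq_iff hl hl'] at hv
  have hmem : ∀ κ, κ ∈ I.blk X (I.k - j) ++ I.blk Y (j + 1) ↔ κ ∈ I.blk X' (I.k - j') ++ I.blk Y' (j' + 1) := by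
    grind
  simp only [List.mem_append, mem_blk] at hmem
  have hX : X = X' ∨ X = Y' := by
    rcases (hmem (X * I.k + 0)).1 (Or.inl ⟨0, by omega, rfl⟩) with ⟨f, hf, h1⟩ | ⟨f, hf, h1⟩
    · exact Or.inl (addr_inj (by omega) (by omega) h1).1
    · exact Or.inr (addr_inj (by omega) (by omega) h1).1
  have hY : Y = X' ∨ Y = Y' := by
    rcases (hmem (Y * I.k + 0)).1 (Or.inr ⟨0, by omega, rfl⟩) with ⟨f, hf, h1⟩ | ⟨f, hf, h1⟩
    · exact Or.inl (addr_inj (by omega) (by omega) h1).1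
    · exact Or.inr (addr_inj (by omega) (by omega) h1).1
  -- Both lists start with position 0 of either block, so the pairs of blocks agree as unordered
  -- pairs; exchanging them is excluded by hypothesis.
  obtain ⟨rfl, rfl⟩ : X = X' ∧ Y = Y' := by
    grind
  -- Position `j` is the last one of block `Y` that occurs, so the set of classes determines `j`.
  have hjj : j = j' := by
    have a1 : j ≤ j' := by
      rcases (hmem (Y * I.k + j)).1 (Or.inr ⟨j, by omega, rfl⟩) with ⟨f, hf, h1⟩ | ⟨f, hf, h1⟩
      · exact absurd (addr_inj (by omega) (by omega) h1).1.symm hne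
      · omega
    have a2 : j' ≤ j := by
      rcases (hmem (Y * I.k + j')).2 (Or.inr ⟨j', by omega, rfl⟩) with ⟨f, hf, h1⟩ | ⟨f, hf, h1⟩
      · exact absurd (addr_inj (by omega) (by omega) h1).1.symm hne
      · omega
    omega
  subst hjj
  refine ⟨rfl, rfl, rfl, ?_⟩
  have hcc : l.map I.cls = l'.map I.cls := hc.trans hc'.symm
  have hlen : l.length = l'.length := by
    have := congrArg List.length hcc
    simpa using this
  refine List.ext_getElem hlen fun i h1 h2 => ?_
  obtain ⟨i', h3, h4⟩ := List.getElem_of_mem ((hv _).1 (List.getElem_mem h1))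
  have h5 : I.cls l[i] = I.cls l'[i] := by
    have := List.getElem_of_eq hcc (i := i) (by simpa using h1)
    simpa using this
  rw [← h4] at h5 ⊢
  have h6 : i' = i := by
    rw [← List.Nodup.getElem_inj_iff hnc (hi := by simpa using h3) (hj := by simpa using h2)]
    simpa using h5
  subst h6
  rfl

/-- Pairs of blocks for sets inspected in a search tree. -/
def TreeBlocks (side X Y : ℕ) : Prop :=
  (X = 6 + side ∧ Y = side * 3 + 1) ∨ ∃ a < 3, X = side * 3 + a ∧ Y = side * 3 + (a + 1) % 3

theorem TreeBlocks.ne (hs : side < 2) (h : TreeBlocks side X Y) : X ≠ Y := by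
  grind [TreeBlocks]

/-- Three levels form an oriented cycle without opposite arcs. With levels modulo 2 the parent and
the child block could not be told apart. -/
theorem TreeBlocks.order (hs : side < 2) (h : TreeBlocks side X Y) (h' : TreeBlocks side X' Y') : ¬
    (X = Y' ∧ Y = X') := by
  grind [TreeBlocks]

/-- Lists of vertices of sets inspected in a search tree. -/
def Inp.TreeShape (I : Inp) (side j : ℕ) (l : List ℕ) : Prop :=
  ∃ X Y, TreeBlocks side X Y ∧ I.Shape X Y j l

theorem Inp.TreeShape.inj (hs : side < 2) (h : I.TreeShape side j l) (h' : I.TreeShape side j' l')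
    (hv : vset I.n l = vset I.n l') : j = j' ∧ l = l' := by
  obtain ⟨X, Y, h1, h2⟩ := h
  obtain ⟨X', Y', h1', h2'⟩ := h'
  obtain ⟨h3, -, -, h4⟩ := h2.inj h2' (h1.order hs h1') hv
  exact ⟨h3, h4⟩

/-- The beginning of a tuple that identifies the search in which a set is inspected. -/
def Inp.key (I : Inp) (side j : ℕ) (l : List ℕ) : List ℕ :=
  if j < I.h side then l.take (I.h side) else (l.drop (I.k - j)).take (I.h side)

/-- The set `W` contains all sets not in `X` that may be inspected in a search tree and do not belong
to a search in `K`, and all members of `W₀` that are not inspected in search trees of this side. -/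
structure Inp.Fresh (I : Inp) (side : ℕ) (X W₀ : Finset (Finset (Fin I.n))) (K : ℕ → List ℕ → Prop)
    (W : Finset (Finset (Fin I.n))) : Prop where
  legal : ∀ j l, I.TreeShape side j l → vset I.n l ∉ X → ¬ K j (I.key side j l) → vset I.n l ∈ W
  keep : ∀ z ∈ W₀, (∀ j l, I.TreeShape side j l → vset I.n l ≠ z) → z ∈ W

theorem Inp.Fresh.mono {X W₀ W : Finset (Finset (Fin I.n))} {K K' : ℕ → List ℕ → Prop}
    (h : I.Fresh side X W₀ K W) (hK : ∀ j < I.k, ∀ l, K j l → K' j l) : I.Fresh side X W₀ K' W :=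
  ⟨fun j l h1 h2 h3 => h.legal j l h1 h2 fun h4 => h3 (hK j (by obtain ⟨_, _, -, -, h5, -⟩ := h1; exact h5) _ h4),
    h.keep⟩

end Classes

/-! ### Searching in a random hypergraph -/

section Search

/-- The hypotheses on the input under which the search succeeds; the edges in `X` are not random. -/
structure Inp.Hyp (I : Inp) (X : Finset (Finset (Fin I.n))) : Prop where
  valid : I.Valid
  chk : I.Chk
  card_E : ∀ e ∈ I.E, e.card = I.k
  mix : ∀ e ∈ I.E, ∀ x ∈ e, ∀ y ∈ e, I.Usable x.val → ∀ f < I.k, ∀ side < 2, I.rt side f ≠ y.val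
  cover : ∀ z ∈ X, ∃ e ∈ I.E, e ⊆ z
  ends : ∀ side < 2, ∀ x, I.Usable x → vset I.n ((List.range I.k).map (I.rt side) ++ [x]) ∉ X
  UE_lt : I.UE.card < (I.q / I.D1 + 1) ^ I.k
  tot_lt : ∀ side < 2, I.tot side < (I.q / 8 + 1) ^ I.h side
  excl : 2 ^ I.k * (I.q / I.D1) + I.q / 8 + I.dep * I.k ≤ I.q / 2

variable {I : Inp} {X W₀ W : Finset (Finset (Fin I.n))} {side : ℕ}
variable {l : List ℕ} {f i q s tot x : ℕ}

theorem digits_surj {k : ℕ} (a : ℕ → ℕ) (ha : ∀ i < k, a i < s) : ∃ c < s ^ k, ∀ i < k, c / s ^ i % s = a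
    i := by
  induction k generalizing a with
  | zero => exact ⟨0, by simp, by simp⟩
  | succ k ih =>
    obtain ⟨c, hc, h⟩ := ih (fun i => a (i + 1)) fun i hi => ha (i + 1) (by omega)
    have h0 := ha 0 (by omega)
    have hdiv : (a 0 + s * c) / s = c := by
      rw [Nat.add_mul_div_left _ _ (by omega), Nat.div_eq_of_lt h0, zero_add]
    refine ⟨a 0 + s * c, ?_, ?_⟩
    · calc a 0 + s * c < s + s * c := by omega
        _ = s * (c + 1) := by ring
        _ ≤ s * s ^ k := Nat.mul_le_mul_left _ hc
        _ = s ^ (k + 1) := by ring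
    · intro i hi
      cases i with
      | zero => rw [pow_zero, Nat.div_one, Nat.add_mul_mod_self_left, Nat.mod_eq_of_lt h0]
      | succ i => rw [pow_succ', ← Nat.div_div_eq_div_mul, hdiv, h i (by omega)]

/-- The numbers below `s ^ k` run through all sequences of `k` usable vertices. In particular every
ordering of an old base counts, so overload does not depend on the order in which a base arises. -/
theorem Inp.mem_UE : l ∈ I.UE ↔ l.length = I.k ∧ (∀ x ∈ l, I.Usable x) ∧ vset I.n l ∈ I.E := by
  rw [UE, UEUpTo, mem_image]
  constructor
  · rintro ⟨c, hc, rfl⟩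
    grind [seq, sl_usable, Nat.mod_lt, Nat.pos_of_ne_zero, zero_pow]
  · rintro ⟨h1, h2, h3⟩
    have h4 : ∀ i : ℕ, ∃ a, i < I.k → a < I.s ∧ I.sl.getD a 0 = l.getD i 0 := by
      intro i
      by_cases hi : i < I.k
      · have hm : l.getD i 0 ∈ I.sl := by
          grind [List.getD_eq_getElem, mem_sl, List.getElem_mem]
        obtain ⟨a, ha, h5⟩ := List.getElem_of_mem hm
        exact ⟨a, fun _ => ⟨ha, by rw [List.getD_eq_getElem _ _ ha, h5]⟩⟩
      · exact ⟨0, fun h => absurd h hi⟩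
    choose a ha using h4
    obtain ⟨c, hc, hd⟩ := digits_surj a fun i hi => (ha i hi).1
    have hs : I.seq c = l := by
      refine List.ext_getElem (by simp [seq, h1]) fun i hi hi' => ?_
      grind [seq, List.getD_eq_getElem]
    grind

/-- No part of the list is overloaded. -/
def Inp.Sound (I : Inp) (l : List ℕ) : Prop :=
  ∀ Q, Q.Sublist l → Q.length ≤ I.k → ¬ Over I.n (I.q / I.D1 + 1) I.UE (I.k - Q.length) Q

theorem Inp.Sound.sublist {l' : List ℕ} (h : I.Sound l) (hl : l'.Sublist l) : I.Sound l' :=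
  fun Q hQ hk => h Q (hQ.trans hl) hk

theorem Inp.Sound.append (h : I.Sound l) (hx : ∀ Q, Q.Sublist l → Q.length + 1 ≤ I.k → ¬ Over I.n (I.q / I.D1 +
    1) I.UE (I.k - (Q.length + 1)) (Q ++ [x])) : I.Sound (l ++ [x]) := by
  intro Q hQ hk
  obtain ⟨Q₁, Q₂, rfl, h1, h2⟩ := List.sublist_append_iff.1 hQ
  rcases List.sublist_singleton.1 h2 with rfl | rfl
  · rw [List.append_nil] at hk ⊢
    exact h Q₁ h1 hk
  · rw [List.length_append, List.length_singleton] at hk ⊢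
    exact hx Q₁ h1 hk

/-- A nonempty part of an end tuple starts with a vertex that is not usable, so no member of `UE`
extends it. The empty sequence is not overloaded because `UE` has fewer than threshold-to-the-`k`
members. -/
theorem Inp.Hyp.sound_root (h : I.Hyp X) : I.Sound ((List.range I.k).map (I.rt side)) := by
  intro Q hQ hk hO
  have h1 := pow_le_card_of_over hO
  rcases Q with _ | ⟨x, Q⟩
  · have h2 := Finset.card_filter_le I.UE fun l' => [] <+: l'
    have h3 := h.UE_lt
    rw [List.length_nil, Nat.sub_zero] at h1
    omega
  · have h2 : 0 < (I.UE.filter fun l' => x :: Q <+: l').card := lt_of_lt_of_le (by positivity) h1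
    obtain ⟨l', hl'⟩ := Finset.card_pos.1 h2
    obtain ⟨h3, h4⟩ := mem_filter.1 hl'
    have h5 := (mem_UE.1 h3).2.1 x (h4.subset (by simp))
    obtain ⟨f, hf, rfl⟩ := List.mem_map.1 (hQ.subset (show x ∈ x :: Q by simp))
    have h6 := h5.2 f (List.mem_range.1 hf)
    unfold rt at h6
    grind

/-- Each base arises from the previous one by dropping an entry of `g` and appending a tested
vertex. For `j = k` the base is the child itself, which carries soundness down the tree. -/
theorem Inp.sound_base {A : Nodes} {g c j : ℕ} (hg : I.Sound (A.pre g I.k)) (hj : j ≤ I.k)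
    (hent : ∀ f < j, (I.P side).Ent univ A g c f (A c f)) : I.Sound (A.base I.k g c j) := by
  induction j with
  | zero => simpa [Nodes.base, Nodes.pre] using hg
  | succ j ih =>
    have h1 := ih (by omega) fun f hf => hent f (by omega)
    have h2 : A.base I.k g c (j + 1) = (A.pre g (I.k - (j + 1)) ++ A.pre c j) ++ [A c j] := by
      rw [Nodes.base, List.append_assoc]
      simp [Nodes.pre, List.range_succ]
    have h3 : (A.pre g (I.k - (j + 1)) ++ A.pre c j).Sublist (A.base I.k g c j) := by
      refine List.Sublist.append ?_ (List.Sublist.refl _)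
      exact List.Sublist.map _ (List.range_sublist.2 (by omega))
    rw [h2]
    refine (h1.sublist h3).append fun Q hQ hk => ?_
    exact (hent j (by omega)).2.2.1 Q (List.mem_sublists.2 (hQ.trans h3)) hk

theorem Inp.Hyp.sound_node (h : I.Hyp X) (hs : side < 2) {A : Nodes} {U : Finset (List ℕ)}
    (hW : WF (I.P side) univ A U tot) (q : ℕ) (hq : q < tot) : I.Sound (A.pre q I.k) := by
  induction q using Nat.strong_induction_on with
  | _ q ih =>
    rcases Nat.eq_zero_or_pos q with rfl | h0
    · have : A.pre 0 I.k = (List.range I.k).map (I.rt side) :=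
        List.map_congr_left fun f hf => hW.root f (List.mem_range.1 hf)
      rw [this]
      exact h.sound_root
    · obtain ⟨h1, -, h2⟩ := hW.node q h0 hq
      have h3 := sound_base (ih _ h1 (h1.trans hq)) le_rfl h2
      simpa [Nodes.base, Nodes.pre] using h3

/-- There are many candidates for the next vertex. -/
theorem Inp.Hyp.le_cands (h : I.Hyp X) (hs : side < 2) {A : Nodes} {U : Finset (List ℕ)} {g c j : ℕ}
    (hj : j < I.k) (hS : I.Sound (A.base I.k g c j))
    (hU : j < I.h side → ¬ Over I.n (I.q / 8 + 1) U (I.h side - j) (A.pre c j)) : I.q / 2 ≤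
    ((I.P side).cands A U g c j I.q).length := by
  classical
  have hv := valid_P h.valid hs
  set Cl := (range I.q).image ((I.P side).vtx (A g (I.k + 1) + 1) j) with hCl
  have hCc : Cl.card = I.q := by
    rw [hCl, Finset.card_image_of_injOn, card_range]
    intro i hi i' hi' he
    exact (hv.vtx_inj hj hj (mem_range.1 hi) (mem_range.1 hi') he).2.2
  set B₁ := (A.base I.k g c j).sublists.toFinset.biUnion fun Q =>
    if Q.length + 1 ≤ I.k then (range I.n).filter fun x =>
      Over I.n (I.q / I.D1 + 1) I.UE (I.k - (Q.length + 1)) (Q ++ [x]) else ∅ with hB₁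
  set B₂ := if j < I.h side then (range I.n).filter fun x =>
    Over I.n (I.q / 8 + 1) U (I.h side - (j + 1)) (A.pre c j ++ [x]) else ∅ with hB₂
  set B₃ := (range I.dep ×ˢ range I.k).image fun z => A (A.anc I.k g z.1) z.2 with hB₃
  -- A vertex of the class is rejected for overloading a part of the base (`B₁`), for overloading a
  -- beginning (`B₂`), or for occurring in an ancestor (`B₃`).
  have hsub : Cl ⊆ (((I.P side).cands A U g c j I.q).toFinset ∪ B₁) ∪ (B₂ ∪ B₃) := by
    intro x hx
    by_contra hn
    simp only [mem_union, not_or] at hn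
    obtain ⟨⟨hn0, hn1⟩, hn2, hn3⟩ := hn
    obtain ⟨i, hi, rfl⟩ := mem_image.1 hx
    have hlt : (I.P side).vtx (A g (I.k + 1) + 1) j i < I.n := hv.vtx_lt hj (mem_range.1 hi)
    refine hn0 (List.mem_toFinset.2 (mem_cands.2 ⟨⟨i, mem_range.1 hi, rfl⟩, ?_, ?_, ?_⟩))
    · intro Q hQ hk hO
      refine hn1 (mem_biUnion.2 ⟨Q, List.mem_toFinset.2 hQ, ?_⟩)
      rw [if_pos (show Q.length + 1 ≤ I.k from hk)]
      exact mem_filter.2 ⟨mem_range.2 hlt, hO⟩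
    · intro hjh hO
      refine hn2 ?_
      rw [hB₂, if_pos (show j < I.h side from hjh)]
      exact mem_filter.2 ⟨mem_range.2 hlt, hO⟩
    · intro i' hi' f hf he
      exact hn3 (mem_image.2 ⟨(i', f), mem_product.2 ⟨mem_range.2 hi', mem_range.2 hf⟩, he⟩)
  have c1 : B₁.card ≤ 2 ^ I.k * (I.q / I.D1) := by
    have h1 : (A.base I.k g c j).length = I.k := by
      simp [Nodes.base, Nodes.pre]
      omega
    refine (card_biUnion_le_card_mul _ _ (I.q / I.D1) fun Q hQ => ?_).trans (Nat.mul_le_mul_right _ ?_)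
    · split_ifs with hk
      · have h2 := hS Q (List.mem_sublists.1 (List.mem_toFinset.1 hQ)) (by omega)
        rw [show I.k - Q.length = I.k - (Q.length + 1) + 1 by omega, over_succ] at h2
        omega
      · simp
    · refine (List.toFinset_card_le _).trans ?_
      rw [List.length_sublists, h1]
  have c2 : B₂.card ≤ I.q / 8 := by
    rw [hB₂]
    split_ifs with hjh
    · have h2 := hU hjh
      rw [show I.h side - j = I.h side - (j + 1) + 1 by omega, over_succ] at h2
      omega
    · simp
  have c3 : B₃.card ≤ I.dep * I.k := by
    grind [card_product, card_range]
  have c4 := card_le_card hsub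
  have c5 := card_union_le (((I.P side).cands A U g c j I.q).toFinset ∪ B₁) (B₂ ∪ B₃)
  have c6 := card_union_le ((I.P side).cands A U g c j I.q).toFinset B₁
  have c7 := card_union_le B₂ B₃
  have c8 := List.toFinset_card_le ((I.P side).cands A U g c j I.q)
  have c9 := h.excl
  omega

theorem Inp.Hyp.cls_node (h : I.Hyp X) (hs : side < 2) {A : Nodes} {U : Finset (List ℕ)}
    (hW : WF (I.P side) univ A U tot) (hq : q < tot) (hf : f < I.k) : I.cls (A q f) =
    (if q = 0 then 6 + side else side * 3 + A q (I.k + 1) % 3) * I.k + f := by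
  rcases Nat.eq_zero_or_pos q with rfl | h0
  · rw [if_pos rfl, hW.root f hf]
    exact cls_rt h.valid h.chk.1.1 hs hf
  · obtain ⟨-, h2, h3⟩ := hW.node q h0 hq
    obtain ⟨⟨i, hi, h4⟩, -⟩ := h3 f hf
    rw [if_neg (by omega), h4, cls_vtx hs hf hi]
    rw [show A q (I.k + 1) = A (A q I.k) (I.k + 1) + 1 from h2]
    rfl

theorem Inp.vtx_usable {lev j : ℕ} (hs : side < 2) (hj : j < I.k) (hi : i < I.q) : I.Usable
    ((I.P side).vtx lev j i) :=
  sl_usable ((class_index_lt hs (Nat.mod_lt _ (by omega)) hj hi).trans_le kq_le)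

theorem Inp.Hyp.usable_node (_ : I.Hyp X) (hs : side < 2) {A : Nodes} {U : Finset (List ℕ)}
    (hW : WF (I.P side) univ A U tot) (h0 : 0 < q) (hq : q < tot) (hf : f < I.k) : I.Usable (A q f) := by
  obtain ⟨-, -, h3⟩ := hW.node q h0 hq
  obtain ⟨⟨i, hi, h4⟩, -⟩ := h3 f hf
  rw [h4]
  exact vtx_usable hs hf hi

theorem Inp.Usable.lt (h : I.Usable x) : x < I.n := by
  obtain ⟨y, -, rfl⟩ := Finset.mem_map.1 h.1
  exact y.2

theorem Inp.Usable.ne_rt (h : I.Usable x) (hf : f < I.k) : I.rt side f ≠ x := by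
  unfold rt
  split_ifs
  · exact (h.2 f hf).1
  · exact (h.2 f hf).2

variable {A : Nodes} {U U₀ : Finset (List ℕ)} {g b c j : ℕ}

theorem Inp.Hyp.treeShape (h : I.Hyp X) (hs : side < 2) (hW : WF (I.P side) univ A U₀ b) (hg : g < b)
    (hj : j < I.k) (hent : ∀ f < j, (I.P side).Ent univ A g c f (A c f)) (hi : i < I.q) : I.TreeShape side j
    (A.base I.k g c j ++ [(I.P side).vtx (A g (I.k + 1) + 1) j i]) := by
  have hv := valid_P h.valid hs
  have hbl : TreeBlocks side (if g = 0 then 6 + side else side * 3 + A g (I.k + 1) % 3)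
      (side * 3 + (A g (I.k + 1) + 1) % 3) := by
    unfold TreeBlocks
    split_ifs with h0
    · left
      have h1 : A g (I.k + 1) = 0 := by rw [h0]; exact hW.rootlev
      rw [h1]
      exact ⟨rfl, rfl⟩
    simp_all [Nat.mod_lt]
  refine ⟨_, _, hbl, hbl.ne hs, hj, ?_, ?_⟩
  · intro x hx
    simp only [Nodes.base, Nodes.pre, List.mem_append, List.mem_map, List.mem_range,
      List.mem_singleton] at hx
    rcases hx with (⟨f, hf, rfl⟩ | ⟨f, hf, rfl⟩) | rfl
    · exact hW.vert hv hg (show f < I.k by omega)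
    · exact (hent f hf).lt hv (show f < I.k by omega)
    · exact hv.vtx_lt hj hi
  · rw [Nodes.base, List.append_assoc, List.map_append]
    congr 1
    · rw [Nodes.pre, List.map_map, blk]
      refine List.map_congr_left fun f hf => ?_
      have := List.mem_range.1 hf
      exact h.cls_node hs hW hg (by omega)
    · rw [List.map_append, blk, List.range_succ, List.map_append]
      congr 1
      · rw [Nodes.pre, List.map_map]
        refine List.map_congr_left fun f hf => ?_
        have hf := List.mem_range.1 hf
        obtain ⟨⟨i', hi', h4⟩, -⟩ := hent f hf
        show I.cls (A c f) = _
        rw [h4]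
        exact cls_vtx hs (by omega) hi'
      · simp only [List.map_cons, List.map_nil]
        rw [cls_vtx hs hj hi]

theorem exists_sublist_of_subset {n : ℕ} (hn : l.Nodup) {e : Finset (Fin n)} (he : e ⊆ vset n l) : ∃ Q,
    Q.Sublist l ∧ vset n Q = e ∧ Q.length = e.card := by
  classical
  set Q := l.filter fun y => ∃ x ∈ e, x.val = y with hQ
  have h1 : vset n Q = e := by
    ext x
    grind [Fin.ext, mem_vset]
  refine ⟨Q, List.filter_sublist, h1, ?_⟩
  rw [← h1, card_vset _ (hn.filter _)]
  grind

/-- A sound list that consists of usable vertices contains no search base used before. -/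
theorem Inp.Hyp.no_base (h : I.Hyp X) {Q : List ℕ} (hS : I.Sound l) (hQ : Q.Sublist l) (hE : vset I.n Q ∈ I.E)
    (hk : Q.length = I.k) : ∃ y ∈ Q, ¬ I.Usable y := by
  by_contra! hc
  refine hS Q hQ hk.le ?_
  rw [hk, Nat.sub_self, over_zero]
  exact mem_UE.2 ⟨hk, hc, hE⟩

/-- Suppose the inspected set contains an old base. By soundness the base has a vertex that is not
usable, which can only come from the root. No old base mixes usable vertices with end vertices, so
all its `k` vertices come from the root; hence `j = 0` and the base is the end tuple. That case is
excluded by `ends`. -/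
theorem Inp.Hyp.notMem (h : I.Hyp X) (hs : side < 2) (hW : WF (I.P side) univ A U₀ b) (hg : g < b)
    (hj : j < I.k) (hent : ∀ f < j, (I.P side).Ent univ A g c f (A c f))
    (hx : x ∈ (I.P side).cands A U g c j I.q) : vset I.n (A.base I.k g c j ++ [x]) ∉ X := by
  obtain ⟨⟨i, hi, rfl⟩, hT⟩ := mem_cands.1 hx
  have hS := (sound_base (h.sound_node hs hW g hg) hj.le hent).append fun Q hQ hk =>
    hT.1 Q (List.mem_sublists.2 hQ) hk
  obtain ⟨_, _, -, hsh⟩ := h.treeShape hs hW hg hj hent hi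
  intro hX
  obtain ⟨e, he, hez⟩ := h.cover _ hX
  obtain ⟨Q, hQ, rfl, hQc⟩ := exists_sublist_of_subset hsh.nodup hez
  rw [h.card_E _ he] at hQc
  obtain ⟨y, hy, hyu⟩ := h.no_base hS hQ he hQc
  have hl := hsh.2.2.1
  have hroot : ∀ y ∈ Q, ¬ I.Usable y → g = 0 ∧ y ∈ (List.range (I.k - j)).map (I.rt side) := by
    intro y hy hyu
    have h1 := hQ.subset hy
    simp only [Nodes.base, Nodes.pre, List.mem_append, List.mem_map, List.mem_range,
      List.mem_singleton] at h1
    rcases h1 with (⟨f, hf, rfl⟩ | ⟨f, hf, rfl⟩) | rfl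
    · rcases Nat.eq_zero_or_pos g with rfl | h0
      · exact ⟨rfl, List.mem_map.2 ⟨f, List.mem_range.2 hf, (hW.root f (show f < I.k by omega)).symm⟩⟩
      · exact absurd (h.usable_node hs hW h0 hg (by omega)) hyu
    · obtain ⟨⟨i', hi', h4⟩, -⟩ := hent f hf
      rw [h4] at hyu
      exact absurd (vtx_usable hs (by omega) hi') hyu
    · exact absurd (vtx_usable hs hj hi) hyu
  obtain ⟨rfl, hyr⟩ := hroot y hy hyu
  obtain ⟨f, hf, rfl⟩ := List.mem_map.1 hyr
  have hf := List.mem_range.1 hf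
  have hall : ∀ y' ∈ Q, ¬ I.Usable y' := by
    intro y' hy' hu
    exact h.mix _ he ⟨y', hu.lt⟩ (mem_vset.2 hy') ⟨_, hl _ (hQ.subset hy)⟩ (mem_vset.2 hy) hu f (by omega)
      side hs rfl
  have hsubs : Q ⊆ (List.range (I.k - j)).map (I.rt side) := fun y' hy' => (hroot y' hy' (hall y' hy')).2
  have h6 := (hsh.nodup.sublist hQ).subperm hsubs |>.length_le
  rw [hQc, List.length_map, List.length_range] at h6
  obtain rfl : j = 0 := by omega
  have h7 : A.base I.k 0 c 0 = (List.range I.k).map (I.rt side) := by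
    rw [Nodes.base, Nat.sub_zero]
    have : A.pre c 0 = [] := rfl
    rw [this, List.append_nil]
    exact List.map_congr_left fun f hf => hW.root f (List.mem_range.1 hf)
  rw [h7] at hX
  exact h.ends side hs _ (vtx_usable hs hj hi) hX

/-- A bound for the probability that a scan fails. -/
noncomputable def Inp.err (I : Inp) (p : ℝ) : ℝ := 2 ^ I.m * (1 - p / 2) ^ (I.q / 2)

theorem pre_take {A : Nodes} {a b : ℕ} (h : b ≤ a) : (A.pre q a).take b = A.pre q b := by
  rw [Nodes.pre, Nodes.pre, ← List.map_take, List.take_range, min_eq_left h]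

/-- By `2 * h ≤ k + 1` the inspected set contains a whole beginning: that of the parent for the
shared entries, where all children are served by one search, and that of the child afterwards. -/
theorem Inp.key_base (hj : j < I.k) : I.key side j (A.base I.k g c j ++ [x]) = if j < I.h side
    then A.pre g (I.h side) else A.pre c (I.h side) := by
  have h1 := I.h_le side
  have hlen : ∀ q a, (A.pre q a).length = a := fun q a => by simp [Nodes.pre]
  grind [key, Nodes.base, List.append_assoc, pre_take, List.drop_left']

/-- A search is identified by the position `j` and the beginning `κ`, both of which can be read off
any set it inspects. So a search not done before meets only unrevealed sets, and afterwards exactly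
the label `(j, κ)` is used up. -/
theorem Inp.Hyp.search (h : I.Hyp X) {p : ℝ} (h0 : 0 ≤ p) (h1 : p ≤ 1) (hs : side < 2)
    (hW : WF (I.P side) univ A U₀ b) (hg : g < b) (hj : j < I.k)
    (hent : ∀ f < j, (I.P side).Ent univ A g c f (A c f))
    (hU : j < I.h side → ¬ Over I.n (I.q / 8 + 1) U (I.h side - j) (A.pre c j)) {K : ℕ → List ℕ → Prop}
    (hF : I.Fresh side X W₀ K W) {κ : List ℕ}
    (hκ : κ = if j < I.h side then A.pre g (I.h side) else A.pre c (I.h side)) (hK : ¬ K j κ) (hsm : s ≤ I.m) :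
    Tri p W (fun G => (I.P side).scan G s U g c j A) (I.err p) (fun A' W' => (∃ G', (I.P side).scan G' s U g c
    j A = some A') ∧ I.Fresh side X W₀ (fun j' l => K j' l ∨ (j' = j ∧ l = κ)) W') := by
  have hv := valid_P h.valid hs
  have hS := sound_base (h.sound_node hs hW g hg) hj.le hent
  have hsh : ∀ x ∈ (I.P side).cands A U g c j I.q, I.TreeShape side j (A.base I.k g c j ++ [x]) := by
    intro x hx
    obtain ⟨⟨i, hi, rfl⟩, -⟩ := mem_cands.1 hx
    exact h.treeShape hs hW hg hj hent hi
  have hkey : ∀ x, I.key side j (A.base I.k g c j ++ [x]) = κ := fun x => (key_base hj).trans hκ.symm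
  have hask : (I.P side).asked A U g c j ⊆ W := by
    intro z hz
    obtain ⟨x, hx, rfl⟩ := mem_image.1 hz
    have hx := List.mem_toFinset.1 hx
    refine hF.legal j _ (hsh x hx) (h.notMem hs hW hg hj hent hx) ?_
    show ¬ K j (I.key side j (A.base I.k g c j ++ [x]))
    rw [hkey]
    exact hK
  refine (Tri.scan (s := s) h0 h1 hv hj (h.le_cands hs hj hS hU) hask ?_).mono ?_ ?_
  · intro x hx y hy he
    have := ((hsh x hx).inj hs (hsh y hy) he).2
    simpa using this
  · refine mul_le_mul_of_nonneg_right (pow_le_pow_right₀ (by norm_num) hsm) (pow_nonneg (by linarith) _)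
  · rintro A' W' ⟨hA', rfl⟩
    refine ⟨hA', ?_, ?_⟩
    · intro j' l hl hX hk
      refine mem_sdiff.2 ⟨hF.legal j' l hl hX fun hk' => hk (Or.inl hk'), fun hz => ?_⟩
      obtain ⟨x, hx, he⟩ := mem_image.1 hz
      obtain ⟨rfl, rfl⟩ := (hsh x (List.mem_toFinset.1 hx)).inj hs hl he
      exact hk (Or.inr ⟨rfl, hkey x⟩)
    · intro z hz hl
      refine mem_sdiff.2 ⟨hF.keep z hz hl, fun hz' => ?_⟩
      obtain ⟨x, hx, he⟩ := mem_image.1 hz'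
      exact hl j _ (hsh x (List.mem_toFinset.1 hx)) he

end Search

/-! ### Growing a search tree in a random hypergraph -/

section Grow

theorem WF.congr {P : Par} {G : Finset (Finset (Fin P.n))} {A A₀ : Nodes} {U : Finset (List ℕ)} {c : ℕ}
    (h0 : WF P G A₀ U c) (hA : ∀ p < c, ∀ f, A p f = A₀ p f) : WF P G A U c := by
  have hpos := h0.pos
  have hpre : ∀ p < c, A.pre p P.h = A₀.pre p P.h := fun p hp => pre_congr fun f _ => hA p hp f
  refine ⟨hpos, ?_, ?_, ?_, ?_, ?_, ?_, ?_⟩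
  · intro p hp; rw [hA p hp]; exact h0.par p hp
  · intro p hp; rw [hA p hp]; exact h0.lev p hp
  · intro f hf; rw [hA 0 hpos]; exact h0.root f hf
  · rw [hA 0 hpos]; exact h0.rootlev
  · intro p hp0 hp
    obtain ⟨h1, h2, h3⟩ := h0.node p hp0 hp
    rw [hA p hp, hA p hp, hA _ (h1.trans hp)]
    refine ⟨h1, h2, fun j hj => ?_⟩
    rw [hA p hp]
    exact ent_congr (b := c) (h1.trans hp) h0.par (fun p hp f => (hA p hp f).symm)
      (fun f hf => (hA p hp f).symm) (h3 j hj)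
  · intro p p' hp0 hp0' hp hp' he
    rw [hpre p hp, hpre p' hp'] at he
    exact h0.uniq p p' hp0 hp0' hp hp' he
  · intro l
    rw [h0.used]
    grind

theorem WF.card_used {P : Par} {G : Finset (Finset (Fin P.n))} {A : Nodes} {U : Finset (List ℕ)} {c : ℕ}
    (h : WF P G A U c) : U.card ≤ c := by
  have h1 : U ⊆ (range c).image fun p => A.pre p P.h := by
    intro l hl
    obtain ⟨p, -, h2, rfl⟩ := (h.used l).1 hl
    grind
  exact (card_le_card h1).trans (card_image_le.trans (by simp))

theorem scan_not_over {P : Par} {G : Finset (Finset (Fin P.n))} {A A' : Nodes} {U : Finset (List ℕ)} {g c j : ℕ}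
    (hP : P.Valid) (hj : j < P.k) (hjh : j < P.h) (h : P.scan G 1 U g c j A = some A') :
    ¬ Over P.n P.thrU U (P.h - (j + 1)) (A'.pre c (j + 1)) := by
  obtain ⟨xs, hl, -, rfl, hx⟩ := scan_spec hP hj h
  have h1 := (hx _ (List.getElem_mem (l := xs) (n := 0) (by omega))).2 hjh
  have h2 : (A.write c j xs).pre c (j + 1) = A.pre c j ++ [xs[0]] := by
    have h3 : A.write c j xs c j = xs[0] := by
      have := write_get (A := A) (c := c) (j := j) (i := 0) (xs := xs) (by omega)
      simpa using this
    rw [Nodes.pre, List.range_succ, List.map_append, List.map_singleton, h3]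
    congr 1
    refine List.map_congr_left fun f hf => ?_
    have := List.mem_range.1 hf
    exact write_of_ne (Or.inr (by omega))
  rw [h2]
  exact h1

theorem Tri.scans {P : Par} {p δ : ℝ} {U : Finset (List ℕ)} {g c : ℕ} (hδ : 0 ≤ δ)
    (Q : ℕ → Nodes → Finset (Finset (Fin P.n)) → Prop) (len a : ℕ) {A : Nodes}
    {W : Finset (Finset (Fin P.n))} (h0 : Q a A W)
    (h : ∀ j, a ≤ j → j < a + len → ∀ A W, Q j A W →
      Tri p W (fun G => P.scan G 1 U g c j A) δ (Q (j + 1))) :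
    Tri p W (fun G => P.scans G U g c (List.range' a len) A) (len * δ) (Q (a + len)) := by
  induction len generalizing a A W with
  | zero =>
    rw [Nat.cast_zero, zero_mul]
    exact Tri.some h0
  | succ len ih =>
    have h1 := (h a le_rfl (by omega) A W h0).bind (c' := fun G A => P.scans G U g c (List.range' (a + 1) len) A)
      (δ' := len * δ) (Q' := Q (a + 1 + len)) (by positivity) fun A' W' hA' =>
        ih (a + 1) hA' fun j hj hj' => h j (by omega) (by omega)
    rw [show a + (len + 1) = a + 1 + len by omega, show ((len + 1 : ℕ) : ℝ) * δ = δ + len * δ by push_cast; ring]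
    exact h1

variable {I : Inp} {X W₀ W : Finset (Finset (Fin I.n))} {side : ℕ} {p : ℝ}
variable {s : ℕ}

/-- The searches done before the children of the node `g` are searched. -/
def Inp.doneK (I : Inp) (side : ℕ) (A : Nodes) (U : Finset (List ℕ)) (g j : ℕ) (l : List ℕ) : Prop :=
  (j < I.h side ∧ ∃ p < g, l = A.pre p (I.h side)) ∨ (I.h side ≤ j ∧ l ∈ U)

theorem Inp.err_nonneg (I : Inp) (h1 : p ≤ 1) : 0 ≤ I.err p :=
  mul_nonneg (by positivity) (pow_nonneg (by linarith) _)

variable {A₀ : Nodes} {U : Finset (List ℕ)} {g c : ℕ}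

/-- There are too few nodes in the whole tree to overload the empty beginning; so a new stem can
always be started. -/
theorem Inp.Hyp.over_nil (h : I.Hyp X) (hs : side < 2) (h0 : WF (I.P side) univ A₀ U c) (hc : c ≤ I.tot side) :
    ¬ Over I.n (I.q / 8 + 1) U (I.h side) [] := by
  intro hO
  have h1 := pow_le_card_of_over hO
  have h2 := Finset.card_filter_le U fun l' => [] <+: l'
  have h3 := h0.card_used
  have h4 := h.tot_lt side hs
  omega

/-- Extends distinctness of beginnings to the root, whose first entry is not usable while that of
every other node is. -/
theorem Inp.Hyp.pre_inj (h : I.Hyp X) (hs : side < 2) (h0 : WF (I.P side) univ A₀ U c) {p q : ℕ} (hp : p < c)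
    (hq : q < c) (he : A₀.pre p (I.h side) = A₀.pre q (I.h side)) : p = q := by
  have h1 := one_le_h h.valid hs
  have hk := h.valid.hk2
  have h2 : A₀ p 0 = A₀ q 0 := by
    have := List.map_eq_map_iff.1 he 0 (List.mem_range.2 (by omega))
    exact this
  have hr : A₀ 0 0 = I.rt side 0 := h0.root 0 (show 0 < I.k by omega)
  rcases Nat.eq_zero_or_pos p with rfl | hp0 <;> rcases Nat.eq_zero_or_pos q with rfl | hq0
  · rfl
  · exact absurd (hr.symm.trans h2) ((h.usable_node hs h0 hq0 hq (show 0 < I.k by omega)).ne_rt (by omega))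
  · exact absurd (hr.symm.trans h2.symm) ((h.usable_node hs h0 hp0 hp (show 0 < I.k by omega)).ne_rt (by omega))
  · exact h0.uniq p q hp0 hq0 hp hq he

/-- Nodes are expanded in increasing order, so the searches labelled by the beginning of `g` at
positions below `h` are new. Every entry taken keeps the growing beginning free of overload, which
leaves room for the next one. -/
theorem Inp.Hyp.stem (h : I.Hyp X) (h0' : 0 ≤ p) (h1' : p ≤ 1) (hs : side < 2) (h0 : WF (I.P side) univ A₀ U c)
    (hg : g < c) (hc : c ≤ I.tot side) (hF : I.Fresh side X W₀ (I.doneK side A₀ U g) W) (hsm : s ≤ I.m)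
    (h1m : 1 ≤ I.m) : Tri p W (fun G => ((I.P side).scans G U g c (List.range (I.h side - 1)) A₀).bind fun A =>
    (I.P side).scan G s U g c (I.h side - 1) A) (I.h side * I.err p)
    (fun A W => Mid (I.P side) univ A₀ U g c s 0 A U ∧ I.Fresh side X W₀ (I.doneK side A₀ U (g + 1)) W) := by
  have hv := valid_P h.valid hs
  have hh := I.h_le side
  have hh1 := one_le_h h.valid hs
  set κ := A₀.pre g (I.h side) with hκ
  let Q : ℕ → Nodes → Finset (Finset (Fin I.n)) → Prop := fun J A W =>
    Stem (I.P side) univ A₀ g c J A ∧ ¬ Over I.n (I.q / 8 + 1) U (I.h side - J) (A.pre c J) ∧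
    I.Fresh side X W₀ (fun j l => I.doneK side A₀ U g j l ∨ (j < J ∧ l = κ)) W
  have hstep : ∀ s' ≤ I.m, ∀ j < I.h side, ∀ A W, Q j A W →
      Tri p W (fun G => (I.P side).scan G s' U g c j A) (I.err p) (fun A' W' =>
        (∃ G', (I.P side).scan G' s' U g c j A = some A') ∧
        I.Fresh side X W₀ (fun j' l => (I.doneK side A₀ U g j' l ∨ (j' < j ∧ l = κ)) ∨ (j' = j ∧ l = κ)) W') := by
    rintro s' hs' j hj A W ⟨q1, q2, q3⟩
    have hpre : ∀ i, A.pre g i = A₀.pre g i := fun i => pre_congr fun f _ => q1.old g hg f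
    refine h.search h0' h1' hs (h0.congr q1.old) hg (by omega) q1.ent (fun _ => q2) q3 ?_ ?_ hs'
    · rw [if_pos hj, hpre]
    · rintro ((⟨-, q, hq, he⟩ | ⟨hj', -⟩) | ⟨hj', -⟩)
      · have := h.pre_inj hs h0 hg (hq.trans hg) he
        omega
      · omega
      · omega
  have hstem : Tri p W (fun G => (I.P side).scans G U g c (List.range (I.h side - 1)) A₀)
      ((I.h side - 1 : ℕ) * I.err p) (Q (0 + (I.h side - 1))) := by
    have hQ0 : Q 0 A₀ W := by
      refine ⟨⟨fun _ _ _ => rfl, by omega⟩, ?_, hF.mono fun j hj l hl => Or.inl hl⟩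
      exact h.over_nil hs h0 hc
    have := Tri.scans (P := I.P side) (p := p) (U := U) (g := g) (c := c) (I.err_nonneg h1') Q (I.h side - 1) 0 hQ0 ?_
    · rw [← List.range_eq_range'] at this
      exact this
    · intro j _ hj A W hQ
      refine (hstep 1 h1m j (by omega) A W hQ).mono le_rfl ?_
      rintro A' W' ⟨⟨G', hG'⟩, hF'⟩
      refine ⟨Stem.step hv h0 hg (show j < I.k by omega) hQ.1 hG' (subset_univ _),
        scan_not_over hv (show j < I.k by omega) (show j < I.h side by omega) hG', hF'.mono ?_⟩
      grind
  have := hstem.bind (c' := fun G A => (I.P side).scan G s U g c (I.h side - 1) A) (δ' := I.err p)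
    (Q' := fun A W => Mid (I.P side) univ A₀ U g c s 0 A U ∧
        I.Fresh side X W₀ (I.doneK side A₀ U (g + 1)) W) (I.err_nonneg h1') ?_
  · refine this.mono (le_of_eq ?_) fun _ _ h => h
    rw [Nat.cast_sub hh1]
    ring
  · intro A W hQ
    rw [zero_add] at hQ
    refine (hstep s hsm (I.h side - 1) (by omega) A W hQ).mono le_rfl ?_
    rintro A' W' ⟨⟨G', hG'⟩, hF'⟩
    refine ⟨Stem.branch hv h0 hg hQ.1 hG' (subset_univ _), hF'.mono ?_⟩
    rintro j' - l (((⟨h1, q, hq, rfl⟩ | h1) | ⟨h1, rfl⟩) | ⟨h1, rfl⟩)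
    · exact Or.inl ⟨h1, q, by omega, rfl⟩
    · exact Or.inr h1
    · exact Or.inl ⟨by omega, g, by omega, rfl⟩
    · exact Or.inl ⟨by omega, g, by omega, rfl⟩

/-- From position `h` on a search is labelled by the beginning of the child, which is new because it
is not among the beginnings used. -/
theorem Inp.Hyp.child (h : I.Hyp X) (h0' : 0 ≤ p) (h1' : p ≤ 1) (hs : side < 2) (h0 : WF (I.P side) univ A₀ U c)
    (hg : g < c) {t : ℕ} (ht : t < s) (h1m : 1 ≤ I.m) {A : Nodes} {U' : Finset (List ℕ)}
    (hM : Mid (I.P side) univ A₀ U g c s t A U') (hF : I.Fresh side X W₀ (I.doneK side A₀ U' (g + 1)) W) : Tri p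
    W (fun G => (I.P side).child G g c t (A, U')) ((I.k - I.h side : ℕ) * I.err p)
    (fun st W => Mid (I.P side) univ A₀ U g c s (t + 1) st.1 st.2 ∧ I.Fresh side X W₀ (I.doneK side A₀ st.2 (g
    + 1)) W) := by
  have hv := valid_P h.valid hs
  have hh := I.h_le side
  set A1 := (I.P side).prep A g c (c + t) with hA1
  have hT := hM.prep hv h0 hg ht
  set κ := A1.pre (c + t) (I.h side) with hκ
  have hκU : κ ∉ U' := by
    intro hm
    have h2 : κ = A1.pre c (I.h side - 1) ++ [A1 (c + t) (I.h side - 1)] := hT.pre_eq hv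
    rcases (hT.used κ).1 hm with h1 | ⟨i, hi, h1⟩
    · rw [h2] at h1
      exact hT.new t ht h1
    · rw [h2] at h1
      have h3 := List.append_cancel_left h1
      have h4 := hT.inj t ht i (by omega) (List.head_eq_of_cons_eq h3)
      omega
  let Q : ℕ → Nodes → Finset (Finset (Fin I.n)) → Prop := fun J A W =>
    Tail (I.P side) univ A₀ U g c s t J A U' ∧ A.pre (c + t) (I.h side) = κ ∧
    I.Fresh side X W₀ (fun j l => I.doneK side A₀ U' (g + 1) j l ∨ (I.h side ≤ j ∧ j < J ∧ l = κ)) W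
  have hQ0 : Q (I.h side) A1 W := ⟨hT, rfl, hF.mono fun j hj l hl => Or.inl hl⟩
  have hsc := Tri.scans (P := I.P side) (p := p) (U := insert κ U') (g := g) (c := c + t)
    (I.err_nonneg h1') Q (I.k - I.h side) (I.h side) hQ0 ?_
  · refine hsc.map (f := fun A' => (A', insert κ U')) ?_
    rintro A' W' ⟨q1, q2, q3⟩
    rw [show I.h side + (I.k - I.h side) = (I.P side).k by show _ = I.k; omega] at q1
    have q4 := q1.complete hv
    rw [show A'.pre (c + t) (I.P side).h = κ from q2] at q4
    refine ⟨q4, q3.mono ?_⟩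
    rintro j' - l ((h1 | ⟨h1, h2⟩) | ⟨h1, -, rfl⟩)
    · exact Or.inl h1
    · exact Or.inr ⟨h1, mem_insert_of_mem h2⟩
    · exact Or.inr ⟨h1, mem_insert_self _ _⟩
  · rintro j hj1 hj2 A' W' ⟨q1, q2, q3⟩
    refine (h.search h0' h1' hs (h0.congr q1.old) hg (j := j) (by omega) q1.ent (fun _ => by omega) q3
      (κ := κ) ?_ ?_ h1m).mono le_rfl ?_
    · rw [if_neg (by omega), q2]
    · rintro ((⟨h1, -⟩ | ⟨-, h1⟩) | ⟨-, h1, -⟩)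
      · omega
      · exact hκU h1
      · omega
    · rintro A'' W'' ⟨⟨G', hG'⟩, hF'⟩
      refine ⟨Tail.step hv h0 hg (show j < I.k by omega) hj1 q1 hG' (subset_univ _), ?_, hF'.mono ?_⟩
      · obtain ⟨xs, -, -, rfl, -⟩ := scan_spec hv (show j < I.k by omega) hG'
        grind [pre_congr, write_of_ne]
      grind

theorem Inp.Hyp.expand (h : I.Hyp X) (h0' : 0 ≤ p) (h1' : p ≤ 1) (hs : side < 2)
    (h0 : WF (I.P side) univ A₀ U c) (hg : g < c) (hc : c ≤ I.tot side)
    (hF : I.Fresh side X W₀ (I.doneK side A₀ U g) W) (hsm : s ≤ I.m) (h1m : 1 ≤ I.m) : Tri p W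
    (fun G => (I.P side).expand G s g c (A₀, U)) ((I.k * (s + 1) : ℕ) * I.err p)
    (fun st W => Mid (I.P side) univ A₀ U g c s s st.1 st.2 ∧ I.Fresh side X W₀ (I.doneK side st.1 st.2 (g +
    1)) W) := by
  have hh := I.h_le side
  have h1 := h.stem h0' h1' hs h0 hg hc hF hsm h1m
  have h2 := h1.bind (c' := fun G A' => loopM ((I.P side).child G g c) s (A', U))
    (δ' := s * ((I.k - I.h side : ℕ) * I.err p))
    (Q' := fun st W => Mid (I.P side) univ A₀ U g c s s st.1 st.2 ∧
        I.Fresh side X W₀ (I.doneK side A₀ st.2 (g + 1)) W)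
    (mul_nonneg (by positivity) (mul_nonneg (by positivity) (I.err_nonneg h1'))) ?_
  · simp only [Option.bind_assoc] at h2
    refine h2.mono ?_ ?_
    · rw [← mul_assoc, ← add_mul]
      refine mul_le_mul_of_nonneg_right ?_ (I.err_nonneg h1')
      have h4 : I.h side + s * (I.k - I.h side) ≤ I.k * (s + 1) := by
        have : s * (I.k - I.h side) ≤ s * I.k := Nat.mul_le_mul_left _ (by omega)
        grind
      exact_mod_cast h4
    · rintro st W' ⟨q1, q2⟩
      refine ⟨q1, q2.mono ?_⟩
      rintro j' - l (⟨h5, q, hq, rfl⟩ | h5)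
      · exact Or.inl ⟨h5, q, hq, pre_congr fun f _ => (q1.old q (by omega) f).symm⟩
      · exact Or.inr h5
  · rintro A W ⟨q1, q2⟩
    exact Tri.loopM (σ := Nodes × Finset (List ℕ)) (mul_nonneg (by positivity) (I.err_nonneg h1')) (fun t st W =>
      Mid (I.P side) univ A₀ U g c s t st.1 st.2 ∧ I.Fresh side X W₀ (I.doneK side A₀ st.2 (g + 1)) W)
      ⟨q1, q2⟩ fun t ht st W' hst => h.child h0' h1' hs h0 hg ht h1m hst.1 hst.2

/-- A union bound over all scans. `Tree` is asserted with `univ` in place of the random hypergraph: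
only the shape, the classes and the tests matter for what follows, not the edges already found. -/
theorem Inp.Hyp.grow (h : I.Hyp X) (h0' : 0 ≤ p) (h1' : p ≤ 1) (hs : side < 2)
    (hF : I.Fresh side X W₀ (fun _ _ => False) W) : Tri p W (fun G => I.tree G side)
    ((I.e side * (2 * I.k) + I.X side * (I.k * (I.m + 1)) : ℕ) * I.err p)
    (fun st W => Tree (I.P side) univ (I.e side) st.1 st.2 (I.tot side) ∧ ∃ K, I.Fresh side X W₀ K W) := by
  have hv := valid_P h.valid hs
  have hm := h.chk.1.2.1
  have herr := I.err_nonneg h1'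
  have htot : I.tot side = I.e side + 1 + I.X side * I.m := rfl
  have hPm : (I.P side).m = I.m := rfl
  have h1 : Tri p W (fun G => loopM (fun i => (I.P side).expand G 1 i (i + 1)) (I.e side) (I.root side, ∅))
      (I.e side * ((I.k * (1 + 1) : ℕ) * I.err p)) (fun st W =>
        Tree (I.P side) univ (I.e side) st.1 st.2 (I.e side + 1) ∧
        I.Fresh side X W₀ (I.doneK side st.1 st.2 (I.e side)) W) := by
    refine Tri.loopM (f := fun G i => (I.P side).expand G 1 i (i + 1)) (mul_nonneg (by positivity) herr) (fun i st W =>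
        Tree (I.P side) univ (I.e side) st.1 st.2 (i + 1) ∧
        I.Fresh side X W₀ (I.doneK side st.1 st.2 i) W) ⟨⟨wf_root side, by omega⟩, hF.mono (by simp)⟩ ?_
    rintro i hi ⟨A, U⟩ W' ⟨q1, q2⟩
    refine (h.expand h0' h1' hs q1.toWF (by omega) (by omega) q2 (by omega) (by omega)).mono le_rfl ?_
    rintro st W'' ⟨q3, q4⟩
    refine ⟨q3.tree hv q1 (by omega) ?_, q4⟩
    simp_all [parent]
  have h2 := h1.bind (c' := fun G st => loopM (fun i => (I.P side).expand G I.m (I.e side + i)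
    (I.e side + 1 + i * I.m)) (I.X side) st) (δ' := I.X side * ((I.k * (I.m + 1) : ℕ) * I.err p))
    (Q' := fun st W => Tree (I.P side) univ (I.e side) st.1 st.2 (I.tot side) ∧
        I.Fresh side X W₀ (I.doneK side st.1 st.2 (I.e side + I.X side)) W)
    (mul_nonneg (by positivity) (mul_nonneg (by positivity) herr)) ?_
  · refine h2.mono (le_of_eq ?_) fun st W' h => ⟨h.1, _, h.2⟩
    push_cast
    ring
  · rintro st W' ⟨q1, q2⟩
    refine Tri.loopM (f := fun G i => (I.P side).expand G I.m (I.e side + i)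
        (I.e side + 1 + i * I.m)) (mul_nonneg (by positivity) herr) (fun i st W =>
        Tree (I.P side) univ (I.e side) st.1 st.2 (I.e side + 1 + i * I.m) ∧
        I.Fresh side X W₀ (I.doneK side st.1 st.2 (I.e side + i)) W) ⟨by simpa using q1, q2⟩ ?_
    rintro i hi ⟨A, U⟩ W' ⟨q1, q2⟩
    have him : (i + 1) * I.m ≤ I.X side * I.m := Nat.mul_le_mul_right _ hi
    have him' : (i + 1) * I.m = i * I.m + I.m := by ring
    have hii : i ≤ i * I.m := Nat.le_mul_of_pos_right _ (by omega)
    refine (h.expand h0' h1' hs q1.toWF (by omega) (by omega) q2 le_rfl (by omega)).mono le_rfl ?_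
    rintro st W'' ⟨q3, q4⟩
    refine ⟨?_, q4⟩
    rw [him', ← add_assoc]
    refine q3.tree hv q1 (by omega) ?_
    intro i' hi'
    rw [hPm]
    unfold parent
    rw [if_neg (by omega), show I.e side + 1 + i * I.m + i' - I.e side - 1 = i' + i * I.m by omega,
      Nat.add_mul_div_right _ _ (by omega), Nat.div_eq_of_lt hi']
    omega

end Grow

/-! ### Counting pairs of leaves that contain a used search base -/

section Count

/-- If the list `l` is not overloaded, then few of the tuples, which are determined by their first `h`
entries, complete it to a member of `U`. -/
theorem card_complete_le {n thr q h : ℕ} {U : Finset (List ℕ)} (val : ℕ → ℕ → ℕ) (T : Finset ℕ)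
    (C : ℕ → Finset ℕ) (hC : ∀ f < h, (C f).card ≤ q) (hval : ∀ a ∈ T, ∀ f < h, val a f ∈ C f)
    (hinj : ∀ a ∈ T, ∀ a' ∈ T, (∀ f < h, val a f = val a' f) → a = a')
    (hn : ∀ a ∈ T, ∀ f < h, val a f < n) {l is : List ℕ} (hnd : is.Nodup) (hlt : ∀ f ∈ is, f < h)
    (hO : ¬ Over n (thr + 1) U is.length l) :
    (T.filter fun a => l ++ is.map (val a) ∈ U).card ≤ is.length * (thr * q ^ (h - 1)) := by
  classical
  -- The members of `T` for which the entry number `r` is a place where the sequence turns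
  -- overloaded. There must be such a place, since `l` is not overloaded and a member of `U` is.
  let T' : ℕ → Finset ℕ := fun r => T.filter fun a =>
    ¬ Over n (thr + 1) U (is.length - r) (l ++ (is.take r).map (val a)) ∧
      Over n (thr + 1) U (is.length - (r + 1)) (l ++ (is.take (r + 1)).map (val a))
  have hsub : (T.filter fun a => l ++ is.map (val a) ∈ U) ⊆ (range is.length).biUnion T' := by
    intro a ha
    obtain ⟨ha, hU⟩ := mem_filter.1 ha
    by_contra hc
    have h1 : ∀ r ≤ is.length, ¬ Over n (thr + 1) U (is.length - r) (l ++ (is.take r).map (val a)) := by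
      intro r hr
      induction r with
      | zero => simpa using hO
      | succ r ih =>
        intro h2
        exact hc (mem_biUnion.2 ⟨r, mem_range.2 (by omega), mem_filter.2 ⟨ha, ih (by omega), h2⟩⟩)
    have h2 := h1 is.length le_rfl
    rw [Nat.sub_self, List.take_length, over_zero] at h2
    exact h2 hU
  refine (card_le_card hsub).trans ?_
  have hr : ∀ r ∈ range is.length, (T' r).card ≤ thr * q ^ (h - 1) := by
    intro r hr
    have hr := mem_range.1 hr
    set f := is[r] with hf
    have hfh : f < h := hlt f (List.getElem_mem _)
    -- Forget the critical coordinate. The others take at most `q ^ (h - 1)` values, and once they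
    -- are fixed the critical entry is one of at most `thr` overloading extensions.
    let φ : ℕ → Fin h → ℕ := fun a g => if g.val = f then 0 else val a g
    have h1 : ((T' r).image φ).card ≤ q ^ (h - 1) := by
      have h2 : (T' r).image φ ⊆ Fintype.piFinset fun g : Fin h => if g.val = f then {0} else C g := by
        grind
      refine (card_le_card h2).trans ?_
      rw [Fintype.card_piFinset, ← Finset.mul_prod_erase univ _ (mem_univ (⟨f, hfh⟩ : Fin h)), if_pos rfl,
        card_singleton, one_mul]
      calc _ ≤ ∏ _g ∈ univ.erase (⟨f, hfh⟩ : Fin h), q := by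
            refine Finset.prod_le_prod' fun g hg => ?_
            grind
        _ = q ^ (h - 1) := by
            rw [prod_const, card_erase_of_mem (mem_univ _), card_univ, Fintype.card_fin]
    refine (card_le_mul_card_image (f := φ) (T' r) thr ?_).trans (Nat.mul_le_mul_left _ h1)
    intro x hx
    obtain ⟨a, ha, rfl⟩ := mem_image.1 hx
    obtain ⟨-, h3, -⟩ := mem_filter.1 ha
    set L := l ++ (is.take r).map (val a) with hL
    rw [show is.length - r = is.length - (r + 1) + 1 by omega, over_succ, not_le, Nat.lt_succ_iff] at h3
    refine le_trans (card_le_card_of_injOn (fun b => val b f) ?_ ?_) h3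
    · intro b hb
      obtain ⟨hb, he⟩ := mem_filter.1 hb
      obtain ⟨hbT, -, h4⟩ := mem_filter.1 hb
      refine mem_coe.2 (mem_filter.2 ⟨mem_range.2 (hn b hbT f hfh), ?_⟩)
      have h5 : l ++ (is.take (r + 1)).map (val b) = L ++ [val b f] := by
        rw [List.take_succ_eq_append_getElem hr, List.map_append, ← List.append_assoc, hL]
        congr 2
        refine List.map_congr_left fun g hg => ?_
        have hgh : g < h := hlt g (List.mem_of_mem_take hg)
        have hgf : g ≠ f := by
          grind [List.getElem_of_mem, List.Nodup.getElem_inj_iff]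
        have h9 := congrFun he ⟨g, hgh⟩
        simpa [φ, hgf] using h9
      rw [← h5]
      exact h4
    · intro b hb b' hb' he
      obtain ⟨hb, h4⟩ := mem_filter.1 hb
      obtain ⟨hb', h4'⟩ := mem_filter.1 hb'
      refine hinj b (mem_filter.1 hb).1 b' (mem_filter.1 hb').1 fun g hg => ?_
      by_cases hgf : g = f
      · rw [hgf]; exact he
      · have h9 := congrFun (h4.trans h4'.symm) ⟨g, hg⟩
        simpa [φ, hgf] using h9
  calc _ ≤ (range is.length).card * (thr * q ^ (h - 1)) := card_biUnion_le_card_mul _ _ _ hr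
    _ = _ := by rw [card_range]

/-- Most columns contain few of the bad pairs. -/
theorem le_card_good {N N' : ℕ} (hN : 0 < N) (bad : ℕ → ℕ → Prop) [∀ a b, Decidable (bad a b)]
    (h : 4 * (((range N) ×ˢ (range N')).filter fun z => bad z.1 z.2).card ≤ N * N') :
    N' / 2 ≤ ((range N').filter fun b => 2 * ((range N).filter fun a => bad a b).card ≤ N).card := by
  have h1 : (((range N) ×ˢ (range N')).filter fun z => bad z.1 z.2).card =
      ∑ b ∈ range N', ((range N).filter fun a => bad a b).card := by
    simp only [card_filter]
    rw [sum_product_right]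
  have h2 := card_filter_add_card_filter_not (s := range N')
    (fun b => 2 * ((range N).filter fun a => bad a b).card ≤ N)
  rw [card_range] at h2
  set B := (range N').filter fun b => ¬ 2 * ((range N).filter fun a => bad a b).card ≤ N with hB
  have h3 : B.card * N ≤ ∑ b ∈ B, 2 * ((range N).filter fun a => bad a b).card := by
    rw [← smul_eq_mul, ← sum_const]
    refine sum_le_sum fun b hb => ?_
    have := (mem_filter.1 hb).2
    omega
  have h4 : ∑ b ∈ B, 2 * ((range N).filter fun a => bad a b).card ≤
      ∑ b ∈ range N', 2 * ((range N).filter fun a => bad a b).card :=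
    sum_le_sum_of_subset (filter_subset _ _)
  rw [← mul_sum, ← mul_sum, ← h1] at h4
  rw [← mul_sum] at h3
  have h6 : B.card * 2 ≤ N' := by
    have : N * (B.card * 2) ≤ N * N' := by
      grind
    exact Nat.le_of_mul_le_mul_left this hN
  omega

end Count

/-! ### Pairs of leaves and their joining sets. -/

section Leaves

variable {I : Inp} {X W : Finset (Finset (Fin I.n))} {A A' : Nodes} {U U' : Finset (List ℕ)}
variable {a b j side : ℕ} {l : List ℕ}

/-- Properties of the leaves of two search trees. -/
structure Inp.Leaves (I : Inp) (A A' : Nodes) (U U' : Finset (List ℕ)) : Prop where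
  tree₀ : Tree (I.P 0) univ (I.e 0) A U (I.tot 0)
  tree₁ : Tree (I.P 1) univ (I.e 1) A' U' (I.tot 1)

/-- The sets of vertices needed to connect two leaves. -/
noncomputable def Inp.link (I : Inp) (A A' : Nodes) (a b j : ℕ) : Finset (Fin I.n) :=
  vset I.n (A.pre (I.leaf 0 a) (I.k - j) ++ A'.pre (I.leaf 1 b) (j + 1))

theorem Inp.Hyp.leaf_pos (h : I.Hyp X) (hs : side < 2) : 0 < I.leaf side a := by
  have h1 := h.chk.1.2.1
  have hN : 2 ≤ I.N side := by
    obtain ⟨-, -, -, h0, h1⟩ := h.chk.1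
    interval_cases side <;> assumption
  have h2 : 0 < I.d side := Nat.clog_pos h1 hN
  have h3 : 0 < I.L side := by
    unfold Inp.L
    obtain ⟨d, hd⟩ : ∃ d, I.d side = d + 1 := ⟨I.d side - 1, by omega⟩
    rw [hd, start]
    omega
  unfold Inp.leaf
  omega

theorem Inp.Hyp.linkShape (h : I.Hyp X) (hT : I.Leaves A A' U U') (ha : a < I.N 0) (hb : b < I.N 1)
    (hj : j < I.k) : I.Shape (I.d 0 % 3) (3 + (I.d 1 + I.e 1) % 3) j
    (A.pre (I.leaf 0 a) (I.k - j) ++ A'.pre (I.leaf 1 b) (j + 1)) := by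
  have la := leaf_lt h.chk.1 ha
  have lb := leaf_lt h.chk.1 hb
  have pa := h.leaf_pos (side := 0) (a := a) (by omega)
  have pb := h.leaf_pos (side := 1) (a := b) (by omega)
  have v0 := valid_P h.valid (side := 0) (by omega)
  have v1 := valid_P h.valid (side := 1) (by omega)
  refine ⟨by omega, hj, ?_, ?_⟩
  · intro x hx
    simp only [Nodes.pre, List.mem_append, List.mem_map, List.mem_range] at hx
    rcases hx with ⟨f, hf, rfl⟩ | ⟨f, hf, rfl⟩
    · exact hT.tree₀.vert v0 la (show f < I.k by omega)
    · exact hT.tree₁.vert v1 lb (show f < I.k by omega)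
  · rw [List.map_append]
    congr 1
    · rw [Nodes.pre, List.map_map, blk]
      refine List.map_congr_left fun f hf => ?_
      have := List.mem_range.1 hf
      show I.cls (A _ f) = _
      rw [h.cls_node (by omega) hT.tree₀.toWF la (by omega), if_neg (by omega), lev_leaf h.chk hT.tree₀ ha, Inp.e,
        if_pos rfl, Nat.zero_mul, Nat.zero_add, Nat.zero_add]
    · rw [Nodes.pre, List.map_map, blk]
      refine List.map_congr_left fun f hf => ?_
      have := List.mem_range.1 hf
      show I.cls (A' _ f) = _
      rw [h.cls_node (by omega) hT.tree₁.toWF lb (by omega), if_neg (by omega), lev_leaf h.chk hT.tree₁ hb,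
        add_comm (I.e 1), one_mul]

/-- A joining set with `j < h 0` contains `k - j ≥ h 0` entries of the first leaf, and one with `j ≥
h 0` contains `j + 1 ≥ h 1` entries of the second; such beginnings determine the leaf. -/
theorem Inp.Hyp.link_inj (h : I.Hyp X) (hT : I.Leaves A A' U U') {a' b' j' : ℕ} (ha : a < I.N 0)
    (hb : b < I.N 1) (hj : j < I.k) (ha' : a' < I.N 0) (hb' : b' < I.N 1) (hj' : j' < I.k)
    (he : I.link A A' a b j = I.link A A' a' b' j') : j = j' ∧ (j < I.h 0 → a = a') ∧ (I.h 0 ≤ j → b = b') := by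
  have h1 := (h.linkShape hT ha hb hj).inj (h.linkShape hT ha' hb' hj') (by omega) he
  obtain ⟨rfl, -, -, h2⟩ := h1
  obtain ⟨h3, h4⟩ := List.append_inj h2 (by simp [Nodes.pre])
  refine ⟨rfl, fun hjh => ?_, fun hjh => ?_⟩
  · have h5 : I.h 0 ≤ I.k - j := by unfold Inp.h at hjh ⊢; omega
    have h6 := congrArg (List.take (I.h 0)) h3
    rw [pre_take h5, pre_take h5] at h6
    have h7 := h.pre_inj (by omega) hT.tree₀.toWF (leaf_lt h.chk.1 ha) (leaf_lt h.chk.1 ha') h6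
    unfold Inp.leaf at h7
    omega
  · have h5 : I.h 1 ≤ j + 1 := by unfold Inp.h at hjh ⊢; omega
    have h6 := congrArg (List.take (I.h 1)) h4
    rw [pre_take h5, pre_take h5] at h6
    have h7 := h.pre_inj (by omega) hT.tree₁.toWF (leaf_lt h.chk.1 hb) (leaf_lt h.chk.1 hb') h6
    unfold Inp.leaf at h7
    omega

/-- The class of the entries `f` of the leaves. -/
noncomputable def Inp.leafClass (I : Inp) (side f : ℕ) : Finset ℕ :=
  (range I.q).image fun i => (I.P side).vtx (I.e side + I.d side) f i

theorem Inp.Hyp.mem_leafClass (h : I.Hyp X) (hs : side < 2) {A : Nodes} {U : Finset (List ℕ)}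
    (hT : Tree (I.P side) univ (I.e side) A U (I.tot side)) {f : ℕ} (ha : a < I.N side) (hf : f < I.k) : A
    (I.leaf side a) f ∈ I.leafClass side f := by
  obtain ⟨-, h2, h3⟩ := hT.node _ (h.leaf_pos hs) (leaf_lt h.chk.1 ha)
  obtain ⟨⟨i, hi, h4⟩, -⟩ := h3 f hf
  refine mem_image.2 ⟨i, mem_range.2 hi, ?_⟩
  rw [h4, ← h2, show A (I.leaf side a) ((I.P side).k + 1) = _ from lev_leaf h.chk hT ha]

/-- The number of leaves of one tree that complete a list to a used search base. -/
theorem Inp.Hyp.card_leaves_le (h : I.Hyp X) (hs : side < 2) {A : Nodes} {U : Finset (List ℕ)}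
    (hT : Tree (I.P side) univ (I.e side) A U (I.tot side)) {is : List ℕ} (hnd : is.Nodup)
    (hlt : ∀ f ∈ is, f < I.h side) (hl : I.Sound l) (hk : l.length + is.length = I.k) :
    ((range (I.N side)).filter fun a => l ++ is.map (A (I.leaf side a)) ∈ I.UE).card ≤ I.k *
    (I.q / I.D1 * I.q ^ (I.h side - 1)) := by
  have hh := I.h_le side
  have h1 := card_complete_le (n := I.n) (thr := I.q / I.D1) (q := I.q) (h := I.h side) (U := I.UE)
    (fun a => A (I.leaf side a)) (range (I.N side)) (I.leafClass side) (fun f _ => card_image_le.trans (by simp))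
    (fun a ha f hf => h.mem_leafClass hs hT (mem_range.1 ha) (by omega)) (fun a ha a' ha' he => ?_)
    (fun a ha f hf => hT.vert (valid_P h.valid hs) (leaf_lt h.chk.1 (mem_range.1 ha)) (show f < I.k by omega))
    (l := l) hnd hlt ?_
  · exact h1.trans (Nat.mul_le_mul_right _ (by omega))
  · have h7 := h.pre_inj hs hT.toWF (leaf_lt h.chk.1 (mem_range.1 ha)) (leaf_lt h.chk.1 (mem_range.1 ha'))
      (List.map_congr_left fun f hf => he f (List.mem_range.1 hf))
    unfold Inp.leaf at h7
    omega
  · have h2 := hl l (List.Sublist.refl _) (by omega)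
    grind

/-- The pair of leaves cannot be connected as one of the sets needed is in `X`. -/
def Inp.Bad (I : Inp) (X : Finset (Finset (Fin I.n))) (A A' : Nodes) (a b : ℕ) : Prop :=
  ∃ j < I.k, I.link A A' a b j ∈ X

/-- Allows the fixed part of a base to be put first, whichever tree it comes from. -/
theorem Inp.UE_swap {l' : List ℕ} (h : l ++ l' ∈ I.UE) : l' ++ l ∈ I.UE := by
  grind [mem_UE, List.length_append, vset_append, union_comm]

/-- A joining set takes `k - j` entries of `a` and `j + 1` of `b`, so one of the two parts lies
within the beginning that determines its leaf. That leaf is the one to be counted, while the other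
is held fixed. -/
theorem Inp.Hyp.exists_of_bad (h : I.Hyp X) (hT : I.Leaves A A' U U') (ha : a < I.N 0) (hb : b < I.N 1)
    (hB : I.Bad X A A' a b) : ∃ is ∈ (List.range I.k).sublists, ∃ js ∈ (List.range I.k).sublists, is.length +
    js.length = I.k ∧ ((∀ f ∈ is, f < I.h 0) ∨ (∀ f ∈ js, f < I.h 1)) ∧ is.map (A (I.leaf 0 a)) ++ js.map
    (A' (I.leaf 1 b)) ∈ I.UE := by
  obtain ⟨j, hj, hX⟩ := hB
  obtain ⟨e, he, hez⟩ := h.cover _ hX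
  have hsh := h.linkShape hT ha hb hj
  obtain ⟨Q, hQ, rfl, hQc⟩ := exists_sublist_of_subset hsh.nodup hez
  rw [h.card_E _ he] at hQc
  obtain ⟨Q₁, Q₂, rfl, h1, h2⟩ := List.sublist_append_iff.1 hQ
  obtain ⟨is, his, rfl⟩ := List.sublist_map_iff.1 h1
  obtain ⟨js, hjs, rfl⟩ := List.sublist_map_iff.1 h2
  have hhk : I.h 0 + I.h 1 = I.k := by unfold Inp.h; omega
  refine ⟨is, List.mem_sublists.2 (his.trans (List.range_sublist.2 (by omega))), js,
    List.mem_sublists.2 (hjs.trans (List.range_sublist.2 (by omega))), by simpa using hQc, ?_, ?_⟩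
  · grind
  · refine mem_UE.2 ⟨hQc, ?_, he⟩
    intro x hx
    rw [List.mem_append, List.mem_map, List.mem_map] at hx
    rcases hx with ⟨f, hf, rfl⟩ | ⟨f, hf, rfl⟩
    · have := List.mem_range.1 (his.subset hf)
      exact h.usable_node (by omega) hT.tree₀.toWF (h.leaf_pos (by omega)) (leaf_lt h.chk.1 ha) (by omega)
    · have := List.mem_range.1 (hjs.subset hf)
      exact h.usable_node (by omega) hT.tree₁.toWF (h.leaf_pos (by omega)) (leaf_lt h.chk.1 hb) (by omega)

-- There are at most `4 ^ k` choices of the positions of an old base in the two leaves. For each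
-- choice one leaf is fixed and sound, and the number of partners completing it is bounded by
-- `Inp.Hyp.card_leaves_le`. By `hc` the sum is at most a quarter of all pairs.
open Classical in
theorem Inp.Hyp.card_bad_le (h : I.Hyp X) (hT : I.Leaves A A' U U')
    (hc : ∀ side < 2, 8 * (4 ^ I.k * (I.k * (I.q / I.D1 * I.q ^ (I.h side - 1)))) ≤ I.N side) : 4 *
    (((range (I.N 0)) ×ˢ (range (I.N 1))).filter fun z => I.Bad X A A' z.1 z.2).card ≤ I.N 0 * I.N 1 := by
  set SL := (List.range I.k).sublists.toFinset with hSL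
  let T : List ℕ × List ℕ → Finset (ℕ × ℕ) := fun w =>
    if w.1.length + w.2.length = I.k ∧ ((∀ f ∈ w.1, f < I.h 0) ∨ (∀ f ∈ w.2, f < I.h 1)) then
      ((range (I.N 0)) ×ˢ (range (I.N 1))).filter fun z =>
        w.1.map (A (I.leaf 0 z.1)) ++ w.2.map (A' (I.leaf 1 z.2)) ∈ I.UE else ∅
  set M := I.N 1 * (I.k * (I.q / I.D1 * I.q ^ (I.h 0 - 1))) + I.N 0 * (I.k * (I.q / I.D1 * I.q ^ (I.h 1 - 1)))
    with hM
  have hsub : (((range (I.N 0)) ×ˢ (range (I.N 1))).filter fun z => I.Bad X A A' z.1 z.2) ⊆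
      (SL ×ˢ SL).biUnion T := by
    rintro ⟨a, b⟩ hz
    obtain ⟨hz, hB⟩ := mem_filter.1 hz
    obtain ⟨ha, hb⟩ := mem_product.1 hz
    obtain ⟨is, his, js, hjs, h1, h2, h3⟩ := h.exists_of_bad hT (mem_range.1 ha) (mem_range.1 hb) hB
    refine mem_biUnion.2 ⟨(is, js), mem_product.2 ⟨List.mem_toFinset.2 his, List.mem_toFinset.2 hjs⟩, ?_⟩
    grind
  have hSLc : SL.card ≤ 2 ^ I.k := by
    refine (List.toFinset_card_le _).trans ?_
    rw [List.length_sublists, List.length_range]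
  have hTc : ∀ w ∈ SL ×ˢ SL, (T w).card ≤ M := by
    rintro ⟨is, js⟩ hw
    obtain ⟨hw1, hw2⟩ := mem_product.1 hw
    have hw1 := List.mem_sublists.1 (List.mem_toFinset.1 hw1)
    have hw2 := List.mem_sublists.1 (List.mem_toFinset.1 hw2)
    simp only [T]
    split_ifs with hcond
    · obtain ⟨hlen, hcond⟩ := hcond
      change is.length + js.length = I.k at hlen
      rcases hcond with hcond | hcond
      · refine le_trans ?_ (Nat.le_add_right _ _)
        rw [card_filter, sum_product_right, ← card_range (I.N 1), ← smul_eq_mul, ← sum_const, card_range]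
        refine sum_le_sum fun b hb => ?_
        rw [← card_filter]
        have hS := (h.sound_node (by omega) hT.tree₁.toWF (I.leaf 1 b)
          (leaf_lt h.chk.1 (mem_range.1 hb))).sublist (hw2.map _)
        refine le_trans (card_le_card ?_) (h.card_leaves_le (by omega) hT.tree₀ (hw1.nodup List.nodup_range) hcond
          hS (by grind))
        grind [UE_swap]
      · refine le_trans ?_ (Nat.le_add_left _ _)
        rw [card_filter, sum_product, ← card_range (I.N 0), ← smul_eq_mul, ← sum_const, card_range]
        refine sum_le_sum fun a ha => ?_
        rw [← card_filter]
        have hS := (h.sound_node (by omega) hT.tree₀.toWF (I.leaf 0 a)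
          (leaf_lt h.chk.1 (mem_range.1 ha))).sublist (hw1.map _)
        exact h.card_leaves_le (by omega) hT.tree₁ (hw2.nodup List.nodup_range) hcond
          hS (by grind)
    · simp
  have h1 := (card_le_card hsub).trans (card_biUnion_le_card_mul _ _ M hTc)
  rw [card_product] at h1
  have h2 : SL.card * SL.card ≤ 4 ^ I.k := by
    calc SL.card * SL.card ≤ 2 ^ I.k * 2 ^ I.k := Nat.mul_le_mul hSLc hSLc
      _ = 4 ^ I.k := by rw [← mul_pow]; norm_num
  have h3 := h1.trans (Nat.mul_le_mul_right M h2)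
  have h4 := Nat.mul_le_mul_left (I.N 1) (hc 0 (by omega))
  have h5 := Nat.mul_le_mul_left (I.N 0) (hc 1 (by omega))
  grind

end Leaves

/-! ### Connecting the search trees -/

section Connect

variable {I : Inp} {X W : Finset (Finset (Fin I.n))} {A A' : Nodes} {U U' : Finset (List ℕ)} {p : ℝ}

theorem one_sub_pow_mem (h0 : 0 ≤ p) (h1 : p ≤ 1) (k : ℕ) : 0 ≤ 1 - p ^ k ∧ 1 - p ^ k ≤ 1 := by
  grind [pow_le_one₀, pow_nonneg]

-- Exposure in two rounds. In the first, the sets with `j < h 0` are revealed: for fixed `b` those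
-- of different `a` are disjoint, so each good `b` fails to get a partner with probability at most
-- `(1 - p ^ h 0) ^ (N 0 / 2)`. In the second, the sets with `j ≥ h 0` are revealed for the chosen
-- partners only: those of different `b` are disjoint.
open Classical in
theorem Inp.Hyp.connect (h : I.Hyp X) (h0 : 0 ≤ p) (h1 : p ≤ 1) (hT : I.Leaves A A' U U')
    (hc : ∀ side < 2, 8 * (4 ^ I.k * (I.k * (I.q / I.D1 * I.q ^ (I.h side - 1)))) ≤ I.N side)
    (hW : ∀ a < I.N 0, ∀ b < I.N 1, ∀ j < I.k, I.link A A' a b j ∉ X → I.link A A' a b j ∈ W)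
    (F : Finset (Finset (Fin I.n))) :
    Pr p W (fun H => if ∃ i < I.N 0, ∃ j < I.N 1, I.Conn (F ∪ H) A A' (I.leaf 0 i) (I.leaf 1 j) then 0 else 1) ≤
      I.N 1 * (1 - p ^ I.h 0) ^ (I.N 0 / 2) + (1 - p ^ I.h 1) ^ (I.N 1 / 2) := by
  have hhk : I.h 0 + I.h 1 = I.k := by
    unfold Inp.h
    omega
  have hN0 : 2 ≤ I.N 0 := h.chk.1.2.2.2.1
  set good := (range (I.N 1)).filter fun b => 2 * ((range (I.N 0)).filter fun a => I.Bad X A A' a b).card ≤ I.N 0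
    with hgood
  have hgc : I.N 1 / 2 ≤ good.card := le_card_good (by omega) _ (h.card_bad_le hT hc)
  let clean : ℕ → Finset ℕ := fun b => (range (I.N 0)).filter fun a => ¬ I.Bad X A A' a b
  have hclean : ∀ b ∈ good, I.N 0 / 2 ≤ (clean b).card := by
    grind [card_filter_add_card_filter_not, s, card_range]
  have hgl : ∀ b ∈ good, b < I.N 1 := fun b hb => mem_range.1 (mem_filter.1 hb).1
  have hcl : ∀ b, ∀ a ∈ clean b, a < I.N 0 ∧ ∀ j < I.k, I.link A A' a b j ∉ X := fun b a ha =>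
    ⟨mem_range.1 (mem_filter.1 ha).1, fun j hj hX => (mem_filter.1 ha).2 ⟨j, hj, hX⟩⟩
  let K₁ : ℕ → ℕ → Finset (Finset (Fin I.n)) := fun a b => (range (I.h 0)).image (I.link A A' a b)
  let K₂ : ℕ → ℕ → Finset (Finset (Fin I.n)) := fun a b => (Ico (I.h 0) I.k).image (I.link A A' a b)
  set Z := good.biUnion fun b => (clean b).biUnion fun a => K₁ a b with hZ
  have hZW : Z ⊆ W := by
    grind
  rw [Pr_split hZW]
  have hp1 := one_sub_pow_mem h0 h1 (I.h 1)
  have hp0 := one_sub_pow_mem h0 h1 (I.h 0)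
  have key : ∀ H₁ ⊆ Z, (Pr p (W \ Z) fun H₂ => if ∃ i < I.N 0, ∃ j < I.N 1,
      I.Conn (F ∪ (H₁ ∪ H₂)) A A' (I.leaf 0 i) (I.leaf 1 j) then (0 : ℝ) else 1) ≤
      (1 - p ^ I.h 1) ^ (I.N 1 / 2) + ∑ b ∈ good, if ∃ a ∈ clean b, K₁ a b ⊆ H₁ then (0 : ℝ) else 1 := by
    intro H₁ _
    have hsum : ∀ b ∈ good, (0 : ℝ) ≤ if ∃ a ∈ clean b, K₁ a b ⊆ H₁ then (0 : ℝ) else 1 := by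
      intro b _
      split_ifs <;> norm_num
    by_cases hall : ∀ b ∈ good, ∃ a ∈ clean b, K₁ a b ⊆ H₁
    -- The partners `α b` depend on the first round only, while the sets needed now have other
    -- indices `j` and hence are unrevealed.
    · choose! α hα using hall
      have h2 := Pr_none h0 h1 good (fun b => K₂ (α b) b) (k := I.h 1) (W := W \ Z) ?_ ?_ ?_
      · have h3 : (1 - p ^ I.h 1) ^ good.card ≤ (1 - p ^ I.h 1) ^ (I.N 1 / 2) :=
          pow_le_pow_of_le_one hp1.1 hp1.2 hgc
        refine le_trans (Pr_mono h0 h1 fun H₂ _ => ?_) ((h2.trans h3).trans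
          (le_add_of_nonneg_right (sum_nonneg hsum)))
        split_ifs with h4 h5 h5
        · exact le_rfl
        · exact zero_le_one
        · exfalso
          obtain ⟨b, hb, h6⟩ := h5
          refine h4 ⟨α b, (hcl b _ (hα b hb).1).1, b, hgl b hb, fun j hj => ?_⟩
          rw [mem_union, mem_union]
          rcases Nat.lt_or_ge j (I.h 0) with hj' | hj'
          · exact Or.inr (Or.inl ((hα b hb).2 (mem_image.2 ⟨j, mem_range.2 hj', rfl⟩)))
          · exact Or.inr (Or.inr (h6 (mem_image.2 ⟨j, mem_Ico.2 ⟨hj', hj⟩, rfl⟩)))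
        · exact le_rfl
      · intro b hb z hz
        obtain ⟨j, hj, rfl⟩ := mem_image.1 hz
        obtain ⟨hj1, hj2⟩ := mem_Ico.1 hj
        have hcb := hcl b _ (hα b hb).1
        refine mem_sdiff.2 ⟨hW _ hcb.1 b (hgl b hb) j hj2 (hcb.2 j hj2), fun hz' => ?_⟩
        obtain ⟨b', hb', hz'⟩ := mem_biUnion.1 hz'
        obtain ⟨a', ha', hz'⟩ := mem_biUnion.1 hz'
        obtain ⟨j', hj', he⟩ := mem_image.1 hz'
        have hj' := mem_range.1 hj'
        have h3 := (h.link_inj hT (hcl b' a' ha').1 (hgl b' hb') (by omega) hcb.1 (hgl b hb) hj2 he).1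
        omega
      · grind [Nat.card_Ico]
      · intro b hb b' hb' hne
        rw [Finset.disjoint_left]
        intro z hz hz'
        obtain ⟨j, hj, rfl⟩ := mem_image.1 hz
        obtain ⟨j', hj', he⟩ := mem_image.1 hz'
        obtain ⟨hj1, hj2⟩ := mem_Ico.1 hj
        obtain ⟨hj1', hj2'⟩ := mem_Ico.1 hj'
        exact hne ((h.link_inj hT (hcl b' _ (hα b' hb').1).1 (hgl b' hb') hj2' (hcl b _ (hα b hb).1).1
          (hgl b hb) hj2 he).2.2 hj1').symm
    · push Not at hall
      obtain ⟨b, hb, hall⟩ := hall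
      have h2 : (1 : ℝ) ≤ ∑ b ∈ good, if ∃ a ∈ clean b, K₁ a b ⊆ H₁ then (0 : ℝ) else 1 := by
        refine le_trans (le_of_eq ?_) (single_le_sum hsum hb)
        grind
      have h3 : (0 : ℝ) ≤ (1 - p ^ I.h 1) ^ (I.N 1 / 2) := pow_nonneg hp1.1 _
      refine le_trans (Pr_mono (ψ := fun _ => 1) h0 h1 fun H₂ _ => ?_) ?_
      · split_ifs <;> norm_num
      · rw [Pr_const]
        linarith
  refine (Pr_mono h0 h1 key).trans ?_
  rw [Pr_add, Pr_const, Pr_sum, add_comm]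
  refine add_le_add_left ?_ _
  have h2 : ∀ b ∈ good, (Pr p Z fun H₁ => if ∃ a ∈ clean b, K₁ a b ⊆ H₁ then (0 : ℝ) else 1) ≤
      (1 - p ^ I.h 0) ^ (I.N 0 / 2) := by
    intro b hb
    refine (Pr_none h0 h1 (clean b) (fun a => K₁ a b) (k := I.h 0) ?_ ?_ ?_).trans
      (pow_le_pow_of_le_one hp0.1 hp0.2 (hclean b hb))
    · intro a ha z hz
      exact mem_biUnion.2 ⟨b, hb, mem_biUnion.2 ⟨a, ha, hz⟩⟩
    · grind
    · intro a ha a' ha' hne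
      rw [Finset.disjoint_left]
      intro z hz hz'
      obtain ⟨j, hj, rfl⟩ := mem_image.1 hz
      obtain ⟨j', hj', he⟩ := mem_image.1 hz'
      have hj := mem_range.1 hj
      have hj' := mem_range.1 hj'
      exact hne ((h.link_inj hT (hcl b a' ha').1 (hgl b hb) (by omega) (hcl b a ha).1 (hgl b hb)
        (by omega) he).2.1 hj').symm
  refine (sum_le_card_nsmul _ _ _ h2).trans ?_
  rw [nsmul_eq_mul]
  refine mul_le_mul_of_nonneg_right ?_ (pow_nonneg hp0.1 _)
  have : good.card ≤ I.N 1 := (card_filter_le _ _).trans (by rw [card_range])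
  exact_mod_cast this

theorem Inp.Hyp.card_vset (_ : I.Hyp X) {a b j : ℕ} {l : List ℕ} (hl : I.Shape a b j l) :
    vset I.n l ∈ powersetCard (I.k + 1) univ := by
  rw [mem_powersetCard, SpikeLemma.card_vset hl.2.2.1 hl.nodup]
  exact ⟨subset_univ _, hl.length⟩

theorem TreeBlocks.bounds {side X Y : ℕ} (h : TreeBlocks side X Y) :
    (X = 6 + side ∨ (side * 3 ≤ X ∧ X < side * 3 + 3)) ∧ side * 3 ≤ Y ∧ Y < side * 3 + 3 := by
  rcases h with ⟨rfl, rfl⟩ | ⟨a, ha, rfl, rfl⟩ <;> omega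

/-- The number of scans in a search tree. -/
noncomputable def Inp.scanCount (I : Inp) (side : ℕ) : ℕ := I.e side * (2 * I.k) + I.X side * (I.k * (I.m + 1))

/-- A bound for the probability that the algorithm fails. -/
noncomputable def Inp.failBound (I : Inp) (p : ℝ) : ℝ :=
  (I.scanCount 0 + I.scanCount 1) * I.err p + (I.N 1 * (1 - p ^ I.h 0) ^ (I.N 0 / 2) + (1 - p ^ I.h 1) ^ (I.N 1 / 2))

-- The sets inspected in the first tree, in the second tree and between the leaves have different
-- pairs of blocks of classes. So the three phases use disjoint random sets, and their failure
-- bounds add up.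
open Classical in
theorem Inp.Hyp.fail_le (h : I.Hyp X) (h0 : 0 ≤ p) (h1 : p ≤ 1)
    (hc : ∀ side < 2, 8 * (4 ^ I.k * (I.k * (I.q / I.D1 * I.q ^ (I.h side - 1)))) ≤ I.N side)
    (F : Finset (Finset (Fin I.n))) :
    Pr p (powersetCard (I.k + 1) univ \ X) (fun H => if I.Succ (F ∪ H) then 0 else 1) ≤ I.failBound p := by
  set W := powersetCard (I.k + 1) univ \ X with hWdef
  have herr := I.err_nonneg h1
  have hF0 : I.Fresh 0 X W (fun _ _ => False) W := by
    refine ⟨fun j l hl hX _ => mem_sdiff.2 ⟨?_, hX⟩, fun z hz _ => hz⟩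
    obtain ⟨_, _, -, h2⟩ := hl
    exact h.card_vset h2
  have t0 := h.grow h0 h1 (side := 0) (by omega) hF0
  let Q : (Nodes × Finset (List ℕ)) × (Nodes × Finset (List ℕ)) → Finset (Finset (Fin I.n)) → Prop := fun s W' =>
    I.Leaves s.1.1 s.2.1 s.1.2 s.2.2 ∧ ∀ a < I.N 0, ∀ b < I.N 1, ∀ j < I.k,
      I.link s.1.1 s.2.1 a b j ∉ X → I.link s.1.1 s.2.1 a b j ∈ W'
  have t1 := t0.bind (c' := fun G a => (I.tree G 1).map fun b => (a, b)) (δ' := I.scanCount 1 * I.err p)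
    (Q' := Q) (mul_nonneg (by positivity) herr) ?_
  · have t2 := t1 F (fun s G => if ∃ i < I.N 0, ∃ j < I.N 1,
        I.Conn G s.1.1 s.2.1 (I.leaf 0 i) (I.leaf 1 j) then 0 else 1)
      (I.N 1 * (1 - p ^ I.h 0) ^ (I.N 0 / 2) + (1 - p ^ I.h 1) ^ (I.N 1 / 2)) ?_ ?_ ?_ ?_
    · refine le_trans (Pr_mono h0 h1 fun H _ => ?_) (t2.trans (le_of_eq ?_))
      · dsimp only
        cases ha : I.tree (F ∪ H) 0 with
        | none =>
          grind
        | some a =>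
          cases hb : I.tree (F ∪ H) 1 with
          | none =>
            grind
          | some b =>
            show _ ≤ if ∃ i < I.N 0, ∃ j < I.N 1, I.Conn (F ∪ H) a.1 b.1 (I.leaf 0 i) (I.leaf 1 j) then (0 : ℝ) else 1
            split_ifs with h2 h3 h3
            · exact le_rfl
            · exact zero_le_one
            · exact absurd ⟨h.chk, a, b, ha, hb, h3⟩ h2
            · exact le_rfl
      · unfold failBound scanCount
        ring
    · grind [one_sub_pow_mem, add_nonneg, mul_nonneg, pow_nonneg]
    · intro s G
      split_ifs <;> norm_num
    · intro s G
      split_ifs <;> norm_num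
    · intro s F' W' hs
      exact h.connect h0 h1 hs.1 hc hs.2 F'
  · rintro a W₁ ⟨hT0, K, hF1⟩
    have hF1' : I.Fresh 1 X W₁ (fun _ _ => False) W₁ := by
      refine ⟨fun j l hl hX _ => ?_, fun z hz _ => hz⟩
      obtain ⟨Y, Y', hY, hsh⟩ := hl
      refine hF1.keep _ (mem_sdiff.2 ⟨h.card_vset hsh, hX⟩) ?_
      rintro j' l' ⟨Z, Z', hZ, hsh'⟩ he
      have bY := hY.bounds
      have bZ := hZ.bounds
      have hno : ¬ (Z = Y' ∧ Z' = Y) := by omega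
      obtain ⟨-, h2, h3, -⟩ := hsh'.inj hsh hno he
      omega
    refine (h.grow h0 h1 (side := 1) (by omega) hF1').map ?_
    rintro b W₂ ⟨hT1, K', hF2⟩
    have hL : I.Leaves a.1 b.1 a.2 b.2 := ⟨hT0, hT1⟩
    refine ⟨hL, fun i hi i' hi' j hj hX => ?_⟩
    have hsh := h.linkShape hL hi hi' hj
    refine hF2.keep _ (hF1.keep _ (mem_sdiff.2 ⟨h.card_vset hsh, hX⟩) ?_) ?_
    · rintro j' l' ⟨Z, Z', hZ, hsh'⟩ he
      have bZ := hZ.bounds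
      obtain ⟨-, h2, h3, -⟩ := hsh'.inj hsh (by omega) he
      omega
    · rintro j' l' ⟨Z, Z', hZ, hsh'⟩ he
      have bZ := hZ.bounds
      obtain ⟨-, h2, h3, -⟩ := hsh'.inj hsh (by omega) he
      omega

end Connect

/-! ### The sizes of the parameters -/

section Sizes

/-- The inverse density of the leaves. -/
def leafDensity (k : ℕ) : ℕ := 6 * 8 ^ k

/-- The inverse density of overloaded extensions. -/
def overDensity (k : ℕ) : ℕ := 8 * 4 ^ k * k * leafDensity k

/-- The constant for the size of `S`, divided by `24 k`. -/
noncomputable def sizeConst₀ (k : ℕ) : ℝ :=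
  8 * leafDensity k * (k + 7) + 80 * k ^ 2 + 64 + 2 * leafDensity k + Real.exp (20 * k)

/-- The constant for the size of `S`. -/
noncomputable def sizeConst (k : ℕ) : ℝ := 24 * k * sizeConst₀ k

/-- The constant for the number of search bases used before. -/
noncomputable def baseConst (k : ℕ) : ℝ := ((12 * k * k * overDensity k : ℝ)⁻¹) ^ k

theorem leafDensity_pos (k : ℕ) : 1 ≤ leafDensity k := by
  grind [Nat.one_le_pow, leafDensity]

/-- The summands serve in turn: failure probabilities of order `n ^ (-(k + 7))`, ancestors filling
at most an eighth of a class, `q` exceeding a multiple of `log n`, at least two leaves, and `log n ≥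
20 * k`. -/
theorem sizeConst₀_ge (k : ℕ) : 8 * leafDensity k * (k + 7) ≤ sizeConst₀ k ∧ 80 * (k : ℝ) ^ 2 ≤ sizeConst₀ k ∧
    64 ≤ sizeConst₀ k ∧ 2 * leafDensity k ≤ sizeConst₀ k ∧ Real.exp (20 * k) ≤ sizeConst₀ k := by
  have h2 := Real.exp_pos (20 * k)
  have h3 : (0 : ℝ) ≤ 8 * leafDensity k * (k + 7) := by positivity
  have h4 : (0 : ℝ) ≤ 80 * (k : ℝ) ^ 2 := by positivity
  grind [sizeConst₀]

/-- Facts about the number `n` of vertices, the number `S` of usable vertices, the density `p` and the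
size `q` of the classes. -/
structure Sizes (k n S q : ℕ) (p : ℝ) : Prop where
  p_pos : 0 < p
  p_le : p ≤ 1
  log_ge : 20 * (k : ℝ) ≤ Real.log n
  n_ge : sizeConst k * Real.log n ^ 3 ≤ n
  S_le : (S : ℝ) ≤ n / Real.log n ^ 2 + 1
  q_ge : (S : ℝ) / (12 * k) ≤ q
  pq_ge : sizeConst₀ k * Real.log n ≤ p * q

/-- Since `p ≤ 1`, the lower bound on `p` makes `n` large, and it also gives `|S| ≤ n / (log n) ^ 2
+ 1`. Rounding and the at most `2 * k` vertices lost to the ends cost a factor 2 each, whence `24 *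
k` in `sizeConst`: `p * q` is at least `p * |S| / (12 * k)`. -/
theorem Sizes.intro {k n S s : ℕ} {p : ℝ} (hk : 2 ≤ k) (hn : 2 ≤ n)
    (hp : sizeConst k * Real.log n ^ 3 / n ≤ p) (hp1 : p ≤ 1)
    (hS : |(S : ℝ) - sizeConst k * p⁻¹ * Real.log n| < 1) (hs : S ≤ s + 2 * k) :
    Sizes k n S (s / (6 * k)) p := by
  have hk' : (2 : ℝ) ≤ k := by exact_mod_cast hk
  have hn' : (2 : ℝ) ≤ n := by exact_mod_cast hn
  set L := Real.log n with hL
  obtain ⟨-, -, c3, -, c5⟩ := sizeConst₀_ge k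
  have hL2 : (0.69 : ℝ) ≤ L := by
    have h1 := Real.log_two_gt_d9
    have h2 : Real.log 2 ≤ L := Real.log_le_log (by norm_num) hn'
    linarith
  have hL3 : (1 / 4 : ℝ) ≤ L ^ 3 := by
    calc (1 / 4 : ℝ) ≤ 0.69 ^ 3 := by norm_num
      _ ≤ L ^ 3 := pow_le_pow_left₀ (by norm_num) hL2 3
  have hC0 : sizeConst₀ k * 48 ≤ sizeConst k := by
    unfold sizeConst
    nlinarith
  have hCpos : 0 < sizeConst k := by linarith
  have hn0 : (0 : ℝ) < n := by linarith
  have hppos : 0 < p := lt_of_lt_of_le (by positivity) hp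
  have h1 : sizeConst k * L ^ 3 ≤ p * n := (div_le_iff₀ hn0).1 hp
  have hCn : sizeConst k * L ^ 3 ≤ n := by nlinarith
  have hlog : 20 * (k : ℝ) ≤ L := by
    have h2 : Real.exp (20 * k) ≤ n := by nlinarith
    have h3 := Real.log_le_log (Real.exp_pos _) h2
    rwa [Real.log_exp] at h3
  set T := sizeConst k * p⁻¹ * L with hT
  have hpT : p * T = sizeConst k * L := by
    rw [hT]
    field_simp
  have hTn : T ≤ n / L ^ 2 := by
    rw [le_div_iff₀ (by positivity)]
    have h4 : p * (T * L ^ 2) ≤ p * n := by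
      calc p * (T * L ^ 2) = p * T * L ^ 2 := by ring
        _ = sizeConst k * L ^ 3 := by rw [hpT]; ring
        _ ≤ _ := h1
    exact le_of_mul_le_mul_left h4 hppos
  obtain ⟨hS1, hS2⟩ := abs_lt.1 hS
  have hT2 : 64 * 24 * (k : ℝ) ≤ T := by
    nlinarith
  have hq : (S : ℝ) / (12 * k) ≤ ((s / (6 * k) : ℕ) : ℝ) := by
    have h6 : s < 6 * k * (s / (6 * k) + 1) := Nat.lt_mul_div_succ s (by omega)
    have h7 : (s : ℝ) < 6 * k * (((s / (6 * k) : ℕ) : ℝ) + 1) := by exact_mod_cast h6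
    have h8 : (S : ℝ) ≤ s + 2 * k := by exact_mod_cast hs
    rw [div_le_iff₀ (by positivity)]
    nlinarith
  refine ⟨hppos, hp1, hlog, hCn, by linarith, hq, ?_⟩
  have h9 : T / 2 ≤ S := by linarith
  have h10 : p * (S / (12 * k)) ≤ p * ((s / (6 * k) : ℕ) : ℝ) := mul_le_mul_of_nonneg_left hq hppos.le
  refine le_trans ?_ h10
  have h11 : p * (S / (12 * k)) = (p * S) / (12 * k) := by ring
  rw [h11, le_div_iff₀ (by positivity)]
  have h12 : p * (T / 2) ≤ p * S := mul_le_mul_of_nonneg_left h9 hppos.le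
  grind [sizeConst, le_trans, le_of_eq]

variable {k n S q : ℕ} {p : ℝ}
variable {a d : ℕ}

theorem Sizes.q_ge' (h : Sizes k n S q p) : sizeConst₀ k * Real.log n ≤ q := by
  have h1 := h.pq_ge
  have h2 := h.p_le
  nlinarith

theorem Sizes.log_ge' (h : Sizes k n S q p) (hk : 2 ≤ k) : 40 ≤ Real.log n := by
  have h1 := h.log_ge
  have hk' : (2 : ℝ) ≤ k := by exact_mod_cast hk
  linarith

theorem Sizes.n_ge' (h : Sizes k n S q p) (hk : 2 ≤ k) : 40 ≤ n := by
  have h1 := h.log_ge' hk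
  have h2 : (40 : ℝ) ≤ n := h1.trans (Real.log_le_self (by positivity))
  exact_mod_cast h2

theorem Sizes.two_le_log (h : Sizes k n S q p) (hk : 2 ≤ k) : 2 ≤ Nat.log 2 n :=
  Nat.le_log_of_pow_le (by norm_num) (by have := h.n_ge' hk; omega)

theorem natLog_le {n : ℕ} (hn : 1 ≤ n) : (Nat.log 2 n : ℝ) ≤ 2 * Real.log n := by
  have h1 : 2 ^ Nat.log 2 n ≤ n := Nat.pow_log_le_self 2 (by omega)
  have h2 : (2 : ℝ) ^ Nat.log 2 n ≤ n := by exact_mod_cast h1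
  have h3 := Real.log_le_log (by positivity) h2
  rw [Real.log_pow] at h3
  have h4 := Real.log_two_gt_d9
  nlinarith

theorem Sizes.q_ge_log (h : Sizes k n S q p) (hk : 2 ≤ k) : 16 * (Nat.log 2 n + 2) ≤ q := by
  have h1 := h.q_ge'
  have h2 := h.log_ge' hk
  have h3 := natLog_le (n := n) (by have := h.n_ge' hk; omega)
  obtain ⟨-, -, c3, -, -⟩ := sizeConst₀_ge k
  have h4 : (16 * (Nat.log 2 n + 2) : ℝ) ≤ q := by nlinarith
  exact_mod_cast h4

theorem Sizes.q_ge_density (h : Sizes k n S q p) (hk : 2 ≤ k) : 2 * leafDensity k ≤ q := by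
  have h1 := h.q_ge'
  have h2 := h.log_ge' hk
  obtain ⟨-, -, -, c4, -⟩ := sizeConst₀_ge k
  have h4 : (2 * leafDensity k : ℝ) ≤ q := by nlinarith
  exact_mod_cast h4

/-- A bound for the depth of the search. -/
theorem Sizes.depth_le (h : Sizes k n S q p) (hk : 2 ≤ k) (hd : d ≤ 2 * (k * (Nat.log 2 n + 1)) + 3) : (d : ℝ) ≤
    10 * k * Real.log n := by
  have h2 := h.log_ge' hk
  have h3 := natLog_le (n := n) (by have := h.n_ge' hk; omega)
  have hk' : (2 : ℝ) ≤ k := by exact_mod_cast hk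
  have h4 : (d : ℝ) ≤ 2 * (k * (Nat.log 2 n + 1)) + 3 := by exact_mod_cast hd
  nlinarith

theorem Sizes.depth_mul_le (h : Sizes k n S q p) (hk : 2 ≤ k) (hd : d ≤ 2 * (k * (Nat.log 2 n + 1)) + 3) : 8 *
    (d * k) ≤ q := by
  have h1 := h.q_ge'
  have h2 := h.log_ge' hk
  have h3 := h.depth_le hk hd
  obtain ⟨-, c2, -, -, -⟩ := sizeConst₀_ge k
  have h4 : (8 * (d * k) : ℝ) ≤ q := by
    have h5 : 8 * ((d : ℝ) * k) ≤ 8 * ((10 * k * Real.log n) * k) := by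
      simp_all [mul_le_mul_of_nonneg_right]
    have h7 : 80 * (k : ℝ) ^ 2 * Real.log n ≤ sizeConst₀ k * Real.log n :=
      mul_le_mul_of_nonneg_right c2 (by linarith)
    linarith
  exact_mod_cast h4

/-- Here the cube of the logarithm in the assumption on `p` is used: `S` is smaller than `n` by a
factor `(log n) ^ 2`, which absorbs a depth of order `k * log n`. So the program's time check
passes. -/
theorem Sizes.mul_depth_le (h : Sizes k n S q p) (hk : 2 ≤ k) {s : ℕ} (hd : d ≤ 2 * (k * (Nat.log 2 n + 1)) + 3)
    (hs : s ≤ S) : s * d ≤ n := by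
  have h2 := h.log_ge' hk
  have h3 := h.depth_le hk hd
  have h4 := h.log_ge
  set L := Real.log n with hL
  have hs' : (s : ℝ) ≤ n / L ^ 2 + 1 := le_trans (by exact_mod_cast hs) h.S_le
  have h5 : (s : ℝ) * d ≤ (n / L ^ 2 + 1) * (10 * k * L) :=
    mul_le_mul hs' h3 (by positivity) (by positivity)
  have h6 : (n / L ^ 2 + 1) * (10 * k * L) = n * (10 * k / L) + 10 * k * L := by
    field_simp
  have h7 : (10 : ℝ) * k / L ≤ 1 / 2 := by
    rw [div_le_iff₀ (by linarith)]
    linarith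
  have h8 : 10 * (k : ℝ) * L ≤ n / 2 := by
    have h9 := h.n_ge
    obtain ⟨-, c2, c3, -, -⟩ := sizeConst₀_ge k
    have h10 : 20 * (k : ℝ) ≤ sizeConst k := by
      unfold sizeConst
      nlinarith
    have h11 : L ≤ L ^ 3 := le_self_pow₀ (by linarith) (by norm_num)
    have h12 : 20 * (k : ℝ) * L ≤ sizeConst k * L ^ 3 :=
      mul_le_mul h10 h11 (by linarith) (by linarith)
    linarith
  have h13 : (n : ℝ) * (10 * k / L) ≤ n * (1 / 2) := mul_le_mul_of_nonneg_left h7 (by positivity)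
  have h14 : (s : ℝ) * d ≤ n := by linarith
  exact_mod_cast h14

/-- A lower bound for the number of leaves. -/
theorem Sizes.leaves_ge (h : Sizes k n S q p) (hk : 2 ≤ k) (ha : 1 ≤ a) : 2 ≤ q ^ a / leafDensity k ∧ (q : ℝ) ^
    a / (2 * leafDensity k) ≤ ((q ^ a / leafDensity k : ℕ) : ℝ) := by
  have h1 := h.q_ge_density hk
  have h2 := leafDensity_pos k
  have h3 : q ≤ q ^ a := Nat.le_self_pow (by omega) q
  have h4 : 2 ≤ q ^ a / leafDensity k := (Nat.le_div_iff_mul_le (by omega)).2 (by omega)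
  refine ⟨h4, ?_⟩
  have h5 : q ^ a < leafDensity k * (q ^ a / leafDensity k + 1) := Nat.lt_mul_div_succ _ (by omega)
  have h6 : (q : ℝ) ^ a < leafDensity k * (((q ^ a / leafDensity k : ℕ) : ℝ) + 1) := by exact_mod_cast h5
  have h7 : (2 : ℝ) ≤ ((q ^ a / leafDensity k : ℕ) : ℝ) := by exact_mod_cast h4
  rw [div_le_iff₀ (by positivity)]
  nlinarith

/-- The density of leaves is chosen for this: `q < 8 * x` and the factor `6 * 8 ^ k` make `3 * N` at
most half of `x ^ a`, and the lower order terms are less than the other half. -/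
theorem Sizes.tot_lt (h : Sizes k n S q p) (hk : 2 ≤ k) {t : ℕ} (ha : 1 ≤ a) (hak : a ≤ k)
    (ht : t ≤ 2 + (3 * (q ^ a / leafDensity k) + Nat.log 2 n)) : t < (q / 8 + 1) ^ a := by
  have h1 := h.q_ge_log hk
  have h3 : q < 8 * (q / 8 + 1) := Nat.lt_mul_div_succ _ (by omega)
  set x := q / 8 + 1 with hx
  have h4 : q ^ a ≤ 8 ^ a * x ^ a := by
    rw [← mul_pow]
    exact Nat.pow_le_pow_left h3.le a
  have h5 : 6 * (q ^ a / leafDensity k) ≤ x ^ a := by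
    have h6 : q ^ a / leafDensity k * leafDensity k ≤ q ^ a := Nat.div_mul_le_self _ _
    have h7 : 8 ^ a ≤ 8 ^ k := Nat.pow_le_pow_right (by norm_num) hak
    have h8 : 8 ^ a * (6 * (q ^ a / leafDensity k)) ≤ 8 ^ a * x ^ a := by
      calc 8 ^ a * (6 * (q ^ a / leafDensity k)) ≤ 8 ^ k * (6 * (q ^ a / leafDensity k)) :=
            Nat.mul_le_mul_right _ h7
        _ = q ^ a / leafDensity k * leafDensity k := by
            rw [show leafDensity k = 6 * 8 ^ k from rfl]; ring
        _ ≤ _ := h6.trans h4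
    exact Nat.le_of_mul_le_mul_left h8 (by positivity)
  grind [Nat.le_self_pow]

/-- Each of the three reasons for rejection costs at most an eighth of the class. -/
theorem excluded_le {k q : ℕ} (hk : 2 ≤ k) (h1 : 8 * (d * k) ≤ q) (h2 : 16 ≤ q) : 2 ^ k * (q / overDensity k) +
    q / 8 + d * k ≤ q / 2 := by
  have h3 := leafDensity_pos k
  have h4 : 8 * 2 ^ k ≤ overDensity k := by
    unfold overDensity
    have h5 : 2 ^ k ≤ 4 ^ k := Nat.pow_le_pow_left (by norm_num) k
    calc 8 * 2 ^ k ≤ 8 * 4 ^ k := by omega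
      _ ≤ 8 * 4 ^ k * (k * leafDensity k) := Nat.le_mul_of_pos_right _ (Nat.mul_pos (by omega) h3)
      _ = _ := by ring
  have h6 : 8 * (2 ^ k * (q / overDensity k)) ≤ q := by
    calc 8 * (2 ^ k * (q / overDensity k)) = 8 * 2 ^ k * (q / overDensity k) := by ring
      _ ≤ overDensity k * (q / overDensity k) := Nat.mul_le_mul_right _ h4
      _ ≤ q := Nat.mul_div_le _ _
  omega

/-- The density of overload is chosen so that all factors cancel here. -/
theorem bad_le {k q : ℕ} (ha : 1 ≤ a) : 8 * (4 ^ k * (k * (q / overDensity k * q ^ (a - 1)))) ≤ q ^ a /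
    leafDensity k := by
  have h3 := leafDensity_pos k
  rw [Nat.le_div_iff_mul_le (by omega)]
  obtain ⟨a, rfl⟩ : ∃ b, a = b + 1 := ⟨a - 1, by omega⟩
  calc 8 * (4 ^ k * (k * (q / overDensity k * q ^ a))) * leafDensity k
      = overDensity k * (q / overDensity k) * q ^ a := by unfold overDensity; ring
    _ ≤ q * q ^ a := Nat.mul_le_mul_right _ (Nat.mul_div_le _ _)
    _ = q ^ (a + 1) := by ring

theorem one_sub_pow_le_exp {x : ℝ} (hx : x ≤ 1) (N : ℕ) : (1 - x) ^ N ≤ Real.exp (-(x * N)) := by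
  calc (1 - x) ^ N ≤ Real.exp (-x) ^ N := pow_le_pow_left₀ (by linarith) (Real.one_sub_le_exp_neg x) N
    _ = Real.exp (-(x * N)) := by rw [← Real.exp_nat_mul]; ring_nf

theorem quarter_le {N : ℕ} (hN : 2 ≤ N) : (N : ℝ) / 4 ≤ ((N / 2 : ℕ) : ℝ) := by
  have h1 : N ≤ 4 * (N / 2) := by omega
  have h2 : (N : ℝ) ≤ 4 * ((N / 2 : ℕ) : ℝ) := by exact_mod_cast h1
  linarith

theorem exp_log_mul {n : ℕ} (hn : 1 ≤ n) (k : ℕ) : Real.exp (-((k : ℝ) * Real.log n)) = ((n : ℝ) ^ k)⁻¹ := by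
  rw [Real.exp_neg, Real.exp_nat_mul, Real.exp_log (by exact_mod_cast hn)]

/-- A scan fails with small probability. -/
theorem Sizes.scan_small (h : Sizes k n S q p) (hk : 2 ≤ k) : (1 - p / 2) ^ (q / 2) ≤
    ((n : ℝ) ^ (k + 7))⁻¹ := by
  have hn := h.n_ge' hk
  have h1 := h.q_ge_log hk
  have h2 := h.log_ge' hk
  have h3 := h.pq_ge
  have hp := h.p_pos
  obtain ⟨c1, -, -, -, -⟩ := sizeConst₀_ge k
  have h8 : (1 : ℝ) ≤ leafDensity k := by exact_mod_cast leafDensity_pos k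
  rw [← exp_log_mul (by omega)]
  refine (one_sub_pow_le_exp (by linarith [h.p_le]) _).trans (Real.exp_le_exp.2 (neg_le_neg ?_))
  have h4 := quarter_le (N := q) (by omega)
  have h5 : p / 2 * (q / 4) ≤ p / 2 * ((q / 2 : ℕ) : ℝ) := mul_le_mul_of_nonneg_left h4 (by linarith)
  have h6 : 8 * ((k : ℝ) + 7) ≤ sizeConst₀ k := by
    have : 8 * ((k : ℝ) + 7) ≤ 8 * leafDensity k * (k + 7) := by nlinarith
    linarith
  have h7 : 8 * ((k : ℝ) + 7) * Real.log n ≤ sizeConst₀ k * Real.log n :=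
    mul_le_mul_of_nonneg_right h6 (by linarith)
  push_cast
  linarith

/-- Leaves are connected with high probability. -/
theorem Sizes.connect_small (h : Sizes k n S q p) (hk : 2 ≤ k) (ha : 1 ≤ a) : (1 - p ^ a) ^
    (q ^ a / leafDensity k / 2) ≤ ((n : ℝ) ^ (k + 7))⁻¹ := by
  have hn := h.n_ge' hk
  have h2 := h.log_ge' hk
  have h3 := h.pq_ge
  have hp := h.p_pos
  obtain ⟨c1, -, c3, -, -⟩ := sizeConst₀_ge k
  have h8 : (1 : ℝ) ≤ leafDensity k := by exact_mod_cast leafDensity_pos k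
  obtain ⟨h4, h5⟩ := h.leaves_ge hk ha
  rw [← exp_log_mul (by omega)]
  refine (one_sub_pow_le_exp (pow_le_one₀ hp.le h.p_le) _).trans (Real.exp_le_exp.2 (neg_le_neg ?_))
  have h6 := quarter_le h4
  have h7 : p ^ a * ((q : ℝ) ^ a / (2 * leafDensity k) / 4) ≤ p ^ a * ((q ^ a / leafDensity k / 2 : ℕ) : ℝ) :=
    mul_le_mul_of_nonneg_left (by linarith) (by positivity)
  refine le_trans ?_ h7
  have h9 : p ^ a * ((q : ℝ) ^ a / (2 * leafDensity k) / 4) = (p * q) ^ a / (8 * leafDensity k) := by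
    ring
  have h10 : p * q ≤ (p * q) ^ a := le_self_pow₀ (by nlinarith) (by omega)
  rw [h9, le_div_iff₀ (by positivity)]
  refine le_trans ?_ (h3.trans h10)
  have h11 := mul_le_mul_of_nonneg_right c1 (show 0 ≤ Real.log n by linarith)
  push_cast
  linarith

/-- The number of used search bases is small. -/
theorem Sizes.bases_lt (h : Sizes k n S q p) (hk : 2 ≤ k) {x y : ℕ} (hx : x ≤ k ^ k * y)
    (hy : (y : ℝ) ≤ baseConst k * (S : ℝ) ^ k) : x < (q / overDensity k + 1) ^ k := by
  have hD : 1 ≤ overDensity k := by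
    exact Nat.mul_pos (Nat.mul_pos (by positivity) (by omega)) (leafDensity_pos k)
  have hD' : (1 : ℝ) ≤ overDensity k := by exact_mod_cast hD
  have h1 : (x : ℝ) ≤ k ^ k * y := by exact_mod_cast hx
  have h2 : (x : ℝ) ≤ (S / (12 * k) / overDensity k) ^ k := by
    calc (x : ℝ) ≤ k ^ k * (baseConst k * (S : ℝ) ^ k) :=
          h1.trans (mul_le_mul_of_nonneg_left hy (by positivity))
      _ = (S / (12 * k) / overDensity k) ^ k := by
          unfold baseConst
          rw [← mul_pow, ← mul_pow]
          field_simp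
  have h3 : (S : ℝ) / (12 * k) / overDensity k < ((q / overDensity k + 1 : ℕ) : ℝ) := by
    have h4 : q < overDensity k * (q / overDensity k + 1) := Nat.lt_mul_div_succ _ (by omega)
    have h5 : (q : ℝ) < overDensity k * ((q / overDensity k + 1 : ℕ) : ℝ) := by exact_mod_cast h4
    rw [div_lt_iff₀ (by linarith)]
    have h6 := h.q_ge
    linarith
  have h7 := h2.trans_lt (pow_lt_pow_left₀ h3 (by positivity) (by omega))
  exact_mod_cast h7

end Sizes

/-! ### The failure probability -/

section Final

theorem Inp.card_le_s (I : Inp) : I.S.card ≤ I.s + 2 * I.k := by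
  have h1 : I.S.map Fin.valEmbedding ⊆
      I.sl.toFinset ∪ ((range I.k).image I.u ∪ (range I.k).image I.v) := by
    intro x hx
    simp only [mem_union, mem_image, mem_range, List.mem_toFinset]
    by_contra h
    push Not at h
    exact h.1 (mem_sl.2 ⟨hx, fun f hf => ⟨h.2.1 f hf, h.2.2 f hf⟩⟩)
  have h2 := card_le_card h1
  grind [card_union_le, card_image_le, s, List.toFinset_card_le, card_map, card_range]

/-- Using only `m ≥ 2`, this explicit bound of order `k * log n` is valid for all `n` in question,
unlike the asymptotic bound on the length. -/
theorem Inp.dep_le_mul {I : Inp} (hI : I.Valid) (hm : 2 ≤ I.m) : I.dep ≤ 2 * (I.k * (I.m + 1)) + 3 := by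
  have hd : ∀ side < 2, I.d side ≤ I.k * (I.m + 1) := by
    intro side hs
    refine Nat.clog_le_of_le_pow ?_
    calc I.N side ≤ I.n ^ (I.k - 1) := (N_le_pow hI hs).trans (Nat.pow_le_pow_left s_le _)
      _ ≤ I.n ^ I.k := Nat.pow_le_pow_right (by have := hI.hk2; have := hI.hkn; omega) (by omega)
      _ ≤ (2 ^ (I.m + 1)) ^ I.k := Nat.pow_le_pow_left (Nat.lt_pow_succ_log_self (by norm_num) _).le _
      _ ≤ (I.m ^ (I.m + 1)) ^ I.k := Nat.pow_le_pow_left (Nat.pow_le_pow_left hm _) _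
      _ = I.m ^ (I.k * (I.m + 1)) := by rw [← pow_mul, mul_comm]
  grind [dep]

/-- Each old base inside S gives rise to at most `k ^ k` sequences. -/
theorem Inp.card_UE_le {I : Inp} (hE : ∀ e ∈ I.E, e.card = I.k) :
    I.UE.card ≤ I.k ^ I.k * (inside I.E I.S).card := by
  refine card_le_mul_card_image_of_maps_to (f := vset I.n) ?_ _ ?_
  · intro l hl
    obtain ⟨-, h2, h3⟩ := mem_UE.1 hl
    refine mem_filter.2 ⟨h3, fun x hx => ?_⟩
    obtain ⟨y, hy, hxy⟩ := mem_map.1 (h2 _ (mem_vset.1 hx)).1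
    rwa [← Fin.ext (show y.val = x.val from hxy)]
  · intro e he
    have h1 : {l ∈ I.UE | vset I.n l = e} ⊆
        (Fintype.piFinset fun _ : Fin I.k => e).image fun f => List.ofFn fun i => (f i).val := by
      intro l hl
      obtain ⟨hl', rfl⟩ := mem_filter.1 hl
      obtain ⟨h2, h3, -⟩ := mem_UE.1 hl'
      have h4 : ∀ i : Fin I.k, l.getD i 0 ∈ l := fun i => by
        grind
      have h5 : ∀ i : Fin I.k, l.getD i 0 < I.n := fun i => by
        obtain ⟨y, -, hy⟩ := mem_map.1 (h3 _ (h4 i)).1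
        rw [← hy]
        exact y.2
      refine mem_image.2 ⟨fun i => ⟨l.getD i 0, h5 i⟩, ?_, ?_⟩
      · exact Fintype.mem_piFinset.2 fun i => mem_vset.2 (h4 i)
      · refine List.ext_getElem (by simp [h2]) fun i hi hi' => ?_
        grind
    refine (card_le_card h1).trans (card_image_le.trans ?_)
    rw [Fintype.card_piFinset, prod_const, card_univ, Fintype.card_fin, hE e (mem_filter.1 he).1]

variable {r n : ℕ} {p : ℝ}
variable {k : ℕ}

/-- The input of the search. -/
abbrev Instance.inp (I : Instance r n) : Inp := I.toInp (leafDensity (r - 1)) (overDensity (r - 1))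

/-- All checks made by the program succeed deterministically in the range of the parameters
considered; only the scans and the joining are left to chance. -/
theorem Instance.hyp (I : Instance r n) (hr : 3 ≤ r)
    (h : Sizes (r - 1) n I.S.card I.inp.q p)
    (huv : Disjoint (verts I.u) (verts I.v))
    (hmix : ∀ e ∈ I.E, ¬ ((e ∩ I.S).Nonempty ∧ (e ∩ (verts I.u ∪ verts I.v)).Nonempty))
    (hE : ((inside I.E I.S).card : ℝ) ≤ baseConst (r - 1) * (I.S.card : ℝ) ^ (r - 1))
    {X : Finset (Finset (Fin n))} (hX : ∀ x ∈ X, ∃ e ∈ I.E, e ⊆ x)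
    (hends : ∀ s ∈ I.S, insert s (verts I.u) ∉ X ∧ insert s (verts I.v) ∉ X) :
    I.inp.Hyp X := by
  have hk : 2 ≤ r - 1 := by omega
  have hI : I.inp.Valid := I.valid_toInp _ _ hr
  have hu := fun f hf => I.toInp_u (leafDensity (r - 1)) (overDensity (r - 1)) (f := f) hf
  have hv := fun f hf => I.toInp_v (leafDensity (r - 1)) (overDensity (r - 1)) (f := f) hf
  set J := I.inp with hJ
  have hm : 2 ≤ J.m := h.two_le_log hk
  have hN : ∀ side < 2, 2 ≤ J.N side := fun side hs => (h.leaves_ge hk (Inp.one_le_h hI hs)).1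
  have hq : 16 * (J.m + 2) ≤ J.q := h.q_ge_log hk
  have hd : J.dep ≤ 2 * ((r - 1) * (J.m + 1)) + 3 := Inp.dep_le_mul hI hm
  have hchk : J.Chk₁ := by
    refine ⟨fun f hf f' hf' he => ?_, hm, by omega, hN 0 (by omega), hN 1 (by omega)⟩
    rw [hu f hf, hv f' hf'] at he
    exact Finset.disjoint_left.1 huv (mem_image_of_mem _ (mem_univ (⟨f, hf⟩ : Fin (r - 1))))
      (mem_image.2 ⟨⟨f', hf'⟩, mem_univ _, (Fin.ext he).symm⟩)
  have hrt : ∀ side < 2, ∃ w : Fin (r - 1) ↪ Fin n, (w = I.u ∨ w = I.v) ∧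
      ∀ f (hf : f < r - 1), J.rt side f = (w ⟨f, hf⟩).val := by
    intro side hs
    by_cases h0 : side = 0
    · exact ⟨I.u, Or.inl rfl, fun f hf => by rw [Inp.rt, if_pos h0, hu f hf]⟩
    · exact ⟨I.v, Or.inr rfl, fun f hf => by rw [Inp.rt, if_neg h0, hv f hf]⟩
  have hS : ∀ x : ℕ, J.Usable x → ∃ y ∈ I.S, y.val = x := fun x hx => mem_map.1 hx.1
  refine ⟨hI, ⟨hchk, h.mul_depth_le hk hd Inp.s_le_card⟩, I.uniform, ?_, hX, ?_,
    h.bases_lt hk (Inp.card_UE_le I.uniform) hE, ?_, excluded_le hk (h.depth_mul_le hk hd) (le_trans (by omega) hq)⟩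
  · intro e he x hx y hy hux f hf side hs hfy
    obtain ⟨w, hw, hwf⟩ := hrt side hs
    obtain ⟨x', hx', hxx⟩ := hS _ hux
    rw [hwf f hf] at hfy
    refine hmix e he ⟨⟨x, mem_inter.2 ⟨hx, ?_⟩⟩, ⟨y, mem_inter.2 ⟨hy, ?_⟩⟩⟩
    · rwa [← Fin.ext hxx]
    · have h1 : y ∈ verts w := mem_image.2 ⟨_, mem_univ _, Fin.ext hfy⟩
      rcases hw with rfl | rfl
      · exact mem_union_left _ h1
      · exact mem_union_right _ h1
  · intro side hs x hx
    obtain ⟨w, hw, hwf⟩ := hrt side hs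
    obtain ⟨y, hy, rfl⟩ := hS x hx
    have h1 : vset n ((List.range (r - 1)).map (J.rt side) ++ [y.val]) = insert y (verts w) := by
      ext z
      simp only [mem_vset, List.mem_append, List.mem_map, List.mem_range, List.mem_singleton, mem_insert,
        verts, mem_image, mem_univ, true_and]
      rw [or_comm, ← Fin.ext_iff]
      refine or_congr Iff.rfl ⟨?_, ?_⟩
      · rintro ⟨f, hf, h2⟩
        exact ⟨⟨f, hf⟩, Fin.ext ((hwf f hf).symm.trans h2)⟩
      · rintro ⟨f, rfl⟩
        exact ⟨f, f.2, hwf f f.2⟩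
    grind
  · intro side hs
    have hh := Inp.one_le_h hI hs
    have hh' : 2 * J.h side ≤ r - 1 + 1 := Inp.h_le side
    refine h.tot_lt hk hh (show J.h side ≤ r - 1 by omega) ?_
    have h1 := Inp.X_mul_le hchk hs
    have h2 := J.e_le (side := side)
    show J.e side + 1 + J.X side * J.m ≤ 2 + (3 * J.N side + J.m)
    omega

theorem Inp.scanCount_le {I : Inp} (hI : I.Valid) (hc : I.Chk₁) {side : ℕ} (hs : side < 2) : I.scanCount side ≤
    10 * I.n ^ I.k ∧ I.N side ≤ I.n ^ I.k := by
  have hm := hc.2.1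
  have hk := hI.hk2
  have hkn := hI.hkn
  have h1 := X_mul_le hc hs
  have h2 : I.N side ≤ I.n ^ (I.k - 1) := (N_le_pow hI hs).trans (Nat.pow_le_pow_left s_le _)
  have h3 : I.m ≤ I.n := Nat.log_le_self 2 I.n
  have h4 : I.n ^ I.k = I.n * I.n ^ (I.k - 1) := by
    rw [← pow_succ', Nat.sub_add_cancel (by omega)]
  have h5 : I.n ≤ I.n ^ (I.k - 1) := Nat.le_self_pow (by omega) _
  have h6 : I.k * I.N side ≤ I.n ^ I.k := h4 ▸ Nat.mul_le_mul hkn h2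
  have h7 : I.k * I.m ≤ I.n ^ I.k := h4 ▸ Nat.mul_le_mul hkn (h3.trans h5)
  have h8 : I.n ^ (I.k - 1) ≤ I.n ^ I.k := Nat.pow_le_pow_right (by omega) (by omega)
  refine ⟨?_, h2.trans h8⟩
  have h9 : I.e side * (2 * I.k) ≤ 2 * I.k := (Nat.mul_le_mul_right _ e_le).trans (by rw [one_mul])
  calc I.scanCount side ≤ 2 * I.k + I.X side * (I.k * (I.m + 1)) := Nat.add_le_add_right h9 _
    _ ≤ 2 * I.k + I.X side * (I.k * (2 * I.m)) := by gcongr; omega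
    _ = 2 * I.k + 2 * (I.k * (I.X side * I.m)) := by ring
    _ ≤ 2 * I.k + 2 * (I.k * (3 * I.N side + I.m)) := by gcongr
    _ = 2 * I.k + 6 * (I.k * I.N side) + 2 * (I.k * I.m) := by ring
    _ ≤ 10 * I.n ^ I.k := by omega

/-- At most `20 * n ^ k` scans fail with probability at most `n * n ^ (-(k + 7))` each, as `2 ^ m ≤
n`. The joining adds at most `2 * n ^ (-7)`, and `20 * n + 2 ≤ n ^ 2`. -/
theorem Instance.failBound_le (I : Instance r n) (hr : 3 ≤ r)
    (h : Sizes (r - 1) n I.S.card I.inp.q p)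
    (hc : I.inp.Chk₁) :
    I.inp.failBound p ≤ ((n : ℝ) ^ 5)⁻¹ := by
  have hk : 2 ≤ r - 1 := by omega
  have hI : I.inp.Valid := I.valid_toInp _ _ hr
  set J := I.inp with hJ
  obtain ⟨a0, -⟩ := Inp.scanCount_le hI hc (side := 0) (by omega)
  obtain ⟨a1, b1⟩ := Inp.scanCount_le hI hc (side := 1) (by omega)
  have hn := h.n_ge' hk
  have hn' : (40 : ℝ) ≤ n := by exact_mod_cast hn
  set k := r - 1 with hkdef
  have a0' : (J.scanCount 0 : ℝ) ≤ 10 * (n : ℝ) ^ k := by exact_mod_cast a0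
  have a1' : (J.scanCount 1 : ℝ) ≤ 10 * (n : ℝ) ^ k := by exact_mod_cast a1
  have b1' : (J.N 1 : ℝ) ≤ (n : ℝ) ^ k := by exact_mod_cast b1
  have c0 : (1 - p ^ J.h 0) ^ (J.N 0 / 2) ≤ ((n : ℝ) ^ (k + 7))⁻¹ :=
    h.connect_small hk (Inp.one_le_h hI (by omega))
  have c1 : (1 - p ^ J.h 1) ^ (J.N 1 / 2) ≤ ((n : ℝ) ^ (k + 7))⁻¹ :=
    h.connect_small hk (Inp.one_le_h hI (by omega))
  have hmn : (2 : ℝ) ^ J.m ≤ n := by exact_mod_cast Nat.pow_log_le_self 2 (show n ≠ 0 by omega)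
  have hε0 : (0 : ℝ) ≤ ((n : ℝ) ^ (k + 7))⁻¹ := by positivity
  have hlt := h.p_le
  have h1 : J.err p ≤ n * ((n : ℝ) ^ (k + 7))⁻¹ :=
    mul_le_mul hmn (h.scan_small hk) (pow_nonneg (by linarith) _) (by positivity)
  have h2 : ((J.scanCount 0 : ℝ) + J.scanCount 1) * J.err p ≤
      (20 * (n : ℝ) ^ k) * (n * ((n : ℝ) ^ (k + 7))⁻¹) :=
    mul_le_mul (by linarith) h1 (J.err_nonneg hlt) (by positivity)
  have h3 : (J.N 1 : ℝ) * (1 - p ^ J.h 0) ^ (J.N 0 / 2) ≤ (n : ℝ) ^ k * ((n : ℝ) ^ (k + 7))⁻¹ :=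
    mul_le_mul b1' c0 (pow_nonneg (by have := pow_le_one₀ (n := J.h 0) h.p_pos.le hlt; linarith) _)
      (by positivity)
  have h4 : (1 : ℝ) ≤ (n : ℝ) ^ k := one_le_pow₀ (by linarith)
  have h5 : ((n : ℝ) ^ (k + 7))⁻¹ ≤ (n : ℝ) ^ k * ((n : ℝ) ^ (k + 7))⁻¹ := le_mul_of_one_le_left hε0 h4
  have h6 : (n : ℝ) ^ k * ((n : ℝ) ^ (k + 7))⁻¹ = ((n : ℝ) ^ 7)⁻¹ := by
    rw [pow_add]
    field_simp
  have h7 : (n : ℝ) ^ 2 * ((n : ℝ) ^ 7)⁻¹ = ((n : ℝ) ^ 5)⁻¹ := by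
    field_simp
  have h8 : (20 * (n : ℝ) ^ k) * (n * ((n : ℝ) ^ (k + 7))⁻¹) = 20 * n * ((n : ℝ) ^ 7)⁻¹ := by
    rw [← h6]
    ring
  have h9 : (20 * n + 2 : ℝ) * ((n : ℝ) ^ 7)⁻¹ ≤ (n : ℝ) ^ 2 * ((n : ℝ) ^ 7)⁻¹ :=
    mul_le_mul_of_nonneg_right (by nlinarith) (by positivity)
  unfold Inp.failBound
  linarith

open Classical in
theorem prob_eq (A : Finset (Finset (Fin n)) → Prop) : prob r n p A = Pr p (allSets r n) fun G => if A G then 1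
    else 0 := by
  grind [prob, Pr, sum_filter, sum_congr]

/-- A bound for the conditional probability of an event, given the part of the hypergraph in `X`. -/
theorem prob_and_le {A : Finset (Finset (Fin n)) → Prop} {X : Finset (Finset (Fin n))} {δ : ℝ} (h0 : 0 ≤ p)
    (h1 : p ≤ 1)
    (h : ∀ F ⊆ X, (open Classical in Pr p (allSets r n \ X) fun H => if A (F ∪ H) then 1 else 0) ≤ δ)
    (F : Finset (Finset (Fin n))) : prob r n p (fun G => A G ∧ G ∩ X = F) ≤ δ * prob r n p
    (fun G => G ∩ X = F) := by
  classical
  have hZ : allSets r n ∩ X ⊆ allSets r n := inter_subset_left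
  rw [prob_eq, prob_eq, Pr_split hZ, Pr_split hZ, ← Pr_mul_left]
  refine Pr_mono h0 h1 fun H₁ h₁ => ?_
  rw [sdiff_inter_self_left]
  have hX : H₁ ⊆ X := h₁.trans inter_subset_right
  have hH : ∀ H₂ ⊆ allSets r n \ X, (H₁ ∪ H₂) ∩ X = H₁ := fun H₂ h₂ => by
    grind
  have hc : ∀ (a : ℝ) (φ : Finset (Finset (Fin n)) → ℝ), (∀ H₂ ⊆ allSets r n \ X, φ H₂ = a) →
      Pr p (allSets r n \ X) φ = a := fun a φ hφ => (Pr_congr hφ).trans (Pr_const _ a)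
  by_cases hF : H₁ = F
  · subst hF
    refine (le_of_eq (Pr_congr fun H₂ h₂ => ?_)).trans ((h H₁ hX).trans (le_of_eq ?_))
    · grind
    · exact ((congrArg (δ * ·) (hc 1 _ fun H₂ h₂ => if_pos (hH H₂ h₂))).trans (mul_one δ)).symm
  · refine le_of_eq ((hc 0 _ fun H₂ h₂ => if_neg ?_).trans
      ((congrArg (δ * ·) (hc 0 _ fun H₂ h₂ => if_neg ?_)).trans (mul_zero δ)).symm)
    · grind
    grind

-- The bound of `Inp.Hyp.fail_le` is uniform in the known part `F'` of the hypergraph, which gives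
-- the conditional statement.
open Classical in
theorem Instance.fail_le (I : Instance r n) (hr : 3 ≤ r) (hp : sizeConst (r - 1) * Real.log n ^ 3 / n ≤ p)
    (hp1 : p ≤ 1) (huv : Disjoint (verts I.u) (verts I.v))
    (hmix : ∀ e ∈ I.E, ¬ ((e ∩ I.S).Nonempty ∧ (e ∩ (verts I.u ∪ verts I.v)).Nonempty))
    (hS : |(I.S.card : ℝ) - sizeConst (r - 1) * p⁻¹ * Real.log n| < 1)
    (hE : ((inside I.E I.S).card : ℝ) ≤ baseConst (r - 1) * (I.S.card : ℝ) ^ (r - 1))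
    {X : Finset (Finset (Fin n))} (hX : ∀ x ∈ X, ∃ e ∈ I.E, e ⊆ x)
    (hends : ∀ s ∈ I.S, insert s (verts I.u) ∉ X ∧ insert s (verts I.v) ∉ X)
    {A : Finset (Finset (Fin n)) → Prop}
    (hA : ∀ G, A G → ¬ I.inp.Succ G)
    (F : Finset (Finset (Fin n))) : prob r n p (fun G => A G ∧ G ∩ X = F) ≤ ((n : ℝ) ^ 5)⁻¹ * prob r n p
    (fun G => G ∩ X = F) := by
  have hk : 2 ≤ r - 1 := by omega
  have hI : I.inp.Valid := I.valid_toInp _ _ hr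
  have h := Sizes.intro hk (hI.hk2.trans hI.hkn) hp hp1 hS
    (Inp.card_le_s I.inp)
  have hyp := I.hyp hr h huv hmix hE hX hends
  refine prob_and_le h.p_pos.le hp1 (fun F' _ => ?_) F
  have hle := hyp.fail_le h.p_pos.le hp1 (fun side hs => bad_le (Inp.one_le_h hI hs)) F'
  rw [allSets, show r = r - 1 + 1 by omega]
  refine (Pr_mono h.p_pos.le hp1 fun H _ => ?_).trans (hle.trans (I.failBound_le hr h hyp.chk.1))
  grind

theorem prob_true (A : Finset (Finset (Fin n)) → Prop) : prob r n p (fun G => A G ∧ G ∩ ∅ = ∅) = prob r n p A ∧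
    prob r n p (fun G => G ∩ ∅ = ∅) = 1 := by
  simp_all [inter_empty, and_true, prob_eq, Pr_const]

theorem sizeConst_pos (hk : 2 ≤ k) : 0 < sizeConst k := by
  obtain ⟨-, -, h, -, -⟩ := sizeConst₀_ge k
  have : (2 : ℝ) ≤ k := by exact_mod_cast hk
  unfold sizeConst
  nlinarith

theorem baseConst_pos (hk : 2 ≤ k) : 0 < baseConst k := by
  have h1 := leafDensity_pos k
  unfold baseConst overDensity
  positivity

end Final

end SpikeLemma

/-! ### The Spike path Lemma. -/

theorem lemma4p2 (r : ℕ) (hr : 3 ≤ r) :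
    ∃ (c C : ℝ), 0 < c ∧ 0 < C ∧
    -- the algorithm: a program, run with words of `κ * Nat.size n` bits, and what it returns
    ∃ (prog : SpikeLemma.RamCmd (r - 1)) (κ : ℕ)
      (out : (n : ℕ) → Finset (Finset (Fin n)) → SpikeLemma.Instance r n →
        SpikeLemma.Output r n)
      -- the constants of the two `O(·)` and the `o(log n)` bound on the length
      (K K' : ℕ) (ℓ : ℕ → ℕ),
      (fun n : ℕ => (ℓ n : ℝ)) =o[Filter.atTop] (fun n : ℕ => Real.log n) ∧
      -- properties that hold for every input
      (∀ (n : ℕ) (G : Finset (Finset (Fin n))) (I : SpikeLemma.Instance r n),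
        SpikeLemma.IsUniform r G →
        (∃ (T : ℕ) (σ : SpikeLemma.RamState n),
          SpikeLemma.Exec (κ * Nat.size n) G I.S prog (SpikeLemma.initState I) T σ ∧
          T ≤ K * n ^ (r - 1) ∧
          SpikeLemma.Represents σ (out n G I)) ∧
        (∀ (t : ℕ) (a : Fin t → Fin (r - 1) → Fin n), (out n G I).path = some ⟨t, a⟩ →
          SpikeLemma.IsSpikePath r G t a ∧ Even t ∧ t ≤ ℓ n ∧
          SpikeLemma.HasEnds a I.u I.v ∧ SpikeLemma.InteriorIn a I.S) ∧
        SpikeLemma.IsUniform (r - 1) (out n G I).E' ∧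
        I.E ⊆ (out n G I).E' ∧
        (out n G I).E'.card ≤ I.E.card + K' * I.S.card ^ (r - 2) ∧
        (∀ e ∈ (out n G I).E', e ∉ I.E →
          e ⊆ I.S ∪ SpikeLemma.verts I.u ∪ SpikeLemma.verts I.v)) ∧
      -- the failure probability
      (∀ (n : ℕ) (p : ℝ) (I : SpikeLemma.Instance r n),
        C * Real.log n ^ 3 / n ≤ p → p ≤ 1 →
        Disjoint (SpikeLemma.verts I.u) (SpikeLemma.verts I.v) →
        (∀ e ∈ I.E, ¬ ((e ∩ I.S).Nonempty ∧
          (e ∩ (SpikeLemma.verts I.u ∪ SpikeLemma.verts I.v)).Nonempty)) →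
        -- `|S| = C p⁻¹ log n`, rounded up or down
        |(I.S.card : ℝ) - C * p⁻¹ * Real.log n| < 1 →
        ((SpikeLemma.inside I.E I.S).card : ℝ) ≤ c * (I.S.card : ℝ) ^ (r - 1) →
        SpikeLemma.prob r n p (fun G => (out n G I).path = none) ≤ ((n : ℝ) ^ 5)⁻¹ ∧
        -- the same bound holds conditionally on what has been exposed before: `X` is a family of
        -- `r`-sets each containing an edge of the exposure hypergraph (and none consisting of one
        -- of the end tuples and a vertex of `S`), and `F` is the set of edges of `G` in `X`
        (∀ X F : Finset (Finset (Fin n)),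
          (∀ x ∈ X, ∃ e ∈ I.E, e ⊆ x) →
          (∀ s ∈ I.S, insert s (SpikeLemma.verts I.u) ∉ X ∧
            insert s (SpikeLemma.verts I.v) ∉ X) →
          SpikeLemma.prob r n p (fun G => (out n G I).path = none ∧ G ∩ X = F) ≤
            ((n : ℝ) ^ 5)⁻¹ * SpikeLemma.prob r n p (fun G => G ∩ X = F))) := by
  have hk : 2 ≤ r - 1 := by omega
  choose out h1 h2 h3 h4 h5 h6 h7 using
    fun (n : ℕ) (G : Finset (Finset (Fin n))) (I : SpikeLemma.Instance r n) =>
      I.exists_output (SpikeLemma.leafDensity (r - 1)) (SpikeLemma.overDensity (r - 1)) hr G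
  refine ⟨SpikeLemma.baseConst (r - 1), SpikeLemma.sizeConst (r - 1), SpikeLemma.baseConst_pos hk,
    SpikeLemma.sizeConst_pos hk, _, _, out, 2100 * (r - 1), 21 * (r - 1),
    SpikeLemma.lenBound (r - 1), SpikeLemma.lenBound_isLittleO (r - 1), fun n G I _ =>
      ⟨h1 n G I, h2 n G I, h3 n G I, h4 n G I, h5 n G I, h6 n G I⟩, ?_⟩
  intro n p I hp hp1 huv hmix hS hE
  have h := fun (X : Finset (Finset (Fin n))) hX hends F => I.fail_le hr hp hp1 huv hmix hS hE (X := X) hX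
    hends (fun G => h7 n G I) F
  refine ⟨?_, fun X F hX hends => h X hX hends F⟩
  -- The unconditional bound is the case in which nothing has been exposed.
  have h0 := h ∅ (by simp) (by simp) ∅
  obtain ⟨e1, e2⟩ := SpikeLemma.prob_true (p := p) fun G => (out n G I).path = none
  rwa [e1, e2, mul_one] at h0
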